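/- **Theorem (Convergence of the PDE residual under DGM).** Let $\Omega\subset\mathbb R^d$ be a bounded open set whose boundary is of class $C^{3,\alpha}$ for some $\alpha\in(0,1)$. Let $\mu$ be a finite measure on $\Omega$ that is equivalent to Lebesgue measure and whose Radon--Nikodym derivative with respect to Lebesgue measure has a bounded logarithm. Write $\mathcal H^2$ for the Sobolev space $H^2(\Omega)$ and $\mathcal H^2_{(0)}=H^2(\Omega)\cap H^1_0(\Omega)$, with the $H^2$ norm. Let $\mathcal A f=\sum_{|\alpha|\le 2}a_\alpha D_\alpha f$ be a second-order linear differential operator with measurable coefficients for which there is $k>0$ such that, for all $f_1,f_2\in\mathcal H^2$ and almost every $x\in\Omega$, $$|\mathcal Af_1(x)-\mathcal Af_2(x)|\le k\sum_{|\alpha|\le 2}|D_\alpha f_1(x)-D_\alpha f_2(x)|.$$ Let $\eta\in C^3_b(\mathbb R^d)$ satisfy $\eta>0$ in $\Omega$, $\eta=0$ on $\partial\Omega$ and $\nabla\eta\ne0$ on $\partial\Omega$, and let $\sigma\in C^4_b(\mathbb R)$ be non-constant. Let $(c,w,b)$ be a random vector in $\mathbb R\times\mathbb R^d\times\mathbb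 R$ such that $c$ is bounded with $\mathbb E[c]=0$, the law of $(w,b)$ gives positive mass to every non-empty open set, $\mathbb E[|w_i|^4]<\infty$ for $i=1,\dots,d$, and $\mathbb E[|b|]<\infty$. Put $$U(x,y)=\mathbb E\Big[\nabla_{c,w,b}\,\mathcal A[\eta(x)\,c\,\sigma(w\cdot x+b)]\cdot\nabla_{c,w,b}\,[\eta(y)\,c\,\sigma(w\cdot y+b)]\Big],\qquad \mathcal Uf(y)=\int_\Omega f(x)\,U(x,y)\,d\mu(x),$$ where $\mathcal A$ acts in the variable $x$. Suppose that the problem $\mathcal Au=g$ in $\Omega$, $u=0$ on $\partial\Omega$, has a solution $u\in\mathcal H^2_{(0)}$. Then the linear ODE in $\mathcal H^2_{(0)}$ $$\frac{dQ_t}{dt}=-\,\mathcal U[\mathcal AQ_t-g],\quad t\ge 0,\qquad Q_0=0,$$ has a solution (the wide-limit network), and every solution $Q$ satisfies $$\lim_{t\to\infty}\|\mathcal AQ_t-g\|_{L^2(\mu)}=0.$$ -/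

import Mathlib

open MeasureTheory Filter Topology
open scoped ContDiff ENNReal

noncomputable section

namespace DGM

/-- Euclidean space of dimension `d`. -/
abbrev Eucl (d : ℕ) : Type := EuclideanSpace ℝ (Fin d)

/-! ### Partial derivatives -/

/-- Partial-derivative indices of order at most `p`: words `(i₁, …, i_k)` with `k ≤ p`, standing for
`∂_{i₁} ⋯ ∂_{i_k}`. -/
abbrev Idx (d p : ℕ) : Type := Σ k : Fin (p + 1), (Fin (k : ℕ) → Fin d)

/-- The empty word, i.e. the derivative of order zero. -/
def Idx.nil (d p : ℕ) : Idx d p := ⟨0, fun j => j.elim0⟩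

/-- The classical partial derivative `∂_{i₁} ⋯ ∂_{i_k} φ (x)`. -/
def partialD {d p : ℕ} (α : Idx d p) (φ : Eucl d → ℝ) (x : Eucl d) : ℝ :=
  iteratedFDeriv ℝ (α.1 : ℕ) φ x (fun j => EuclideanSpace.single (α.2 j) (1 : ℝ))

/-- `C_c^∞(Ω)`. -/
structure IsTestFunction {d : ℕ} (Ω : Set (Eucl d)) (φ : Eucl d → ℝ) : Prop where
  smooth : ContDiff ℝ ∞ φ
  compact : HasCompactSupport φ
  support : tsupport φ ⊆ Ω

lemma IsTestFunction.partialD_memLp {d p : ℕ} {Ω : Set (Eucl d)} {φ : Eucl d → ℝ}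
    (h : IsTestFunction Ω φ) (α : Idx d p) :
    MemLp (partialD α φ) 2 (volume.restrict Ω) := by
  have hc : Continuous (iteratedFDeriv ℝ (α.1 : ℕ) φ) :=
    h.smooth.continuous_iteratedFDeriv (by exact_mod_cast le_top)
  have hc' : Continuous (partialD α φ) := by
    unfold partialD
    exact (ContinuousMultilinearMap.apply ℝ _ ℝ _).continuous.comp hc
  have hs : HasCompactSupport (partialD α φ) := by
    refine (h.compact.iteratedFDeriv (𝕜 := ℝ) (α.1 : ℕ)).mono ?_
    intro x hx hx'
    exact hx (by simp [partialD, hx'])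
  exact (hc'.memLp_of_hasCompactSupport hs).restrict Ω

lemma IsTestFunction.memLp {d : ℕ} {Ω : Set (Eucl d)} {φ : Eucl d → ℝ}
    (h : IsTestFunction Ω φ) : MemLp φ 2 (volume.restrict Ω) :=
  (h.smooth.continuous.memLp_of_hasCompactSupport h.compact).restrict Ω

/-! ### Sobolev spaces on an open set -/

/-- `L²(Ω)` for the Lebesgue measure. -/
abbrev L2 {d : ℕ} (Ω : Set (Eucl d)) : Type := Lp ℝ 2 (volume.restrict Ω)

/-- Families `(v_α)_{|α| ≤ p}` of `L²(Ω)` functions, normed by `(∑_α ‖v_α‖²)^{1/2}`. -/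
abbrev Jet {d : ℕ} (Ω : Set (Eucl d)) (p : ℕ) : Type := PiLp 2 (fun _ : Idx d p => L2 Ω)

/-- The Sobolev space `H^p(Ω)`. A function `u` is stored together with its weak derivatives
`(D_α u)_{|α| ≤ p}`, all in `L²(Ω)`; these are determined almost everywhere by `u = v_∅`. The
norm is the usual `H^p(Ω)` norm. -/
def sobolev {d : ℕ} (Ω : Set (Eucl d)) (p : ℕ) : Submodule ℝ (Jet Ω p) where
  carrier := {v | ∀ (α : Idx d p) (φ : Eucl d → ℝ), IsTestFunction Ω φ →
    ∫ x in Ω, v (Idx.nil d p) x * partialD α φ x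
      = (-1) ^ (α.1 : ℕ) * ∫ x in Ω, v α x * φ x}
  zero_mem' := by
    intro α φ _
    have h0 : ∀ β : Idx d p, ((0 : Jet Ω p) β : Eucl d → ℝ) =ᵐ[volume.restrict Ω] 0 :=
      fun β => Lp.coeFn_zero _ _ _
    have h1 : ∫ x in Ω, (0 : Jet Ω p) (Idx.nil d p) x * partialD α φ x = 0 := by
      refine integral_eq_zero_of_ae ?_
      filter_upwards [h0 (Idx.nil d p)] with x hx
      rw [hx]
      simp
    have h2 : ∫ x in Ω, (0 : Jet Ω p) α x * φ x = 0 := by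
      refine integral_eq_zero_of_ae ?_
      filter_upwards [h0 α] with x hx
      rw [hx]
      simp
    rw [h1, h2, mul_zero]
  add_mem' := by
    intro u v hu hv α φ hφ
    have key : ∀ (β : Idx d p) (ψ : Eucl d → ℝ), MemLp ψ 2 (volume.restrict Ω) →
        ∫ x in Ω, (u + v) β x * ψ x = (∫ x in Ω, u β x * ψ x) + ∫ x in Ω, v β x * ψ x := by
      intro β ψ hψ
      refine Eq.trans (integral_congr_ae ?_)
        (integral_add ((Lp.memLp (u β)).integrable_mul hψ)
          ((Lp.memLp (v β)).integrable_mul hψ))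
      filter_upwards [Lp.coeFn_add (u β) (v β)] with x hx
      have : (u + v) β x = u β x + v β x := hx
      rw [this, add_mul]
    rw [key _ _ (hφ.partialD_memLp α), key _ _ hφ.memLp, hu α φ hφ, hv α φ hφ, mul_add]
  smul_mem' := by
    intro c v hv α φ hφ
    have key : ∀ (β : Idx d p) (ψ : Eucl d → ℝ),
        ∫ x in Ω, (c • v) β x * ψ x = c * ∫ x in Ω, v β x * ψ x := by
      intro β ψ
      rw [← integral_const_mul]
      refine integral_congr_ae ?_
      filter_upwards [Lp.coeFn_smul c (v β)] with x hx
      have : (c • v) β x = c * v β x := hx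
      rw [this, mul_assoc]
    rw [key, key, hv α φ hφ]
    ring

/-- `H^p_0(Ω)`: the closure of `C_c^∞(Ω)` in the `H^p(Ω)` norm. -/
def sobolevZero {d : ℕ} (Ω : Set (Eucl d)) (p : ℕ) : Submodule ℝ (Jet Ω p) :=
  (Submodule.span ℝ {v : Jet Ω p | ∃ φ, IsTestFunction Ω φ ∧
    ∀ α, v α =ᵐ[volume.restrict Ω] partialD α φ}).topologicalClosure

/-- Forget the derivatives of order `2`. -/
def truncate {d : ℕ} (Ω : Set (Eucl d)) : Jet Ω 2 →ₗ[ℝ] Jet Ω 1 where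
  toFun v := WithLp.toLp 2 fun α => v ⟨Fin.castLE (by omega) α.1, α.2⟩
  map_add' _ _ := rfl
  map_smul' _ _ := rfl

/-- `H²_{(0)}(Ω) = H²(Ω) ∩ H¹_0(Ω)` with the `H²` norm. -/
def H20 {d : ℕ} (Ω : Set (Eucl d)) : Submodule ℝ (Jet Ω 2) :=
  sobolev Ω 2 ⊓ (sobolevZero Ω 1).comap (truncate Ω)

/-! ### Domain, sampling measure, auxiliary function -/

/-- `∂Ω` is of class `C^{k,a}`: near each boundary point, in suitable Cartesian coordinates, with
`ν` the direction of the last coordinate, `Ω` is the strict epigraph of a `C^{k,a}` function `γ` of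
the component of the point orthogonal to `ν`. -/
def HasHolderBoundary {d : ℕ} (k : ℕ) (a : ℝ) (Ω : Set (Eucl d)) : Prop :=
  ∀ x₀ ∈ frontier Ω, ∃ (ν : Eucl d) (γ : Eucl d → ℝ) (r C : ℝ),
    ‖ν‖ = 1 ∧ 0 < r ∧ ContDiff ℝ k γ ∧
    (∀ y z, ‖iteratedFDeriv ℝ k γ y - iteratedFDeriv ℝ k γ z‖ ≤ C * ‖y - z‖ ^ a) ∧
    ∀ y ∈ Metric.ball x₀ r, y ∈ Ω ↔ γ (y - inner ℝ ν y • ν) < inner ℝ ν y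

/-- `μ` is a finite measure on `Ω`, equivalent to the Lebesgue measure on `Ω`, with bounded
logarithm of its Radon–Nikodym derivative. -/
structure IsSamplingMeasure {d : ℕ} (Ω : Set (Eucl d)) (μ : Measure (Eucl d)) : Prop where
  finite : IsFiniteMeasure μ
  ac : μ ≪ volume.restrict Ω
  ac_symm : volume.restrict Ω ≪ μ
  log_bdd : ∃ M : ℝ, ∀ᵐ x ∂(volume.restrict Ω),
    |Real.log (μ.rnDeriv (volume.restrict Ω) x).toReal| ≤ M

/-- `C^k_b`: `k` times continuously differentiable, with all derivatives of order `≤ k` bounded. -/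
def IsCkb {V : Type*} [NormedAddCommGroup V] [NormedSpace ℝ V] (k : ℕ) (f : V → ℝ) : Prop :=
  ContDiff ℝ k f ∧ ∀ j ≤ k, ∃ C : ℝ, ∀ x, ‖iteratedFDeriv ℝ j f x‖ ≤ C

/-- The auxiliary function: `η ∈ C³_b(ℝ^d)`, positive in `Ω`, zero on `∂Ω`, and with first
derivative not vanishing at any boundary point. Since `η = 0` on `∂Ω`, the latter is the same as a
nonzero normal derivative. -/
structure IsAuxiliary {d : ℕ} (Ω : Set (Eucl d)) (η : Eucl d → ℝ) : Prop where
  smooth : IsCkb 3 η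
  pos : ∀ x ∈ Ω, 0 < η x
  zero : ∀ x ∈ frontier Ω, η x = 0
  deriv_ne : ∀ x ∈ frontier Ω, fderiv ℝ η x ≠ 0

/-! ### The differential operator -/

/-- The second-order linear operator `𝒜 = ∑_{|α| ≤ 2} a_α D_α` on `H²`, through weak derivatives. -/
def opA {d : ℕ} {Ω : Set (Eucl d)} (a : Idx d 2 → Eucl d → ℝ) (v : Jet Ω 2) (x : Eucl d) : ℝ :=
  ∑ α, a α x * v α x

/-- The same operator on twice differentiable functions. -/
def opAclassical {d : ℕ} (a : Idx d 2 → Eucl d → ℝ) (ψ : Eucl d → ℝ) (x : Eucl d) : ℝ :=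
  ∑ α, a α x * partialD α ψ x

/-- The pointwise Lipschitz condition on `𝒜`. -/
def IsLipschitzOp {d : ℕ} (Ω : Set (Eucl d)) (a : Idx d 2 → Eucl d → ℝ) : Prop :=
  ∃ k : ℝ, 0 < k ∧ ∀ f₁ ∈ sobolev Ω 2, ∀ f₂ ∈ sobolev Ω 2, ∀ᵐ x ∂(volume.restrict Ω),
    |opA a f₁ x - opA a f₂ x| ≤ k * ∑ α, |f₁ α x - f₂ α x|

/-! ### The network and the limit kernel -/

/-- Parameters `θ = (c, w, b)` of one hidden unit. -/
abbrev Param (d : ℕ) : Type := ℝ × Eucl d × ℝ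

/-- `η(x) c σ(w · x + b)`. -/
def neuron {d : ℕ} (η : Eucl d → ℝ) (σ : ℝ → ℝ) (θ : Param d) (x : Eucl d) : ℝ :=
  η x * (θ.1 * σ (inner ℝ θ.2.1 x + θ.2.2))

/-- The Euclidean inner product `∇_{c,w,b} F (θ) · ∇_{c,w,b} G (θ)`. -/
def gradDot {d : ℕ} (F G : Param d → ℝ) (θ : Param d) : ℝ :=
  fderiv ℝ F θ (1, 0, 0) * fderiv ℝ G θ (1, 0, 0)
    + ∑ i : Fin d, fderiv ℝ F θ (0, EuclideanSpace.single i 1, 0)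
        * fderiv ℝ G θ (0, EuclideanSpace.single i 1, 0)
    + fderiv ℝ F θ (0, 0, 1) * fderiv ℝ G θ (0, 0, 1)

/-- Conditions on the law `π` of the initial parameters `(c, w, b)` of one hidden unit. -/
structure IsInitLaw {d : ℕ} (π : Measure (Param d)) : Prop where
  prob : IsProbabilityMeasure π
  c_bdd : ∃ K₀ : ℝ, ∀ᵐ θ ∂π, |θ.1| < K₀
  c_mean : ∫ θ, θ.1 ∂π = 0
  full_support : ∀ D : Set (Eucl d × ℝ), IsOpen D → D.Nonempty → 0 < π {θ | θ.2 ∈ D}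
  w_moment : ∀ i : Fin d, Integrable (fun θ : Param d => |θ.2.1 i| ^ 4) π
  b_moment : Integrable (fun θ : Param d => |θ.2.2|) π

/-- `U(x,y) = E_{c,w,b}[∇_{c,w,b} 𝒜[η(x) c σ(w·x+b)] · ∇_{c,w,b} [η(y) c σ(w·y+b)]]`. -/
def kernelU {d : ℕ} (a : Idx d 2 → Eucl d → ℝ) (η : Eucl d → ℝ) (σ : ℝ → ℝ)
    (π : Measure (Param d)) (x y : Eucl d) : ℝ :=
  ∫ θ, gradDot (fun θ' => opAclassical a (neuron η σ θ') x) (fun θ' => neuron η σ θ' y) θ ∂π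

/-- `𝒰f(y) = ∫_Ω f(x) U(x,y) dμ(x)`. -/
def opU {d : ℕ} (μ : Measure (Eucl d)) (a : Idx d 2 → Eucl d → ℝ) (η : Eucl d → ℝ) (σ : ℝ → ℝ)
    (π : Measure (Param d)) (f : Eucl d → ℝ) (y : Eucl d) : ℝ :=
  ∫ x, f x * kernelU a η σ π x y ∂μ

/-- `Q` is a wide-limit network: a solution in `H²_{(0)}(Ω)`, on `[0, ∞)`, of
`dQ_t/dt = -𝒰[𝒜 Q_t - g]`, `Q_0 = 0`. -/
def IsWideLimit {d : ℕ} (Ω : Set (Eucl d)) (μ : Measure (Eucl d)) (a : Idx d 2 → Eucl d → ℝ)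
    (η : Eucl d → ℝ) (σ : ℝ → ℝ) (π : Measure (Param d)) (g : Eucl d → ℝ)
    (Q : ℝ → H20 Ω) : Prop :=
  Q 0 = 0 ∧ ∀ t, 0 ≤ t → ∃ V : H20 Ω,
    ((V : Jet Ω 2) (Idx.nil d 2) =ᵐ[volume.restrict Ω]
      opU μ a η σ π (fun x => opA a (Q t : Jet Ω 2) x - g x)) ∧
    HasDerivWithinAt Q (-V) (Set.Ici 0) t

end DGM

end

noncomputable section

namespace DGM

/-! ### Words of length at most two -/

/-- The `i`-th standard basis vector. -/
abbrev bv {d : ℕ} (i : Fin d) : Eucl d := EuclideanSpace.single i (1 : ℝ)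

/-- The word `(i)`. -/
def Idx.one {d : ℕ} (i : Fin d) : Idx d 2 := ⟨1, fun _ => i⟩

/-- The word `(i, j)`. -/
def Idx.two {d : ℕ} (i j : Fin d) : Idx d 2 := ⟨2, ![i, j]⟩

/-- The word `(i)`, as a word of length at most one. -/
def Idx.single {d : ℕ} (i : Fin d) : Idx d 1 := ⟨1, fun _ => i⟩

lemma Idx.cases_two {d : ℕ} {P : Idx d 2 → Prop} (h0 : P (Idx.nil d 2))
    (h1 : ∀ i, P (Idx.one i)) (h2 : ∀ i j, P (Idx.two i j)) (α : Idx d 2) : P α := by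
  obtain ⟨k, s⟩ := α
  fin_cases k
  · convert h0 using 1
    unfold Idx.nil
    congr 1
    funext j
    exact j.elim0
  · convert h1 (s ⟨0, by simp⟩) using 1
    unfold Idx.one
    congr 1
    funext j
    congr 1
    exact Subsingleton.elim (α := Fin 1) _ _
  · convert h2 (s ⟨0, by simp⟩) (s ⟨1, by simp⟩) using 1
    unfold Idx.two
    congr 1
    funext j
    change Fin 2 at j
    fin_cases j <;> rfl

lemma Idx.cases_one {d : ℕ} {P : Idx d 1 → Prop} (h0 : P (Idx.nil d 1))
    (h1 : ∀ i, P (Idx.single i)) (α : Idx d 1) : P α := by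
  obtain ⟨k, s⟩ := α
  fin_cases k
  · convert h0 using 1
    unfold Idx.nil
    congr 1
    funext j
    exact j.elim0
  · convert h1 (s ⟨0, by simp⟩) using 1
    unfold Idx.single
    congr 1
    funext j
    congr 1
    exact Subsingleton.elim (α := Fin 1) _ _

lemma Idx.sum_two {d : ℕ} {M : Type*} [AddCommMonoid M] (F : Idx d 2 → M) :
    ∑ α, F α = F (Idx.nil d 2) + ∑ i, F (Idx.one i) + ∑ i, ∑ j, F (Idx.two i j) := by
  rw [Fintype.sum_sigma, Fin.sum_univ_three]
  congr 1
  · congr 1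
    · refine Fintype.sum_eq_single (Idx.nil d 2).2 ?_
      intro s hs
      exact (hs (funext fun j => j.elim0)).elim
    · refine Fintype.sum_equiv (Equiv.funUnique (Fin 1) (Fin d)) _ _ ?_
      intro s
      congr 1
      unfold Idx.one
      congr 1
      funext j
      congr 1
      exact Subsingleton.elim (α := Fin 1) _ _
  · rw [← Fintype.sum_prod_type' (f := fun i j => F (Idx.two i j))]
    refine Fintype.sum_equiv (finTwoArrowEquiv (Fin d)) _ _ ?_
    intro s
    congr 1
    unfold Idx.two
    congr 1
    funext j
    change Fin 2 at j
    fin_cases j <;> rfl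

/-- The family indexed by words of length at most two with the given entries. -/
def jet2 {d : ℕ} {M : Type*} (f0 : M) (f1 : Fin d → M) (f2 : Fin d → Fin d → M) : Idx d 2 → M
  | ⟨⟨0, _⟩, _⟩ => f0
  | ⟨⟨1, _⟩, s⟩ => f1 (s ⟨0, by simp⟩)
  | ⟨⟨2, _⟩, s⟩ => f2 (s ⟨0, by simp⟩) (s ⟨1, by simp⟩)

@[simp] lemma jet2_nil {d : ℕ} {M : Type*} (f0 : M) (f1 : Fin d → M) (f2 : Fin d → Fin d → M) :
    jet2 f0 f1 f2 (Idx.nil d 2) = f0 := rfl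

@[simp] lemma jet2_one {d : ℕ} {M : Type*} (f0 : M) (f1 : Fin d → M) (f2 : Fin d → Fin d → M)
    (i : Fin d) : jet2 f0 f1 f2 (Idx.one i) = f1 i := rfl

@[simp] lemma jet2_two {d : ℕ} {M : Type*} (f0 : M) (f1 : Fin d → M) (f2 : Fin d → Fin d → M)
    (i j : Fin d) : jet2 f0 f1 f2 (Idx.two i j) = f2 i j := rfl

/-- The partial derivative `∂_i f`. -/
def pd {d : ℕ} (i : Fin d) (f : Eucl d → ℝ) (x : Eucl d) : ℝ := fderiv ℝ f x (bv i)

lemma partialD_nil {d p : ℕ} (f : Eucl d → ℝ) : partialD (Idx.nil d p) f = f := by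
  funext x
  exact iteratedFDeriv_zero_apply _

lemma partialD_single {d : ℕ} (i : Fin d) (f : Eucl d → ℝ) :
    partialD (Idx.single i) f = pd i f := by
  funext x
  exact iteratedFDeriv_one_apply _

lemma partialD_one {d : ℕ} (i : Fin d) (f : Eucl d → ℝ) :
    partialD (Idx.one i) f = pd i f := by
  funext x
  exact iteratedFDeriv_one_apply _

lemma pd_pd_apply {d : ℕ} (i j : Fin d) {f : Eucl d → ℝ} (hf : ContDiff ℝ 2 f) (x : Eucl d) :
    pd i (pd j f) x = fderiv ℝ (fderiv ℝ f) x (bv i) (bv j) := by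
  unfold pd
  have : DifferentiableAt ℝ (fderiv ℝ f) x :=
    (hf.fderiv_right (m := 1) le_rfl).differentiable one_ne_zero x
  rw [fderiv_clm_apply this (differentiableAt_const _)]
  simp

lemma partialD_two {d : ℕ} (i j : Fin d) {f : Eucl d → ℝ} (hf : ContDiff ℝ 2 f) :
    partialD (Idx.two i j) f = pd i (pd j f) := by
  funext x
  rw [pd_pd_apply i j hf]
  exact iteratedFDeriv_two_apply _ _ _

lemma pd_comm {d : ℕ} (i j : Fin d) {f : Eucl d → ℝ} (hf : ContDiff ℝ 2 f) :
    pd i (pd j f) = pd j (pd i f) := by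
  funext x
  rw [pd_pd_apply i j hf, pd_pd_apply j i hf]
  exact (hf.contDiffAt.isSymmSndFDerivAt (by simp)).eq _ _

lemma contDiff_pd {d : ℕ} (i : Fin d) {f : Eucl d → ℝ} {m n : WithTop ℕ∞} (hf : ContDiff ℝ n f)
    (h : m + 1 ≤ n) : ContDiff ℝ m (pd i f) :=
  (hf.fderiv_right h).clm_apply contDiff_const

lemma pd_mul {d : ℕ} (i : Fin d) {f g : Eucl d → ℝ} {x : Eucl d} (hf : DifferentiableAt ℝ f x)
    (hg : DifferentiableAt ℝ g x) :
    pd i (fun y => f y * g y) x = pd i f x * g x + f x * pd i g x := by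
  unfold pd
  rw [fderiv_fun_mul hf hg]
  simp
  ring

lemma pd_add {d : ℕ} (i : Fin d) {f g : Eucl d → ℝ} {x : Eucl d} (hf : DifferentiableAt ℝ f x)
    (hg : DifferentiableAt ℝ g x) :
    pd i (fun y => f y + g y) x = pd i f x + pd i g x := by
  unfold pd
  rw [fderiv_fun_add hf hg]
  simp

lemma pd_pd_mul {d : ℕ} (i j : Fin d) {f g : Eucl d → ℝ} (hf : ContDiff ℝ 2 f)
    (hg : ContDiff ℝ 2 g) (x : Eucl d) :
    pd i (pd j (fun y => f y * g y)) x = pd i (pd j f) x * g x + pd j f x * pd i g x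
      + pd i f x * pd j g x + f x * pd i (pd j g) x := by
  have e : pd j (fun y => f y * g y) = fun y => pd j f y * g y + f y * pd j g y := by
    funext y
    exact pd_mul j (hf.differentiable two_ne_zero y) (hg.differentiable two_ne_zero y)
  have h1 : Differentiable ℝ (pd j f) := (contDiff_pd j hf (m := 1) le_rfl).differentiable one_ne_zero
  have h2 : Differentiable ℝ (pd j g) := (contDiff_pd j hg (m := 1) le_rfl).differentiable one_ne_zero
  have h3 : Differentiable ℝ f := hf.differentiable two_ne_zero
  have h4 : Differentiable ℝ g := hg.differentiable two_ne_zero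
  rw [e, pd_add i ((h1 x).fun_mul (h4 x)) ((h3 x).fun_mul (h2 x)), pd_mul i (h1 x) (h4 x),
    pd_mul i (h3 x) (h2 x)]
  ring

/-- The classical `2`-jet of a function. -/
lemma partialD_eq_jet2 {d : ℕ} {f : Eucl d → ℝ} (hf : ContDiff ℝ 2 f) (α : Idx d 2) :
    partialD α f = jet2 f (fun i => pd i f) (fun i j => pd i (pd j f)) α := by
  refine Idx.cases_two (P := fun α => partialD α f
    = jet2 f (fun i => pd i f) (fun i j => pd i (pd j f)) α) ?_ ?_ ?_ α
  · exact partialD_nil f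
  · exact fun i => partialD_one i f
  · exact fun i j => partialD_two i j hf

lemma continuous_partialD {d p : ℕ} {f : Eucl d → ℝ} (hf : ContDiff ℝ p f) (α : Idx d p) :
    Continuous (partialD α f) := by
  have h : Continuous (iteratedFDeriv ℝ (α.1 : ℕ) f) :=
    hf.continuous_iteratedFDeriv (by exact_mod_cast Nat.lt_succ_iff.mp α.1.2)
  unfold partialD
  exact (ContinuousMultilinearMap.apply ℝ _ ℝ _).continuous.comp h

lemma memLp_of_continuous {d : ℕ} {Ω : Set (Eucl d)} (hΩb : Bornology.IsBounded Ω)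
    {f : Eucl d → ℝ} (hf : Continuous f) (q : ℝ≥0∞) : MemLp f q (volume.restrict Ω) := by
  obtain ⟨R, hR⟩ := hΩb.subset_closedBall 0
  have hm : MemLp f q (volume.restrict (Metric.closedBall (0 : Eucl d) R)) := by
    have : IsFiniteMeasure (volume.restrict (Metric.closedBall (0 : Eucl d) R)) :=
      ⟨by simpa using measure_closedBall_lt_top⟩
    obtain ⟨C, hC⟩ := (isCompact_closedBall (0 : Eucl d) R).exists_bound_of_continuousOn
      hf.continuousOn
    refine MemLp.of_bound hf.aestronglyMeasurable C ?_
    filter_upwards [ae_restrict_mem measurableSet_closedBall] with x hx using hC x hx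
  exact hm.mono_measure (Measure.restrict_mono hR le_rfl)

/-! ### Weak directional derivatives -/

/-- `g` is the weak derivative of `f` in direction `e` on `Ω`, tested with `C¹_c(Ω)`. -/
def HasWeakD {d : ℕ} (Ω : Set (Eucl d)) (e : Eucl d) (f g : Eucl d → ℝ) : Prop :=
  ∀ φ : Eucl d → ℝ, ContDiff ℝ 1 φ → HasCompactSupport φ → tsupport φ ⊆ Ω →
    ∫ x in Ω, f x * fderiv ℝ φ x e = -∫ x in Ω, g x * φ x

lemma exists_testFunction_approx {d : ℕ} {Ω : Set (Eucl d)} (hΩ : IsOpen Ω) {φ : Eucl d → ℝ}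
    (h1 : ContDiff ℝ 1 φ) (h2 : HasCompactSupport φ) (h3 : tsupport φ ⊆ Ω)
    {ε : ℝ} (hε : 0 < ε) :
    ∃ ψ, IsTestFunction Ω ψ ∧ (∀ x, |ψ x - φ x| ≤ ε) ∧
      ∀ x, ‖fderiv ℝ ψ x - fderiv ℝ φ x‖ ≤ ε := by
  obtain ⟨δ₀, hδ₀, hsub⟩ := h2.isCompact.exists_cthickening_subset_open hΩ h3
  have c1 : Continuous (fderiv ℝ φ) := h1.continuous_fderiv one_ne_zero
  have u0 : UniformContinuous φ := h2.uniformContinuous_of_continuous h1.continuous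
  have u1 : UniformContinuous (fderiv ℝ φ) :=
    (h2.fderiv (𝕜 := ℝ)).uniformContinuous_of_continuous c1
  obtain ⟨δ₁, hδ₁, hu0⟩ := Metric.uniformContinuous_iff.mp u0 ε hε
  obtain ⟨δ₂, hδ₂, hu1⟩ := Metric.uniformContinuous_iff.mp u1 ε hε
  set δ := min δ₀ (min δ₁ δ₂)
  have hδ : 0 < δ := by positivity
  let b : ContDiffBump (0 : Eucl d) := ⟨δ / 2, δ, by positivity, by linarith⟩
  have hbout : b.rOut = δ := rfl
  refine ⟨MeasureTheory.convolution (b.normed volume) φ (ContinuousLinearMap.lsmul ℝ ℝ) volume,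
    ⟨?_, ?_, ?_⟩, ?_, ?_⟩
  · exact b.hasCompactSupport_normed.contDiff_convolution_left _ b.contDiff_normed
      (h1.continuous.locallyIntegrable)
  · exact HasCompactSupport.convolution _ b.hasCompactSupport_normed h2
  · refine closure_minimal ?_ Metric.isClosed_cthickening |>.trans hsub
    refine (support_convolution_subset _).trans ?_
    rintro _ ⟨x, hx, y, hy, rfl⟩
    have hy' : y ∈ tsupport φ := subset_tsupport _ hy
    rw [b.support_normed_eq, hbout] at hx
    refine Metric.mem_cthickening_of_dist_le _ y _ _ hy' ?_
    have : dist x 0 < δ := hx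
    have h4 : δ ≤ δ₀ := min_le_left _ _
    simp only [dist_eq_norm, add_sub_cancel_right, sub_zero] at this ⊢
    linarith
  · intro x
    have := b.dist_normed_convolution_le (μ := volume) (x₀ := x) (ε := ε)
      h1.continuous.aestronglyMeasurable (fun y hy => (hu0 (lt_of_lt_of_le hy
        ((min_le_right _ _).trans (min_le_left _ _)))).le)
    rwa [Real.dist_eq] at this
  · intro x
    have hd := h2.hasFDerivAt_convolution_right (ContinuousLinearMap.lsmul ℝ ℝ) (μ := volume)
      (b.integrable_normed.locallyIntegrable) h1 x
    rw [hd.fderiv]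
    have := b.dist_normed_convolution_le (μ := volume) (x₀ := x) (ε := ε)
      c1.aestronglyMeasurable (fun y hy => (hu1 (lt_of_lt_of_le hy
        ((min_le_right _ _).trans (min_le_right _ _)))).le)
    rw [dist_eq_norm] at this
    exact this

lemma fderiv_hasCompactSupport_apply {d : ℕ} {φ : Eucl d → ℝ} (h2 : HasCompactSupport φ)
    (e : Eucl d) : HasCompactSupport (fun x => fderiv ℝ φ x e) :=
  h2.fderiv_apply (𝕜 := ℝ) e

lemma integrable_mul_test {d : ℕ} {Ω : Set (Eucl d)} {f ψ : Eucl d → ℝ} (hf : IntegrableOn f Ω)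
    (hc : Continuous ψ) (hs : HasCompactSupport ψ) :
    IntegrableOn (fun x => f x * ψ x) Ω := by
  obtain ⟨C, hC⟩ := hc.bounded_above_of_compact_support hs
  exact hf.mul_bdd (c := C) hc.aestronglyMeasurable (Eventually.of_forall hC)

lemma nonpos_of_forall_le_mul {x C : ℝ} (h : ∀ ε > 0, x ≤ ε * C) : x ≤ 0 := by
  have h0 : Tendsto (fun ε : ℝ => ε * C) (𝓝[>] 0) (𝓝 0) := by
    have : Continuous (fun ε : ℝ => ε * C) := by fun_prop
    simpa using (this.tendsto 0).mono_left nhdsWithin_le_nhds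
  exact ge_of_tendsto h0 (eventually_nhdsWithin_of_forall h)

/-- It suffices to test weak derivatives with smooth functions. -/
lemma hasWeakD_of_smooth {d : ℕ} {Ω : Set (Eucl d)} (hΩ : IsOpen Ω) {e : Eucl d}
    {f g : Eucl d → ℝ} (hf : IntegrableOn f Ω) (hg : IntegrableOn g Ω)
    (h : ∀ φ, IsTestFunction Ω φ →
      ∫ x in Ω, f x * fderiv ℝ φ x e = -∫ x in Ω, g x * φ x) :
    HasWeakD Ω e f g := by
  intro φ h1 h2 h3
  have key : ∀ ε > 0, |(∫ x in Ω, f x * fderiv ℝ φ x e) + ∫ x in Ω, g x * φ x|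
      ≤ ε * ((∫ x in Ω, |f x|) * ‖e‖ + ∫ x in Ω, |g x|) := by
    intro ε hε
    obtain ⟨ψ, hψ, a1, a2⟩ := exists_testFunction_approx hΩ h1 h2 h3 hε
    have hψ' := h ψ hψ
    have i1 : IntegrableOn (fun x => f x * fderiv ℝ φ x e) Ω :=
      integrable_mul_test hf ((h1.continuous_fderiv one_ne_zero).clm_apply continuous_const)
        (fderiv_hasCompactSupport_apply h2 e)
    have i2 : IntegrableOn (fun x => f x * fderiv ℝ ψ x e) Ω :=
      integrable_mul_test hf ((hψ.smooth.continuous_fderiv (by simp)).clm_apply continuous_const)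
        (fderiv_hasCompactSupport_apply hψ.compact e)
    have i3 := integrable_mul_test hg h1.continuous h2
    have i4 := integrable_mul_test hg hψ.smooth.continuous hψ.compact
    have b1 : |∫ x in Ω, (f x * fderiv ℝ φ x e - f x * fderiv ℝ ψ x e)|
        ≤ ε * ((∫ x in Ω, |f x|) * ‖e‖) := by
      have : ε * ((∫ x in Ω, |f x|) * ‖e‖) = ∫ x in Ω, |f x| * (ε * ‖e‖) := by
        rw [integral_mul_const]; ring
      rw [this]
      rw [← Real.norm_eq_abs]
      refine norm_integral_le_of_norm_le (hf.abs.mul_const _) (Eventually.of_forall fun x => ?_)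
      rw [← mul_sub, norm_mul, Real.norm_eq_abs]
      gcongr
      have := (fderiv ℝ φ x - fderiv ℝ ψ x).le_opNorm e
      refine this.trans ?_
      gcongr
      rw [norm_sub_rev]
      exact a2 x
    have b2 : |∫ x in Ω, (g x * φ x - g x * ψ x)| ≤ ε * (∫ x in Ω, |g x|) := by
      rw [mul_comm, ← integral_mul_const]
      rw [← Real.norm_eq_abs]
      refine norm_integral_le_of_norm_le (hg.abs.mul_const _) (Eventually.of_forall fun x => ?_)
      rw [← mul_sub, norm_mul, Real.norm_eq_abs]
      gcongr
      rw [norm_sub_rev]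
      exact a1 x
    rw [integral_sub i1 i2] at b1
    rw [integral_sub i3 i4] at b2
    calc _ = |((∫ x in Ω, f x * fderiv ℝ φ x e) - ∫ x in Ω, f x * fderiv ℝ ψ x e)
          + ((∫ x in Ω, g x * φ x) - ∫ x in Ω, g x * ψ x)| := by
            rw [hψ']; congr 1; ring
      _ ≤ _ := (abs_add_le _ _).trans (by linarith)
  have : |(∫ x in Ω, f x * fderiv ℝ φ x e) + ∫ x in Ω, g x * φ x| ≤ 0 := by
    exact nonpos_of_forall_le_mul key
  have := abs_nonpos_iff.mp this
  linarith

lemma setIntegral_eq_of_support {d : ℕ} {Ω : Set (Eucl d)} {F φ : Eucl d → ℝ}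
    (h : tsupport φ ⊆ Ω) (hF : ∀ x, x ∉ tsupport φ → F x = 0) :
    ∫ x in Ω, F x = ∫ x, F x :=
  setIntegral_eq_integral_of_forall_compl_eq_zero fun x hx => hF x fun hx' => hx (h hx')

lemma fderiv_eq_zero_of_notMem_tsupport {d : ℕ} {φ : Eucl d → ℝ} {x : Eucl d}
    (hx : x ∉ tsupport φ) : fderiv ℝ φ x = 0 := by
  by_contra h
  exact hx (support_fderiv_subset ℝ h)

/-- Classical derivatives are weak derivatives. -/
lemma hasWeakD_of_contDiff {d : ℕ} {Ω : Set (Eucl d)} {f : Eucl d → ℝ} (hf : ContDiff ℝ 1 f)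
    (e : Eucl d) : HasWeakD Ω e f (fun x => fderiv ℝ f x e) := by
  intro φ h1 h2 h3
  have c1 : Continuous (fun x => fderiv ℝ φ x e) :=
    (h1.continuous_fderiv one_ne_zero).clm_apply continuous_const
  have c2 : Continuous (fun x => fderiv ℝ f x e) :=
    (hf.continuous_fderiv one_ne_zero).clm_apply continuous_const
  rw [setIntegral_eq_of_support h3, setIntegral_eq_of_support h3]
  · refine integral_mul_fderiv_eq_neg_fderiv_mul_of_integrable ?_ ?_ ?_
      (fun x _ => hf.differentiable one_ne_zero x) (fun x _ => h1.differentiable one_ne_zero x)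
    · exact (c2.mul h1.continuous).integrable_of_hasCompactSupport (h2.mul_left)
    · exact (hf.continuous.mul c1).integrable_of_hasCompactSupport
        ((fderiv_hasCompactSupport_apply h2 e).mul_left)
    · exact (hf.continuous.mul h1.continuous).integrable_of_hasCompactSupport (h2.mul_left)
  · intro x hx
    rw [image_eq_zero_of_notMem_tsupport hx, mul_zero]
  · intro x hx
    rw [fderiv_eq_zero_of_notMem_tsupport hx]
    simp

/-- Extending a function differentiable on an open set by a compactly supported factor. -/
lemma contDiff_mul_of_tsupport {d : ℕ} {Ω : Set (Eucl d)} (hΩ : IsOpen Ω) {m φ : Eucl d → ℝ}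
    {n : WithTop ℕ∞} (hm : ContDiffOn ℝ n m Ω) (h1 : ContDiff ℝ n φ) (h3 : tsupport φ ⊆ Ω) :
    ContDiff ℝ n (fun x => m x * φ x) := by
  rw [contDiff_iff_contDiffAt]
  intro x
  by_cases hx : x ∈ Ω
  · exact (hm.contDiffAt (hΩ.mem_nhds hx)).mul h1.contDiffAt
  · have hx' : x ∉ tsupport φ := fun h => hx (h3 h)
    have : (fun x => m x * φ x) =ᶠ[𝓝 x] fun _ => 0 := by
      filter_upwards [(isClosed_tsupport φ).isOpen_compl.mem_nhds hx'] with y hy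
      rw [image_eq_zero_of_notMem_tsupport hy, mul_zero]
    exact contDiffAt_const.congr_of_eventuallyEq this

/-- Leibniz rule for weak derivatives. -/
lemma HasWeakD.mul {d : ℕ} {Ω : Set (Eucl d)} (hΩ : IsOpen Ω) {e : Eucl d} {f g m : Eucl d → ℝ}
    (h : HasWeakD Ω e f g) (hf : IntegrableOn f Ω) (hg : IntegrableOn g Ω)
    (hm : ContDiffOn ℝ 1 m Ω) :
    HasWeakD Ω e (fun x => m x * f x) (fun x => m x * g x + fderiv ℝ m x e * f x) := by
  intro φ h1 h2 h3
  have hmφ : ContDiff ℝ 1 (fun x => m x * φ x) := contDiff_mul_of_tsupport hΩ hm h1 h3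
  have hs : HasCompactSupport (fun x => m x * φ x) := h2.mul_left
  have hts : tsupport (fun x => m x * φ x) ⊆ Ω :=
    (closure_mono (Function.support_mul_subset_right m φ)).trans h3
  have k1 := h _ hmφ hs hts
  have d1 : ∀ x ∈ Ω, fderiv ℝ (fun x => m x * φ x) x e
      = m x * fderiv ℝ φ x e + fderiv ℝ m x e * φ x := by
    intro x hx
    rw [fderiv_fun_mul ((hm.contDiffAt (hΩ.mem_nhds hx)).differentiableAt one_ne_zero)
      (h1.differentiable one_ne_zero x)]
    simp
    ring
  have hcd : Continuous (fun x => fderiv ℝ φ x e) :=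
    (h1.continuous_fderiv one_ne_zero).clm_apply continuous_const
  have hfm : ContinuousOn (fun x => fderiv ℝ m x e) Ω :=
    (hm.continuousOn_fderiv_of_isOpen hΩ le_rfl).clm_apply continuousOn_const
  have c3 : ∀ ψ : Eucl d → ℝ, Continuous ψ → tsupport ψ ⊆ Ω →
      Continuous (fun x => fderiv ℝ m x e * ψ x) := by
    intro ψ hψ hψs
    rw [← contDiff_zero (𝕜 := ℝ)]
    exact contDiff_mul_of_tsupport hΩ (contDiffOn_zero.mpr hfm) (contDiff_zero.mpr hψ) hψs
  have c4 : Continuous (fun x => m x * fderiv ℝ φ x e) := by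
    rw [← contDiff_zero (𝕜 := ℝ)]
    exact contDiff_mul_of_tsupport hΩ (hm.of_le zero_le_one) (contDiff_zero.mpr hcd)
      ((tsupport_fderiv_apply_subset ℝ e).trans h3)
  have i1 : IntegrableOn (fun x => f x * (m x * fderiv ℝ φ x e)) Ω :=
    integrable_mul_test hf c4 (fderiv_hasCompactSupport_apply h2 e).mul_left
  have i2 : IntegrableOn (fun x => f x * (fderiv ℝ m x e * φ x)) Ω :=
    integrable_mul_test hf (c3 φ h1.continuous h3) h2.mul_left
  have i3 : IntegrableOn (fun x => g x * (m x * φ x)) Ω :=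
    integrable_mul_test hg hmφ.continuous hs
  have e1 : ∫ x in Ω, f x * fderiv ℝ (fun x => m x * φ x) x e
      = (∫ x in Ω, f x * (m x * fderiv ℝ φ x e)) + ∫ x in Ω, f x * (fderiv ℝ m x e * φ x) := by
    rw [← integral_add i1 i2]
    refine setIntegral_congr_fun hΩ.measurableSet fun x hx => ?_
    simp only [d1 x hx]
    ring
  have e2 : ∫ x in Ω, (m x * g x + fderiv ℝ m x e * f x) * φ x
      = (∫ x in Ω, g x * (m x * φ x)) + ∫ x in Ω, f x * (fderiv ℝ m x e * φ x) := by
    rw [← integral_add i3 i2]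
    refine integral_congr_ae (Eventually.of_forall fun x => ?_)
    simp only
    ring
  rw [e2]
  have e3 : ∫ x in Ω, m x * f x * fderiv ℝ φ x e = ∫ x in Ω, f x * (m x * fderiv ℝ φ x e) := by
    refine integral_congr_ae (Eventually.of_forall fun x => ?_)
    simp only
    ring
  rw [e3]
  linarith

lemma HasWeakD.congr {d : ℕ} {Ω : Set (Eucl d)} {e : Eucl d} {f g f' g' : Eucl d → ℝ}
    (h : HasWeakD Ω e f g) (hf : f =ᵐ[volume.restrict Ω] f') (hg : g =ᵐ[volume.restrict Ω] g') :
    HasWeakD Ω e f' g' := by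
  intro φ h1 h2 h3
  have e1 : ∫ x in Ω, f' x * fderiv ℝ φ x e = ∫ x in Ω, f x * fderiv ℝ φ x e :=
    integral_congr_ae (hf.symm.mul (EventuallyEq.refl _ _))
  have e2 : ∫ x in Ω, g' x * φ x = ∫ x in Ω, g x * φ x :=
    integral_congr_ae (hg.symm.mul (EventuallyEq.refl _ _))
  rw [e1, e2, h φ h1 h2 h3]

lemma HasWeakD.add {d : ℕ} {Ω : Set (Eucl d)} {e : Eucl d} {f g f' g' : Eucl d → ℝ}
    (h : HasWeakD Ω e f g) (h' : HasWeakD Ω e f' g') (hf : IntegrableOn f Ω)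
    (hg : IntegrableOn g Ω) (hf' : IntegrableOn f' Ω) (hg' : IntegrableOn g' Ω) :
    HasWeakD Ω e (fun x => f x + f' x) (fun x => g x + g' x) := by
  intro φ h1 h2 h3
  have c1 : Continuous (fun x => fderiv ℝ φ x e) :=
    (h1.continuous_fderiv one_ne_zero).clm_apply continuous_const
  have s1 := fderiv_hasCompactSupport_apply h2 e
  simp only [add_mul]
  rw [integral_add (integrable_mul_test hf c1 s1) (integrable_mul_test hf' c1 s1),
    integral_add (integrable_mul_test hg h1.continuous h2)
      (integrable_mul_test hg' h1.continuous h2), h φ h1 h2 h3, h' φ h1 h2 h3]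
  ring

/-- Functions with the same integral against all test functions agree. -/
lemma ae_eq_of_integral_test_eq {d : ℕ} {Ω : Set (Eucl d)} (hΩ : IsOpen Ω) {f g : Eucl d → ℝ}
    (hf : LocallyIntegrableOn f Ω) (hg : LocallyIntegrableOn g Ω)
    (h : ∀ φ, IsTestFunction Ω φ → ∫ x in Ω, f x * φ x = ∫ x in Ω, g x * φ x) :
    f =ᵐ[volume.restrict Ω] g := by
  have h0 : ∀ᵐ x ∂(volume : Measure (Eucl d)), x ∈ Ω → (f x - g x) = 0 := by
    refine hΩ.ae_eq_zero_of_integral_contDiff_smul_eq_zero (hf.sub hg) ?_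
    intro φ s1 s2 s3
    have hφ : IsTestFunction Ω φ := ⟨s1, s2, s3⟩
    have k := h φ hφ
    have loc : ∀ F : Eucl d → ℝ, LocallyIntegrableOn F Ω →
        Integrable (fun x => F x * φ x) := by
      intro F hF
      have hFK : IntegrableOn F (tsupport φ) := hF.integrableOn_compact_subset s3 s2.isCompact
      have := (integrable_mul_test hFK s1.continuous s2)
      rwa [integrableOn_iff_integrable_of_support_subset] at this
      intro x hx
      by_contra hx'
      exact hx (by simp [image_eq_zero_of_notMem_tsupport hx'])
    rw [setIntegral_eq_of_support s3, setIntegral_eq_of_support s3] at k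
    · have : ∀ x, φ x • (f - g) x = f x * φ x - g x * φ x := by
        intro x
        simp
        ring
      simp only [Pi.sub_apply, smul_eq_mul] at this ⊢
      simp_rw [this]
      rw [integral_sub (loc f hf) (loc g hg), k, sub_self]
    all_goals
      intro x hx
      rw [image_eq_zero_of_notMem_tsupport hx, mul_zero]
  rw [EventuallyEq, ae_restrict_iff' hΩ.measurableSet]
  filter_upwards [h0] with x hx hxΩ
  linarith [hx hxΩ]

end DGM
end

noncomputable section

namespace DGM

/-! ### Sobolev jets -/

/-- The jet with the given square integrable entries. -/
def toJet {d p : ℕ} {Ω : Set (Eucl d)} (F : Idx d p → Eucl d → ℝ)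
    (h : ∀ α, MemLp (F α) 2 (volume.restrict Ω)) : Jet Ω p :=
  WithLp.toLp 2 fun α => (h α).toLp (F α)

lemma coeFn_toJet {d p : ℕ} {Ω : Set (Eucl d)} (F : Idx d p → Eucl d → ℝ)
    (h : ∀ α, MemLp (F α) 2 (volume.restrict Ω)) (α : Idx d p) :
    toJet F h α =ᵐ[volume.restrict Ω] F α :=
  (h α).coeFn_toLp

lemma volume_restrict_finite {d : ℕ} {Ω : Set (Eucl d)} (hΩb : Bornology.IsBounded Ω) :
    IsFiniteMeasure (volume.restrict Ω) :=
  ⟨by simpa using hΩb.measure_lt_top⟩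

lemma integrableOn_of_memLp {d : ℕ} {Ω : Set (Eucl d)} (hΩb : Bornology.IsBounded Ω)
    {f : Eucl d → ℝ} (hf : MemLp f 2 (volume.restrict Ω)) : IntegrableOn f Ω := by
  have := volume_restrict_finite hΩb
  exact hf.integrable one_le_two

lemma IsTestFunction.fderiv_apply {d : ℕ} {Ω : Set (Eucl d)} {φ : Eucl d → ℝ}
    (h : IsTestFunction Ω φ) (e : Eucl d) : IsTestFunction Ω (fun x => fderiv ℝ φ x e) where
  smooth := (h.smooth.fderiv_right (m := ∞) le_rfl).clm_apply contDiff_const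
  compact := fderiv_hasCompactSupport_apply h.compact e
  support := (tsupport_fderiv_apply_subset ℝ e).trans h.support

lemma IsTestFunction.contDiff_two {d : ℕ} {Ω : Set (Eucl d)} {φ : Eucl d → ℝ}
    (h : IsTestFunction Ω φ) : ContDiff ℝ 2 φ := contDiff_infty.mp h.smooth 2

lemma sobolev_weakD_nil {d : ℕ} {Ω : Set (Eucl d)} (hΩ : IsOpen Ω)
    (hΩb : Bornology.IsBounded Ω) {v : Jet Ω 2} (hv : v ∈ sobolev Ω 2) (i : Fin d) :
    HasWeakD Ω (bv i) (v (Idx.nil d 2)) (v (Idx.one i)) := by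
  refine hasWeakD_of_smooth hΩ (integrableOn_of_memLp hΩb (Lp.memLp _))
    (integrableOn_of_memLp hΩb (Lp.memLp _)) fun φ hφ => ?_
  have := hv (Idx.one i) φ hφ
  rw [partialD_one] at this
  have e : ((Idx.one i).1 : ℕ) = 1 := rfl
  rw [e] at this
  simpa [pd] using this

lemma sobolev_weakD_one {d : ℕ} {Ω : Set (Eucl d)} (hΩ : IsOpen Ω)
    (hΩb : Bornology.IsBounded Ω) {v : Jet Ω 2} (hv : v ∈ sobolev Ω 2) (i j : Fin d) :
    HasWeakD Ω (bv j) (v (Idx.one i)) (v (Idx.two i j)) := by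
  refine hasWeakD_of_smooth hΩ (integrableOn_of_memLp hΩb (Lp.memLp _))
    (integrableOn_of_memLp hΩb (Lp.memLp _)) fun φ hφ => ?_
  have h1 := hv (Idx.two i j) φ hφ
  have h2 := hv (Idx.one i) (pd j φ) (hφ.fderiv_apply (bv j))
  rw [partialD_two i j hφ.contDiff_two] at h1
  rw [partialD_one] at h2
  have e : ((Idx.one i).1 : ℕ) = 1 := rfl
  have e' : ((Idx.two i j).1 : ℕ) = 2 := rfl
  rw [e] at h2
  rw [e'] at h1
  rw [h1] at h2
  have h3 : ∫ x in Ω, v (Idx.one i) x * fderiv ℝ φ x (bv j)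
    = ∫ x in Ω, v (Idx.one i) x * pd j φ x := rfl
  rw [h3]
  linarith

lemma toJet_mem_sobolev {d : ℕ} {Ω : Set (Eucl d)} {f0 : Eucl d → ℝ} {f1 : Fin d → Eucl d → ℝ}
    {f2 : Fin d → Fin d → Eucl d → ℝ}
    (h : ∀ α, MemLp (jet2 f0 f1 f2 α) 2 (volume.restrict Ω))
    (w1 : ∀ i, HasWeakD Ω (bv i) f0 (f1 i))
    (w2 : ∀ i j, HasWeakD Ω (bv j) (f1 i) (f2 i j)) :
    toJet (jet2 f0 f1 f2) h ∈ sobolev Ω 2 := by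
  intro α φ hφ
  have c : ∀ (β : Idx d 2) (ψ : Eucl d → ℝ), ∫ x in Ω, toJet (jet2 f0 f1 f2) h β x * ψ x
      = ∫ x in Ω, jet2 f0 f1 f2 β x * ψ x := fun β ψ =>
    integral_congr_ae ((coeFn_toJet _ h β).mul (EventuallyEq.refl _ _))
  rw [c, c]
  have s1 : ∀ {ψ : Eucl d → ℝ}, IsTestFunction Ω ψ → ContDiff ℝ 1 ψ := fun hψ =>
    hψ.contDiff_two.of_le one_le_two
  refine Idx.cases_two (P := fun α => ∫ x in Ω, jet2 f0 f1 f2 (Idx.nil d 2) x * partialD α φ x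
    = (-1) ^ (α.1 : ℕ) * ∫ x in Ω, jet2 f0 f1 f2 α x * φ x) ?_ ?_ ?_ α
  · rw [partialD_nil]
    simp [Idx.nil]
  · intro i
    rw [partialD_one]
    have := w1 i φ (s1 hφ) hφ.compact hφ.support
    have e' : ((Idx.one i).1 : ℕ) = 1 := rfl
    rw [e', pow_one, neg_one_mul]
    exact this
  · intro i j
    rw [partialD_two i j hφ.contDiff_two]
    have hj := hφ.fderiv_apply (bv j)
    have k1 := w1 i _ (s1 hj) hj.compact hj.support
    have k2 := w2 i j φ (s1 hφ) hφ.compact hφ.support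
    have e' : ((Idx.two i j).1 : ℕ) = 2 := rfl
    rw [e']
    simp only [jet2_nil, jet2_two]
    have k3 : ∫ x in Ω, f0 x * pd i (pd j φ) x
      = ∫ x in Ω, f0 x * fderiv ℝ (fun x => fderiv ℝ φ x (bv j)) x (bv i) := rfl
    rw [k3, k1, k2]
    ring

/-- The jet of a function of class `C²`. -/
def cjet {d : ℕ} {Ω : Set (Eucl d)} (hΩb : Bornology.IsBounded Ω) (f : Eucl d → ℝ)
    (hf : ContDiff ℝ 2 f) : Jet Ω 2 :=
  toJet (fun α => partialD α f) fun α => memLp_of_continuous hΩb (continuous_partialD hf α) 2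

lemma coeFn_cjet {d : ℕ} {Ω : Set (Eucl d)} (hΩb : Bornology.IsBounded Ω) {f : Eucl d → ℝ}
    (hf : ContDiff ℝ 2 f) (α : Idx d 2) :
    cjet hΩb f hf α =ᵐ[volume.restrict Ω] partialD α f :=
  coeFn_toJet _ _ α

lemma jet_ext {d p : ℕ} {Ω : Set (Eucl d)} {u v : Jet Ω p}
    (h : ∀ α, u α =ᵐ[volume.restrict Ω] v α) : u = v := by
  ext α : 1
  exact Lp.ext (h α)

lemma cjet_mem_sobolev {d : ℕ} {Ω : Set (Eucl d)} (hΩb : Bornology.IsBounded Ω)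
    {f : Eucl d → ℝ} (hf : ContDiff ℝ 2 f) : cjet hΩb f hf ∈ sobolev Ω 2 := by
  have h : ∀ α, MemLp (jet2 f (fun i => pd i f) (fun i j => pd j (pd i f)) α) 2
      (volume.restrict Ω) := by
    intro α
    have : (fun i j => pd j (pd i f)) = fun i j => pd i (pd j f) := by
      funext i j
      exact pd_comm j i hf
    rw [this, ← partialD_eq_jet2 hf α]
    exact memLp_of_continuous hΩb (continuous_partialD hf α) 2
  have e : cjet hΩb f hf = toJet _ h := by
    have e2 : (fun i j => pd j (pd i f)) = fun i j => pd i (pd j f) := by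
      funext i j
      exact pd_comm j i hf
    refine jet_ext fun α => (coeFn_cjet hΩb hf α).trans
      (EventuallyEq.trans ?_ (coeFn_toJet _ h α).symm)
    rw [partialD_eq_jet2 hf α, e2]
  rw [e]
  refine toJet_mem_sobolev h (fun i => hasWeakD_of_contDiff (hf.of_le one_le_two) _)
    (fun i j => hasWeakD_of_contDiff (contDiff_pd i hf le_rfl) _)

/-- A Sobolev jet is determined by its entry of order zero. -/
lemma sobolev_eq_zero {d : ℕ} {Ω : Set (Eucl d)} (hΩ : IsOpen Ω)
    (hΩb : Bornology.IsBounded Ω) {v : Jet Ω 2} (hv : v ∈ sobolev Ω 2)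
    (h0 : v (Idx.nil d 2) =ᵐ[volume.restrict Ω] 0) : v = 0 := by
  have li : ∀ α, LocallyIntegrableOn (v α) Ω := fun α =>
    (integrableOn_of_memLp hΩb (Lp.memLp (v α))).locallyIntegrableOn
  refine jet_ext fun α => ?_
  have hz : ((0 : Jet Ω 2) α : Eucl d → ℝ) =ᵐ[volume.restrict Ω] 0 := Lp.coeFn_zero _ _ _
  refine EventuallyEq.trans ?_ hz.symm
  refine ae_eq_of_integral_test_eq hΩ (li α)
    (g := 0) (locallyIntegrableOn_zero) ?_
  intro φ hφ
  have k := hv α φ hφ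
  have k0 : ∫ x in Ω, v (Idx.nil d 2) x * partialD α φ x = 0 := by
    refine integral_eq_zero_of_ae ?_
    filter_upwards [h0] with x hx
    simp [hx]
  rw [k0] at k
  have := (mul_eq_zero.mp k.symm).resolve_left (by positivity)
  simpa using this

lemma sobolev_ext {d : ℕ} {Ω : Set (Eucl d)} (hΩ : IsOpen Ω)
    (hΩb : Bornology.IsBounded Ω) {u v : Jet Ω 2} (hu : u ∈ sobolev Ω 2) (hv : v ∈ sobolev Ω 2)
    (h0 : u (Idx.nil d 2) =ᵐ[volume.restrict Ω] v (Idx.nil d 2)) : u = v := by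
  refine sub_eq_zero.mp (sobolev_eq_zero hΩ hΩb ((sobolev Ω 2).sub_mem hu hv) ?_)
  have : (u - v) (Idx.nil d 2) =ᵐ[volume.restrict Ω]
      u (Idx.nil d 2) - v (Idx.nil d 2) := Lp.coeFn_sub _ _
  filter_upwards [this, h0] with x hx hx0
  rw [hx, Pi.sub_apply, hx0, sub_self, Pi.zero_apply]

lemma continuous_integral_mul {d p : ℕ} {Ω : Set (Eucl d)} (α : Idx d p) {ψ : Eucl d → ℝ}
    (hψ : MemLp ψ 2 (volume.restrict Ω)) :
    Continuous (fun v : Jet Ω p => ∫ x in Ω, v α x * ψ x) := by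
  have : (fun v : Jet Ω p => ∫ x in Ω, v α x * ψ x)
      = fun v : Jet Ω p => inner ℝ (hψ.toLp ψ) (v α) := by
    funext v
    rw [L2.inner_def]
    refine integral_congr_ae ?_
    filter_upwards [hψ.coeFn_toLp] with x hx
    rw [hx]
    rfl
  rw [this]
  exact continuous_const.inner (PiLp.continuous_apply 2 _ α)

lemma isClosed_sobolev {d p : ℕ} (Ω : Set (Eucl d)) : IsClosed (sobolev Ω p : Set (Jet Ω p)) := by
  have : (sobolev Ω p : Set (Jet Ω p)) = ⋂ (α : Idx d p) (φ : Eucl d → ℝ)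
      (_ : IsTestFunction Ω φ), {v : Jet Ω p | ∫ x in Ω, v (Idx.nil d p) x * partialD α φ x
      = (-1) ^ (α.1 : ℕ) * ∫ x in Ω, v α x * φ x} := by
    ext v
    simp only [Set.mem_iInter]
    rfl
  rw [this]
  refine isClosed_iInter fun α => isClosed_iInter fun φ => isClosed_iInter fun hφ => ?_
  exact isClosed_eq (continuous_integral_mul _ (hφ.partialD_memLp α))
    (continuous_const.mul (continuous_integral_mul _ hφ.memLp))

lemma continuous_truncate {d : ℕ} (Ω : Set (Eucl d)) : Continuous (truncate Ω) :=
  (PiLp.continuous_toLp 2 _).comp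
    (continuous_pi fun _ => PiLp.continuous_apply 2 _ _)

lemma isClosed_H20 {d : ℕ} (Ω : Set (Eucl d)) : IsClosed (H20 Ω : Set (Jet Ω 2)) := by
  have h1 : IsClosed (sobolevZero Ω 1 : Set (Jet Ω 1)) :=
    Submodule.isClosed_topologicalClosure _
  exact (isClosed_sobolev Ω).inter (h1.preimage (continuous_truncate Ω))

instance {d : ℕ} (Ω : Set (Eucl d)) : CompleteSpace (H20 Ω) :=
  (isClosed_H20 Ω).completeSpace_coe

/-! ### `H¹₀` -/

/-- `u` is the limit in `H¹(Ω)` of the functions `φ k`. -/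
def TendstoH1 {d : ℕ} (Ω : Set (Eucl d)) (φ : ℕ → Eucl d → ℝ) (u : Jet Ω 1) : Prop :=
  ∀ α, Tendsto (fun k => eLpNorm (fun x => u α x - partialD α (φ k) x) 2 (volume.restrict Ω))
    atTop (𝓝 0)

lemma partialD_add_test {d p : ℕ} {Ω : Set (Eucl d)} {φ ψ : Eucl d → ℝ}
    (hφ : IsTestFunction Ω φ) (hψ : IsTestFunction Ω ψ) (α : Idx d p) :
    partialD α (φ + ψ) = partialD α φ + partialD α ψ := by
  funext x
  have h1 : ContDiff ℝ (α.1 : ℕ) φ := hφ.smooth.of_le (by exact_mod_cast le_top)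
  have h2 : ContDiff ℝ (α.1 : ℕ) ψ := hψ.smooth.of_le (by exact_mod_cast le_top)
  simp only [partialD, Pi.add_apply]
  rw [iteratedFDeriv_add h1 h2]
  rfl

lemma partialD_smul_test {d p : ℕ} {Ω : Set (Eucl d)} {φ : Eucl d → ℝ}
    (hφ : IsTestFunction Ω φ) (c : ℝ) (α : Idx d p) :
    partialD α (c • φ) = c • partialD α φ := by
  funext x
  have h1 : ContDiffAt ℝ (α.1 : ℕ) φ x :=
    (hφ.smooth.of_le (by exact_mod_cast le_top)).contDiffAt
  simp only [partialD, Pi.smul_apply]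
  rw [iteratedFDeriv_const_smul_apply h1]
  rfl

lemma IsTestFunction.add {d : ℕ} {Ω : Set (Eucl d)} {φ ψ : Eucl d → ℝ}
    (hφ : IsTestFunction Ω φ) (hψ : IsTestFunction Ω ψ) : IsTestFunction Ω (φ + ψ) where
  smooth := hφ.smooth.add hψ.smooth
  compact := hφ.compact.add hψ.compact
  support := (tsupport_add φ ψ).trans (Set.union_subset hφ.support hψ.support)

lemma IsTestFunction.smul {d : ℕ} {Ω : Set (Eucl d)} {φ : Eucl d → ℝ}
    (hφ : IsTestFunction Ω φ) (c : ℝ) : IsTestFunction Ω (c • φ) where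
  smooth := hφ.smooth.const_smul c
  compact := HasCompactSupport.smul_left (f := fun _ => c) hφ.compact
  support := (closure_mono (Function.support_const_smul_subset c φ)).trans hφ.support

lemma isTestFunction_zero {d : ℕ} (Ω : Set (Eucl d)) : IsTestFunction Ω (0 : Eucl d → ℝ) where
  smooth := contDiff_const
  compact := HasCompactSupport.zero
  support := by simp [tsupport]

lemma span_testJets {d : ℕ} {Ω : Set (Eucl d)} {v : Jet Ω 1}
    (hv : v ∈ Submodule.span ℝ {v : Jet Ω 1 | ∃ φ, IsTestFunction Ω φ ∧
      ∀ α, v α =ᵐ[volume.restrict Ω] partialD α φ}) :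
    ∃ φ, IsTestFunction Ω φ ∧ ∀ α, v α =ᵐ[volume.restrict Ω] partialD α φ := by
  induction hv using Submodule.span_induction with
  | mem v h => exact h
  | zero =>
    refine ⟨0, isTestFunction_zero Ω, fun α => ?_⟩
    have : partialD α (0 : Eucl d → ℝ) = 0 := by
      have := partialD_smul_test (isTestFunction_zero Ω) 0 α
      simpa using this
    rw [this]
    exact Lp.coeFn_zero _ _ _
  | add u v _ _ hu hv =>
    obtain ⟨φ, h1, h2⟩ := hu
    obtain ⟨ψ, h3, h4⟩ := hv
    refine ⟨φ + ψ, h1.add h3, fun α => ?_⟩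
    rw [partialD_add_test h1 h3]
    exact (Lp.coeFn_add (u α) (v α)).trans ((h2 α).add (h4 α))
  | smul c v _ hv =>
    obtain ⟨φ, h1, h2⟩ := hv
    refine ⟨c • φ, h1.smul c, fun α => ?_⟩
    rw [partialD_smul_test h1]
    exact (Lp.coeFn_smul c (v α)).trans ((h2 α).const_smul c)

lemma exists_tendstoH1 {d : ℕ} {Ω : Set (Eucl d)} {u : Jet Ω 1} (hu : u ∈ sobolevZero Ω 1) :
    ∃ φ : ℕ → Eucl d → ℝ, (∀ k, IsTestFunction Ω (φ k)) ∧ TendstoH1 Ω φ u := by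
  obtain ⟨s, hs, hlim⟩ := mem_closure_iff_seq_limit.mp
    (show u ∈ closure _ from hu)
  choose φ hφ hφ' using fun k => span_testJets (hs k)
  refine ⟨φ, hφ, fun α => ?_⟩
  have h1 : Tendsto (fun k => s k α) atTop (𝓝 (u α)) :=
    ((PiLp.continuous_apply 2 _ α).tendsto u).comp hlim
  rw [Lp.tendsto_Lp_iff_tendsto_eLpNorm'] at h1
  refine h1.congr fun k => ?_
  rw [← eLpNorm_neg]
  refine eLpNorm_congr_ae ?_
  filter_upwards [hφ' k α] with x hx
  simp [hx]

lemma mem_sobolevZero_of_tendsto {d : ℕ} {Ω : Set (Eucl d)} {u : Jet Ω 1}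
    {φ : ℕ → Eucl d → ℝ} (hφ : ∀ k, IsTestFunction Ω (φ k)) (h : TendstoH1 Ω φ u) :
    u ∈ sobolevZero Ω 1 := by
  have hm : ∀ k α, MemLp (partialD (p := 1) α (φ k)) 2 (volume.restrict Ω) := fun k α =>
    (hφ k).partialD_memLp α
  refine mem_closure_iff_seq_limit.mpr ⟨fun k => toJet (fun α => partialD α (φ k)) (hm k),
    fun k => Submodule.subset_span ⟨φ k, hφ k, coeFn_toJet _ _⟩, ?_⟩
  rw [(PiLp.homeomorph 2 (fun _ : Idx d 1 => L2 Ω)).isInducing.tendsto_nhds_iff]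
  refine tendsto_pi_nhds.mpr fun α => ?_
  rw [Lp.tendsto_Lp_iff_tendsto_eLpNorm']
  refine (h α).congr fun k => ?_
  rw [← eLpNorm_neg]
  refine eLpNorm_congr_ae ?_
  filter_upwards [coeFn_toJet _ (hm k) α] with x hx
  simp only [Pi.neg_apply, Pi.sub_apply, Function.comp, neg_sub]
  exact congrArg (· - _) hx.symm

/-- Limits in `H¹` of `C¹_c(Ω)` functions belong to `H¹₀(Ω)`. -/
lemma mem_sobolevZero_of_tendsto_C1 {d : ℕ} {Ω : Set (Eucl d)} (hΩ : IsOpen Ω)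
    (hΩb : Bornology.IsBounded Ω) {u : Jet Ω 1}
    {f : ℕ → Eucl d → ℝ} (h1 : ∀ k, ContDiff ℝ 1 (f k)) (h2 : ∀ k, HasCompactSupport (f k))
    (h3 : ∀ k, tsupport (f k) ⊆ Ω) (h : TendstoH1 Ω f u) :
    u ∈ sobolevZero Ω 1 := by
  have := volume_restrict_finite hΩb
  have hpos : ∀ k : ℕ, (0 : ℝ) < 1 / (k + 1) := fun k => Nat.one_div_pos_of_nat
  choose φ hφ a0 a1 using fun k => exists_testFunction_approx hΩ (h1 k) (h2 k) (h3 k) (hpos k)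
  refine mem_sobolevZero_of_tendsto hφ fun α => ?_
  have hb : ∀ k x, |partialD α (f k) x - partialD α (φ k) x| ≤ 1 / ((k : ℝ) + 1) := by
    intro k x
    refine Idx.cases_one (P := fun α =>
      |partialD α (f k) x - partialD α (φ k) x| ≤ 1 / ((k : ℝ) + 1)) ?_ ?_ α
    · simp only [partialD_nil]
      rw [abs_sub_comm]
      exact a0 k x
    · intro i
      simp only [partialD_single, pd]
      rw [abs_sub_comm]
      have := (fderiv ℝ (φ k) x - fderiv ℝ (f k) x).le_opNorm (bv i)
      simp only [PiLp.norm_single, norm_one, mul_one] at this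
      exact this.trans (a1 k x)
  set c : ℝ≥0∞ := (volume.restrict Ω) Set.univ ^ (2 : ℝ≥0∞).toReal⁻¹
  have hc : c ≠ ⊤ := ENNReal.rpow_ne_top_of_nonneg (by positivity) (measure_ne_top _ _)
  have lim : Tendsto (fun k : ℕ => eLpNorm (fun x => u α x - partialD α (f k) x) 2
      (volume.restrict Ω) + c * ENNReal.ofReal (1 / ((k : ℝ) + 1))) atTop (𝓝 0) := by
    have l2 : Tendsto (fun k : ℕ => ENNReal.ofReal (1 / ((k : ℝ) + 1))) atTop (𝓝 0) := by
      have := ENNReal.tendsto_ofReal (tendsto_one_div_add_atTop_nhds_zero_nat (𝕜 := ℝ))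
      simpa using this
    simpa using (h α).add (ENNReal.Tendsto.const_mul l2 (Or.inr hc))
  refine tendsto_of_tendsto_of_tendsto_of_le_of_le tendsto_const_nhds lim (fun _ => zero_le) ?_
  intro k
  have mf : AEStronglyMeasurable (partialD α (f k)) (volume.restrict Ω) :=
    (continuous_partialD (h1 k) α).aestronglyMeasurable
  have mφ : AEStronglyMeasurable (partialD α (φ k)) (volume.restrict Ω) :=
    ((hφ k).partialD_memLp α).1
  calc eLpNorm (fun x => u α x - partialD α (φ k) x) 2 (volume.restrict Ω)
      = eLpNorm ((fun x => u α x - partialD α (f k) x)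
          + fun x => partialD α (f k) x - partialD α (φ k) x) 2 (volume.restrict Ω) := by
        congr 1
        funext x
        simp
    _ ≤ _ := eLpNorm_add_le ((Lp.memLp (u α)).1.sub mf) (mf.sub mφ) one_le_two
    _ ≤ _ := by
      refine add_le_add le_rfl ?_
      exact eLpNorm_le_of_ae_bound (Eventually.of_forall (hb k))

end DGM
end

noncomputable section

namespace DGM

/-! ### Multiplication of Sobolev functions by smooth functions -/

lemma exists_bound_on {d : ℕ} {Ω : Set (Eucl d)} (hΩb : Bornology.IsBounded Ω)
    {m : Eucl d → ℝ} (hm : Continuous m) : ∃ C : ℝ, 0 ≤ C ∧ ∀ x ∈ Ω, |m x| ≤ C := by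
  obtain ⟨R, hR⟩ := hΩb.subset_closedBall 0
  obtain ⟨C, hC⟩ := (isCompact_closedBall (0 : Eucl d) R).exists_bound_of_continuousOn
    hm.continuousOn
  exact ⟨max C 0, le_max_right _ _, fun x hx => (hC x (hR hx)).trans (le_max_left _ _)⟩

lemma memLp_mul {d : ℕ} {Ω : Set (Eucl d)} (hΩ : IsOpen Ω) (hΩb : Bornology.IsBounded Ω)
    {m f : Eucl d → ℝ} (hm : Continuous m) (hf : MemLp f 2 (volume.restrict Ω)) :
    MemLp (fun x => m x * f x) 2 (volume.restrict Ω) := by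
  obtain ⟨C, hC0, hC⟩ := exists_bound_on hΩb hm
  refine hf.of_le_mul (c := C) (hm.aestronglyMeasurable.mul hf.1) ?_
  filter_upwards [ae_restrict_mem hΩ.measurableSet] with x hx
  rw [norm_mul]
  exact mul_le_mul_of_nonneg_right (hC x hx) (norm_nonneg _)

lemma eLpNorm_mul_le {d : ℕ} {Ω : Set (Eucl d)} (hΩ : IsOpen Ω)
    {m f : Eucl d → ℝ} {C : ℝ} (hC : ∀ x ∈ Ω, |m x| ≤ C) :
    eLpNorm (fun x => m x * f x) 2 (volume.restrict Ω)
      ≤ ENNReal.ofReal C * eLpNorm f 2 (volume.restrict Ω) := by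
  refine eLpNorm_le_mul_eLpNorm_of_ae_le_mul ?_ 2
  filter_upwards [ae_restrict_mem hΩ.measurableSet] with x hx
  rw [norm_mul]
  exact mul_le_mul_of_nonneg_right (hC x hx) (norm_nonneg _)

lemma IsTestFunction.mul_left {d : ℕ} {Ω : Set (Eucl d)} {φ χ : Eucl d → ℝ}
    (hφ : IsTestFunction Ω φ) (hχ : ContDiff ℝ ∞ χ) : IsTestFunction Ω (fun x => χ x * φ x) where
  smooth := hχ.mul hφ.smooth
  compact := hφ.compact.mul_left
  support := (closure_mono (Function.support_mul_subset_right χ φ)).trans hφ.support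

lemma exists_mul_H20 {d : ℕ} {Ω : Set (Eucl d)} (hΩ : IsOpen Ω) (hΩb : Bornology.IsBounded Ω)
    {χ : Eucl d → ℝ} (hχ : ContDiff ℝ ∞ χ) {v : Jet Ω 2} (hv : v ∈ H20 Ω) :
    ∃ w ∈ H20 Ω, ∀ α, w α =ᵐ[volume.restrict Ω]
      jet2 (fun x => χ x * v (Idx.nil d 2) x)
        (fun i x => χ x * v (Idx.one i) x + pd i χ x * v (Idx.nil d 2) x)
        (fun i j x => χ x * v (Idx.two i j) x + pd j χ x * v (Idx.one i) x
          + (pd i χ x * v (Idx.one j) x + pd j (pd i χ) x * v (Idx.nil d 2) x)) α := by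
  have c0 : Continuous χ := hχ.continuous
  have hχ2 : ContDiff ℝ 2 χ := contDiff_infty.mp hχ 2
  have s1 : ∀ i, ContDiff ℝ 1 (pd i χ) := fun i => contDiff_pd i hχ2 le_rfl
  have c1 : ∀ i, Continuous (pd i χ) := fun i => (s1 i).continuous
  have c2 : ∀ i j, Continuous (pd j (pd i χ)) := fun i j =>
    (contDiff_pd (m := 0) j (s1 i) (by simp)).continuous
  have L : ∀ α, MemLp (v α) 2 (volume.restrict Ω) := fun α => Lp.memLp _
  have hm : ∀ α, MemLp (jet2 (fun x => χ x * v (Idx.nil d 2) x)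
        (fun i x => χ x * v (Idx.one i) x + pd i χ x * v (Idx.nil d 2) x)
        (fun i j x => χ x * v (Idx.two i j) x + pd j χ x * v (Idx.one i) x
          + (pd i χ x * v (Idx.one j) x + pd j (pd i χ) x * v (Idx.nil d 2) x)) α) 2
      (volume.restrict Ω) := by
    refine Idx.cases_two (memLp_mul hΩ hΩb c0 (L _)) (fun i => ?_) (fun i j => ?_)
    · exact (memLp_mul hΩ hΩb c0 (L _)).add (memLp_mul hΩ hΩb (c1 i) (L _))
    · exact ((memLp_mul hΩ hΩb c0 (L _)).add (memLp_mul hΩ hΩb (c1 j) (L _))).add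
        ((memLp_mul hΩ hΩb (c1 i) (L _)).add (memLp_mul hΩ hΩb (c2 i j) (L _)))
  have I : ∀ {f : Eucl d → ℝ}, MemLp f 2 (volume.restrict Ω) → IntegrableOn f Ω :=
    fun hf => integrableOn_of_memLp hΩb hf
  refine ⟨toJet _ hm, ⟨toJet_mem_sobolev hm (fun i => ?_) (fun i j => ?_), ?_⟩, coeFn_toJet _ hm⟩
  · exact (sobolev_weakD_nil hΩ hΩb hv.1 i).mul hΩ (I (L _)) (I (L _))
      (hχ2.of_le one_le_two).contDiffOn
  · refine HasWeakD.add ((sobolev_weakD_one hΩ hΩb hv.1 i j).mul hΩ (I (L _)) (I (L _))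
      (hχ2.of_le one_le_two).contDiffOn) ((sobolev_weakD_nil hΩ hΩb hv.1 j).mul hΩ (I (L _))
      (I (L _)) (s1 i).contDiffOn) ?_ ?_ ?_ ?_
    · exact I (memLp_mul hΩ hΩb c0 (L _))
    · exact I ((memLp_mul hΩ hΩb c0 (L _)).add (memLp_mul hΩ hΩb (c1 j) (L _)))
    · exact I (memLp_mul hΩ hΩb (c1 i) (L _))
    · exact I ((memLp_mul hΩ hΩb (c1 i) (L _)).add (memLp_mul hΩ hΩb (c2 i j) (L _)))
  · obtain ⟨φ, hφ, hlim⟩ := exists_tendstoH1 hv.2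
    refine mem_sobolevZero_of_tendsto (φ := fun k x => χ x * φ k x)
      (fun k => (hφ k).mul_left hχ) ?_
    obtain ⟨C, hC0, hC⟩ := exists_bound_on hΩb c0
    choose D hD0 hD using fun i => exists_bound_on hΩb (c1 i)
    have l0 : Tendsto (fun k => eLpNorm (fun x => v (Idx.nil d 2) x - φ k x) 2
        (volume.restrict Ω)) atTop (𝓝 0) := by
      have := hlim (Idx.nil d 1)
      simp only [partialD_nil] at this
      exact this
    have l1 : ∀ i, Tendsto (fun k => eLpNorm (fun x => v (Idx.one i) x - pd i (φ k) x) 2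
        (volume.restrict Ω)) atTop (𝓝 0) := by
      intro i
      have := hlim (Idx.single i)
      simp only [partialD_single] at this
      exact this
    have mφ : ∀ k, AEStronglyMeasurable (φ k) (volume.restrict Ω) := fun k =>
      (hφ k).memLp.1
    have mφ1 : ∀ k i, AEStronglyMeasurable (pd i (φ k)) (volume.restrict Ω) := fun k i =>
      ((hφ k).fderiv_apply (bv i)).memLp.1
    refine Idx.cases_one ?_ (fun i => ?_)
    · refine tendsto_of_tendsto_of_tendsto_of_le_of_le tendsto_const_nhds
        (g := fun _ => 0)
        (h := fun k => ENNReal.ofReal C * eLpNorm (fun x => v (Idx.nil d 2) x - φ k x) 2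
          (volume.restrict Ω)) ?_ (fun _ => zero_le) fun k => ?_
      · simpa using ENNReal.Tendsto.const_mul l0 (Or.inr ENNReal.ofReal_ne_top)
      · simp only [partialD_nil]
        refine le_trans (le_of_eq (eLpNorm_congr_ae ?_)) (eLpNorm_mul_le hΩ hC)
        filter_upwards [coeFn_toJet _ hm (Idx.nil d 2)] with x hx
        have hx' : (truncate Ω) (toJet _ hm) (Idx.nil d 1) x = χ x * v (Idx.nil d 2) x := hx
        rw [hx']
        ring
    · refine tendsto_of_tendsto_of_tendsto_of_le_of_le tendsto_const_nhds
        (g := fun _ => 0)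
        (h := fun k => ENNReal.ofReal C * eLpNorm (fun x => v (Idx.one i) x - pd i (φ k) x) 2
          (volume.restrict Ω) + ENNReal.ofReal (D i) *
            eLpNorm (fun x => v (Idx.nil d 2) x - φ k x) 2
          (volume.restrict Ω)) ?_ (fun _ => zero_le) fun k => ?_
      · simpa using (ENNReal.Tendsto.const_mul (l1 i) (Or.inr ENNReal.ofReal_ne_top)).add
          (ENNReal.Tendsto.const_mul l0 (Or.inr ENNReal.ofReal_ne_top))
      · simp only [partialD_single]
        refine le_trans (le_of_eq (eLpNorm_congr_ae
          (g := (fun x => χ x * (v (Idx.one i) x - pd i (φ k) x)) +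
            fun x => pd i χ x * (v (Idx.nil d 2) x - φ k x)) ?_)) ?_
        · filter_upwards [coeFn_toJet _ hm (Idx.one i)] with x hx
          have hx' : (truncate Ω) (toJet _ hm) (Idx.single i) x
            = χ x * v (Idx.one i) x + pd i χ x * v (Idx.nil d 2) x := hx
          rw [hx', pd_mul i (hχ2.differentiable two_ne_zero x)
            ((hφ k).contDiff_two.differentiable two_ne_zero x)]
          simp only [Pi.add_apply]
          ring
        · refine (eLpNorm_add_le ?_ ?_ one_le_two).trans
            (add_le_add (eLpNorm_mul_le hΩ hC) (eLpNorm_mul_le hΩ (hD i)))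
          · exact c0.aestronglyMeasurable.mul ((L _).1.sub (mφ1 k i))
          · exact (c1 i).aestronglyMeasurable.mul ((L _).1.sub (mφ k))

/-! ### Functions vanishing on the boundary -/

lemma tendsto_eLpNorm_of_bounded {X : Type*} [MeasurableSpace X] {μ : Measure X}
    [IsFiniteMeasure μ] {F : ℕ → X → ℝ} {C : ℝ} (hm : ∀ k, AEStronglyMeasurable (F k) μ)
    (hb : ∀ k, ∀ᵐ x ∂μ, |F k x| ≤ C) (hl : ∀ᵐ x ∂μ, Tendsto (fun k => F k x) atTop (𝓝 0)) :
    Tendsto (fun k => eLpNorm (F k) 2 μ) atTop (𝓝 0) := by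
  have h2 : Tendsto (fun k => ∫⁻ x, ‖F k x‖ₑ ^ (2 : ℝ) ∂μ) atTop (𝓝 (∫⁻ _, 0 ∂μ)) := by
    refine tendsto_lintegral_of_dominated_convergence' (fun _ => ENNReal.ofReal C ^ (2 : ℝ))
      (fun k => (hm k).enorm.pow_const _) (fun k => ?_) ?_ ?_
    · filter_upwards [hb k] with x hx
      gcongr
      rw [Real.enorm_eq_ofReal_abs]
      exact ENNReal.ofReal_le_ofReal hx
    · rw [lintegral_const]
      exact ENNReal.mul_ne_top (ENNReal.rpow_ne_top_of_nonneg (by positivity)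
        ENNReal.ofReal_ne_top) (measure_ne_top _ _)
    · filter_upwards [hl] with x hx
      have h0 : Tendsto (fun k => ‖F k x‖ₑ) atTop (𝓝 0) := by
        simpa using hx.enorm
      have h1 := ((ENNReal.continuous_rpow_const (y := (2 : ℝ))).tendsto 0).comp h0
      rw [ENNReal.zero_rpow_of_pos (by norm_num)] at h1
      exact h1
  have h3 := ((ENNReal.continuous_rpow_const (y := (1 / 2 : ℝ))).tendsto _).comp h2
  simp only [lintegral_zero] at h3
  rw [ENNReal.zero_rpow_of_pos (by norm_num)] at h3
  refine h3.congr fun k => ?_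
  rw [eLpNorm_eq_lintegral_rpow_enorm_toReal (by simp) (by simp)]
  simp

/-- A smooth truncation of the identity near zero. -/
def softTrunc (s : ℝ) : ℝ := s * Real.smoothTransition (s - 1)

lemma contDiff_softTrunc : ContDiff ℝ ∞ softTrunc :=
  contDiff_id.mul (Real.smoothTransition.contDiff.comp (contDiff_id.sub contDiff_const))

lemma softTrunc_of_le {s : ℝ} (h : s ≤ 1) : softTrunc s = 0 := by
  unfold softTrunc
  rw [Real.smoothTransition.zero_of_nonpos (by linarith), mul_zero]

lemma softTrunc_of_ge {s : ℝ} (h : 2 ≤ s) : softTrunc s = s := by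
  unfold softTrunc
  rw [Real.smoothTransition.one_of_one_le (by linarith), mul_one]

lemma abs_softTrunc_le (s : ℝ) : |softTrunc s| ≤ |s| := by
  unfold softTrunc
  rw [abs_mul, abs_of_nonneg (Real.smoothTransition.nonneg _)]
  exact mul_le_of_le_one_right (abs_nonneg _) (Real.smoothTransition.le_one _)

lemma deriv_softTrunc_of_gt {s : ℝ} (h : 2 < s) : deriv softTrunc s = 1 := by
  have : softTrunc =ᶠ[𝓝 s] id := by
    filter_upwards [lt_mem_nhds h] with y hy using softTrunc_of_ge hy.le
  rw [this.deriv_eq, deriv_id]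

lemma exists_deriv_softTrunc_bound : ∃ C : ℝ, 1 ≤ C ∧ ∀ s, |deriv softTrunc s| ≤ C := by
  have hc : Continuous (deriv softTrunc) := contDiff_softTrunc.continuous_deriv (by simp)
  obtain ⟨C, hC⟩ := (isCompact_Icc (a := (1 : ℝ)) (b := 2)).exists_bound_of_continuousOn
    hc.continuousOn
  refine ⟨max C 1, le_max_right _ _, fun s => ?_⟩
  rcases lt_or_ge s 1 with h | h
  · have : softTrunc =ᶠ[𝓝 s] fun _ => 0 := by
      filter_upwards [gt_mem_nhds h] with y hy using softTrunc_of_le (le_of_lt hy)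
    rw [this.deriv_eq]
    simp
  rcases lt_or_ge 2 s with h' | h'
  · rw [deriv_softTrunc_of_gt h']
    simp
  · exact (hC s ⟨h, h'⟩).trans (le_max_left _ _)

/-- Products of the auxiliary function and a `C²` function belong to `H²₍₀₎(Ω)`. -/
lemma cjet_mul_mem_H20 {d : ℕ} {Ω : Set (Eucl d)} (hΩ : IsOpen Ω)
    (hΩb : Bornology.IsBounded Ω) {η m : Eucl d → ℝ} (hη : IsAuxiliary Ω η)
    (hm : ContDiff ℝ 2 m) (hηm : ContDiff ℝ 2 (fun x => η x * m x)) :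
    cjet hΩb (fun x => η x * m x) hηm ∈ H20 Ω := by
  have := volume_restrict_finite hΩb
  refine ⟨cjet_mem_sobolev hΩb hηm, ?_⟩
  have hη1 : ContDiff ℝ 1 η := hη.smooth.1.of_le (by norm_cast)
  have hm1 : ContDiff ℝ 1 m := hm.of_le one_le_two
  obtain ⟨C, hC1, hC⟩ := exists_deriv_softTrunc_bound
  let G : ℕ → Eucl d → ℝ := fun k x => ((k : ℝ) + 1)⁻¹ * softTrunc (((k : ℝ) + 1) * η x) * m x
  have hGs : ∀ k, ContDiff ℝ 1 (G k) := fun k =>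
    (contDiff_const.mul ((contDiff_infty.mp contDiff_softTrunc 1).comp
      (contDiff_const.mul hη1))).mul hm1
  let f : ℕ → Eucl d → ℝ := fun k => Ω.indicator (G k)
  have hcl : ∀ x ∈ closure Ω, x ∉ Ω → η x = 0 := by
    intro x hx hxΩ
    exact hη.zero x ⟨hx, by rwa [hΩ.interior_eq]⟩
  have hfsupp : ∀ k, tsupport (f k) ⊆ closure Ω ∩ {x | ((k : ℝ) + 1)⁻¹ ≤ η x} := by
    intro k
    refine closure_minimal ?_ (isClosed_closure.inter
      (isClosed_le continuous_const hη1.continuous))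
    intro x hx
    have hxΩ : x ∈ Ω := Set.mem_of_indicator_ne_zero hx
    refine ⟨subset_closure hxΩ, ?_⟩
    by_contra hlt
    simp only [Set.mem_ofPred_eq, not_le] at hlt
    refine hx ?_
    simp only [f, Set.indicator_of_mem hxΩ, G]
    rw [softTrunc_of_le]
    · simp
    · have hk : (0 : ℝ) < (k : ℝ) + 1 := by positivity
      have := mul_lt_mul_of_pos_left hlt hk
      rw [mul_inv_cancel₀ hk.ne'] at this
      exact this.le
  have hfΩ : ∀ k, tsupport (f k) ⊆ Ω := by
    intro k x hx
    obtain ⟨h1, h2⟩ := hfsupp k hx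
    by_contra hxΩ
    have h0 := hcl x h1 hxΩ
    simp only [Set.mem_ofPred_eq, h0] at h2
    have : (0 : ℝ) < ((k : ℝ) + 1)⁻¹ := by positivity
    linarith
  have hfC : ∀ k, HasCompactSupport (f k) := fun k =>
    (hΩb.isCompact_closure).of_isClosed_subset (isClosed_tsupport _)
      ((hfsupp k).trans Set.inter_subset_left)
  have hfs : ∀ k, ContDiff ℝ 1 (f k) := by
    intro k
    rw [contDiff_iff_contDiffAt]
    intro x
    by_cases hx : x ∈ Ω
    · refine (hGs k).contDiffAt.congr_of_eventuallyEq ?_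
      filter_upwards [hΩ.mem_nhds hx] with y hy using Set.indicator_of_mem hy _
    · have hx' : x ∉ tsupport (f k) := fun h => hx (hfΩ k h)
      refine (contDiffAt_const (c := (0 : ℝ))).congr_of_eventuallyEq ?_
      filter_upwards [(isClosed_tsupport (f k)).isOpen_compl.mem_nhds hx'] with y hy
      exact image_eq_zero_of_notMem_tsupport hy
  refine mem_sobolevZero_of_tendsto_C1 hΩ hΩb hfs hfC hfΩ ?_
  obtain ⟨Cη, hCη0, hCη⟩ := exists_bound_on hΩb hη1.continuous
  obtain ⟨Cm, hCm0, hCm⟩ := exists_bound_on hΩb hm1.continuous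
  have hev : ∀ x ∈ Ω, ∀ᶠ k : ℕ in atTop, 2 < ((k : ℝ) + 1) * η x := by
    intro x hx
    have h0 := hη.pos x hx
    have : Tendsto (fun k : ℕ => ((k : ℝ) + 1) * η x) atTop atTop :=
      (tendsto_atTop_add_const_right _ _ tendsto_natCast_atTop_atTop).atTop_mul_const h0
    exact this.eventually_gt_atTop 2
  have hGbound : ∀ k : ℕ, ∀ x, |((k : ℝ) + 1)⁻¹ * softTrunc (((k : ℝ) + 1) * η x)| ≤ |η x| := by
    intro k x
    have hk : (0 : ℝ) < (k : ℝ) + 1 := by positivity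
    rw [abs_mul, abs_of_pos (inv_pos.mpr hk)]
    calc _ ≤ ((k : ℝ) + 1)⁻¹ * |((k : ℝ) + 1) * η x| := 
        mul_le_mul_of_nonneg_left (abs_softTrunc_le _) (by positivity)
      _ = |η x| := by rw [abs_mul, abs_of_pos hk]; field_simp
  refine Idx.cases_one ?_ (fun i => ?_)
  · refine tendsto_eLpNorm_of_bounded (C := 2 * (Cη * Cm)) (fun k => ?_) (fun k => ?_) ?_
    · exact (Lp.memLp _).1.sub (continuous_partialD (hfs k) _).aestronglyMeasurable
    · filter_upwards [coeFn_cjet hΩb hηm (Idx.nil d 2), ae_restrict_mem hΩ.measurableSet]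
        with x hx hxΩ
      have hx' : (truncate Ω) (cjet hΩb _ hηm) (Idx.nil d 1) x = η x * m x := by
        rw [partialD_nil] at hx
        exact hx
      rw [hx', partialD_nil]
      simp only [f, Set.indicator_of_mem hxΩ, G]
      have h1 : |η x * m x| ≤ Cη * Cm := by
        rw [abs_mul]
        exact mul_le_mul (hCη x hxΩ) (hCm x hxΩ) (abs_nonneg _) hCη0
      have h2 : |((k : ℝ) + 1)⁻¹ * softTrunc (((k : ℝ) + 1) * η x) * m x| ≤ Cη * Cm := by
        rw [abs_mul]
        exact mul_le_mul ((hGbound k x).trans (hCη x hxΩ)) (hCm x hxΩ) (abs_nonneg _) hCη0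
      exact (abs_sub _ _).trans (by linarith)
    · filter_upwards [coeFn_cjet hΩb hηm (Idx.nil d 2), ae_restrict_mem hΩ.measurableSet]
        with x hx hxΩ
      have hx' : (truncate Ω) (cjet hΩb _ hηm) (Idx.nil d 1) x = η x * m x := by
        rw [partialD_nil] at hx
        exact hx
      refine tendsto_const_nhds.congr' ?_
      filter_upwards [hev x hxΩ] with k hk
      have hk0 : (0 : ℝ) < (k : ℝ) + 1 := by positivity
      rw [hx', partialD_nil]
      simp only [f, Set.indicator_of_mem hxΩ, G]
      rw [softTrunc_of_ge hk.le]
      field_simp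
      ring
  · have hdη : Continuous (pd i η) := (contDiff_pd (m := 0) i hη1 (by simp)).continuous
    have hdm : Continuous (pd i m) := (contDiff_pd (m := 0) i hm1 (by simp)).continuous
    obtain ⟨Dη, hDη0, hDη⟩ := exists_bound_on hΩb hdη
    obtain ⟨Dm, hDm0, hDm⟩ := exists_bound_on hΩb hdm
    have hpf : ∀ k, ∀ x ∈ Ω, pd i (f k) x = deriv softTrunc (((k : ℝ) + 1) * η x) * pd i η x * m x
        + ((k : ℝ) + 1)⁻¹ * softTrunc (((k : ℝ) + 1) * η x) * pd i m x := by
      intro k x hx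
      have hk0 : (0 : ℝ) < (k : ℝ) + 1 := by positivity
      have e1 : pd i (f k) x = pd i (G k) x := by
        unfold pd
        congr 1
        refine Filter.EventuallyEq.fderiv_eq ?_
        filter_upwards [hΩ.mem_nhds hx] with y hy using Set.indicator_of_mem hy _
      have hη' := (hη1.differentiable one_ne_zero x).hasFDerivAt
      have hs : HasDerivAt softTrunc (deriv softTrunc (((k : ℝ) + 1) * η x))
          (((k : ℝ) + 1) * η x) :=
        (contDiff_softTrunc.differentiable (by simp) _).hasDerivAt
      have h3 := ((hs.comp_hasFDerivAt x (hη'.const_mul ((k : ℝ) + 1))).const_mul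
        (((k : ℝ) + 1)⁻¹)).mul (hm1.differentiable one_ne_zero x).hasFDerivAt
      have e2 : pd i (G k) x = _ := congrArg (fun T => T (bv i)) h3.fderiv
      rw [e1, e2]
      simp only [add_apply, smul_apply, smul_eq_mul, pd,
        Function.comp]
      field_simp
      ring
    have hpu : ∀ x, pd i (fun x => η x * m x) x = pd i η x * m x + η x * pd i m x := fun x =>
      pd_mul i (hη1.differentiable one_ne_zero x) (hm1.differentiable one_ne_zero x)
    refine tendsto_eLpNorm_of_bounded (C := (Dη * Cm + Cη * Dm) + (C * Dη * Cm + Cη * Dm))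
      (fun k => ?_) (fun k => ?_) ?_
    · exact (Lp.memLp _).1.sub (continuous_partialD (hfs k) _).aestronglyMeasurable
    · filter_upwards [coeFn_cjet hΩb hηm (Idx.one i), ae_restrict_mem hΩ.measurableSet]
        with x hx hxΩ
      have hx' : (truncate Ω) (cjet hΩb _ hηm) (Idx.single i) x
          = pd i η x * m x + η x * pd i m x := by
        rw [partialD_one, hpu] at hx
        exact hx
      rw [hx', partialD_single, hpf k x hxΩ]
      refine (abs_sub _ _).trans (add_le_add ((abs_add_le _ _).trans ?_)
        ((abs_add_le _ _).trans ?_))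
      · rw [abs_mul, abs_mul]
        exact add_le_add (mul_le_mul (hDη x hxΩ) (hCm x hxΩ) (abs_nonneg _) hDη0)
          (mul_le_mul (hCη x hxΩ) (hDm x hxΩ) (abs_nonneg _) hCη0)
      · rw [abs_mul, abs_mul, abs_mul _ (pd i m x)]
        exact add_le_add (mul_le_mul (mul_le_mul (hC _) (hDη x hxΩ) (abs_nonneg _) (by linarith))
          (hCm x hxΩ) (abs_nonneg _) (mul_nonneg (by linarith) hDη0))
          (mul_le_mul ((hGbound k x).trans (hCη x hxΩ)) (hDm x hxΩ) (abs_nonneg _) hCη0)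
    · filter_upwards [coeFn_cjet hΩb hηm (Idx.one i), ae_restrict_mem hΩ.measurableSet]
        with x hx hxΩ
      have hx' : (truncate Ω) (cjet hΩb _ hηm) (Idx.single i) x
          = pd i η x * m x + η x * pd i m x := by
        rw [partialD_one, hpu] at hx
        exact hx
      refine tendsto_const_nhds.congr' ?_
      filter_upwards [hev x hxΩ] with k hk
      have hk0 : (0 : ℝ) < (k : ℝ) + 1 := by positivity
      rw [hx', partialD_single, hpf k x hxΩ, softTrunc_of_ge hk.le, deriv_softTrunc_of_gt hk]
      field_simp
      ring

/-! ### Bounded approximation -/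

lemma tendsto_inner_of_bounded {X : Type*} [NormedAddCommGroup X] [InnerProductSpace ℝ X]
    [CompleteSpace X] {S : Set X} (hS : ∀ v, (∀ s ∈ S, inner ℝ s v = 0) → v = 0)
    {u : X} {un : ℕ → X} {C : ℝ} (hb : ∀ n, ‖un n‖ ≤ C)
    (hl : ∀ s ∈ S, Tendsto (fun n => inner ℝ s (un n)) atTop (𝓝 (inner ℝ s u))) (z : X) :
    Tendsto (fun n => inner ℝ z (un n)) atTop (𝓝 (inner ℝ z u)) := by
  have hd : (Submodule.span ℝ S).topologicalClosure = ⊤ := by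
    rw [Submodule.topologicalClosure_eq_top_iff, Submodule.eq_bot_iff]
    intro v hv
    exact hS v fun s hs => (Submodule.mem_orthogonal _ _).mp hv s (Submodule.subset_span hs)
  have hspan : ∀ s ∈ Submodule.span ℝ S,
      Tendsto (fun n => inner ℝ s (un n)) atTop (𝓝 (inner ℝ s u)) := by
    intro s hs
    induction hs using Submodule.span_induction with
    | mem s h => exact hl s h
    | zero => simp
    | add s t _ _ h1 h2 => simpa only [inner_add_left] using h1.add h2
    | smul c s _ h => simpa only [inner_smul_left, RCLike.conj_to_real] using h.const_mul c
  have hz : z ∈ closure (Submodule.span ℝ S : Set X) := by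
    have : z ∈ (Submodule.span ℝ S).topologicalClosure := by rw [hd]; trivial
    exact this
  have hC : 0 ≤ C := (norm_nonneg _).trans (hb 0)
  rw [Metric.tendsto_atTop]
  intro ε hε
  obtain ⟨s, hs, hzs⟩ := Metric.mem_closure_iff.mp hz (ε / (2 * (C + ‖u‖ + 1))) (by positivity)
  obtain ⟨N, hN⟩ := Metric.tendsto_atTop.mp (hspan s hs) (ε / 2) (by positivity)
  refine ⟨N, fun n hn => ?_⟩
  have h1 := hN n hn
  rw [Real.dist_eq] at h1 ⊢
  have h2 : |inner ℝ (z - s) (un n - u)| ≤ ‖z - s‖ * (C + ‖u‖) :=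
    (abs_real_inner_le_norm _ _).trans (mul_le_mul_of_nonneg_left
      ((norm_sub_le _ _).trans (by linarith [hb n])) (norm_nonneg _))
  rw [dist_eq_norm] at hzs
  have h3 : ‖z - s‖ * (C + ‖u‖) ≤ ε / (2 * (C + ‖u‖ + 1)) * (C + ‖u‖ + 1) :=
    mul_le_mul hzs.le (by linarith) (by positivity) (by positivity)
  have h4 : ε / (2 * (C + ‖u‖ + 1)) * (C + ‖u‖ + 1) = ε / 2 := by
    have : C + ‖u‖ + 1 ≠ 0 := by positivity
    field_simp
  have h5 : inner ℝ z (un n) - inner ℝ z u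
      = inner ℝ (z - s) (un n - u) + (inner ℝ s (un n) - inner ℝ s u) := by
    simp only [inner_sub_left, inner_sub_right]
    ring
  rw [h5]
  exact (abs_add_le _ _).trans_lt (by linarith)

/-- A functional vanishing on a bounded sequence in `H²(Ω)` vanishes at its distributional
limit. -/
lemma inner_eq_zero_of_bounded_approx {d : ℕ} {Ω : Set (Eucl d)} (hΩ : IsOpen Ω)
    (hΩb : Bornology.IsBounded Ω) {l u : Jet Ω 2} {un : ℕ → Jet Ω 2} {C : ℝ}
    (hu : u ∈ sobolev Ω 2) (hun : ∀ n, un n ∈ sobolev Ω 2) (hl : ∀ n, inner ℝ l (un n) = 0)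
    (hb : ∀ n, ‖un n‖ ≤ C)
    (hlim : ∀ z, IsTestFunction Ω z → Tendsto (fun n => ∫ x in Ω, un n (Idx.nil d 2) x * z x) atTop
      (𝓝 (∫ x in Ω, u (Idx.nil d 2) x * z x))) :
    inner ℝ l u = 0 := by
  have hcomplete : CompleteSpace (sobolev Ω 2) := (isClosed_sobolev Ω).completeSpace_coe
  have hz : ∀ z, IsTestFunction Ω z → ∀ α : Idx d 2,
      MemLp (jet2 z (fun _ => 0) (fun _ _ => 0) α) 2 (volume.restrict Ω) := by
    intro z hz
    exact Idx.cases_two hz.memLp (fun i => MemLp.zero) (fun i j => MemLp.zero)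
  have hin : ∀ z (h : IsTestFunction Ω z) (v : Jet Ω 2),
      inner ℝ (toJet _ (hz z h)) v = ∫ x in Ω, v (Idx.nil d 2) x * z x := by
    intro z h v
    rw [PiLp.inner_apply, Idx.sum_two]
    have e1 : ∀ i, toJet _ (hz z h) (Idx.one i) = 0 := fun i =>
      Lp.ext ((coeFn_toJet _ (hz z h) (Idx.one i)).trans (Lp.coeFn_zero _ _ _).symm)
    have e2 : ∀ i j, toJet _ (hz z h) (Idx.two i j) = 0 := fun i j =>
      Lp.ext ((coeFn_toJet _ (hz z h) (Idx.two i j)).trans (Lp.coeFn_zero _ _ _).symm)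
    simp only [e1, e2, inner_zero_left, Finset.sum_const_zero, add_zero]
    rw [L2.inner_def]
    refine integral_congr_ae ?_
    filter_upwards [coeFn_toJet _ (hz z h) (Idx.nil d 2)] with x hx
    rw [hx]
    rfl
  let P := (sobolev Ω 2).orthogonalProjectionOnto
  have hP : ∀ (s : Jet Ω 2) (v : sobolev Ω 2), inner ℝ (P s) v = inner ℝ s (v : Jet Ω 2) := by
    intro s v
    exact Submodule.inner_orthogonalProjectionOnto_eq_of_mem_right v s
  let S : Set (sobolev Ω 2) := {s | ∃ z, ∃ h : IsTestFunction Ω z, s = P (toJet _ (hz z h))}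
  have key := tendsto_inner_of_bounded (S := S) (u := ⟨u, hu⟩) (un := fun n => ⟨un n, hun n⟩)
    (C := C) ?_ hb ?_ (P l)
  · simp only [hP, hl] at key
    exact tendsto_nhds_unique key tendsto_const_nhds
  · intro v hv
    have h0 : (v : Jet Ω 2) = 0 := by
      refine sobolev_eq_zero hΩ hΩb v.2 ?_
      refine ae_eq_of_integral_test_eq hΩ
        (integrableOn_of_memLp hΩb (Lp.memLp _)).locallyIntegrableOn
        (g := 0) (locallyIntegrableOn_zero) fun φ hφ => ?_
      have := hv _ ⟨φ, hφ, rfl⟩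
      rw [hP, hin φ hφ] at this
      rw [this]
      simp
    exact Subtype.ext h0
  · rintro _ ⟨z, h, rfl⟩
    simp only [hP, hin z h]
    exact hlim z h

end DGM
end

noncomputable section

namespace DGM

/-! ### Mollification -/

/-- Mollification with a (not necessarily centred) normalised bump function. -/
def moll {d : ℕ} {a : Eucl d} (b : ContDiffBump a) (f : Eucl d → ℝ) : Eucl d → ℝ :=
  MeasureTheory.convolution f (b.normed volume) (ContinuousLinearMap.mul ℝ ℝ) volume

lemma moll_apply {d : ℕ} {a : Eucl d} (b : ContDiffBump a) (f : Eucl d → ℝ) (x : Eucl d) :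
    moll b f x = ∫ t, f t * b.normed volume (x - t) := rfl

lemma moll_apply' {d : ℕ} {a : Eucl d} (b : ContDiffBump a) (f : Eucl d → ℝ) (x : Eucl d) :
    moll b f x = ∫ s, f (x - s) * b.normed volume s := by
  rw [moll_apply, ← integral_sub_left_eq_self _ volume x]
  simp

lemma contDiff_moll {d : ℕ} {a : Eucl d} (b : ContDiffBump a) {f : Eucl d → ℝ}
    (hf : LocallyIntegrable f) : ContDiff ℝ ∞ (moll b f) :=
  b.hasCompactSupport_normed.contDiff_convolution_right _ hf b.contDiff_normed

lemma fderiv_moll {d : ℕ} {a : Eucl d} (b : ContDiffBump a) {f : Eucl d → ℝ}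
    (hf : LocallyIntegrable f) (x e : Eucl d) :
    fderiv ℝ (moll b f) x e = ∫ t, f t * fderiv ℝ (b.normed volume) (x - t) e := by
  have h1 : ContDiff ℝ 1 (b.normed (volume : Measure (Eucl d))) := b.contDiff_normed (n := 1)
  have h := b.hasCompactSupport_normed.hasFDerivAt_convolution_right
    (ContinuousLinearMap.mul ℝ ℝ) hf h1 x
  unfold moll
  rw [h.fderiv, convolution_precompR_apply _ hf (b.hasCompactSupport_normed.fderiv (𝕜 := ℝ))
    (h1.continuous_fderiv one_ne_zero)]
  rfl

lemma hasCompactSupport_moll {d : ℕ} {a : Eucl d} (b : ContDiffBump a) {f : Eucl d → ℝ}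
    (hf : HasCompactSupport f) : HasCompactSupport (moll b f) :=
  HasCompactSupport.convolution _ hf b.hasCompactSupport_normed

lemma normed_eq_zero {d : ℕ} {a : Eucl d} (b : ContDiffBump a) {z : Eucl d}
    (hz : b.rOut ≤ dist z a) : b.normed volume z = 0 := by
  by_contra h
  have : z ∈ Function.support (b.normed volume) := h
  rw [b.support_normed_eq] at this
  exact absurd (Metric.mem_ball.mp this) (not_lt.mpr hz)

/-- Weak derivatives commute with mollification. -/
lemma fderiv_moll_eq {d : ℕ} {Ω : Set (Eucl d)} (hΩ : IsOpen Ω) {a : Eucl d}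
    (b : ContDiffBump a) {e : Eucl d} {f g : Eucl d → ℝ} (h : HasWeakD Ω e f g)
    (hf : IntegrableOn f Ω) {x : Eucl d} (hx : Metric.closedBall (x - a) b.rOut ⊆ Ω) :
    fderiv ℝ (moll b (Ω.indicator f)) x e = moll b (Ω.indicator g) x := by
  have hfl : LocallyIntegrable (Ω.indicator f) :=
    (hf.integrable_indicator hΩ.measurableSet).locallyIntegrable
  have hρ : ContDiff ℝ 1 (b.normed (volume : Measure (Eucl d))) := b.contDiff_normed (n := 1)
  rw [fderiv_moll b hfl, moll_apply]
  set φ : Eucl d → ℝ := fun t => b.normed volume (x - t)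
  have h1 : ContDiff ℝ 1 φ := hρ.comp (contDiff_const.sub contDiff_id)
  have hs : tsupport φ ⊆ Metric.closedBall (x - a) b.rOut := by
    refine closure_minimal ?_ Metric.isClosed_closedBall
    intro t ht
    by_contra hn
    rw [Metric.mem_closedBall, not_le] at hn
    refine ht (normed_eq_zero b ?_)
    have : dist (x - t) a = dist t (x - a) := by
      rw [dist_eq_norm, dist_eq_norm, ← norm_neg]
      congr 1
      abel
    rw [this]
    exact hn.le
  have h2 : HasCompactSupport φ :=
    (isCompact_closedBall _ _).of_isClosed_subset (isClosed_tsupport _) hs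
  have hd : ∀ t, fderiv ℝ φ t e = -fderiv ℝ (b.normed volume) (x - t) e := by
    intro t
    have h3 : HasFDerivAt φ _ t := ((hρ.differentiable one_ne_zero (x - t)).hasFDerivAt).comp t
      ((hasFDerivAt_id t).const_sub x)
    rw [h3.fderiv]
    simp
  have k := h φ h1 h2 (hs.trans hx)
  have e1 : ∀ (F ψ : Eucl d → ℝ), ∫ t, Ω.indicator F t * ψ t = ∫ t in Ω, F t * ψ t := by
    intro F ψ
    rw [← integral_indicator hΩ.measurableSet]
    congr 1
    funext t
    by_cases ht : t ∈ Ω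
    · simp [ht]
    · simp [ht]
  rw [e1, e1]
  simp only [hd, mul_neg, integral_neg] at k
  have := neg_injective k
  exact this

lemma moll_mono_abs {d : ℕ} {a : Eucl d} (b : ContDiffBump a) {f g : Eucl d → ℝ}
    {x : Eucl d} {c : ℝ} (hg : Integrable g)
    (h : ∀ᵐ t, dist (x - t) a < b.rOut → |f t| * c ≤ g t) (hc : 0 ≤ c) :
    |moll b f x| * c ≤ moll b g x := by
  rw [moll_apply, moll_apply, ← Real.norm_eq_abs]
  have hcont : Continuous (fun t => b.normed volume (x - t)) :=
    b.continuous_normed.comp (continuous_const.sub continuous_id)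
  obtain ⟨D, hD⟩ := b.continuous_normed.bounded_above_of_compact_support
    (b.hasCompactSupport_normed (μ := volume))
  have hi : Integrable (fun t => g t * b.normed volume (x - t)) :=
    hg.mul_bdd (c := D) hcont.aestronglyMeasurable (Eventually.of_forall fun t => hD _)
  calc ‖∫ t, f t * b.normed volume (x - t)‖ * c
      = ‖∫ t, (f t * b.normed volume (x - t)) * c‖ := by
        rw [integral_mul_const, norm_mul, Real.norm_of_nonneg hc]
    _ ≤ _ := by
      refine norm_integral_le_of_norm_le hi ?_
      filter_upwards [h] with t ht
      rw [norm_mul, norm_mul, Real.norm_of_nonneg hc, Real.norm_of_nonneg (b.nonneg_normed _),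
        Real.norm_eq_abs]
      by_cases hz : dist (x - t) a < b.rOut
      · calc _ = |f t| * c * b.normed volume (x - t) := by ring
          _ ≤ _ := mul_le_mul_of_nonneg_right (ht hz) (b.nonneg_normed _)
      · rw [normed_eq_zero b (not_lt.mp hz)]
        simp

/-- The mollification is a contraction of `L²`. -/
lemma eLpNorm_moll_le {d : ℕ} {a : Eucl d} (b : ContDiffBump a) {f : Eucl d → ℝ}
    (hf : AEStronglyMeasurable f) :
    eLpNorm (moll b f) 2 volume ≤ eLpNorm f 2 volume := by
  wlog hsm : StronglyMeasurable f generalizing f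
  · have hmk := this hf.stronglyMeasurable_mk.aestronglyMeasurable hf.stronglyMeasurable_mk
    have e : moll b f = moll b (hf.mk f) := by
      funext x
      rw [moll_apply, moll_apply]
      exact integral_congr_ae (hf.ae_eq_mk.mul (EventuallyEq.refl _ _))
    rw [e, eLpNorm_congr_ae hf.ae_eq_mk]
    exact hmk
  set m : Measure (Eucl d) := volume.withDensity fun s => ENNReal.ofReal (b.normed volume s)
  have hm1 : m Set.univ = 1 := by
    rw [withDensity_apply _ MeasurableSet.univ, Measure.restrict_univ,
      ← ofReal_integral_eq_lintegral_ofReal b.integrable_normed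
        (Eventually.of_forall b.nonneg_normed), b.integral_normed, ENNReal.ofReal_one]
  have : IsProbabilityMeasure m := ⟨hm1⟩
  have hmeas : Measurable fun p : Eucl d × Eucl d => ‖f (p.1 - p.2)‖ₑ :=
    (hsm.measurable.comp (measurable_fst.sub measurable_snd)).enorm
  have hpt : ∀ x, ‖moll b f x‖ₑ ^ (2 : ℝ) ≤ ∫⁻ s, ‖f (x - s)‖ₑ ^ (2 : ℝ) ∂m := by
    intro x
    have hmx : Measurable fun s => ‖f (x - s)‖ₑ := hmeas.comp (measurable_const.prodMk measurable_id)
    have h1 : ‖moll b f x‖ₑ ≤ ∫⁻ s, ‖f (x - s)‖ₑ ∂m := by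
      rw [moll_apply', lintegral_withDensity_eq_lintegral_mul _
        (by exact b.continuous_normed.measurable.ennreal_ofReal) hmx]
      refine (enorm_integral_le_lintegral_enorm _).trans (lintegral_mono fun s => ?_)
      rw [enorm_mul, mul_comm, Real.enorm_eq_ofReal (b.nonneg_normed s)]
      rfl
    have h2 : ∫⁻ s, ‖f (x - s)‖ₑ ∂m ≤ (∫⁻ s, ‖f (x - s)‖ₑ ^ (2 : ℝ) ∂m) ^ (1 / (2 : ℝ)) := by
      have := ENNReal.lintegral_mul_le_Lp_mul_Lq m Real.HolderConjugate.two_two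
        hmx.aemeasurable (g := fun _ => 1) aemeasurable_const
      simpa [hm1] using this
    calc ‖moll b f x‖ₑ ^ (2 : ℝ)
        ≤ ((∫⁻ s, ‖f (x - s)‖ₑ ^ (2 : ℝ) ∂m) ^ (1 / (2 : ℝ))) ^ (2 : ℝ) := by
          gcongr
          exact h1.trans h2
      _ = _ := by
          rw [← ENNReal.rpow_mul]
          norm_num
  rw [eLpNorm_eq_lintegral_rpow_enorm_toReal (by simp) (by simp),
    eLpNorm_eq_lintegral_rpow_enorm_toReal (by simp) (by simp)]
  simp only [ENNReal.toReal_ofNat]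
  refine ENNReal.rpow_le_rpow ?_ (by norm_num)
  calc ∫⁻ x, ‖moll b f x‖ₑ ^ (2 : ℝ) ≤ ∫⁻ x, ∫⁻ s, ‖f (x - s)‖ₑ ^ (2 : ℝ) ∂m :=
        lintegral_mono hpt
    _ = ∫⁻ s, ∫⁻ x, ‖f (x - s)‖ₑ ^ (2 : ℝ) ∂volume ∂m :=
        lintegral_lintegral_swap (hmeas.pow_const _).aemeasurable
    _ = ∫⁻ s, ∫⁻ x, ‖f x‖ₑ ^ (2 : ℝ) ∂volume ∂m := by
        congr 1
        funext s
        exact lintegral_sub_right_eq_self (fun x => ‖f x‖ₑ ^ (2 : ℝ)) s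
    _ = ∫⁻ x, ‖f x‖ₑ ^ (2 : ℝ) := by simp [hm1]

lemma moll_sub_le {d : ℕ} {a : Eucl d} (b : ContDiffBump a) {f : Eucl d → ℝ}
    (hf : Continuous f) {x : Eucl d} {ε : ℝ}
    (h : ∀ t, dist t x < ‖a‖ + b.rOut → |f t - f x| ≤ ε) : |moll b f x - f x| ≤ ε := by
  have hε : 0 ≤ ε := (abs_nonneg _).trans (h x (by
    rw [dist_self]
    have := b.rOut_pos
    positivity))
  have hcont : Continuous (fun t => b.normed volume (x - t)) :=
    b.continuous_normed.comp (continuous_const.sub continuous_id)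
  have hcs : HasCompactSupport (fun t => b.normed volume (x - t)) :=
    b.hasCompactSupport_normed.comp_homeomorph (Homeomorph.subLeft x)
  have e1 : ∫ t, b.normed volume (x - t) = 1 := by
    rw [integral_sub_left_eq_self (fun t => b.normed volume t) volume x, b.integral_normed]
  have e2 : f x = ∫ t, f x * b.normed volume (x - t) := by
    rw [integral_const_mul, e1, mul_one]
  have i1 : Integrable (fun t => f t * b.normed volume (x - t)) :=
    (hf.mul hcont).integrable_of_hasCompactSupport hcs.mul_left
  have i2 : Integrable (fun t => f x * b.normed volume (x - t)) :=
    (hcont.integrable_of_hasCompactSupport hcs).const_mul _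
  have e3 : ε = ∫ t, ε * b.normed volume (x - t) := by
    rw [integral_const_mul, e1, mul_one]
  rw [moll_apply]
  conv_lhs => rw [e2]
  rw [← integral_sub i1 i2, ← Real.norm_eq_abs]
  conv_rhs => rw [e3]
  refine norm_integral_le_of_norm_le ((hcont.integrable_of_hasCompactSupport hcs).const_mul _)
    (Eventually.of_forall fun t => ?_)
  rw [← sub_mul, norm_mul, Real.norm_of_nonneg (b.nonneg_normed _), Real.norm_eq_abs]
  by_cases hz : dist (x - t) a < b.rOut
  · refine mul_le_mul_of_nonneg_right (h t ?_) (b.nonneg_normed _)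
    rw [dist_comm, dist_eq_norm]
    rw [dist_eq_norm] at hz
    calc ‖x - t‖ = ‖a + (x - t - a)‖ := by congr 1; abel
      _ ≤ ‖a‖ + ‖x - t - a‖ := norm_add_le _ _
      _ < _ := by linarith
  · rw [normed_eq_zero b (not_lt.mp hz)]
    simp

/-- Mollifications converge in `L²`. -/
lemma tendsto_moll {d : ℕ} {Ω : Set (Eucl d)} (hΩb : Bornology.IsBounded Ω)
    {a : ℕ → Eucl d} (b : ∀ n, ContDiffBump (a n))
    (hlim : Tendsto (fun n => ‖a n‖ + (b n).rOut) atTop (𝓝 0)) {f : Eucl d → ℝ}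
    (hf : MemLp f 2 volume) :
    Tendsto (fun n => eLpNorm (fun x => moll (b n) f x - f x) 2 (volume.restrict Ω)) atTop
      (𝓝 0) := by
  have := volume_restrict_finite hΩb
  set c : ℝ≥0∞ := (volume.restrict Ω) Set.univ ^ (2 : ℝ≥0∞).toReal⁻¹
  have hc : c ≠ ⊤ := ENNReal.rpow_ne_top_of_nonneg (by positivity) (measure_ne_top _ _)
  rw [ENNReal.tendsto_nhds_zero]
  intro ε hε
  wlog hε' : ε ≠ ⊤ generalizing ε
  · rw [not_not] at hε'
    exact Eventually.of_forall fun n => hε' ▸ le_top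
  have hε3 : ε / 3 ≠ 0 := (ENNReal.div_pos hε.ne' (by simp)).ne'
  obtain ⟨g, hg1, hg2, hg3, hg4⟩ := hf.exists_hasCompactSupport_eLpNorm_sub_le (by simp) hε3
  have hc3 : ∃ r : ℝ, 0 < r ∧ c * ENNReal.ofReal r ≤ ε / 3 := by
    have : Tendsto (fun r : ℝ => c * ENNReal.ofReal r) (𝓝[>] 0) (𝓝 0) := by
      have h1 : Tendsto (fun r : ℝ => ENNReal.ofReal r) (𝓝[>] 0) (𝓝 0) := by
        have := (ENNReal.continuous_ofReal.tendsto 0).mono_left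
          (nhdsWithin_le_nhds (s := Set.Ioi (0 : ℝ)))
        simpa using this
      simpa using ENNReal.Tendsto.const_mul h1 (Or.inr hc)
    have h2 := (ENNReal.tendsto_nhds_zero.mp this (ε / 3) (pos_iff_ne_zero.mpr hε3)).and
      self_mem_nhdsWithin
    obtain ⟨r, hr1, hr2⟩ := h2.exists
    exact ⟨r, hr2, hr1⟩
  obtain ⟨r, hr0, hr⟩ := hc3
  obtain ⟨δ, hδ, hu⟩ := Metric.uniformContinuous_iff.mp
    (hg1.uniformContinuous_of_continuous hg3) r hr0
  filter_upwards [hlim.eventually_lt_const hδ] with n hn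
  have hlf : LocallyIntegrable f := hf.locallyIntegrable one_le_two
  have hlg : LocallyIntegrable g := hg4.locallyIntegrable one_le_two
  have hsub : ∀ x, moll (b n) f x - moll (b n) g x = moll (b n) (f - g) x := by
    intro x
    have hi : ∀ F : Eucl d → ℝ, LocallyIntegrable F →
        Integrable (fun t => F t * (b n).normed volume (x - t)) := by
      intro F hF
      have hcont : Continuous (fun t => (b n).normed volume (x - t)) :=
        (b n).continuous_normed.comp (continuous_const.sub continuous_id)
      have hcs : HasCompactSupport (fun t => (b n).normed volume (x - t)) :=
        (b n).hasCompactSupport_normed.comp_homeomorph (Homeomorph.subLeft x)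
      have := hF.integrable_smul_right_of_hasCompactSupport hcont hcs
      simpa using this
    rw [moll_apply, moll_apply, moll_apply, ← integral_sub (hi f hlf) (hi g hlg)]
    simp [sub_mul]
  have m1 : AEStronglyMeasurable (moll (b n) f) (volume.restrict Ω) :=
    (contDiff_moll _ hlf).continuous.aestronglyMeasurable
  have m2 : AEStronglyMeasurable (moll (b n) g) (volume.restrict Ω) :=
    (contDiff_moll _ hlg).continuous.aestronglyMeasurable
  have b1 : eLpNorm (fun x => moll (b n) f x - moll (b n) g x) 2 (volume.restrict Ω) ≤ ε / 3 := by
    simp only [hsub]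
    exact (eLpNorm_mono_measure _ Measure.restrict_le_self).trans
      ((eLpNorm_moll_le _ (hf.1.sub hg4.1)).trans hg2)
  have b2 : eLpNorm (fun x => moll (b n) g x - g x) 2 (volume.restrict Ω) ≤ ε / 3 := by
    refine (eLpNorm_le_of_ae_bound (C := r) (Eventually.of_forall fun x => ?_)).trans hr
    refine moll_sub_le _ hg3 fun t ht => ?_
    have := hu (ht.trans hn)
    rw [Real.dist_eq] at this
    exact this.le
  have b3 : eLpNorm (fun x => g x - f x) 2 (volume.restrict Ω) ≤ ε / 3 := by
    have e : (fun x => g x - f x) = -(f - g) := by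
      funext x
      simp
    rw [e, eLpNorm_neg]
    exact (eLpNorm_mono_measure _ Measure.restrict_le_self).trans hg2
  have mf : AEStronglyMeasurable f (volume.restrict Ω) := hf.1.restrict
  have mg : AEStronglyMeasurable g (volume.restrict Ω) := hg4.1.restrict
  calc eLpNorm (fun x => moll (b n) f x - f x) 2 (volume.restrict Ω)
      = eLpNorm ((fun x => moll (b n) f x - moll (b n) g x)
          + ((fun x => moll (b n) g x - g x) + fun x => g x - f x)) 2 (volume.restrict Ω) := by
        congr 1
        funext x
        simp
    _ ≤ ε / 3 + (ε / 3 + ε / 3) :=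
      (eLpNorm_add_le (m1.sub m2) ((m2.sub mg).add (mg.sub mf)) one_le_two).trans
        (add_le_add b1 ((eLpNorm_add_le (m2.sub mg) (mg.sub mf) one_le_two).trans
          (add_le_add b2 b3)))
    _ = ε := by
      rw [← add_assoc]
      exact ENNReal.add_thirds ε

lemma tendsto_integral_mul_of_eLpNorm {X : Type*} [MeasurableSpace X] {μ : Measure X}
    {F : ℕ → X → ℝ} {f z : X → ℝ} (hF : ∀ n, MemLp (F n) 2 μ) (hf : MemLp f 2 μ)
    (hz : MemLp z 2 μ) (h : Tendsto (fun n => eLpNorm (fun x => F n x - f x) 2 μ) atTop (𝓝 0)) :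
    Tendsto (fun n => ∫ x, F n x * z x ∂μ) atTop (𝓝 (∫ x, f x * z x ∂μ)) := by
  have e : ∀ {g : X → ℝ} (hg : MemLp g 2 μ),
      ∫ x, g x * z x ∂μ = inner ℝ (hz.toLp z) (hg.toLp g) := by
    intro g hg
    rw [L2.inner_def]
    refine integral_congr_ae ?_
    filter_upwards [hz.coeFn_toLp, hg.coeFn_toLp] with x h1 h2
    rw [h1, h2]
    rfl
  rw [e hf]
  simp only [e (hF _)]
  have : Tendsto (fun n => (hF n).toLp (F n)) atTop (𝓝 (hf.toLp f)) :=
    (Lp.tendsto_Lp_iff_tendsto_eLpNorm'' _ hF _ hf).mpr h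
  exact (continuous_const.inner continuous_id).tendsto _ |>.comp this

end DGM
end

noncomputable section

namespace DGM

/-! ### Approximation of `v` by `η W` when `v / η` is regular -/

lemma norm_jet_le {d : ℕ} {Ω : Set (Eucl d)} {v : Jet Ω 2} {B : ℝ}
    (h : ∀ α, ‖v α‖ ≤ B) : ‖v‖ ≤ Fintype.card (Idx d 2) * B := by
  have hB : 0 ≤ B := (norm_nonneg _).trans (h (Idx.nil d 2))
  have h1 : ‖v‖ ^ 2 ≤ (Fintype.card (Idx d 2) * B) ^ 2 := by
    rw [PiLp.norm_sq_eq_of_L2]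
    calc ∑ α, ‖v α‖ ^ 2 ≤ ∑ _α : Idx d 2, B ^ 2 :=
          Finset.sum_le_sum fun α _ => pow_le_pow_left₀ (norm_nonneg _) (h α) 2
      _ = Fintype.card (Idx d 2) * B ^ 2 := by simp
      _ ≤ _ := by
        rw [mul_pow]
        refine mul_le_mul_of_nonneg_right ?_ (by positivity)
        have : (1 : ℝ) ≤ Fintype.card (Idx d 2) := by
          exact_mod_cast Fintype.card_pos_iff.mpr ⟨Idx.nil d 2⟩
        nlinarith
  exact le_of_sq_le_sq h1 (by positivity)

lemma pd_congr_of_eventuallyEq {d : ℕ} {f g : Eucl d → ℝ} {x : Eucl d} (h : f =ᶠ[𝓝 x] g)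
    (i : Fin d) : pd i f x = pd i g x := by
  unfold pd
  rw [h.fderiv_eq]

/-- The entries of the jet of a quotient `v / η`. -/
structure IsQuotient {d : ℕ} (Ω : Set (Eucl d)) (η : Eucl d → ℝ) (v : Jet Ω 2)
    (w : Eucl d → ℝ) (w1 : Fin d → Eucl d → ℝ) : Prop where
  memLp : MemLp w 2 (volume.restrict Ω)
  memLp_one : ∀ i, MemLp (w1 i) 2 (volume.restrict Ω)
  eq : ∀ᵐ x ∂(volume.restrict Ω), w x = v (Idx.nil d 2) x / η x
  eq_one : ∀ i, ∀ᵐ x ∂(volume.restrict Ω),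
    w1 i x = (v (Idx.one i) x - w x * pd i η x) / η x

/-- `η` times the second derivative of the quotient. -/
def quotSnd {d : ℕ} {Ω : Set (Eucl d)} (η : Eucl d → ℝ) (v : Jet Ω 2)
    (w : Eucl d → ℝ) (w1 : Fin d → Eucl d → ℝ) (i j : Fin d) (x : Eucl d) : ℝ :=
  v (Idx.two i j) x - (pd i η x * w1 j x + pd j (pd i η) x * w x) - pd j η x * w1 i x

lemma hasWeakD_inv_mul {d : ℕ} {Ω : Set (Eucl d)} (hΩ : IsOpen Ω) {η : Eucl d → ℝ}
    (hη : ContDiff ℝ 1 η) (hpos : ∀ x ∈ Ω, 0 < η x) {j : Fin d} {f g f' : Eucl d → ℝ}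
    (h : HasWeakD Ω (bv j) f g) (hf : IntegrableOn f Ω) (hg : IntegrableOn g Ω)
    (hf' : ∀ᵐ x ∂(volume.restrict Ω), f' x = f x / η x) :
    HasWeakD Ω (bv j) f' (fun x => (g x - pd j η x * f' x) / η x) := by
  have hinv : ContDiffOn ℝ 1 (fun x => (η x)⁻¹) Ω :=
    hη.contDiffOn.inv fun x hx => (hpos x hx).ne'
  refine (h.mul hΩ hf hg hinv).congr ?_ ?_
  · filter_upwards [hf'] with x hx
    rw [hx]
    ring
  · filter_upwards [hf', ae_restrict_mem hΩ.measurableSet] with x hx hxΩ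
    have h0 := (hpos x hxΩ).ne'
    have hd := (hη.differentiable one_ne_zero x).hasFDerivAt
    have : HasFDerivAt (fun x => (η x)⁻¹) _ x := (hasDerivAt_inv h0).comp_hasFDerivAt x hd
    rw [this.fderiv, hx]
    simp only [smul_apply, smul_eq_mul, pd]
    field_simp
    ring

lemma IsQuotient.weakD {d : ℕ} {Ω : Set (Eucl d)} (hΩ : IsOpen Ω)
    (hΩb : Bornology.IsBounded Ω) {η : Eucl d → ℝ} (hη : IsAuxiliary Ω η) {v : Jet Ω 2}
    (hv : v ∈ sobolev Ω 2) {w : Eucl d → ℝ} {w1 : Fin d → Eucl d → ℝ}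
    (h : IsQuotient Ω η v w w1) (i : Fin d) : HasWeakD Ω (bv i) w (w1 i) := by
  have hη1 : ContDiff ℝ 1 η := hη.smooth.1.of_le (by norm_cast)
  refine (hasWeakD_inv_mul hΩ hη1 hη.pos (sobolev_weakD_nil hΩ hΩb hv i)
    (integrableOn_of_memLp hΩb (Lp.memLp _)) (integrableOn_of_memLp hΩb (Lp.memLp _))
    h.eq).congr (EventuallyEq.refl _ _) ?_
  filter_upwards [h.eq_one i] with x hx
  rw [hx]
  ring

lemma IsQuotient.weakD_one {d : ℕ} {Ω : Set (Eucl d)} (hΩ : IsOpen Ω)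
    (hΩb : Bornology.IsBounded Ω) {η : Eucl d → ℝ} (hη : IsAuxiliary Ω η) {v : Jet Ω 2}
    (hv : v ∈ sobolev Ω 2) {w : Eucl d → ℝ} {w1 : Fin d → Eucl d → ℝ}
    (h : IsQuotient Ω η v w w1) (i j : Fin d) :
    HasWeakD Ω (bv j) (w1 i) (fun x => quotSnd η v w w1 i j x / η x) := by
  have hη2 : ContDiff ℝ 2 η := hη.smooth.1.of_le (by norm_cast)
  have hη1 : ContDiff ℝ 1 η := hη2.of_le one_le_two
  have s1 : ContDiff ℝ 1 (pd i η) := contDiff_pd i hη2 le_rfl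
  have c1 : Continuous (pd j (pd i η)) := (contDiff_pd (m := 0) j s1 (by simp)).continuous
  have I : ∀ {f : Eucl d → ℝ}, MemLp f 2 (volume.restrict Ω) → IntegrableOn f Ω :=
    fun hf => integrableOn_of_memLp hΩb hf
  have L : ∀ α, MemLp (v α) 2 (volume.restrict Ω) := fun α => Lp.memLp _
  have p1 := (h.weakD hΩ hΩb hη hv j).mul hΩ (I h.memLp) (I (h.memLp_one j)) s1.contDiffOn
  have p2 := p1.mul (m := fun _ => -1) hΩ (I (memLp_mul hΩ hΩb s1.continuous h.memLp))
    (I ((memLp_mul hΩ hΩb s1.continuous (h.memLp_one j)).add (memLp_mul hΩ hΩb c1 h.memLp)))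
    contDiffOn_const
  have m1 : MemLp (fun x => -1 * (pd i η x * w x)) 2 (volume.restrict Ω) :=
    (memLp_mul hΩ hΩb s1.continuous h.memLp).const_mul (-1)
  have m2 : MemLp (fun x => -1 * (pd i η x * w1 j x + fderiv ℝ (pd i η) x (bv j) * w x)
      + fderiv ℝ (fun _ : Eucl d => (-1 : ℝ)) x (bv j) * (pd i η x * w x)) 2
      (volume.restrict Ω) := by
    simp only [fderiv_fun_const, Pi.zero_apply, zero_apply, zero_mul, add_zero]
    exact ((memLp_mul hΩ hΩb s1.continuous (h.memLp_one j)).add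
      (memLp_mul hΩ hΩb c1 h.memLp)).const_mul (-1)
  have p3 := (sobolev_weakD_one hΩ hΩb hv i j).add p2 (I (L _)) (I (L _)) (I m1) (I m2)
  refine (hasWeakD_inv_mul hΩ hη1 hη.pos p3 (I ((L _).add m1)) (I ((L _).add m2))
    (f' := w1 i) ?_).congr (EventuallyEq.refl _ _) ?_
  · filter_upwards [h.eq_one i] with x hx
    rw [hx]
    ring
  · refine Eventually.of_forall fun x => ?_
    simp only [quotSnd, fderiv_fun_const, Pi.zero_apply, zero_apply, zero_mul, add_zero, pd]
    ring

lemma IsQuotient.memLp_quotSnd {d : ℕ} {Ω : Set (Eucl d)} (hΩ : IsOpen Ω)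
    (hΩb : Bornology.IsBounded Ω) {η : Eucl d → ℝ} (hη : IsAuxiliary Ω η) {v : Jet Ω 2}
    {w : Eucl d → ℝ} {w1 : Fin d → Eucl d → ℝ}
    (h : IsQuotient Ω η v w w1) (i j : Fin d) :
    MemLp (quotSnd η v w w1 i j) 2 (volume.restrict Ω) := by
  have hη2 : ContDiff ℝ 2 η := hη.smooth.1.of_le (by norm_cast)
  have s1 : ∀ i, ContDiff ℝ 1 (pd i η) := fun i => contDiff_pd i hη2 le_rfl
  have c1 : Continuous (pd j (pd i η)) := (contDiff_pd (m := 0) j (s1 i) (by simp)).continuous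
  exact ((Lp.memLp (v (Idx.two i j))).sub ((memLp_mul hΩ hΩb (s1 i).continuous
    (h.memLp_one j)).add (memLp_mul hΩ hΩb c1 h.memLp))).sub
    (memLp_mul hΩ hΩb (s1 j).continuous (h.memLp_one i))

/-- Inward directions at a point: translates of `Ω ∩ B` by vectors near `ε ν` stay in `Ω`, and
`η` does not decrease by more than a constant factor. -/
structure IsInward {d : ℕ} (Ω : Set (Eucl d)) (η : Eucl d → ℝ) (B : Set (Eucl d)) (ν : Eucl d)
    (δ ε₀ C : ℝ) : Prop where
  delta_pos : 0 < δ
  eps_pos : 0 < ε₀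
  const_pos : 0 ≤ C
  mem : ∀ x ∈ Ω ∩ B, ∀ ε, 0 < ε → ε < ε₀ → ∀ z, ‖z - ε • ν‖ ≤ ε * δ → x + z ∈ Ω
  le : ∀ x ∈ Ω ∩ B, ∀ ε, 0 < ε → ε < ε₀ → ∀ z, ‖z - ε • ν‖ ≤ ε * δ → η x ≤ C * η (x + z)

/-- The shifted bump functions. -/
def shiftBump {d : ℕ} (ν : Eucl d) (ε δ : ℝ) (hε : 0 < ε) (hδ : 0 < δ) :
    ContDiffBump (-(ε • ν)) :=
  ⟨ε * δ / 2, ε * δ, by positivity, by linarith [mul_pos hε hδ]⟩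

lemma IsInward.closedBall_subset {d : ℕ} {Ω : Set (Eucl d)} {η : Eucl d → ℝ} {B : Set (Eucl d)}
    {ν : Eucl d} {δ ε₀ C : ℝ} (h : IsInward Ω η B ν δ ε₀ C) {x : Eucl d} (hx : x ∈ Ω ∩ B)
    {ε : ℝ} (hε : 0 < ε) (hε' : ε < ε₀) :
    Metric.closedBall (x - -(ε • ν)) (shiftBump ν ε δ hε h.delta_pos).rOut ⊆ Ω := by
  intro t ht
  have := h.mem x hx ε hε hε' (t - x) (by
    rw [Metric.mem_closedBall, dist_eq_norm] at ht
    have e : t - x - ε • ν = t - (x - -(ε • ν)) := by abel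
    rw [e]
    exact ht)
  simpa using this

lemma pd_eq_zero_of_eventually {d : ℕ} {f : Eucl d → ℝ} {x : Eucl d} (h : f =ᶠ[𝓝 x] 0)
    (i : Fin d) : pd i f =ᶠ[𝓝 x] 0 := by
  filter_upwards [h.eventually_nhds] with y hy
  rw [pd_congr_of_eventuallyEq hy]
  simp [pd]

/-- If `ℓ` vanishes on all `η W`, it vanishes on `v` when `v / η` is regular and localised where
an inward direction exists. -/
lemma inner_eq_zero_of_isQuotient {d : ℕ} {Ω : Set (Eucl d)} (hΩ : IsOpen Ω)
    (hΩb : Bornology.IsBounded Ω) {η : Eucl d → ℝ} (hη : IsAuxiliary Ω η) {l v : Jet Ω 2}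
    (hl : ∀ W, ContDiff ℝ ∞ W → HasCompactSupport W →
      ∀ h : ContDiff ℝ 2 (fun x => η x * W x), inner ℝ l (cjet hΩb _ h) = 0)
    (hv : v ∈ sobolev Ω 2) {w : Eucl d → ℝ} {w1 : Fin d → Eucl d → ℝ}
    (hw : IsQuotient Ω η v w w1) {x₀ ν : Eucl d} {ρ ρ' δ ε₀ C : ℝ} (hρ : ρ < ρ')
    (hin : IsInward Ω η (Metric.ball x₀ ρ') ν δ ε₀ C)
    (hsupp : ∀ x ∉ Metric.closedBall x₀ ρ, w x = 0) :
    inner ℝ l v = 0 := by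
  have hη2 : ContDiff ℝ 2 η := hη.smooth.1.of_le (by norm_cast)
  have hη1 : ContDiff ℝ 1 η := hη2.of_le one_le_two
  have hMeas := hΩ.measurableSet
  obtain ⟨δ_pos, ε₀_pos, hC0, hmem, hle⟩ := id hin
  -- the scales
  obtain ⟨ε₁, hε₁, hε₁', hε₁ρ⟩ : ∃ ε₁ : ℝ, 0 < ε₁ ∧ ε₁ < ε₀ ∧ ε₁ * (‖ν‖ + δ) < ρ' - ρ := by
    refine ⟨min (ε₀ / 2) ((ρ' - ρ) / (2 * (‖ν‖ + δ))), ?_, ?_, ?_⟩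
    · have : 0 < ρ' - ρ := by linarith
      positivity
    · exact (min_le_left _ _).trans_lt (by linarith)
    · have h1 : 0 < ‖ν‖ + δ := by positivity
      calc _ ≤ (ρ' - ρ) / (2 * (‖ν‖ + δ)) * (‖ν‖ + δ) := by gcongr; exact min_le_right _ _
        _ = (ρ' - ρ) / 2 := by field_simp
        _ < _ := by linarith
  let εn : ℕ → ℝ := fun n => ε₁ / (n + 1)
  have hεn : ∀ n, 0 < εn n := fun n => by positivity
  have hεn' : ∀ n, εn n ≤ ε₁ := fun n => by
    refine div_le_self hε₁.le ?_
    have : (0 : ℝ) ≤ n := Nat.cast_nonneg n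
    linarith
  have hεlim : Tendsto εn atTop (𝓝 0) := by
    have := (tendsto_one_div_add_atTop_nhds_zero_nat (𝕜 := ℝ)).const_mul ε₁
    simpa [εn, div_eq_mul_inv] using this
  let b : ∀ n, ContDiffBump (-(εn n • ν)) := fun n => shiftBump ν (εn n) δ (hεn n) δ_pos
  have hbout : ∀ n, (b n).rOut = εn n * δ := fun n => rfl
  have hblim : Tendsto (fun n => ‖-(εn n • ν)‖ + (b n).rOut) atTop (𝓝 0) := by
    have e : ∀ n, ‖-(εn n • ν)‖ + (b n).rOut = εn n * (‖ν‖ + δ) := by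
      intro n
      rw [norm_neg, norm_smul, Real.norm_of_nonneg (hεn n).le, hbout]
      ring
    simp only [e]
    simpa using hεlim.mul_const (‖ν‖ + δ)
  have I : ∀ {f : Eucl d → ℝ}, MemLp f 2 (volume.restrict Ω) → IntegrableOn f Ω :=
    fun hf => integrableOn_of_memLp hΩb hf
  have LI : ∀ {f : Eucl d → ℝ}, MemLp f 2 (volume.restrict Ω) →
      LocallyIntegrable (Ω.indicator f) := fun hf =>
    ((I hf).integrable_indicator hMeas).locallyIntegrable
  have hm0 : MemLp (Ω.indicator w) 2 volume := (memLp_indicator_iff_restrict hMeas).mpr hw.memLp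
  let W : ℕ → Eucl d → ℝ := fun n => moll (b n) (Ω.indicator w)
  have hWs : ∀ n, ContDiff ℝ ∞ (W n) := fun n => contDiff_moll _ (LI hw.memLp)
  have hW2 : ∀ n, ContDiff ℝ 2 (W n) := fun n => contDiff_infty.mp (hWs n) 2
  have hWc : ∀ n, HasCompactSupport (W n) := by
    intro n
    refine hasCompactSupport_moll _ ?_
    refine (isCompact_closedBall x₀ ρ).of_isClosed_subset (isClosed_tsupport _)
      (closure_minimal ?_ Metric.isClosed_closedBall)
    intro x hx
    by_contra hx'
    refine hx ?_
    by_cases hxΩ : x ∈ Ω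
    · rw [Set.indicator_of_mem hxΩ, hsupp x hx']
    · rw [Set.indicator_of_notMem hxΩ]
  have hηW : ∀ n, ContDiff ℝ 2 (fun x => η x * W n x) := fun n => hη2.mul (hW2 n)
  -- outside the ball the mollified quotient vanishes
  have hWout : ∀ n, ∀ x ∉ Metric.ball x₀ ρ', W n =ᶠ[𝓝 x] 0 := by
    intro n x hx
    rw [Metric.mem_ball, not_lt] at hx
    have hopen : {y : Eucl d | ρ + ε₁ * (‖ν‖ + δ) < dist y x₀} ∈ 𝓝 x :=
      (isOpen_lt continuous_const (continuous_id.dist continuous_const)).mem_nhds (by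
        change ρ + ε₁ * (‖ν‖ + δ) < dist x x₀
        linarith)
    filter_upwards [hopen] with y hy
    change moll (b n) (Ω.indicator w) y = 0
    rw [moll_apply]
    refine integral_eq_zero_of_ae (Eventually.of_forall fun t => ?_)
    by_cases ht : t ∈ Metric.closedBall x₀ ρ
    · have : (b n).normed volume (y - t) = 0 := by
        refine normed_eq_zero _ ?_
        rw [hbout]
        by_contra hlt
        rw [not_le, dist_eq_norm] at hlt
        have h1 : dist y x₀ ≤ dist y t + dist t x₀ := dist_triangle _ _ _
        have h2 : dist y t ≤ εn n * (‖ν‖ + δ) := by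
          rw [dist_eq_norm]
          calc ‖y - t‖ = ‖(y - t - -(εn n • ν)) + -(εn n • ν)‖ := by congr 1; abel
            _ ≤ _ := norm_add_le _ _
            _ ≤ εn n * δ + εn n * ‖ν‖ := by
              rw [norm_neg (εn n • ν), norm_smul, Real.norm_of_nonneg (hεn n).le]
              linarith
            _ = _ := by ring
        have h3 : εn n * (‖ν‖ + δ) ≤ ε₁ * (‖ν‖ + δ) :=
          mul_le_mul_of_nonneg_right (hεn' n) (by positivity)
        have h4 : dist t x₀ ≤ ρ := ht
        have h5 : ρ + ε₁ * (‖ν‖ + δ) < dist y x₀ := hy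
        linarith
      simp [this]
    · by_cases htΩ : t ∈ Ω
      · simp [htΩ, hsupp t ht]
      · simp [htΩ]
  -- first and second derivatives
  have hball : ∀ n, ∀ x ∈ Ω ∩ Metric.ball x₀ ρ',
      Metric.closedBall (x - -(εn n • ν)) (b n).rOut ⊆ Ω := fun n x hx =>
    hin.closedBall_subset hx (hεn n) ((hεn' n).trans_lt hε₁')
  have hopenB : IsOpen (Ω ∩ Metric.ball x₀ ρ') := hΩ.inter Metric.isOpen_ball
  have hW1 : ∀ n i, ∀ x ∈ Ω ∩ Metric.ball x₀ ρ',
      pd i (W n) x = moll (b n) (Ω.indicator (w1 i)) x := fun n i x hx =>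
    fderiv_moll_eq hΩ (b n) (hw.weakD hΩ hΩb hη hv i) (I hw.memLp) (hball n x hx)
  have hW2' : ∀ n i j, ∀ x ∈ Ω ∩ Metric.ball x₀ ρ', pd j (pd i (W n)) x
      = moll (b n) (Ω.indicator fun x => quotSnd η v w w1 i j x / η x) x := by
    intro n i j x hx
    have : pd i (W n) =ᶠ[𝓝 x] moll (b n) (Ω.indicator (w1 i)) := by
      filter_upwards [hopenB.mem_nhds hx] with y hy using hW1 n i y hy
    rw [pd_congr_of_eventuallyEq this]
    exact fderiv_moll_eq hΩ (b n) (hw.weakD_one hΩ hΩb hη hv i j) (I (hw.memLp_one i))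
      (hball n x hx)
  let q : Fin d → Fin d → Eucl d → ℝ := fun i j => Ω.indicator fun x => |quotSnd η v w w1 i j x|
  have hq2 : ∀ i j, MemLp (q i j) 2 volume := fun i j =>
    (memLp_indicator_iff_restrict hMeas).mpr (hw.memLp_quotSnd hΩ hΩb hη i j).abs
  have hqi : ∀ i j, Integrable (q i j) := fun i j =>
    (I (hw.memLp_quotSnd hΩ hΩb hη i j).abs).integrable_indicator hMeas
  have hmnn : ∀ n (f : Eucl d → ℝ), (∀ x, 0 ≤ f x) → ∀ x, 0 ≤ moll (b n) f x := by
    intro n f hf x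
    rw [moll_apply]
    exact integral_nonneg fun t => mul_nonneg (hf t) ((b n).nonneg_normed _)
  have hqnn : ∀ i j x, 0 ≤ q i j x := fun i j x => Set.indicator_nonneg (fun _ _ => abs_nonneg _) x
  have hW2b : ∀ n i j, ∀ x ∈ Ω, |pd j (pd i (W n)) x| * η x ≤ C * moll (b n) (q i j) x := by
    intro n i j x hxΩ
    by_cases hxB : x ∈ Metric.ball x₀ ρ'
    · rw [hW2' n i j x ⟨hxΩ, hxB⟩]
      have e : C * moll (b n) (q i j) x = moll (b n) (fun t => C * q i j t) x := by
        rw [moll_apply, moll_apply, ← integral_const_mul]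
        congr 1
        funext t
        ring
      rw [e]
      refine moll_mono_abs (b n) ((hqi i j).const_mul C) (Eventually.of_forall fun t ht => ?_)
        (hη.pos x hxΩ).le
      by_cases htΩ : t ∈ Ω
      · simp only [q, Set.indicator_of_mem htΩ]
        have h1 := hle x ⟨hxΩ, hxB⟩ (εn n) (hεn n) ((hεn' n).trans_lt hε₁') (t - x) (by
          rw [hbout, dist_eq_norm] at ht
          rw [← norm_neg]
          have e : -(t - x - εn n • ν) = x - t - -(εn n • ν) := by abel
          rw [e]
          exact ht.le)
        have h2 := hη.pos t htΩ
        rw [add_sub_cancel] at h1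
        rw [abs_div, abs_of_pos h2, div_mul_eq_mul_div, div_le_iff₀ h2]
        calc _ ≤ |quotSnd η v w w1 i j t| * (C * η t) :=
              mul_le_mul_of_nonneg_left h1 (abs_nonneg _)
          _ = _ := by ring
      · simp [q, htΩ]
    · have := (pd_eq_zero_of_eventually (pd_eq_zero_of_eventually (hWout n x hxB) i) j).self_of_nhds
      rw [this]
      simp only [Pi.zero_apply, abs_zero, zero_mul]
      exact mul_nonneg hC0 (hmnn n _ (hqnn i j) x)
  have hW1b : ∀ n i, ∀ x ∈ Ω, |pd i (W n) x| ≤ |moll (b n) (Ω.indicator (w1 i)) x| := by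
    intro n i x hxΩ
    by_cases hxB : x ∈ Metric.ball x₀ ρ'
    · rw [hW1 n i x ⟨hxΩ, hxB⟩]
    · have := (pd_eq_zero_of_eventually (hWout n x hxB) i).self_of_nhds
      rw [this]
      simp
  -- a common majorant of the jets
  obtain ⟨Cη, hCη0, hCη⟩ := exists_bound_on hΩb hη1.continuous
  choose D hD0 hD using fun i => exists_bound_on hΩb (contDiff_pd (m := 0) i hη1 (by simp)).continuous
  choose E hE0 hE using fun i j => exists_bound_on hΩb
    (contDiff_pd (m := 0) j (contDiff_pd (m := 1) i hη2 le_rfl) (by simp)).continuous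
  set K : ℝ := Cη + ∑ i, D i + ∑ i, ∑ j, E i j with hK
  have hDs : ∀ i, D i ≤ ∑ i, D i := fun i =>
    Finset.single_le_sum (f := D) (fun i _ => hD0 i) (Finset.mem_univ i)
  have hEs : ∀ i j, E i j ≤ ∑ i, ∑ j, E i j := fun i j =>
    (Finset.single_le_sum (f := fun j => E i j) (fun j _ => hE0 i j) (Finset.mem_univ j)).trans
      (Finset.single_le_sum (f := fun i => ∑ j, E i j)
        (fun i _ => Finset.sum_nonneg fun j _ => hE0 i j) (Finset.mem_univ i))
  have hDn : 0 ≤ ∑ i, D i := Finset.sum_nonneg fun i _ => hD0 i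
  have hEn : 0 ≤ ∑ i, ∑ j, E i j := Finset.sum_nonneg fun i _ => Finset.sum_nonneg fun j _ => hE0 i j
  have hK0 : 0 ≤ K := by positivity
  let G : ℕ → Eucl d → ℝ := fun n x => K * (|W n x| + 2 * ∑ i, |moll (b n) (Ω.indicator (w1 i)) x|)
    + C * ∑ i, ∑ j, moll (b n) (q i j) x
  have hWn : ∀ n x i, |moll (b n) (Ω.indicator (w1 i)) x|
      ≤ ∑ i, |moll (b n) (Ω.indicator (w1 i)) x| := fun n x i =>
    Finset.single_le_sum (f := fun i => |moll (b n) (Ω.indicator (w1 i)) x|)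
      (fun i _ => abs_nonneg _) (Finset.mem_univ i)
  have hQn : ∀ n x i j, moll (b n) (q i j) x ≤ ∑ i, ∑ j, moll (b n) (q i j) x := fun n x i j =>
    (Finset.single_le_sum (f := fun j => moll (b n) (q i j) x)
      (fun j _ => hmnn n _ (hqnn i j) x) (Finset.mem_univ j)).trans
      (Finset.single_le_sum (f := fun i => ∑ j, moll (b n) (q i j) x)
        (fun i _ => Finset.sum_nonneg fun j _ => hmnn n _ (hqnn i j) x) (Finset.mem_univ i))
  have hSn : ∀ n x, 0 ≤ ∑ i, |moll (b n) (Ω.indicator (w1 i)) x| := fun n x =>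
    Finset.sum_nonneg fun i _ => abs_nonneg _
  have hQ0 : ∀ n x, 0 ≤ ∑ i, ∑ j, moll (b n) (q i j) x := fun n x =>
    Finset.sum_nonneg fun i _ => Finset.sum_nonneg fun j _ => hmnn n _ (hqnn i j) x
  have hdom : ∀ n (α : Idx d 2), ∀ x ∈ Ω, |partialD α (fun x => η x * W n x) x| ≤ G n x := by
    intro n α x hxΩ
    have hη' : |η x| ≤ K := (hCη x hxΩ).trans (by linarith)
    have hd' : ∀ i, |pd i η x| ≤ K := fun i => (hD i x hxΩ).trans (by linarith [hDs i])
    have he' : ∀ i j, |pd j (pd i η) x| ≤ K := fun i j => (hE i j x hxΩ).trans (by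
      linarith [hEs i j])
    have hS := hSn n x
    have hQ := mul_nonneg hC0 (hQ0 n x)
    rw [partialD_eq_jet2 (hηW n)]
    refine Idx.cases_two (P := fun α => |jet2 (fun x => η x * W n x) (fun i => pd i _)
      (fun i j => pd i (pd j _)) α x| ≤ G n x) ?_ ?_ ?_ α
    · simp only [jet2_nil, G]
      rw [abs_mul]
      have := mul_le_mul_of_nonneg_right hη' (abs_nonneg (W n x))
      have := mul_nonneg hK0 hS
      linarith
    · intro i
      simp only [jet2_one, G]
      rw [pd_mul i (hη1.differentiable one_ne_zero x) ((hW2 n).differentiable two_ne_zero x)]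
      refine (abs_add_le _ _).trans ?_
      rw [abs_mul, abs_mul]
      have k1 := mul_le_mul_of_nonneg_right (hd' i) (abs_nonneg (W n x))
      have k2 := mul_le_mul hη' ((hW1b n i x hxΩ).trans (hWn n x i)) (abs_nonneg _) hK0
      have := mul_nonneg hK0 hS
      linarith
    · intro i j
      simp only [jet2_two, G]
      rw [pd_pd_mul i j hη2 (hW2 n)]
      have k1 := mul_le_mul_of_nonneg_right (he' j i) (abs_nonneg (W n x))
      have k2 := mul_le_mul (hd' j) ((hW1b n i x hxΩ).trans (hWn n x i)) (abs_nonneg _) hK0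
      have k3 := mul_le_mul (hd' i) ((hW1b n j x hxΩ).trans (hWn n x j)) (abs_nonneg _) hK0
      have k4 := (hW2b n j i x hxΩ).trans (mul_le_mul_of_nonneg_left (hQn n x j i) hC0)
      rw [← abs_mul] at k1 k2 k3
      have k5 : |η x * pd i (pd j (W n)) x| = |pd i (pd j (W n)) x| * η x := by
        rw [abs_mul, abs_of_pos (hη.pos x hxΩ), mul_comm]
      refine (abs_add_le _ _).trans ?_
      rw [k5]
      have := (abs_add_le (pd i (pd j η) x * W n x + pd j η x * pd i (W n) x)
        (pd i η x * pd j (W n) x))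
      have := abs_add_le (pd i (pd j η) x * W n x) (pd j η x * pd i (W n) x)
      linarith
  have hc1 : ∀ n i, Continuous (moll (b n) (Ω.indicator (w1 i))) := fun n i =>
    (contDiff_moll (b n) (LI (hw.memLp_one i))).continuous
  have hcq : ∀ n i j, Continuous (moll (b n) (q i j)) := fun n i j =>
    (contDiff_moll (b n) (hqi i j).locallyIntegrable).continuous
  -- the uniform bound
  let B : ℝ≥0∞ := ENNReal.ofReal K * (eLpNorm (Ω.indicator w) 2 volume
      + ENNReal.ofReal 2 * ∑ i, eLpNorm (Ω.indicator (w1 i)) 2 volume)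
    + ENNReal.ofReal C * ∑ i, ∑ j, eLpNorm (q i j) 2 volume
  have hBtop : B ≠ ⊤ := by
    refine ENNReal.add_ne_top.mpr ⟨ENNReal.mul_ne_top ENNReal.ofReal_ne_top
      (ENNReal.add_ne_top.mpr ⟨hm0.2.ne, ENNReal.mul_ne_top ENNReal.ofReal_ne_top ?_⟩),
      ENNReal.mul_ne_top ENNReal.ofReal_ne_top ?_⟩
    · exact ENNReal.sum_ne_top.mpr fun i _ =>
        ((memLp_indicator_iff_restrict hMeas).mpr (hw.memLp_one i)).2.ne
    · exact ENNReal.sum_ne_top.mpr fun i _ => ENNReal.sum_ne_top.mpr fun j _ => (hq2 i j).2.ne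
  have hGB : ∀ n, eLpNorm (G n) 2 (volume.restrict Ω) ≤ B := by
    intro n
    refine (eLpNorm_mono_measure _ Measure.restrict_le_self).trans ?_
    have hcW := (hWs n).continuous
    have cm : ∀ (c : ℝ) (f : Eucl d → ℝ), 0 ≤ c →
        eLpNorm (fun x => c * f x) 2 volume = ENNReal.ofReal c * eLpNorm f 2 volume := by
      intro c f hc
      have := eLpNorm_const_smul c f 2 (volume : Measure (Eucl d))
      rw [Real.enorm_eq_ofReal hc] at this
      exact this
    have ab : ∀ f : Eucl d → ℝ, eLpNorm (fun x => |f x|) 2 volume = eLpNorm f 2 volume :=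
      fun f => eLpNorm_norm f
    have cS : Continuous fun x => ∑ i, |moll (b n) (Ω.indicator (w1 i)) x| :=
      continuous_finsetSum _ fun i _ => (hc1 n i).abs
    have cQ : Continuous fun x => ∑ i, ∑ j, moll (b n) (q i j) x :=
      continuous_finsetSum _ fun i _ => continuous_finsetSum _ fun j _ => hcq n i j
    refine (eLpNorm_add_le (f := fun x => K * (|W n x| + 2 * ∑ i, |moll (b n) (Ω.indicator (w1 i)) x|))
      (g := fun x => C * ∑ i, ∑ j, moll (b n) (q i j) x)
      (by fun_prop) (by fun_prop) one_le_two).trans ?_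
    rw [cm K _ hK0, cm C _ hC0]
    refine add_le_add (mul_le_mul_right ?_ _) (mul_le_mul_right ?_ _)
    · refine (eLpNorm_add_le (f := fun x => |W n x|)
        (g := fun x => 2 * ∑ i, |moll (b n) (Ω.indicator (w1 i)) x|)
        (by fun_prop) (by fun_prop) one_le_two).trans ?_
      rw [cm 2 _ zero_le_two, ab]
      refine add_le_add (eLpNorm_moll_le _ hm0.1) (mul_le_mul_right ?_ _)
      have e : (fun x => ∑ i, |moll (b n) (Ω.indicator (w1 i)) x|)
        = ∑ i, fun x => |moll (b n) (Ω.indicator (w1 i)) x| := by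
        funext x
        simp
      rw [e]
      refine (eLpNorm_sum_le (fun i _ => (hc1 n i).abs.aestronglyMeasurable) one_le_two).trans
        (Finset.sum_le_sum fun i _ => ?_)
      rw [ab]
      exact eLpNorm_moll_le _ ((memLp_indicator_iff_restrict hMeas).mpr (hw.memLp_one i)).1
    · have e : (fun x => ∑ i, ∑ j, moll (b n) (q i j) x)
        = ∑ i, fun x => ∑ j, moll (b n) (q i j) x := by
        funext x
        simp
      rw [e]
      refine (eLpNorm_sum_le (fun i _ => (continuous_finsetSum _ fun j _ =>
        hcq n i j).aestronglyMeasurable) one_le_two).trans (Finset.sum_le_sum fun i _ => ?_)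
      have e : (fun x => ∑ j, moll (b n) (q i j) x) = ∑ j, fun x => moll (b n) (q i j) x := by
        funext x
        simp
      rw [e]
      exact (eLpNorm_sum_le (fun j _ => (hcq n i j).aestronglyMeasurable) one_le_two).trans
        (Finset.sum_le_sum fun j _ => eLpNorm_moll_le _ (hq2 i j).1)
  refine inner_eq_zero_of_bounded_approx hΩ hΩb (un := fun n => cjet hΩb _ (hηW n))
    (C := Fintype.card (Idx d 2) * B.toReal) hv (fun n => cjet_mem_sobolev hΩb (hηW n))
    (fun n => hl (W n) (hWs n) (hWc n) (hηW n)) (fun n => norm_jet_le fun α => ?_) ?_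
  · rw [Lp.norm_def]
    refine ENNReal.toReal_mono hBtop (le_trans ?_ (hGB n))
    refine eLpNorm_mono_ae_real ?_
    filter_upwards [coeFn_cjet hΩb (hηW n) α, ae_restrict_mem hMeas] with x hx hxΩ
    rw [hx]
    exact hdom n α x hxΩ
  · intro z hz
    have hηz : MemLp (fun x => η x * z x) 2 (volume.restrict Ω) :=
      memLp_mul hΩ hΩb hη1.continuous hz.memLp
    have lim := tendsto_integral_mul_of_eLpNorm
      (F := W) (f := Ω.indicator w) (z := fun x => η x * z x) (μ := volume.restrict Ω)
      (fun n => memLp_of_continuous hΩb (hWs n).continuous 2) (hm0.restrict Ω) hηz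
      (tendsto_moll hΩb b hblim hm0)
    have e1 : ∀ n, ∫ x in Ω, cjet hΩb _ (hηW n) (Idx.nil d 2) x * z x
        = ∫ x in Ω, W n x * (η x * z x) := by
      intro n
      refine integral_congr_ae ?_
      filter_upwards [coeFn_cjet hΩb (hηW n) (Idx.nil d 2)] with x hx
      rw [hx, partialD_nil]
      ring
    have e2 : ∫ x in Ω, v (Idx.nil d 2) x * z x = ∫ x in Ω, Ω.indicator w x * (η x * z x) := by
      refine integral_congr_ae ?_
      filter_upwards [hw.eq, ae_restrict_mem hMeas] with x hx hxΩ
      rw [Set.indicator_of_mem hxΩ, hx]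
      have := (hη.pos x hxΩ).ne'
      field_simp
    simp only [e1, e2]
    exact lim

end DGM
end

noncomputable section

namespace DGM

/-! ### Averages along segments towards a graph -/

/-- The height of `y` above the graph of `γ` in direction `ν`. -/
def height {d : ℕ} (ν : Eucl d) (γ : Eucl d → ℝ) (y : Eucl d) : ℝ :=
  inner ℝ ν y - γ (y - inner ℝ ν y • ν)

/-- The point above the same point of the graph as `y`, with height multiplied by `τ²`. -/
def slide {d : ℕ} (ν : Eucl d) (γ : Eucl d → ℝ) (τ : ℝ) (y : Eucl d) : Eucl d :=
  y - ((1 - τ ^ 2) * height ν γ y) • ν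

/-- The average of `F` over the segment from the graph to `y`. -/
def lineAvg {d : ℕ} (ν : Eucl d) (γ F : Eucl d → ℝ) (y : Eucl d) : ℝ :=
  ∫ τ in (0 : ℝ)..1, 2 * τ * F (slide ν γ τ y)

lemma height_add_smul {d : ℕ} {ν : Eucl d} (hν : ‖ν‖ = 1) (γ : Eucl d → ℝ) (y : Eucl d) (s : ℝ) :
    height ν γ (y + s • ν) = height ν γ y + s := by
  unfold height
  have h : inner ℝ ν (y + s • ν) = inner ℝ ν y + s := by
    rw [inner_add_right, inner_smul_right, real_inner_self_eq_norm_sq, hν]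
    ring
  rw [h]
  have : y + s • ν - (inner ℝ ν y + s) • ν = y - inner ℝ ν y • ν := by
    rw [add_smul]
    abel
  rw [this]
  ring

lemma height_slide {d : ℕ} {ν : Eucl d} (hν : ‖ν‖ = 1) (γ : Eucl d → ℝ) (τ : ℝ) (y : Eucl d) :
    height ν γ (slide ν γ τ y) = τ ^ 2 * height ν γ y := by
  have : slide ν γ τ y = y + (-((1 - τ ^ 2) * height ν γ y)) • ν := by
    unfold slide
    rw [neg_smul, sub_eq_add_neg]
  rw [this, height_add_smul hν]
  ring

lemma slide_one {d : ℕ} (ν : Eucl d) (γ : Eucl d → ℝ) (y : Eucl d) : slide ν γ 1 y = y := by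
  simp [slide]

lemma contDiff_height {d : ℕ} (ν : Eucl d) {γ : Eucl d → ℝ} {n : WithTop ℕ∞}
    (hγ : ContDiff ℝ n γ) : ContDiff ℝ n (height ν γ) := by
  unfold height
  have h1 : ContDiff ℝ n (fun y : Eucl d => inner ℝ ν y) := contDiff_const.inner ℝ contDiff_id
  exact h1.sub (hγ.comp (contDiff_id.sub (h1.smul contDiff_const)))

lemma continuous_slide {d : ℕ} (ν : Eucl d) {γ : Eucl d → ℝ} (hγ : Continuous γ) :
    Continuous (fun p : Eucl d × ℝ => slide ν γ p.2 p.1) := by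
  have : Continuous (height ν γ) := by
    unfold height
    fun_prop
  unfold slide
  fun_prop

/-- The derivative of `slide`. -/
def slideD {d : ℕ} (ν : Eucl d) (γ : Eucl d → ℝ) (τ : ℝ) (y : Eucl d) : Eucl d →L[ℝ] Eucl d :=
  ContinuousLinearMap.id ℝ (Eucl d) - ((1 - τ ^ 2) • fderiv ℝ (height ν γ) y).smulRight ν

lemma hasFDerivAt_slide {d : ℕ} (ν : Eucl d) {γ : Eucl d → ℝ} (hγ : ContDiff ℝ 1 γ) (τ : ℝ)
    (y : Eucl d) : HasFDerivAt (slide ν γ τ) (slideD ν γ τ y) y := by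
  have h := ((contDiff_height ν hγ).differentiable one_ne_zero y).hasFDerivAt
  exact (hasFDerivAt_id y).sub ((h.const_mul (1 - τ ^ 2)).smul_const ν)

lemma fderiv_height_self {d : ℕ} {ν : Eucl d} (hν : ‖ν‖ = 1) {γ : Eucl d → ℝ}
    (hγ : ContDiff ℝ 1 γ) (y : Eucl d) : fderiv ℝ (height ν γ) y ν = 1 := by
  have h := ((contDiff_height ν hγ).differentiable one_ne_zero y).hasFDerivAt
  have h1 : HasDerivAt (fun s : ℝ => y + s • ν) ν 0 := by
    simpa using ((hasDerivAt_id (0 : ℝ)).smul_const ν).const_add y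
  have h2 := HasFDerivAt.comp_hasDerivAt (0 : ℝ) (f := fun s : ℝ => y + s • ν)
    (l := height ν γ) (by simpa using h) h1
  have h3 : HasDerivAt (fun s : ℝ => height ν γ y + s) 1 0 := (hasDerivAt_id _).const_add _
  have e : (height ν γ ∘ fun s : ℝ => y + s • ν) = fun s : ℝ => height ν γ y + s := by
    funext s
    exact height_add_smul hν γ y s
  rw [e] at h2
  exact h2.unique h3

lemma det_slideD {d : ℕ} {ν : Eucl d} (hν : ‖ν‖ = 1) {γ : Eucl d → ℝ}
    (hγ : ContDiff ℝ 1 γ) (τ : ℝ) (y : Eucl d) : (slideD ν γ τ y).det = τ ^ 2 := by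
  have h := LinearMap.transvection.det
    (-((1 - τ ^ 2) • (fderiv ℝ (height ν γ) y : Eucl d →ₗ[ℝ] ℝ))) ν
  have e : (slideD ν γ τ y : Eucl d →ₗ[ℝ] Eucl d) = LinearMap.transvection
      (-((1 - τ ^ 2) • (fderiv ℝ (height ν γ) y : Eucl d →ₗ[ℝ] ℝ))) ν := by
    ext1 x
    simp [slideD, LinearMap.transvection.apply, sub_eq_add_neg]
  rw [ContinuousLinearMap.det, e, h]
  simp only [LinearMap.neg_apply, LinearMap.smul_apply, ContinuousLinearMap.coe_coe,
    fderiv_height_self hν hγ, smul_eq_mul]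
  ring

lemma injective_slide {d : ℕ} {ν : Eucl d} (hν : ‖ν‖ = 1) (γ : Eucl d → ℝ) {τ : ℝ} (hτ : τ ≠ 0) :
    Function.Injective (slide ν γ τ) := by
  intro x y h
  have h1 := congrArg (height ν γ) h
  rw [height_slide hν, height_slide hν] at h1
  have h2 : height ν γ x = height ν γ y := mul_left_cancel₀ (pow_ne_zero 2 hτ) h1
  unfold slide at h
  rw [h2] at h
  exact sub_left_injective h

/-- Fundamental theorem of calculus along the segments. -/
lemma height_mul_lineAvg {d : ℕ} (ν : Eucl d) (γ : Eucl d → ℝ) {F : Eucl d → ℝ}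
    (hF : ContDiff ℝ 1 F) (y : Eucl d) :
    height ν γ y * lineAvg ν γ (fun x => fderiv ℝ F x ν) y = F y - F (slide ν γ 0 y) := by
  have hd : ∀ τ : ℝ, HasDerivAt (fun τ => F (slide ν γ τ y))
      (height ν γ y * (2 * τ * fderiv ℝ F (slide ν γ τ y) ν)) τ := by
    intro τ
    have h1 : HasDerivAt (fun τ => slide ν γ τ y) ((2 * τ * height ν γ y) • ν) τ := by
      have h2 : HasDerivAt (fun τ : ℝ => (1 - τ ^ 2) * height ν γ y)
          (-(2 * τ) * height ν γ y) τ := by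
        have := ((hasDerivAt_pow 2 τ).const_sub 1).mul_const (height ν γ y)
        simpa using this
      have := (h2.smul_const ν).const_sub y
      simpa [slide] using this
    have := (hF.differentiable one_ne_zero (slide ν γ τ y)).hasFDerivAt.comp_hasDerivAt τ h1
    refine HasDerivAt.congr_deriv this ?_
    rw [map_smul, smul_eq_mul]
    ring
  have hcs : Continuous (fun τ => slide ν γ τ y) := by
    unfold slide
    fun_prop
  have hc : Continuous (fun τ => height ν γ y * (2 * τ * fderiv ℝ F (slide ν γ τ y) ν)) := by
    have := (hF.continuous_fderiv one_ne_zero).comp hcs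
    have h2 : Continuous (fun τ => fderiv ℝ F (slide ν γ τ y) ν) := this.clm_apply continuous_const
    fun_prop
  have := intervalIntegral.integral_eq_sub_of_hasDerivAt (a := 0) (b := 1) (fun τ _ => hd τ)
    (hc.intervalIntegrable 0 1)
  rw [intervalIntegral.integral_const_mul, slide_one] at this
  exact this

lemma continuous_lineAvg {d : ℕ} (ν : Eucl d) {γ F : Eucl d → ℝ} (hγ : Continuous γ)
    (hF : Continuous F) : Continuous (lineAvg ν γ F) := by
  unfold lineAvg
  refine intervalIntegral.continuous_parametric_intervalIntegral_of_continuous'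
    (f := fun y τ => 2 * τ * F (slide ν γ τ y)) ?_ 0 1
  exact (continuous_const.mul continuous_snd).mul (hF.comp (continuous_slide ν hγ))

lemma lineAvg_sub {d : ℕ} (ν : Eucl d) {γ F G : Eucl d → ℝ} (hγ : Continuous γ)
    (hF : Continuous F) (hG : Continuous G) (y : Eucl d) :
    lineAvg ν γ (fun x => F x - G x) y = lineAvg ν γ F y - lineAvg ν γ G y := by
  unfold lineAvg
  have hcs : Continuous (fun τ => slide ν γ τ y) :=
    (continuous_slide ν hγ).comp (continuous_const.prodMk continuous_id)
  rw [← intervalIntegral.integral_sub]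
  · congr 1
    funext τ
    ring
  · exact ((continuous_const.mul continuous_id).mul (hF.comp hcs)).intervalIntegrable _ _
  · exact ((continuous_const.mul continuous_id).mul (hG.comp hcs)).intervalIntegrable _ _

/-- Hardy's inequality: averaging is bounded on `L²`. -/
lemma eLpNorm_lineAvg_le {d : ℕ} {ν : Eucl d} (hν : ‖ν‖ = 1) {γ F : Eucl d → ℝ}
    (hγ : ContDiff ℝ 1 γ) (hF : Continuous F) {P P' : Set (Eucl d)} (hP : MeasurableSet P)
    (hPP' : ∀ y ∈ P, ∀ τ, 0 < τ → τ ≤ 1 → slide ν γ τ y ∈ P') :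
    eLpNorm (lineAvg ν γ F) 2 (volume.restrict P) ≤ 2 * eLpNorm F 2 (volume.restrict P') := by
  set I : Measure ℝ := volume.restrict (Set.Ioc 0 1)
  have hI1 : I Set.univ = 1 := by simp [I]
  have hcj : Continuous fun p : Eucl d × ℝ => F (slide ν γ p.2 p.1) :=
    hF.comp (continuous_slide ν hγ.continuous)
  have hmj : Measurable fun p : Eucl d × ℝ => ‖2 * p.2 * F (slide ν γ p.2 p.1)‖ₑ ^ (2 : ℝ) :=
    ((continuous_const.mul continuous_snd).mul hcj).measurable.enorm.pow_const _
  have hpt : ∀ y, ‖lineAvg ν γ F y‖ₑ ^ (2 : ℝ)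
      ≤ ∫⁻ τ, ‖2 * τ * F (slide ν γ τ y)‖ₑ ^ (2 : ℝ) ∂I := by
    intro y
    have hmy : Measurable fun τ => ‖2 * τ * F (slide ν γ τ y)‖ₑ := by
      have : Continuous fun τ => slide ν γ τ y :=
        (continuous_slide ν hγ.continuous).comp (continuous_const.prodMk continuous_id)
      exact ((continuous_const.mul continuous_id).mul (hF.comp this)).measurable.enorm
    have h1 : ‖lineAvg ν γ F y‖ₑ ≤ ∫⁻ τ, ‖2 * τ * F (slide ν γ τ y)‖ₑ ∂I := by
      unfold lineAvg
      rw [intervalIntegral.integral_of_le zero_le_one]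
      exact enorm_integral_le_lintegral_enorm _
    have h2 : ∫⁻ τ, ‖2 * τ * F (slide ν γ τ y)‖ₑ ∂I
        ≤ (∫⁻ τ, ‖2 * τ * F (slide ν γ τ y)‖ₑ ^ (2 : ℝ) ∂I) ^ (1 / (2 : ℝ)) := by
      have := ENNReal.lintegral_mul_le_Lp_mul_Lq I Real.HolderConjugate.two_two
        hmy.aemeasurable (g := fun _ => 1) aemeasurable_const
      simpa [hI1] using this
    calc ‖lineAvg ν γ F y‖ₑ ^ (2 : ℝ)
        ≤ ((∫⁻ τ, ‖2 * τ * F (slide ν γ τ y)‖ₑ ^ (2 : ℝ) ∂I) ^ (1 / (2 : ℝ))) ^ (2 : ℝ) :=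
          ENNReal.rpow_le_rpow (h1.trans h2) (by norm_num)
      _ = _ := by
          rw [← ENNReal.rpow_mul]
          norm_num
  have hcv : ∀ τ ∈ Set.Ioc (0 : ℝ) 1, ∫⁻ y in P, ‖2 * τ * F (slide ν γ τ y)‖ₑ ^ (2 : ℝ)
      ≤ 4 * ∫⁻ y in P', ‖F y‖ₑ ^ (2 : ℝ) := by
    intro τ hτ
    have hcov := lintegral_image_eq_lintegral_abs_det_fderiv_mul volume hP
      (fun x _ => (hasFDerivAt_slide ν hγ τ x).hasFDerivWithinAt)
      ((injective_slide hν γ hτ.1.ne').injOn) (fun y => 4 * ‖F y‖ₑ ^ (2 : ℝ))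
    have hsub : slide ν γ τ '' P ⊆ P' := by
      rintro _ ⟨y, hy, rfl⟩
      exact hPP' y hy τ hτ.1 hτ.2
    calc ∫⁻ y in P, ‖2 * τ * F (slide ν γ τ y)‖ₑ ^ (2 : ℝ)
        = ∫⁻ y in P, ENNReal.ofReal |(slideD ν γ τ y).det|
            * (4 * ‖F (slide ν γ τ y)‖ₑ ^ (2 : ℝ)) := by
          congr 1
          funext y
          rw [det_slideD hν hγ, abs_of_nonneg (by positivity), enorm_mul,
            ENNReal.mul_rpow_of_nonneg _ _ (by norm_num),
            Real.enorm_eq_ofReal (by linarith [hτ.1]),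
            ENNReal.ofReal_rpow_of_nonneg (by linarith [hτ.1]) (by norm_num), ← mul_assoc]
          congr 1
          have h4 : (4 : ℝ≥0∞) = ENNReal.ofReal 4 := by simp
          rw [h4, ← ENNReal.ofReal_mul (by positivity)]
          congr 1
          norm_cast
          ring
      _ = ∫⁻ y in slide ν γ τ '' P, 4 * ‖F y‖ₑ ^ (2 : ℝ) := hcov.symm
      _ ≤ ∫⁻ y in P', 4 * ‖F y‖ₑ ^ (2 : ℝ) := lintegral_mono_set hsub
      _ = _ := lintegral_const_mul _ (hF.measurable.enorm.pow_const _)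
  have hmain : ∫⁻ y in P, ‖lineAvg ν γ F y‖ₑ ^ (2 : ℝ) ≤ 4 * ∫⁻ y in P', ‖F y‖ₑ ^ (2 : ℝ) := by
    calc _ ≤ ∫⁻ y in P, ∫⁻ τ, ‖2 * τ * F (slide ν γ τ y)‖ₑ ^ (2 : ℝ) ∂I := lintegral_mono hpt
      _ = ∫⁻ τ, ∫⁻ y in P, ‖2 * τ * F (slide ν γ τ y)‖ₑ ^ (2 : ℝ) ∂volume ∂I :=
        lintegral_lintegral_swap hmj.aemeasurable
      _ ≤ ∫⁻ _τ, (4 * ∫⁻ y in P', ‖F y‖ₑ ^ (2 : ℝ)) ∂I := by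
        refine lintegral_mono_ae ?_
        filter_upwards [ae_restrict_mem measurableSet_Ioc] with τ hτ using hcv τ hτ
      _ = _ := by simp [hI1]
  rw [eLpNorm_eq_lintegral_rpow_enorm_toReal (by simp) (by simp),
    eLpNorm_eq_lintegral_rpow_enorm_toReal (by simp) (by simp)]
  simp only [ENNReal.toReal_ofNat]
  have h2 : (2 : ℝ≥0∞) = (4 : ℝ≥0∞) ^ (1 / (2 : ℝ)) := by
    have : (4 : ℝ≥0∞) = 2 ^ (2 : ℝ) := by norm_num
    rw [this, ← ENNReal.rpow_mul]
    norm_num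
  calc _ ≤ (4 * ∫⁻ y in P', ‖F y‖ₑ ^ (2 : ℝ)) ^ (1 / (2 : ℝ)) :=
        ENNReal.rpow_le_rpow hmain (by norm_num)
    _ = _ := by
      rw [ENNReal.mul_rpow_of_nonneg _ _ (by norm_num), ← h2]

lemma hasFDerivAt_lineAvg {d : ℕ} (ν : Eucl d) {γ F : Eucl d → ℝ} (hγ : ContDiff ℝ 1 γ)
    (hF : ContDiff ℝ 1 F) (y₀ : Eucl d) :
    HasFDerivAt (lineAvg ν γ F) (∫ τ in (0 : ℝ)..1, (2 * τ) •
      (fderiv ℝ F (slide ν γ τ y₀)).comp (slideD ν γ τ y₀)) y₀ ∧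
    Continuous (fun p : Eucl d × ℝ => (2 * p.2) •
      (fderiv ℝ F (slide ν γ p.2 p.1)).comp (slideD ν γ p.2 p.1)) := by
  have hcF : Continuous fun p : Eucl d × ℝ => fderiv ℝ F (slide ν γ p.2 p.1) :=
    (hF.continuous_fderiv one_ne_zero).comp (continuous_slide ν hγ.continuous)
  have hch : Continuous (fun p : Eucl d × ℝ => fderiv ℝ (height ν γ) p.1) :=
    ((contDiff_height ν hγ).continuous_fderiv one_ne_zero).comp continuous_fst
  have hcD : Continuous fun p : Eucl d × ℝ => slideD ν γ p.2 p.1 := by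
    unfold slideD
    have h1 : Continuous fun p : Eucl d × ℝ => (1 - p.2 ^ 2) • fderiv ℝ (height ν γ) p.1 := by
      fun_prop
    exact continuous_const.sub (((ContinuousLinearMap.smulRightL ℝ (Eucl d) (Eucl d)).flip
      ν).continuous.comp h1)
  have hc : Continuous (fun p : Eucl d × ℝ => (2 * p.2) •
      (fderiv ℝ F (slide ν γ p.2 p.1)).comp (slideD ν γ p.2 p.1)) :=
    (continuous_const.mul continuous_snd).smul (hcF.clm_comp hcD)
  refine ⟨?_, hc⟩
  obtain ⟨C, hC⟩ := ((isCompact_closedBall y₀ 1).prod (isCompact_Icc (a := (0 : ℝ)) (b := 1))).exists_bound_of_continuousOn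
    hc.continuousOn
  have hcy : ∀ y, Continuous fun τ => slide ν γ τ y := fun y =>
    (continuous_slide ν hγ.continuous).comp (continuous_const.prodMk continuous_id)
  have hcG : ∀ y, Continuous fun τ => 2 * τ * F (slide ν γ τ y) := fun y =>
    (continuous_const.mul continuous_id).mul (hF.continuous.comp (hcy y))
  refine intervalIntegral.hasFDerivAt_integral_of_dominated_of_fderiv_le
    (F' := fun y τ => (2 * τ) • (fderiv ℝ F (slide ν γ τ y)).comp (slideD ν γ τ y))
    (bound := fun _ => C)
    (Metric.closedBall_mem_nhds y₀ one_pos) (Eventually.of_forall fun y =>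
      (hcG y).aestronglyMeasurable) ((hcG y₀).intervalIntegrable _ _) ?_ ?_
    intervalIntegrable_const ?_
  · exact (hc.comp (continuous_const.prodMk continuous_id)).aestronglyMeasurable
  · refine Eventually.of_forall fun τ hτ y hy => hC (y, τ) ⟨hy, ?_⟩
    rw [Set.uIoc_of_le zero_le_one] at hτ
    exact ⟨hτ.1.le, hτ.2⟩
  · refine Eventually.of_forall fun τ _ y _ => ?_
    exact ((hF.differentiable one_ne_zero _).hasFDerivAt.comp y
      (hasFDerivAt_slide ν hγ τ y)).const_mul (2 * τ)

lemma contDiff_lineAvg {d : ℕ} (ν : Eucl d) {γ F : Eucl d → ℝ} (hγ : ContDiff ℝ 1 γ)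
    (hF : ContDiff ℝ 1 F) : ContDiff ℝ 1 (lineAvg ν γ F) := by
  rw [contDiff_one_iff_fderiv]
  refine ⟨fun y => (hasFDerivAt_lineAvg ν hγ hF y).1.differentiableAt, ?_⟩
  have : fderiv ℝ (lineAvg ν γ F) = fun y => ∫ τ in (0 : ℝ)..1, (2 * τ) •
      (fderiv ℝ F (slide ν γ τ y)).comp (slideD ν γ τ y) := by
    funext y
    exact (hasFDerivAt_lineAvg ν hγ hF y).1.fderiv
  rw [this]
  exact intervalIntegral.continuous_parametric_intervalIntegral_of_continuous'
    (f := fun y τ => (2 * τ) • (fderiv ℝ F (slide ν γ τ y)).comp (slideD ν γ τ y))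
    (hasFDerivAt_lineAvg ν hγ hF 0).2 0 1

lemma abs_fderiv_le {d : ℕ} (f : Eucl d → ℝ) (x e : Eucl d) :
    |fderiv ℝ f x e| ≤ ‖e‖ * ∑ i, |pd i f x| := by
  have he : e = ∑ i, e i • bv i := by
    ext j
    simp [Finset.sum_apply, bv, Pi.single_apply]
  have h1 : fderiv ℝ f x e = ∑ i, e i * pd i f x := by
    conv_lhs => rw [he]
    simp [map_sum, pd]
  rw [h1, Finset.mul_sum]
  refine (Finset.abs_sum_le_sum_abs _ _).trans (Finset.sum_le_sum fun i _ => ?_)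
  rw [abs_mul]
  exact mul_le_mul_of_nonneg_right (PiLp.norm_apply_le e i) (abs_nonneg _)

lemma abs_pd_lineAvg_le {d : ℕ} {ν : Eucl d} (hν : ‖ν‖ = 1) {γ F : Eucl d → ℝ}
    (hγ : ContDiff ℝ 1 γ) (hF : ContDiff ℝ 1 F) (i : Fin d) (y : Eucl d) :
    |pd i (lineAvg ν γ F) y| ≤ (1 + |pd i (height ν γ) y|) *
      lineAvg ν γ (fun x => ∑ j, |pd j F x|) y := by
  obtain ⟨h1, h2⟩ := hasFDerivAt_lineAvg ν hγ hF y
  have hcy : Continuous (fun τ : ℝ => (y, τ)) := continuous_const.prodMk continuous_id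
  have hcs : Continuous fun τ => slide ν γ τ y := (continuous_slide ν hγ.continuous).comp hcy
  have e1 : pd i (lineAvg ν γ F) y = ∫ τ in (0 : ℝ)..1,
      2 * τ * fderiv ℝ F (slide ν γ τ y) (slideD ν γ τ y (bv i)) := by
    have hi : IntervalIntegrable (fun τ => (2 * τ) •
        (fderiv ℝ F (slide ν γ τ y)).comp (slideD ν γ τ y)) volume 0 1 :=
      (h2.comp hcy).intervalIntegrable _ _
    unfold pd
    rw [h1.fderiv, ContinuousLinearMap.intervalIntegral_apply hi]
    rfl
  have hS : Continuous fun x => ∑ j, |pd j F x| :=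
    continuous_finsetSum _ fun j _ => (contDiff_pd (m := 0) j hF (by simp)).continuous.abs
  rw [e1]
  unfold lineAvg
  rw [← intervalIntegral.integral_const_mul, ← Real.norm_eq_abs]
  refine intervalIntegral.norm_integral_le_of_norm_le zero_le_one
    (Eventually.of_forall fun τ hτ => ?_) (Continuous.intervalIntegrable ?_ _ _)
  · have hτ0 : 0 ≤ 2 * τ := by linarith [hτ.1]
    rw [norm_mul, Real.norm_of_nonneg hτ0, Real.norm_eq_abs]
    have k1 : ‖slideD ν γ τ y (bv i)‖ ≤ 1 + |pd i (height ν γ) y| := by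
      have : slideD ν γ τ y (bv i) = bv i - ((1 - τ ^ 2) * pd i (height ν γ) y) • ν := by
        simp [slideD, pd]
      rw [this]
      refine (norm_sub_le _ _).trans ?_
      rw [norm_smul, hν, mul_one, PiLp.norm_single, norm_one, norm_mul]
      refine add_le_add le_rfl (mul_le_of_le_one_left (abs_nonneg _) ?_)
      rw [Real.norm_eq_abs, abs_le]
      constructor <;> nlinarith [hτ.1, hτ.2]
    calc _ ≤ 2 * τ * ((1 + |pd i (height ν γ) y|) * ∑ j, |pd j F (slide ν γ τ y)|) := by
          refine mul_le_mul_of_nonneg_left ((abs_fderiv_le _ _ _).trans ?_) hτ0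
          exact mul_le_mul_of_nonneg_right k1 (Finset.sum_nonneg fun j _ => abs_nonneg _)
      _ = _ := by ring
  · exact continuous_const.mul ((continuous_const.mul continuous_id).mul (hS.comp hcs))

end DGM
end

noncomputable section

namespace DGM

/-! ### Weak limits of bounded sequences in `L²` -/

/-- The space of test functions. -/
def testSpace {d : ℕ} (O : Set (Eucl d)) : Submodule ℝ (Eucl d → ℝ) where
  carrier := {φ | IsTestFunction O φ}
  zero_mem' := isTestFunction_zero O
  add_mem' h h' := h.add h'
  smul_mem' c _ h := h.smul c

/-- Test functions as elements of `L²`. -/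
def testToL2 {d : ℕ} (O : Set (Eucl d)) : testSpace O →ₗ[ℝ] L2 O where
  toFun φ := φ.2.memLp.toLp φ.1
  map_add' _ _ := rfl
  map_smul' _ _ := rfl

lemma inner_testToL2 {d : ℕ} {O : Set (Eucl d)} (f : L2 O) (φ : testSpace O) :
    inner ℝ f (testToL2 O φ) = ∫ x in O, f x * φ.1 x := by
  rw [L2.inner_def]
  refine integral_congr_ae ?_
  have h : (testToL2 O φ : Eucl d → ℝ) =ᵐ[volume.restrict O] φ.1 := φ.2.memLp.coeFn_toLp
  filter_upwards [h] with x hx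
  rw [hx]
  simp [mul_comm]

lemma locallyIntegrableOn_of_memLp {d : ℕ} {O : Set (Eucl d)} {f : Eucl d → ℝ}
    (hf : MemLp f 2 (volume.restrict O)) : LocallyIntegrableOn f O :=
  locallyIntegrableOn_of_locallyIntegrable_restrict (hf.locallyIntegrable (by norm_num))

lemma denseRange_testToL2 {d : ℕ} {O : Set (Eucl d)} (hO : IsOpen O) :
    DenseRange (testToL2 O) := by
  have h : (LinearMap.range (testToL2 O)).topologicalClosure = ⊤ := by
    rw [Submodule.topologicalClosure_eq_top_iff, Submodule.eq_bot_iff]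
    intro f hf
    have h0 : (f : Eucl d → ℝ) =ᵐ[volume.restrict O] (0 : Eucl d → ℝ) := by
      refine ae_eq_of_integral_test_eq hO (locallyIntegrableOn_of_memLp (Lp.memLp f))
        locallyIntegrableOn_zero fun φ hφ => ?_
      have := Submodule.inner_left_of_mem_orthogonal
        (LinearMap.mem_range_self (testToL2 O) ⟨φ, hφ⟩) hf
      rw [inner_testToL2] at this
      simpa using this
    exact (Lp.eq_zero_iff_ae_eq_zero).mpr h0
  have := Submodule.dense_iff_topologicalClosure_eq_top.mpr h
  rwa [DenseRange, ← LinearMap.coe_range]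

lemma integrableOn_mul_test {d : ℕ} {O : Set (Eucl d)} {f φ : Eucl d → ℝ}
    (hf : LocallyIntegrableOn f O) (hφ : IsTestFunction O φ) :
    IntegrableOn (fun x => f x * φ x) O := by
  have hFK : IntegrableOn f (tsupport φ) :=
    hf.integrableOn_compact_subset hφ.support hφ.compact.isCompact
  have := integrable_mul_test hFK hφ.smooth.continuous hφ.compact
  rw [integrableOn_iff_integrable_of_support_subset] at this
  · exact this.integrableOn
  · intro x hx
    by_contra hx'
    exact hx (by simp [image_eq_zero_of_notMem_tsupport hx'])

lemma abs_integral_mul_le {X : Type*} [MeasurableSpace X] {μ : Measure X} {f z : X → ℝ}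
    (hf : MemLp f 2 μ) (hz : MemLp z 2 μ) :
    |∫ x, f x * z x ∂μ| ≤ (eLpNorm f 2 μ).toReal * ‖hz.toLp z‖ := by
  have e : ∫ x, f x * z x ∂μ = inner ℝ (hz.toLp z) (hf.toLp f) := by
    rw [L2.inner_def]
    refine integral_congr_ae ?_
    filter_upwards [hz.coeFn_toLp, hf.coeFn_toLp] with x h1 h2
    rw [h1, h2]
    rfl
  rw [e]
  refine (abs_real_inner_le_norm _ _).trans ?_
  rw [mul_comm, Lp.norm_toLp f hf]

/-- A distributional limit of a bounded sequence in `L²` is in `L²`. -/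
lemma memLp_of_tendsto_test {d : ℕ} {O : Set (Eucl d)} (hO : IsOpen O) {f : Eucl d → ℝ}
    (hf : LocallyIntegrableOn f O) {F : ℕ → Eucl d → ℝ} {B : ℝ≥0∞} (hB : B ≠ ⊤)
    (hF : ∀ n, AEStronglyMeasurable (F n) (volume.restrict O))
    (hb : ∀ n, eLpNorm (F n) 2 (volume.restrict O) ≤ B)
    (hl : ∀ z, IsTestFunction O z →
      Tendsto (fun n => ∫ x in O, F n x * z x) atTop (𝓝 (∫ x in O, f x * z x))) :
    MemLp f 2 (volume.restrict O) := by
  let lam : testSpace O →ₗ[ℝ] ℝ :=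
    { toFun := fun φ => ∫ x in O, f x * φ.1 x
      map_add' := by
        intro φ ψ
        rw [← integral_add (integrableOn_mul_test hf φ.2) (integrableOn_mul_test hf ψ.2)]
        simp [mul_add]
      map_smul' := by
        intro c φ
        rw [RingHom.id_apply, smul_eq_mul, ← integral_const_mul]
        congr 1
        funext x
        simp
        ring }
  have hFm : ∀ n, MemLp (F n) 2 (volume.restrict O) := fun n =>
    ⟨hF n, (hb n).trans_lt hB.lt_top⟩
  have hbound : ∀ φ, ‖lam φ‖ ≤ B.toReal * ‖testToL2 O φ‖ := by
    intro φ
    refine le_of_tendsto (hl φ.1 φ.2).norm (Eventually.of_forall fun n => ?_)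
    refine (abs_integral_mul_le (hFm n) φ.2.memLp).trans ?_
    exact mul_le_mul_of_nonneg_right (ENNReal.toReal_mono hB (hb n)) (norm_nonneg _)
  let Λ := lam.extendOfNorm (testToL2 O)
  let h := (InnerProductSpace.toDual ℝ (L2 O)).symm Λ
  have hh : ∀ φ, IsTestFunction O φ → ∫ x in O, f x * φ x = ∫ x in O, h x * φ x := by
    intro φ hφ
    have h1 : Λ (testToL2 O ⟨φ, hφ⟩) = ∫ x in O, f x * φ x :=
      LinearMap.extendOfNorm_eq (denseRange_testToL2 hO) ⟨_, hbound⟩ _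
    rw [← h1, ← InnerProductSpace.toDual_symm_apply, inner_testToL2]
  exact (Lp.memLp h).ae_eq (ae_eq_of_integral_test_eq hO hf
    (locallyIntegrableOn_of_memLp (Lp.memLp h)) hh).symm

end DGM
end

noncomputable section

namespace DGM

/-! ### Division by `η` near the boundary -/

lemma HasWeakD.sum_mul {d : ℕ} {Ω : Set (Eucl d)} {e : Eucl d} {ι : Type*} (s : Finset ι)
    (c : ι → ℝ) {f g : ι → Eucl d → ℝ} (h : ∀ i, HasWeakD Ω e (f i) (g i))
    (hf : ∀ i, IntegrableOn (f i) Ω) (hg : ∀ i, IntegrableOn (g i) Ω) :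
    HasWeakD Ω e (fun x => ∑ i ∈ s, c i * f i x) (fun x => ∑ i ∈ s, c i * g i x) := by
  intro φ h1 h2 h3
  have a1 : ∀ i, IntegrableOn (fun x => c i * (f i x * fderiv ℝ φ x e)) Ω := fun i =>
    (integrable_mul_test (hf i) ((h1.continuous_fderiv one_ne_zero).clm_apply continuous_const)
      (fderiv_hasCompactSupport_apply h2 e)).const_mul (c i)
  have a2 : ∀ i, IntegrableOn (fun x => c i * (g i x * φ x)) Ω := fun i =>
    (integrable_mul_test (hg i) h1.continuous h2).const_mul (c i)
  simp only [Finset.sum_mul, mul_assoc]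
  rw [integral_finsetSum _ fun i _ => a1 i, integral_finsetSum _ fun i _ => a2 i,
    ← Finset.sum_neg_distrib]
  refine Finset.sum_congr rfl fun i _ => ?_
  rw [integral_const_mul, integral_const_mul, h i φ h1 h2 h3]
  ring

lemma fderiv_eq_sum_pd {d : ℕ} (f : Eucl d → ℝ) (x e : Eucl d) :
    fderiv ℝ f x e = ∑ i, e i * pd i f x := by
  have he : e = ∑ i, e i • bv i := by
    ext j
    simp [Finset.sum_apply, bv, Pi.single_apply]
  conv_lhs => rw [he]
  simp [map_sum, pd]

lemma memLp_indicator {d : ℕ} {Ω : Set (Eucl d)} (hΩ : IsOpen Ω) {f : Eucl d → ℝ}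
    (hf : MemLp f 2 (volume.restrict Ω)) : MemLp (Ω.indicator f) 2 volume :=
  (memLp_indicator_iff_restrict hΩ.measurableSet).mpr hf

lemma eLpNorm_indicator_eq {d : ℕ} {Ω : Set (Eucl d)} (hΩ : IsOpen Ω) (f : Eucl d → ℝ) :
    eLpNorm (Ω.indicator f) 2 volume = eLpNorm f 2 (volume.restrict Ω) :=
  eLpNorm_indicator_eq_eLpNorm_restrict hΩ.measurableSet

/-- Mollification with inward shifts. -/
lemma IsInward.exists_smooth_approx {d : ℕ} {Ω : Set (Eucl d)} (hΩ : IsOpen Ω)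
    (hΩb : Bornology.IsBounded Ω) {η : Eucl d → ℝ} {B : Set (Eucl d)} (hB : MeasurableSet B)
    {ν : Eucl d} {δ ε₀ C : ℝ}
    (hin : IsInward Ω η B ν δ ε₀ C) {f : Eucl d → ℝ} {g : Fin d → Eucl d → ℝ}
    (hf : MemLp f 2 (volume.restrict Ω)) (hg : ∀ j, MemLp (g j) 2 (volume.restrict Ω))
    (hw : ∀ j, HasWeakD Ω (bv j) f (g j)) :
    ∃ H : ℕ → Eucl d → ℝ, (∀ n, ContDiff ℝ ∞ (H n)) ∧
      (∀ n, eLpNorm (H n) 2 (volume.restrict Ω) ≤ eLpNorm f 2 (volume.restrict Ω)) ∧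
      Tendsto (fun n => eLpNorm (fun x => H n x - f x) 2 (volume.restrict Ω)) atTop (𝓝 0) ∧
      ∀ n j, eLpNorm (pd j (H n)) 2 (volume.restrict (Ω ∩ B))
        ≤ eLpNorm (g j) 2 (volume.restrict Ω) := by
  let εn : ℕ → ℝ := fun n => ε₀ / (n + 2)
  have hεn : ∀ n, 0 < εn n := fun n => div_pos hin.eps_pos (by positivity)
  have hεn' : ∀ n, εn n < ε₀ := fun n => by
    refine div_lt_self hin.eps_pos ?_
    have : (0 : ℝ) ≤ n := Nat.cast_nonneg n
    linarith
  have hεlim : Tendsto εn atTop (𝓝 0) := by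
    refine Tendsto.div_atTop tendsto_const_nhds ?_
    exact tendsto_atTop_add_const_right _ _ tendsto_natCast_atTop_atTop
  let b : ∀ n, ContDiffBump (-(εn n • ν)) := fun n => shiftBump ν (εn n) δ (hεn n) hin.delta_pos
  have hblim : Tendsto (fun n => ‖-(εn n • ν)‖ + (b n).rOut) atTop (𝓝 0) := by
    have e : ∀ n, ‖-(εn n • ν)‖ + (b n).rOut = εn n * (‖ν‖ + δ) := by
      intro n
      have : (b n).rOut = εn n * δ := rfl
      rw [norm_neg, norm_smul, Real.norm_of_nonneg (hεn n).le, this]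
      ring
    simp only [e]
    simpa using hεlim.mul_const (‖ν‖ + δ)
  have mf := memLp_indicator hΩ hf
  have mg := fun j => memLp_indicator hΩ (hg j)
  have hres : ∀ F : Eucl d → ℝ, ∀ s, eLpNorm F 2 (volume.restrict s) ≤ eLpNorm F 2 volume :=
    fun F s => eLpNorm_mono_measure F Measure.restrict_le_self
  refine ⟨fun n => moll (b n) (Ω.indicator f), fun n => ?_, fun n => ?_, ?_, fun n j => ?_⟩
  · exact contDiff_moll _ (mf.locallyIntegrable (by norm_num))
  · exact (hres _ _).trans ((eLpNorm_moll_le (b n) mf.1).trans_eq (eLpNorm_indicator_eq hΩ f))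
  · refine (tendsto_moll hΩb b hblim mf).congr fun n => ?_
    refine eLpNorm_congr_ae ?_
    filter_upwards [ae_restrict_mem hΩ.measurableSet] with x hx
    rw [Set.indicator_of_mem hx]
  · have : eLpNorm (pd j (moll (b n) (Ω.indicator f))) 2 (volume.restrict (Ω ∩ B))
        = eLpNorm (moll (b n) (Ω.indicator (g j))) 2 (volume.restrict (Ω ∩ B)) := by
      refine eLpNorm_congr_ae ?_
      filter_upwards [ae_restrict_mem (hΩ.measurableSet.inter hB)] with x hx
      exact fderiv_moll_eq hΩ (b n) (hw j) (integrableOn_of_memLp hΩb hf)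
        (hin.closedBall_subset hx (hεn n) (hεn' n))
    rw [this]
    exact (hres _ _).trans ((eLpNorm_moll_le (b n) (mg j).1).trans_eq
      (eLpNorm_indicator_eq hΩ (g j)))

/-- Functions in `H¹₀` are integrals of their normal derivative. -/
lemma eLpNorm_height_mul_lineAvg_sub_le {d : ℕ} {Ω : Set (Eucl d)}
    {v : Jet Ω 2} (hv : v ∈ H20 Ω) {ν : Eucl d} (hν : ‖ν‖ = 1) {γ : Eucl d → ℝ}
    (hγ : ContDiff ℝ 1 γ) {P : Set (Eucl d)} (hP : MeasurableSet P) (hPΩ : P ⊆ Ω)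
    (hslide : ∀ y ∈ P, ∀ τ, 0 < τ → τ ≤ 1 → slide ν γ τ y ∈ Ω)
    (hzero : ∀ y ∈ P, slide ν γ 0 y ∉ Ω) {T : ℝ} (hT : ∀ x ∈ P, |height ν γ x| ≤ T)
    {H : Eucl d → ℝ} (hH : Continuous H) :
    eLpNorm (fun x => height ν γ x * lineAvg ν γ H x - v (Idx.nil d 2) x) 2 (volume.restrict P)
      ≤ ENNReal.ofReal T * (2 * eLpNorm (fun x => H x - ∑ i, ν i * v (Idx.one i) x) 2
        (volume.restrict Ω)) := by
  obtain ⟨φ, hφ, hlim⟩ := exists_tendstoH1 (Submodule.mem_comap.mp hv.2)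
  have l0 : Tendsto (fun k => eLpNorm (fun x => v (Idx.nil d 2) x - φ k x) 2
      (volume.restrict Ω)) atTop (𝓝 0) := by
    have := hlim (Idx.nil d 1)
    simp only [partialD_nil] at this
    exact this
  have l1 : ∀ i, Tendsto (fun k => eLpNorm (fun x => v (Idx.one i) x - pd i (φ k) x) 2
      (volume.restrict Ω)) atTop (𝓝 0) := by
    intro i
    have := hlim (Idx.single i)
    simp only [partialD_single] at this
    exact this
  have hφ1 : ∀ k, ContDiff ℝ 1 (φ k) := fun k => (hφ k).contDiff_two.of_le one_le_two
  have cpd : ∀ k i, Continuous (pd i (φ k)) := fun k i =>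
    (contDiff_pd (m := 0) i (hφ1 k) (by simp)).continuous
  have cν : ∀ k, Continuous (fun x => fderiv ℝ (φ k) x ν) := fun k =>
    ((hφ1 k).continuous_fderiv one_ne_zero).clm_apply continuous_const
  have mvi : ∀ i, AEStronglyMeasurable (v (Idx.one i)) (volume.restrict Ω) :=
    fun i => (Lp.memLp _).1
  let R : ℕ → ℝ≥0∞ := fun k => ∑ i, ENNReal.ofReal |ν i| *
    eLpNorm (fun x => v (Idx.one i) x - pd i (φ k) x) 2 (volume.restrict Ω)
  have hR : Tendsto R atTop (𝓝 0) := by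
    have : Tendsto R atTop (𝓝 (∑ i : Fin d, ENNReal.ofReal |ν i| * 0)) :=
      tendsto_finsetSum _ fun i _ =>
        ENNReal.Tendsto.const_mul (l1 i) (Or.inr ENNReal.ofReal_ne_top)
    simpa using this
  set N := eLpNorm (fun x => H x - ∑ i, ν i * v (Idx.one i) x) 2 (volume.restrict Ω)
  have hk : ∀ k, eLpNorm (fun x => height ν γ x * lineAvg ν γ H x - v (Idx.nil d 2) x) 2
      (volume.restrict P) ≤ ENNReal.ofReal T * (2 * (N + R k))
        + eLpNorm (fun x => v (Idx.nil d 2) x - φ k x) 2 (volume.restrict Ω) := by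
    intro k
    set D : Eucl d → ℝ := fun x => H x - fderiv ℝ (φ k) x ν
    have cD : Continuous D := hH.sub (cν k)
    have e1 : eLpNorm (fun x => height ν γ x * lineAvg ν γ H x - v (Idx.nil d 2) x) 2
        (volume.restrict P) = eLpNorm ((fun x => height ν γ x * lineAvg ν γ D x)
          - fun x => v (Idx.nil d 2) x - φ k x) 2 (volume.restrict P) := by
      refine eLpNorm_congr_ae ?_
      filter_upwards [ae_restrict_mem hP] with x hx
      have h1 := height_mul_lineAvg ν γ (hφ1 k) x
      have h2 : φ k (slide ν γ 0 x) = 0 :=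
        image_eq_zero_of_notMem_tsupport fun h => hzero x hx ((hφ k).support h)
      rw [Pi.sub_apply, lineAvg_sub ν hγ.continuous hH (cν k), mul_sub, h1, h2]
      ring
    have b1 : eLpNorm (fun x => height ν γ x * lineAvg ν γ D x) 2 (volume.restrict P)
        ≤ ENNReal.ofReal T * eLpNorm (lineAvg ν γ D) 2 (volume.restrict P) := by
      refine eLpNorm_le_mul_eLpNorm_of_ae_le_mul ?_ 2
      filter_upwards [ae_restrict_mem hP] with x hx
      rw [norm_mul]
      exact mul_le_mul_of_nonneg_right (hT x hx) (norm_nonneg _)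
    have b2 : eLpNorm (lineAvg ν γ D) 2 (volume.restrict P)
        ≤ 2 * eLpNorm D 2 (volume.restrict Ω) := eLpNorm_lineAvg_le hν hγ cD hP hslide
    have b3 : eLpNorm D 2 (volume.restrict Ω) ≤ N + R k := by
      have e : D = (fun x => H x - ∑ i, ν i * v (Idx.one i) x)
          + ∑ i, fun x => ν i * (v (Idx.one i) x - pd i (φ k) x) := by
        funext x
        simp only [D, Pi.add_apply, Finset.sum_apply, fderiv_eq_sum_pd (φ k) x ν, mul_sub,
          Finset.sum_sub_distrib]
        ring
      rw [e]
      refine (eLpNorm_add_le ?_ ?_ one_le_two).trans (add_le_add le_rfl ?_)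
      · exact hH.aestronglyMeasurable.sub
          (Finset.aestronglyMeasurable_fun_sum _ fun i _ => (mvi i).const_mul _)
      · exact Finset.aestronglyMeasurable_sum _ fun i _ =>
          ((mvi i).sub (cpd k i).aestronglyMeasurable).const_mul _
      · refine (eLpNorm_sum_le (fun i _ =>
          ((mvi i).sub (cpd k i).aestronglyMeasurable).const_mul _) one_le_two).trans ?_
        refine Finset.sum_le_sum fun i _ => ?_
        refine eLpNorm_le_mul_eLpNorm_of_ae_le_mul (Eventually.of_forall fun x => ?_) 2
        rw [norm_mul]
        rfl
    rw [e1]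
    refine (eLpNorm_sub_le ?_ ?_ one_le_two).trans (add_le_add ?_ ?_)
    · exact ((contDiff_height ν hγ).continuous.mul
        (continuous_lineAvg ν hγ.continuous cD)).aestronglyMeasurable
    · exact (((Lp.memLp (v (Idx.nil d 2))).1.mono_measure (Measure.restrict_mono hPΩ le_rfl)).sub
        (hφ1 k).continuous.aestronglyMeasurable)
    · exact b1.trans (by gcongr; exact b2.trans (by gcongr))
    · exact eLpNorm_mono_measure _ (Measure.restrict_mono hPΩ le_rfl)
  have hlim2 : Tendsto (fun k => ENNReal.ofReal T * (2 * (N + R k))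
        + eLpNorm (fun x => v (Idx.nil d 2) x - φ k x) 2 (volume.restrict Ω)) atTop
      (𝓝 (ENNReal.ofReal T * (2 * (N + 0)) + 0)) :=
    (ENNReal.Tendsto.const_mul (ENNReal.Tendsto.const_mul (tendsto_const_nhds.add hR)
      (Or.inr (by simp))) (Or.inr ENNReal.ofReal_ne_top)).add l0
  simp only [add_zero] at hlim2
  exact ge_of_tendsto' hlim2 hk

end DGM
end

noncomputable section

namespace DGM

lemma HasWeakD.mono {d : ℕ} {Ω O : Set (Eucl d)} {e : Eucl d} {f g : Eucl d → ℝ}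
    (h : HasWeakD Ω e f g) (hO : O ⊆ Ω) : HasWeakD O e f g := by
  intro φ h1 h2 h3
  have := h φ h1 h2 (h3.trans hO)
  have z1 : ∀ x, x ∉ tsupport φ → f x * fderiv ℝ φ x e = 0 := fun x hx => by
    rw [fderiv_eq_zero_of_notMem_tsupport hx]
    simp
  have z2 : ∀ x, x ∉ tsupport φ → g x * φ x = 0 := fun x hx => by
    rw [image_eq_zero_of_notMem_tsupport hx, mul_zero]
  rwa [setIntegral_eq_of_support (h3.trans hO) z1, setIntegral_eq_of_support (h3.trans hO) z2,
    ← setIntegral_eq_of_support h3 z1, ← setIntegral_eq_of_support h3 z2] at this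

lemma eLpNorm_mul_le_of_mem {d : ℕ} {P : Set (Eucl d)} (hP : MeasurableSet P)
    {m f : Eucl d → ℝ} {C : ℝ} (hC : ∀ x ∈ P, |m x| ≤ C) :
    eLpNorm (fun x => m x * f x) 2 (volume.restrict P)
      ≤ ENNReal.ofReal C * eLpNorm f 2 (volume.restrict P) := by
  refine eLpNorm_le_mul_eLpNorm_of_ae_le_mul ?_ 2
  filter_upwards [ae_restrict_mem hP] with x hx
  rw [norm_mul]
  exact mul_le_mul_of_nonneg_right (hC x hx) (norm_nonneg _)

lemma le_lineAvg {d : ℕ} (ν : Eucl d) {γ F : Eucl d → ℝ} (hγ : Continuous γ) (hF : Continuous F)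
    {c : ℝ} {y : Eucl d} (h : ∀ τ, 0 < τ → τ ≤ 1 → c ≤ F (slide ν γ τ y)) :
    c ≤ lineAvg ν γ F y := by
  have hcs : Continuous fun τ => slide ν γ τ y :=
    (continuous_slide ν hγ).comp (continuous_const.prodMk continuous_id)
  have h1 : ∫ τ in (0 : ℝ)..1, 2 * τ * c = c := by
    rw [intervalIntegral.integral_mul_const, intervalIntegral.integral_const_mul, integral_id]
    ring
  rw [← h1]
  refine intervalIntegral.integral_mono_on_of_le_Ioo zero_le_one
    ((by fun_prop : Continuous fun τ : ℝ => 2 * τ * c).intervalIntegrable _ _)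
    (((continuous_const.mul continuous_id).mul (hF.comp hcs)).intervalIntegrable _ _)
    fun τ hτ => ?_
  exact mul_le_mul_of_nonneg_left (h τ hτ.1 hτ.2.le) (by linarith [hτ.1])

/-- The quotients `v / η` and `∇ (v / η)` are square integrable near a boundary point, for `v` in
`H² ∩ H¹₀`. -/
lemma memLp_quotient_of_chart {d : ℕ} {Ω : Set (Eucl d)} (hΩ : IsOpen Ω)
    (hΩb : Bornology.IsBounded Ω) {η : Eucl d → ℝ} (hη : IsAuxiliary Ω η) {v : Jet Ω 2}
    (hv : v ∈ H20 Ω) {ν x₀ : Eucl d} (hν : ‖ν‖ = 1) {γ : Eucl d → ℝ} (hγ : ContDiff ℝ 1 γ)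
    {ρ r c δ ε₀ C : ℝ} (hc : 0 < c)
    (hslide : ∀ y ∈ Ω ∩ Metric.ball x₀ ρ, ∀ τ, 0 < τ → τ ≤ 1 →
      slide ν γ τ y ∈ Ω ∩ Metric.ball x₀ r)
    (hzero : ∀ y ∈ Ω ∩ Metric.ball x₀ ρ, slide ν γ 0 y ∈ frontier Ω)
    (hheight : ∀ y ∈ Ω ∩ Metric.ball x₀ ρ, 0 < height ν γ y)
    (hpos : ∀ y ∈ Ω ∩ Metric.ball x₀ r, c ≤ fderiv ℝ η y ν)
    (hin : IsInward Ω η (Metric.ball x₀ r) ν δ ε₀ C) :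
    MemLp (fun x => v (Idx.nil d 2) x / η x) 2 (volume.restrict (Ω ∩ Metric.ball x₀ ρ)) ∧
    ∀ i, MemLp (fun x => (v (Idx.one i) x - pd i η x * (v (Idx.nil d 2) x / η x)) / η x) 2
      (volume.restrict (Ω ∩ Metric.ball x₀ ρ)) := by
  set O := Ω ∩ Metric.ball x₀ ρ
  have hO : IsOpen O := hΩ.inter Metric.isOpen_ball
  have hOΩ : O ⊆ Ω := Set.inter_subset_left
  have hOb : Bornology.IsBounded O := hΩb.subset hOΩ
  have hOm := hO.measurableSet
  have hη2 : ContDiff ℝ 2 η := hη.smooth.1.of_le (by norm_cast)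
  have hη1 : ContDiff ℝ 1 η := hη2.of_le one_le_two
  have hην : ContDiff ℝ 1 (fun x => fderiv ℝ η x ν) :=
    (hη2.fderiv_right (m := 1) (by norm_num)).clm_apply contDiff_const
  have L : ∀ α, MemLp (v α) 2 (volume.restrict Ω) := fun α => Lp.memLp _
  have LO : ∀ α, MemLp (v α) 2 (volume.restrict O) := fun α =>
    (L α).mono_measure (Measure.restrict_mono hOΩ le_rfl)
  have I : ∀ α, IntegrableOn (v α) Ω := fun α => integrableOn_of_memLp hΩb (L α)
  -- smooth approximations of the normal derivative
  obtain ⟨H, hHs, hHb, hHlim, hHd⟩ := hin.exists_smooth_approx hΩ hΩb measurableSet_ball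
    (f := fun x => ∑ i, ν i * v (Idx.one i) x) (g := fun j x => ∑ i, ν i * v (Idx.two i j) x)
    (memLp_finsetSum _ fun i _ => (L _).const_mul _)
    (fun j => memLp_finsetSum _ fun i _ => (L _).const_mul _)
    (fun j => HasWeakD.sum_mul _ _ (fun i => sobolev_weakD_one hΩ hΩb hv.1 i j)
      (fun i => I _) (fun i => I _))
  have hH1 : ∀ n, ContDiff ℝ 1 (H n) := fun n => contDiff_infty.mp (hHs n) 1
  set B : ℝ≥0∞ := eLpNorm (fun x => ∑ i, ν i * v (Idx.one i) x) 2 (volume.restrict Ω)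
  have hB : B ≠ ⊤ := (memLp_finsetSum _ fun i _ => (L _).const_mul _ :
    MemLp (fun x => ∑ i, ν i * v (Idx.one i) x) 2 (volume.restrict Ω)).2.ne
  set B2 : Fin d → ℝ≥0∞ := fun j =>
    eLpNorm (fun x => ∑ i, ν i * v (Idx.two i j) x) 2 (volume.restrict Ω)
  have hB2 : ∀ j, B2 j ≠ ⊤ := fun j => (memLp_finsetSum _ fun i _ => (L _).const_mul _ :
    MemLp (fun x => ∑ i, ν i * v (Idx.two i j) x) 2 (volume.restrict Ω)).2.ne
  -- the factor `η / height`
  set κ := lineAvg ν γ (fun x => fderiv ℝ η x ν)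
  have hκ1 : ContDiff ℝ 1 κ := contDiff_lineAvg ν hγ hην
  have hκc : ∀ y ∈ O, c ≤ κ y := fun y hy =>
    le_lineAvg ν hγ.continuous hην.continuous fun τ h0 h1 => hpos _ (hslide y hy τ h0 h1)
  have hκpos : ∀ y ∈ O, 0 < κ y := fun y hy => hc.trans_le (hκc y hy)
  have hηκ : ∀ y ∈ O, η y = height ν γ y * κ y := by
    intro y hy
    rw [height_mul_lineAvg ν γ hη1 y, hη.zero _ (hzero y hy), sub_zero]
  have hinv : ContDiffOn ℝ 1 (fun x => (κ x)⁻¹) O :=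
    hκ1.contDiffOn.inv fun x hx => (hκpos x hx).ne'
  have hinvb : ∀ x ∈ O, |(κ x)⁻¹| ≤ c⁻¹ := by
    intro x hx
    rw [abs_of_pos (inv_pos.mpr (hκpos x hx))]
    exact inv_anti₀ hc (hκc x hx)
  have hηinv : ContDiffOn ℝ 1 (fun x => (η x)⁻¹) O :=
    hη1.contDiffOn.inv fun x hx => (hη.pos x (hOΩ hx)).ne'
  set Ln : ℕ → Eucl d → ℝ := fun n => lineAvg ν γ (H n)
  have hL1 : ∀ n, ContDiff ℝ 1 (Ln n) := fun n => contDiff_lineAvg ν hγ (hH1 n)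
  have hLb : ∀ n, eLpNorm (Ln n) 2 (volume.restrict O) ≤ 2 * B := fun n =>
    (eLpNorm_lineAvg_le hν hγ (hH1 n).continuous hOm
      fun y hy τ h0 h1 => (hslide y hy τ h0 h1).1).trans (by gcongr; exact hHb n)
  obtain ⟨T, hT0, hT⟩ := exists_bound_on hOb (contDiff_height ν hγ).continuous
  have htL : Tendsto (fun n => eLpNorm (fun x => height ν γ x * Ln n x - v (Idx.nil d 2) x) 2
      (volume.restrict O)) atTop (𝓝 0) := by
    refine tendsto_of_tendsto_of_tendsto_of_le_of_le tendsto_const_nhds ?_ (fun n => zero_le)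
      (fun n => eLpNorm_height_mul_lineAvg_sub_le hv hν hγ hOm hOΩ
        (fun y hy τ h0 h1 => (hslide y hy τ h0 h1).1)
        (fun y hy hyΩ => (hzero y hy).2 (hΩ.interior_eq.symm ▸ hyΩ)) hT (hH1 n).continuous)
    have := ENNReal.Tendsto.const_mul (a := ENNReal.ofReal T)
      (ENNReal.Tendsto.const_mul (a := 2) hHlim (Or.inr (by simp)))
      (Or.inr ENNReal.ofReal_ne_top)
    simpa using this
  -- convergence against test functions
  have hlim : ∀ z, IsTestFunction O z → Tendsto (fun n => ∫ x in O, ((κ x)⁻¹ * Ln n x) * z x)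
      atTop (𝓝 (∫ x in O, v (Idx.nil d 2) x / η x * z x)) := by
    intro z hz
    have hz1 : ContDiff ℝ 1 z := hz.contDiff_two.of_le one_le_two
    have hzη : ContDiff ℝ 1 (fun x => (η x)⁻¹ * z x) :=
      contDiff_mul_of_tsupport hO hηinv hz1 hz.support
    have := tendsto_integral_mul_of_eLpNorm (F := fun n x => height ν γ x * Ln n x)
      (fun n => memLp_of_continuous hOb
        ((contDiff_height ν hγ).continuous.mul (hL1 n).continuous) 2) (LO (Idx.nil d 2))
      (memLp_of_continuous hOb hzη.continuous 2) htL
    have e0 : ∫ x in O, v (Idx.nil d 2) x / η x * z x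
        = ∫ x in O, v (Idx.nil d 2) x * ((η x)⁻¹ * z x) := by
      simp only [div_eq_mul_inv, mul_assoc]
    rw [e0]
    refine this.congr fun n => setIntegral_congr_fun hOm fun x hx => ?_
    have h1 := (hheight x hx).ne'
    have h2 := (hκpos x hx).ne'
    simp only [hηκ x hx]
    field_simp
  have locη : ∀ {f : Eucl d → ℝ}, LocallyIntegrableOn f O →
      LocallyIntegrableOn (fun x => f x / η x) O := by
    intro f hf
    have := hf.mul_continuousOn hηinv.continuousOn hO.isLocallyClosed
    simpa [div_eq_mul_inv] using this
  have loc0 := locη (locallyIntegrableOn_of_memLp (LO (Idx.nil d 2)))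
  refine ⟨memLp_of_tendsto_test hO loc0
    (F := fun n x => (κ x)⁻¹ * Ln n x) (B := ENNReal.ofReal c⁻¹ * (2 * B))
    (by finiteness) (fun n => ?_) (fun n => ?_) hlim, fun i => ?_⟩
  · exact (hinv.continuousOn.mul (hL1 n).continuous.continuousOn).aestronglyMeasurable hOm
  · exact (eLpNorm_mul_le_of_mem hOm hinvb).trans (by gcongr; exact hLb n)
  -- the derivative
  obtain ⟨K, hK0, hK⟩ := exists_bound_on hOb (contDiff_pd (m := 0) i hκ1 (by simp)).continuous
  obtain ⟨T1, hT10, hT1⟩ := exists_bound_on hOb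
    (contDiff_pd (m := 0) i (contDiff_height ν hγ) (by simp)).continuous
  have hweak : HasWeakD O (bv i) (fun x => v (Idx.nil d 2) x / η x)
      (fun x => (v (Idx.one i) x - pd i η x * (v (Idx.nil d 2) x / η x)) / η x) :=
    (hasWeakD_inv_mul hΩ hη1 hη.pos (sobolev_weakD_nil hΩ hΩb hv.1 i) (I _) (I _)
      (Eventually.of_forall fun x => rfl)).mono hOΩ
  have hweakn : ∀ n, HasWeakD O (bv i) (fun x => (κ x)⁻¹ * Ln n x)
      (fun x => (κ x)⁻¹ * pd i (Ln n) x + fderiv ℝ (fun y => (κ y)⁻¹) x (bv i) * Ln n x) :=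
    fun n => (hasWeakD_of_contDiff (hL1 n) (bv i)).mul hO
      (integrableOn_of_memLp hOb (memLp_of_continuous hOb (hL1 n).continuous 2))
      (integrableOn_of_memLp hOb (memLp_of_continuous hOb
        (contDiff_pd (m := 0) i (hL1 n) (by simp)).continuous 2)) hinv
  have hdinv : ∀ x ∈ O, |fderiv ℝ (fun y => (κ y)⁻¹) x (bv i)| ≤ K * (c⁻¹ * c⁻¹) := by
    intro x hx
    have hd := (hκ1.differentiable one_ne_zero x).hasFDerivAt
    have : HasFDerivAt (fun x => (κ x)⁻¹) _ x :=
      (hasDerivAt_inv (hκpos x hx).ne').comp_hasFDerivAt x hd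
    rw [this.fderiv]
    have e : (-(κ x ^ 2)⁻¹ • fderiv ℝ κ x) (bv i) = -(pd i κ x * ((κ x)⁻¹ * (κ x)⁻¹)) := by
      simp only [smul_apply, smul_eq_mul, pd]
      ring
    rw [e, abs_neg, abs_mul, abs_mul]
    have := hinvb x hx
    exact mul_le_mul (hK x hx) (mul_le_mul this this (abs_nonneg _) (by positivity))
      (by positivity) hK0
  have cinv : ContinuousOn (fun x => fderiv ℝ (fun y => (κ y)⁻¹) x (bv i)) O :=
    (hinv.continuousOn_fderiv_of_isOpen hO le_rfl).clm_apply continuousOn_const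
  have cpd : ∀ n j, Continuous (pd j (H n)) := fun n j =>
    (contDiff_pd (m := 0) j (hH1 n) (by simp)).continuous
  have cS : ∀ n, Continuous (fun x => ∑ j, |pd j (H n) x|) := fun n =>
    continuous_finsetSum _ fun j _ => (cpd n j).abs
  have hS : ∀ n, eLpNorm (fun x => ∑ j, |pd j (H n) x|) 2
      (volume.restrict (Ω ∩ Metric.ball x₀ r)) ≤ ∑ j, B2 j := by
    intro n
    have e : (fun x => ∑ j, |pd j (H n) x|) = ∑ j, fun x => |pd j (H n) x| := by
      funext x
      simp
    rw [e]
    refine (eLpNorm_sum_le (fun j _ => (cpd n j).abs.aestronglyMeasurable) one_le_two).trans ?_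
    refine Finset.sum_le_sum fun j _ => ?_
    exact (eLpNorm_norm (pd j (H n))).trans_le (hHd n j)
  have hpdL : ∀ n, eLpNorm (pd i (Ln n)) 2 (volume.restrict O)
      ≤ ENNReal.ofReal (1 + T1) * (2 * ∑ j, B2 j) := by
    intro n
    have b1 : eLpNorm (pd i (Ln n)) 2 (volume.restrict O) ≤ ENNReal.ofReal (1 + T1) *
        eLpNorm (lineAvg ν γ (fun x => ∑ j, |pd j (H n) x|)) 2 (volume.restrict O) := by
      refine eLpNorm_le_mul_eLpNorm_of_ae_le_mul ?_ 2
      filter_upwards [ae_restrict_mem hOm] with x hx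
      have h0 : 0 ≤ lineAvg ν γ (fun x => ∑ j, |pd j (H n) x|) x :=
        le_lineAvg ν hγ.continuous (cS n) fun τ _ _ => Finset.sum_nonneg fun j _ => abs_nonneg _
      rw [Real.norm_of_nonneg h0]
      refine (abs_pd_lineAvg_le hν hγ (hH1 n) i x).trans ?_
      exact mul_le_mul_of_nonneg_right (by linarith [hT1 x hx]) h0
    refine b1.trans ?_
    gcongr
    exact (eLpNorm_lineAvg_le hν hγ (cS n) hOm hslide).trans (by gcongr; exact hS n)
  refine memLp_of_tendsto_test hO ?_
    (F := fun n x => (κ x)⁻¹ * pd i (Ln n) x + fderiv ℝ (fun y => (κ y)⁻¹) x (bv i) * Ln n x)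
    (B := ENNReal.ofReal c⁻¹ * (ENNReal.ofReal (1 + T1) * (2 * ∑ j, B2 j))
      + ENNReal.ofReal (K * (c⁻¹ * c⁻¹)) * (2 * B)) ?_ (fun n => ?_) (fun n => ?_) ?_
  · refine locη ((locallyIntegrableOn_of_memLp (LO _)).sub ?_)
    exact loc0.continuousOn_mul (contDiff_pd (m := 0) i hη1 (by simp)).continuous.continuousOn
      hO.isLocallyClosed
  · have : ∑ j, B2 j ≠ ⊤ := by
      simp [hB2]
    finiteness
  · exact ((hinv.continuousOn.mul (contDiff_pd (m := 0) i (hL1 n)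
      (by simp)).continuous.continuousOn).add
        (cinv.mul (hL1 n).continuous.continuousOn)).aestronglyMeasurable hOm
  · refine (eLpNorm_add_le ?_ ?_ one_le_two).trans (add_le_add ?_ ?_)
    · exact (hinv.continuousOn.mul (contDiff_pd (m := 0) i (hL1 n)
        (by simp)).continuous.continuousOn).aestronglyMeasurable hOm
    · exact (cinv.mul (hL1 n).continuous.continuousOn).aestronglyMeasurable hOm
    · exact (eLpNorm_mul_le_of_mem hOm hinvb).trans (by gcongr; exact hpdL n)
    · exact (eLpNorm_mul_le_of_mem hOm hdinv).trans (by gcongr; exact hLb n)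
  · intro z hz
    have hz1 : ContDiff ℝ 1 z := hz.contDiff_two.of_le one_le_two
    have h1 := (hlim _ (hz.fderiv_apply (bv i))).neg
    rw [hweak z hz1 hz.compact hz.support, neg_neg] at h1
    refine h1.congr fun n => ?_
    rw [hweakn n z hz1 hz.compact hz.support, neg_neg]

end DGM
end

noncomputable section

namespace DGM

/-! ### Local geometry -/

/-- Near `B`, division by `η` maps `H² ∩ H¹₀` to `H¹`, and there is an inward direction. -/
def IsGoodBall {d : ℕ} (Ω : Set (Eucl d)) (η : Eucl d → ℝ) (B : Set (Eucl d)) : Prop :=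
  (∃ ν δ ε₀ C, IsInward Ω η B ν δ ε₀ C) ∧ ∀ v ∈ H20 Ω,
    MemLp (fun x => v (Idx.nil d 2) x / η x) 2 (volume.restrict (Ω ∩ B)) ∧
    ∀ i, MemLp (fun x => (v (Idx.one i) x - pd i η x * (v (Idx.nil d 2) x / η x)) / η x) 2
      (volume.restrict (Ω ∩ B))

lemma IsInward.mono {d : ℕ} {Ω B B' : Set (Eucl d)} {η : Eucl d → ℝ} {ν : Eucl d} {δ ε₀ C : ℝ}
    (h : IsInward Ω η B ν δ ε₀ C) (hB : B' ⊆ B) : IsInward Ω η B' ν δ ε₀ C :=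
  ⟨h.delta_pos, h.eps_pos, h.const_pos, fun x hx => h.mem x ⟨hx.1, hB hx.2⟩,
    fun x hx => h.le x ⟨hx.1, hB hx.2⟩⟩

lemma le_add_of_fderiv_pos {d : ℕ} {F : Eucl d → ℝ} (hF : ContDiff ℝ 1 F) {x₀ ν : Eucl d}
    {R c M δ ε : ℝ} (hc : ∀ y ∈ Metric.ball x₀ R, c ≤ fderiv ℝ F y ν)
    (hM : ∀ y ∈ Metric.ball x₀ R, ‖fderiv ℝ F y‖ ≤ M) (hδ : M * δ ≤ c) (hε : 0 ≤ ε)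
    {x z : Eucl d} (hx : x ∈ Metric.ball x₀ R) (hxz : x + z ∈ Metric.ball x₀ R)
    (hz : ‖z - ε • ν‖ ≤ ε * δ) : F x ≤ F (x + z) := by
  obtain ⟨y, hy, e⟩ := domain_mvt (f := F) (f' := fderiv ℝ F) (s := Metric.ball x₀ R)
    (fun y _ => (hF.differentiable one_ne_zero y).hasFDerivAt.hasFDerivWithinAt)
    (convex_ball x₀ R) hx hxz
  have hyB : y ∈ Metric.ball x₀ R := (convex_ball x₀ R).segment_subset hx hxz hy
  have e1 : fderiv ℝ F y z = ε * fderiv ℝ F y ν + fderiv ℝ F y (z - ε • ν) := by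
    rw [map_sub, map_smul, smul_eq_mul]
    ring
  have e2 : |fderiv ℝ F y (z - ε • ν)| ≤ M * (ε * δ) :=
    ((fderiv ℝ F y).le_opNorm _).trans (mul_le_mul (hM y hyB) hz (norm_nonneg _)
      ((norm_nonneg _).trans (hM y hyB)))
  rw [add_sub_cancel_left, e1] at e
  have e3 := (abs_le.mp e2).1
  have e4 := mul_le_mul_of_nonneg_left (hc y hyB) hε
  have e5 := mul_le_mul_of_nonneg_left hδ hε
  nlinarith

lemma isGoodBall_of_mem {d : ℕ} {Ω : Set (Eucl d)} (hΩ : IsOpen Ω) {η : Eucl d → ℝ}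
    (hη : IsAuxiliary Ω η) {x₀ : Eucl d} (hx₀ : x₀ ∈ Ω) :
    ∃ ρ > 0, IsGoodBall Ω η (Metric.ball x₀ ρ) := by
  obtain ⟨R, hR, hRΩ⟩ := Metric.nhds_basis_closedBall.mem_iff.mp (hΩ.mem_nhds hx₀)
  have hη1 : ContDiff ℝ 1 η := hη.smooth.1.of_le (by norm_cast)
  have hne : (Metric.closedBall x₀ R).Nonempty := ⟨x₀, Metric.mem_closedBall_self hR.le⟩
  obtain ⟨y₁, hy₁, hmin⟩ := (isCompact_closedBall x₀ R).exists_isMinOn hne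
    hη1.continuous.continuousOn
  obtain ⟨y₂, hy₂, hmax⟩ := (isCompact_closedBall x₀ R).exists_isMaxOn hne
    hη1.continuous.continuousOn
  have hc : 0 < η y₁ := hη.pos _ (hRΩ hy₁)
  have hC : 0 < η y₂ := hη.pos _ (hRΩ hy₂)
  have hsub : Metric.ball x₀ (R / 2) ⊆ Metric.closedBall x₀ R :=
    (Metric.ball_subset_ball (by linarith)).trans Metric.ball_subset_closedBall
  have hadd : ∀ x ∈ Metric.ball x₀ (R / 2), ∀ ε, ε < R / 2 → ∀ z : Eucl d, ‖z‖ ≤ ε →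
      x + z ∈ Metric.closedBall x₀ R := by
    intro x hx ε hε z hz
    rw [Metric.mem_ball, dist_eq_norm] at hx
    rw [Metric.mem_closedBall, dist_eq_norm]
    calc ‖x + z - x₀‖ = ‖(x - x₀) + z‖ := by congr 1; abel
      _ ≤ ‖x - x₀‖ + ‖z‖ := norm_add_le _ _
      _ ≤ R := by linarith
  refine ⟨R / 2, by positivity, ⟨0, 1, R / 2, η y₂ / η y₁, one_pos, by positivity, by positivity,
    ?_, ?_⟩, ?_⟩
  · intro x hx ε _ hε z hz
    exact hRΩ (hadd x hx.2 ε hε z (by simpa using hz))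
  · intro x hx ε _ hε z hz
    have h1 : η y₁ ≤ η (x + z) := hmin (hadd x hx.2 ε hε z (by simpa using hz))
    have h2 : η x ≤ η y₂ := hmax (hsub hx.2)
    calc η x ≤ η y₂ / η y₁ * η y₁ := by rwa [div_mul_cancel₀ _ hc.ne']
      _ ≤ _ := by gcongr
  · intro v hv
    set O := Ω ∩ Metric.ball x₀ (R / 2)
    have hO : IsOpen O := hΩ.inter Metric.isOpen_ball
    have hOm := hO.measurableSet
    have hOb : Bornology.IsBounded O := Metric.isBounded_ball.subset Set.inter_subset_right
    have LO : ∀ α, MemLp (v α) 2 (volume.restrict O) := fun α =>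
      (Lp.memLp (v α)).mono_measure (Measure.restrict_mono Set.inter_subset_left le_rfl)
    have hηinv : ContinuousOn (fun x => (η x)⁻¹) O :=
      hη1.continuous.continuousOn.inv₀ fun x hx => (hη.pos x hx.1).ne'
    have key : ∀ {f : Eucl d → ℝ}, MemLp f 2 (volume.restrict O) →
        MemLp (fun x => f x / η x) 2 (volume.restrict O) := by
      intro f hf
      have e : (fun x => f x / η x) = fun x => (η x)⁻¹ * f x := by
        funext x
        rw [div_eq_mul_inv, mul_comm]
      rw [e]
      refine ⟨(hηinv.aestronglyMeasurable hOm).mul hf.1, lt_of_le_of_lt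
        (eLpNorm_mul_le_of_mem hOm (C := (η y₁)⁻¹) fun x hx => ?_)
        (ENNReal.mul_lt_top ENNReal.ofReal_lt_top hf.2)⟩
      rw [abs_of_pos (inv_pos.mpr (hη.pos x hx.1))]
      exact inv_anti₀ hc (hmin (hsub hx.2))
    refine ⟨key (LO _), fun i => key ((LO _).sub ?_)⟩
    exact memLp_mul hO hOb (contDiff_pd (m := 0) i hη1 (by simp)).continuous (key (LO _))

lemma isGoodBall_of_mem_frontier {d : ℕ} {Ω : Set (Eucl d)} (hΩ : IsOpen Ω)
    (hΩb : Bornology.IsBounded Ω) {a : ℝ} (hbdry : HasHolderBoundary 3 a Ω) {η : Eucl d → ℝ}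
    (hη : IsAuxiliary Ω η) {x₀ : Eucl d} (hx₀ : x₀ ∈ frontier Ω) :
    ∃ ρ > 0, IsGoodBall Ω η (Metric.ball x₀ ρ) := by
  obtain ⟨ν, γ, r, -, hν, hr, hγ3, -, hmem⟩ := hbdry x₀ hx₀
  have hγ : ContDiff ℝ 1 γ := hγ3.of_le (by norm_cast)
  have hη1 : ContDiff ℝ 1 η := hη.smooth.1.of_le (by norm_cast)
  set t := height ν γ
  have ht1 : ContDiff ℝ 1 t := contDiff_height ν hγ
  have htΩ : ∀ y ∈ Metric.ball x₀ r, (y ∈ Ω ↔ 0 < t y) := by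
    intro y hy
    rw [hmem y hy]
    exact sub_pos.symm
  have hx₀B : x₀ ∈ Metric.ball x₀ r := Metric.mem_ball_self hr
  have hBn : Metric.ball x₀ r ∈ 𝓝 x₀ := Metric.ball_mem_nhds x₀ hr
  have hx₀Ω : x₀ ∉ Ω := fun h => hx₀.2 (hΩ.interior_eq.symm ▸ h)
  have hfr : ∀ y ∈ Metric.ball x₀ r, t y = 0 → y ∈ frontier Ω := by
    intro y hy hty
    refine ⟨?_, fun h => ?_⟩
    · have hc : Continuous fun s : ℝ => y + s • ν := by fun_prop
      have h1 : Tendsto (fun s : ℝ => y + s • ν) (𝓝[>] 0) (𝓝 y) := by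
        have := (hc.tendsto 0).mono_left (nhdsWithin_le_nhds (s := Set.Ioi 0))
        simpa using this
      refine mem_closure_of_tendsto h1 ?_
      filter_upwards [h1 (Metric.isOpen_ball.mem_nhds hy), self_mem_nhdsWithin] with s hs hs0
      have e : t (y + s • ν) = t y + s := height_add_smul hν γ y s
      rw [htΩ _ hs]
      change 0 < t (y + s • ν)
      rw [e, hty, zero_add]
      exact hs0
    · have := (htΩ y hy).mp (interior_subset h)
      linarith
  have ht0 : t x₀ = 0 := by
    by_contra hne
    rcases lt_or_gt_of_ne hne with h | h
    · have h2 : ∀ᶠ y in 𝓝 x₀, y ∉ Ω := by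
        filter_upwards [ht1.continuous.continuousAt.eventually_lt continuousAt_const h, hBn]
          with y hy hyB hyΩ
        exact absurd ((htΩ y hyB).mp hyΩ) (by linarith)
      obtain ⟨y, hy, hy'⟩ := (mem_closure_iff_frequently.mp hx₀.1).and_eventually h2 |>.exists
      exact hy' hy
    · exact hx₀Ω ((htΩ x₀ hx₀B).mpr h)
  have hs0 : slide ν γ 0 x₀ = x₀ := by
    have : height ν γ x₀ = 0 := ht0
    simp [slide, this]
  have hp : 0 < fderiv ℝ η x₀ ν := by
    have hd := (hη1.differentiable one_ne_zero x₀).hasFDerivAt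
    have hcomp : HasFDerivAt (η ∘ slide ν γ 0) ((fderiv ℝ η x₀).comp (slideD ν γ 0 x₀)) x₀ :=
      HasFDerivAt.comp x₀ (by rwa [hs0]) (hasFDerivAt_slide ν hγ 0 x₀)
    have hz : (η ∘ slide ν γ 0) =ᶠ[𝓝 x₀] fun _ => 0 := by
      have hcs : ContinuousAt (slide ν γ 0) x₀ := (hasFDerivAt_slide ν hγ 0 x₀).continuousAt
      have : slide ν γ 0 ⁻¹' Metric.ball x₀ r ∈ 𝓝 x₀ := hcs (by rwa [hs0])
      filter_upwards [this] with y hy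
      refine hη.zero _ (hfr _ hy ?_)
      change height ν γ (slide ν γ 0 y) = 0
      rw [height_slide hν]
      simp
    have h0 : (fderiv ℝ η x₀).comp (slideD ν γ 0 x₀) = 0 :=
      hcomp.unique ((hasFDerivAt_const (0 : ℝ) x₀).congr_of_eventuallyEq hz)
    have hne : fderiv ℝ η x₀ ν ≠ 0 := by
      intro h
      refine hη.deriv_ne x₀ hx₀ ?_
      ext1 e
      have := congrArg (fun A : Eucl d →L[ℝ] ℝ => A e) h0
      simpa [slideD, h] using this
    refine lt_of_le_of_ne ?_ hne.symm
    have hline : HasDerivAt (fun s : ℝ => η (x₀ + s • ν)) (fderiv ℝ η x₀ ν) 0 := by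
      have h1 : HasDerivAt (fun s : ℝ => x₀ + s • ν) ν 0 := by
        simpa using ((hasDerivAt_id (0 : ℝ)).smul_const ν).const_add x₀
      exact HasFDerivAt.comp_hasDerivAt (0 : ℝ) (l := η) (by simpa using hd) h1
    have hslope := hline.tendsto_slope_zero_right
    refine ge_of_tendsto hslope ?_
    have hc : Continuous fun s : ℝ => x₀ + s • ν := by fun_prop
    have h1 : Tendsto (fun s : ℝ => x₀ + s • ν) (𝓝[>] 0) (𝓝 x₀) := by
      have := (hc.tendsto 0).mono_left (nhdsWithin_le_nhds (s := Set.Ioi 0))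
      simpa using this
    filter_upwards [h1 hBn, self_mem_nhdsWithin] with s hs hs0
    have hsΩ : x₀ + s • ν ∈ Ω := by
      have e : t (x₀ + s • ν) = t x₀ + s := height_add_smul hν γ x₀ s
      rw [htΩ _ hs]
      change 0 < t (x₀ + s • ν)
      rw [e, ht0, zero_add]
      exact hs0
    have hs0' : (0 : ℝ) < s := hs0
    simp only [zero_add, zero_smul, add_zero, hη.zero x₀ hx₀, sub_zero, smul_eq_mul]
    have := hη.pos _ hsΩ
    positivity
  set c := fderiv ℝ η x₀ ν / 2
  have hc : 0 < c := by positivity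
  have hcν : Continuous fun y => fderiv ℝ η y ν :=
    (hη1.continuous_fderiv one_ne_zero).clm_apply continuous_const
  obtain ⟨R, hR, hRc⟩ : ∃ R > 0, ∀ y ∈ Metric.ball x₀ R, y ∈ Metric.ball x₀ r ∧
      c ≤ fderiv ℝ η y ν := by
    have h1 : ∀ᶠ y in 𝓝 x₀, c < fderiv ℝ η y ν :=
      continuousAt_const.eventually_lt hcν.continuousAt (half_lt_self hp)
    obtain ⟨R, hR, h⟩ := Metric.eventually_nhds_iff_ball.mp (h1.and hBn)
    exact ⟨R, hR, fun y hy => ⟨(h y hy).2, (h y hy).1.le⟩⟩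
  obtain ⟨M1, hM1⟩ := (isCompact_closedBall x₀ R).exists_bound_of_continuousOn
    (ht1.continuous_fderiv one_ne_zero).continuousOn
  obtain ⟨M2, hM2⟩ := (isCompact_closedBall x₀ R).exists_bound_of_continuousOn
    (hη1.continuous_fderiv one_ne_zero).continuousOn
  set M := max (max M1 M2) 1
  have hM : 0 < M := lt_max_of_lt_right one_pos
  set δ := min 1 c / M
  have hδ : 0 < δ := div_pos (lt_min one_pos hc) hM
  have hMδ : M * δ = min 1 c := by
    simp only [δ]
    field_simp
  set ε₀ := R / 2 / (1 + δ)
  have hε₀ : 0 < ε₀ := by positivity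
  have hsub : Metric.ball x₀ (R / 2) ⊆ Metric.ball x₀ R := Metric.ball_subset_ball (by linarith)
  have hadd : ∀ x ∈ Metric.ball x₀ (R / 2), ∀ ε, 0 < ε → ε < ε₀ → ∀ z : Eucl d,
      ‖z - ε • ν‖ ≤ ε * δ → x + z ∈ Metric.ball x₀ R := by
    intro x hx ε hε hε' z hz
    rw [Metric.mem_ball, dist_eq_norm] at hx ⊢
    have h1 : ‖z‖ ≤ ε * (1 + δ) := by
      calc ‖z‖ = ‖(z - ε • ν) + ε • ν‖ := by congr 1; abel
        _ ≤ ‖z - ε • ν‖ + ‖ε • ν‖ := norm_add_le _ _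
        _ ≤ ε * δ + ε := by
          rw [norm_smul, hν, mul_one, Real.norm_of_nonneg hε.le]
          linarith
        _ = _ := by ring
    have h2 : ε * (1 + δ) < R / 2 := by
      have : 0 < 1 + δ := by positivity
      rwa [← lt_div_iff₀ this]
    calc ‖x + z - x₀‖ = ‖(x - x₀) + z‖ := by congr 1; abel
      _ ≤ ‖x - x₀‖ + ‖z‖ := norm_add_le _ _
      _ < R := by linarith
  have hin : IsInward Ω η (Metric.ball x₀ (R / 2)) ν δ ε₀ 1 := by
    refine ⟨hδ, hε₀, zero_le_one, fun x hx ε hε hε' z hz => ?_, fun x hx ε hε hε' z hz => ?_⟩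
    · have hxz := hadd x hx.2 ε hε hε' z hz
      rw [htΩ _ (hRc _ hxz).1]
      refine ((htΩ x (hRc x (hsub hx.2)).1).mp hx.1).trans_le ?_
      refine le_add_of_fderiv_pos ht1 (c := 1) (M := M) (δ := δ) (fun y _ => ?_) (fun y hy => ?_)
        (hMδ.trans_le (min_le_left _ _)) hε.le (hsub hx.2) hxz hz
      · exact (fderiv_height_self hν hγ y).ge
      · exact (hM1 y (Metric.ball_subset_closedBall hy)).trans
          ((le_max_left _ _).trans (le_max_left _ _))
    · rw [one_mul]
      refine le_add_of_fderiv_pos hη1 (c := c) (M := M) (δ := δ) (fun y hy => (hRc y hy).2)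
        (fun y hy => ?_) (hMδ.trans_le (min_le_right _ _)) hε.le (hsub hx.2)
        (hadd x hx.2 ε hε hε' z hz) hz
      exact (hM2 y (Metric.ball_subset_closedBall hy)).trans
          ((le_max_right _ _).trans (le_max_left _ _))
  obtain ⟨ρ, hρ, hρt⟩ : ∃ ρ > 0, ∀ y ∈ Metric.ball x₀ ρ, dist y x₀ + |t y| < R / 2 := by
    have hcont : Continuous fun y => dist y x₀ + |t y| :=
      (continuous_id.dist continuous_const).add ht1.continuous.abs
    have h1 : ∀ᶠ y in 𝓝 x₀, dist y x₀ + |t y| < R / 2 :=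
      hcont.continuousAt.eventually_lt continuousAt_const (by simp [ht0, hR])
    obtain ⟨ρ, hρ, h⟩ := Metric.eventually_nhds_iff_ball.mp h1
    exact ⟨ρ, hρ, h⟩
  have hsl : ∀ y ∈ Metric.ball x₀ ρ, ∀ τ : ℝ, 0 ≤ τ → τ ≤ 1 →
      slide ν γ τ y ∈ Metric.ball x₀ (R / 2) := by
    intro y hy τ h0 h1
    refine lt_of_le_of_lt ?_ (hρt y hy)
    rw [dist_eq_norm, dist_eq_norm]
    have e : slide ν γ τ y - x₀ = (y - x₀) - ((1 - τ ^ 2) * t y) • ν := by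
      unfold slide
      abel
    rw [e]
    refine (norm_sub_le _ _).trans (add_le_add le_rfl ?_)
    rw [norm_smul, hν, mul_one, norm_mul]
    refine mul_le_of_le_one_left (abs_nonneg _) ?_
    rw [Real.norm_eq_abs, abs_le]
    constructor <;> nlinarith
  have hρr : Metric.ball x₀ ρ ⊆ Metric.ball x₀ (R / 2) := by
    intro y hy
    have := hρt y hy
    exact lt_of_le_of_lt (le_add_of_nonneg_right (abs_nonneg _)) this
  have hpos : ∀ y ∈ Ω ∩ Metric.ball x₀ ρ, 0 < t y := fun y hy =>
    (htΩ y (hRc y (hsub (hρr hy.2))).1).mp hy.1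
  refine ⟨ρ, hρ, ⟨ν, δ, ε₀, 1, hin.mono hρr⟩, fun v hv => ?_⟩
  refine memLp_quotient_of_chart hΩ hΩb hη hv hν hγ hc (fun y hy τ h0 h1 => ?_) (fun y hy => ?_)
    hpos (fun y hy => (hRc y (hsub hy.2)).2) hin
  · have h2 := hsl y hy.2 τ h0.le h1
    refine ⟨(htΩ _ (hRc _ (hsub h2)).1).mpr ?_, h2⟩
    change 0 < height ν γ (slide ν γ τ y)
    rw [height_slide hν]
    have := hpos y hy
    exact mul_pos (by positivity) this
  · have h2 := hsl y hy.2 0 le_rfl zero_le_one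
    refine hfr _ (hRc _ (hsub h2)).1 ?_
    change height ν γ (slide ν γ 0 y) = 0
    rw [height_slide hν]
    simp

end DGM
end

noncomputable section

namespace DGM

/-! ### Density of `η W` in `H² ∩ H¹₀` -/

lemma inner_eq_zero_of_isGoodBall {d : ℕ} {Ω : Set (Eucl d)} (hΩ : IsOpen Ω)
    (hΩb : Bornology.IsBounded Ω) {η : Eucl d → ℝ} (hη : IsAuxiliary Ω η) {l : Jet Ω 2}
    (hl : ∀ W, ContDiff ℝ ∞ W → HasCompactSupport W →
      ∀ h : ContDiff ℝ 2 (fun x => η x * W x), inner ℝ l (cjet hΩb _ h) = 0)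
    {x₀ : Eucl d} {ρ : ℝ} (hρ : 0 < ρ) (hB : IsGoodBall Ω η (Metric.ball x₀ ρ))
    {χ : Eucl d → ℝ} (hχ : ContDiff ℝ ∞ χ) (hχs : tsupport χ ⊆ Metric.closedBall x₀ (ρ / 2))
    {u w : Jet Ω 2} (hu : u ∈ H20 Ω) (hw : w ∈ H20 Ω)
    (hwu : w (Idx.nil d 2) =ᵐ[volume.restrict Ω] fun x => χ x * u (Idx.nil d 2) x) :
    inner ℝ l w = 0 := by
  obtain ⟨⟨ν, δ, ε₀, C, hin⟩, hquot⟩ := hB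
  obtain ⟨w', hw', hjet⟩ := exists_mul_H20 hΩ hΩb hχ hu
  have hww' : w = w' := sobolev_ext hΩ hΩb hw.1 hw'.1 (hwu.trans (hjet (Idx.nil d 2)).symm)
  subst hww'
  obtain ⟨m0, m1⟩ := hquot w hw
  set K := Metric.closedBall x₀ (ρ / 2)
  have hK : MeasurableSet K := measurableSet_closedBall
  have hKB : K ⊆ Metric.ball x₀ ρ := Metric.closedBall_subset_ball (by linarith)
  have z0 : ∀ᵐ x ∂(volume.restrict Ω), x ∉ K → w (Idx.nil d 2) x = 0 := by
    filter_upwards [hjet (Idx.nil d 2)] with x hx hxK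
    rw [hx, jet2_nil, image_eq_zero_of_notMem_tsupport fun h => hxK (hχs h), zero_mul]
  have z1 : ∀ i, ∀ᵐ x ∂(volume.restrict Ω), x ∉ K → w (Idx.one i) x = 0 := by
    intro i
    filter_upwards [hjet (Idx.one i)] with x hx hxK
    have hxs : x ∉ tsupport χ := fun h => hxK (hχs h)
    rw [hx, jet2_one, image_eq_zero_of_notMem_tsupport hxs, pd,
      fderiv_eq_zero_of_notMem_tsupport hxs]
    simp
  have hind : ∀ {f : Eucl d → ℝ}, MemLp f 2 (volume.restrict (Ω ∩ Metric.ball x₀ ρ)) →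
      MemLp (K.indicator f) 2 (volume.restrict Ω) := by
    intro f hf
    rw [memLp_indicator_iff_restrict hK, Measure.restrict_restrict hK]
    have hsub : K ∩ Ω ⊆ Ω ∩ Metric.ball x₀ ρ := fun x hx => ⟨hx.2, hKB hx.1⟩
    exact hf.mono_measure (Measure.restrict_mono hsub le_rfl)
  refine inner_eq_zero_of_isQuotient hΩ hΩb hη hl hw.1
    (w := K.indicator fun x => w (Idx.nil d 2) x / η x)
    (w1 := fun i => K.indicator fun x =>
      (w (Idx.one i) x - pd i η x * (w (Idx.nil d 2) x / η x)) / η x)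
    ⟨hind m0, fun i => hind (m1 i), ?_, fun i => ?_⟩ (by linarith : ρ / 2 < ρ) hin
    (fun x hx => Set.indicator_of_notMem hx _)
  · filter_upwards [z0] with x hx
    by_cases hxK : x ∈ K
    · rw [Set.indicator_of_mem hxK]
    · rw [Set.indicator_of_notMem hxK, hx hxK, zero_div]
  · filter_upwards [z1 i] with x hx
    by_cases hxK : x ∈ K
    · rw [Set.indicator_of_mem hxK, Set.indicator_of_mem hxK]
      ring
    · rw [Set.indicator_of_notMem hxK, Set.indicator_of_notMem hxK, hx hxK]
      simp

/-- The products `η W` with `W ∈ C_c^∞(ℝ^d)` are total in `H² ∩ H¹₀`. -/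
lemma inner_eq_zero_of_smooth {d : ℕ} {Ω : Set (Eucl d)} (hΩ : IsOpen Ω)
    (hΩb : Bornology.IsBounded Ω) {a : ℝ} (hbdry : HasHolderBoundary 3 a Ω) {η : Eucl d → ℝ}
    (hη : IsAuxiliary Ω η) {l : Jet Ω 2}
    (hl : ∀ W, ContDiff ℝ ∞ W → HasCompactSupport W →
      ∀ h : ContDiff ℝ 2 (fun x => η x * W x), inner ℝ l (cjet hΩb _ h) = 0)
    {u : Jet Ω 2} (hu : u ∈ H20 Ω) : inner ℝ l u = 0 := by
  have key : ∃ χ : Eucl d → ℝ, ContDiff ℝ ∞ χ ∧ (∀ x ∈ closure Ω, χ x = 1) ∧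
      ∀ u ∈ H20 Ω, ∀ w ∈ H20 Ω,
        (w (Idx.nil d 2) =ᵐ[volume.restrict Ω] fun x => χ x * u (Idx.nil d 2) x) →
        inner ℝ l w = 0 := by
    refine IsCompact.induction_on (p := fun s => ∃ χ : Eucl d → ℝ, ContDiff ℝ ∞ χ ∧
      (∀ x ∈ s, χ x = 1) ∧ ∀ u ∈ H20 Ω, ∀ w ∈ H20 Ω,
        (w (Idx.nil d 2) =ᵐ[volume.restrict Ω] fun x => χ x * u (Idx.nil d 2) x) →
        inner ℝ l w = 0) hΩb.isCompact_closure ?_ ?_ ?_ ?_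
    · refine ⟨fun _ => 0, contDiff_const, by simp, fun u _ w hw h => ?_⟩
      have : w = 0 := sobolev_eq_zero hΩ hΩb hw.1 (h.trans (Eventually.of_forall fun x => by simp))
      rw [this, inner_zero_right]
    · rintro s t hst ⟨χ, h1, h2, h3⟩
      exact ⟨χ, h1, fun x hx => h2 x (hst hx), h3⟩
    · rintro s t ⟨χ₁, h1, h2, h3⟩ ⟨χ₂, k1, k2, k3⟩
      refine ⟨fun x => χ₁ x + χ₂ x * (1 - χ₁ x), h1.add (k1.mul (contDiff_const.sub h1)), ?_, ?_⟩
      · rintro x (hx | hx)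
        · simp only [h2 x hx]
          ring
        · simp only [k2 x hx]
          ring
      · intro u hu w hw hwu
        obtain ⟨w₁, hw₁, e₁⟩ := exists_mul_H20 hΩ hΩb h1 hu
        obtain ⟨u', hu', e'⟩ := exists_mul_H20 hΩ hΩb
          (contDiff_const.sub h1 : ContDiff ℝ ∞ fun x => 1 - χ₁ x) hu
        obtain ⟨w₂, hw₂, e₂⟩ := exists_mul_H20 hΩ hΩb k1 hu'
        have hsum : w = w₁ + w₂ := by
          refine sobolev_ext hΩ hΩb hw.1 ((sobolev Ω 2).add_mem hw₁.1 hw₂.1) ?_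
          have hadd : ((w₁ + w₂ : Jet Ω 2) (Idx.nil d 2) : Eucl d → ℝ)
              =ᵐ[volume.restrict Ω] w₁ (Idx.nil d 2) + w₂ (Idx.nil d 2) := Lp.coeFn_add _ _
          filter_upwards [hwu, e₁ (Idx.nil d 2), e₂ (Idx.nil d 2), e' (Idx.nil d 2), hadd]
            with x a1 a2 a3 a4 a5
          rw [a1, a5, Pi.add_apply, a2, a3, jet2_nil, jet2_nil, a4, jet2_nil]
          ring
        rw [hsum, inner_add_right, h3 u hu w₁ hw₁ (e₁ _), k3 u' hu' w₂ hw₂ (e₂ _), add_zero]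
    · intro x hx
      have hball : ∃ ρ > 0, IsGoodBall Ω η (Metric.ball x ρ) := by
        by_cases hxΩ : x ∈ Ω
        · exact isGoodBall_of_mem hΩ hη hxΩ
        · exact isGoodBall_of_mem_frontier hΩ hΩb hbdry hη ⟨hx, by rwa [hΩ.interior_eq]⟩
      obtain ⟨ρ, hρ, hB⟩ := hball
      let b : ContDiffBump x := ⟨ρ / 4, ρ / 2, by positivity, by linarith⟩
      refine ⟨Metric.ball x (ρ / 4), mem_nhdsWithin_of_mem_nhds
        (Metric.ball_mem_nhds x (by positivity)), b, b.contDiff, fun y hy => ?_,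
        fun u hu w hw h => ?_⟩
      · exact b.one_of_mem_closedBall (Metric.ball_subset_closedBall hy)
      · exact inner_eq_zero_of_isGoodBall hΩ hΩb hη hl hρ hB b.contDiff b.tsupport_eq.le hu hw h
  obtain ⟨χ, -, h1, h2⟩ := key
  refine h2 u hu u hu ?_
  filter_upwards [ae_restrict_mem hΩ.measurableSet] with x hx
  rw [h1 x (subset_closure hx), one_mul]

end DGM
end

noncomputable section

namespace DGM

/-! ### Second-order functionals of ridge functions -/

/-- The functional `g ↦ ∫ M₀ g(Y) + M₁ g'(Y) + M₂ g''(Y)`. -/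
def ridge {X : Type*} [MeasurableSpace X] (μ : Measure X) (M0 M1 M2 Y : X → ℝ) (g : ℝ → ℝ) : ℝ :=
  ∫ x, M0 x * g (Y x) + M1 x * deriv g (Y x) + M2 x * deriv (deriv g) (Y x) ∂μ

/-- The data of a ridge functional: integrable coefficients and a bounded function `Y`. -/
structure IsRidge {X : Type*} [MeasurableSpace X] (μ : Measure X) (M0 M1 M2 Y : X → ℝ)
    (R : ℝ) : Prop where
  int0 : Integrable M0 μ
  int1 : Integrable M1 μ
  int2 : Integrable M2 μ
  meas : AEStronglyMeasurable Y μ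
  bdd : ∀ᵐ x ∂μ, |Y x| ≤ R

lemma IsRidge.integrable_mul {X : Type*} [MeasurableSpace X] {μ : Measure X}
    {M0 M1 M2 Y M : X → ℝ} {R : ℝ} (h : IsRidge μ M0 M1 M2 Y R) (hM : Integrable M μ)
    {g : ℝ → ℝ} (hg : Continuous g) : Integrable (fun x => M x * g (Y x)) μ := by
  obtain ⟨C, hC⟩ := (isCompact_Icc (a := -R) (b := R)).exists_bound_of_continuousOn
    hg.continuousOn
  refine hM.mul_bdd (c := C) (hg.comp_aestronglyMeasurable h.meas) ?_
  filter_upwards [h.bdd] with x hx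
  exact hC _ (abs_le.mp hx)

/-- Differentiation under the functional. -/
lemma IsRidge.hasDerivAt {X : Type*} [MeasurableSpace X] {μ : Measure X}
    {M0 M1 M2 Y : X → ℝ} {R : ℝ} (h : IsRidge μ M0 M1 M2 Y R) {G : ℝ × ℝ → ℝ}
    (hG : ContDiff ℝ ∞ G) (s₀ : ℝ) :
    HasDerivAt (fun s => ridge μ M0 M1 M2 Y (fun x => G (s, x)))
      (ridge μ M0 M1 M2 Y (fun x => fderiv ℝ G (s₀, x) (1, 0))) s₀ := by
  have smooth : ∀ {H : ℝ × ℝ → ℝ}, ContDiff ℝ ∞ H → ∀ e : ℝ × ℝ,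
      ContDiff ℝ ∞ (fun p => fderiv ℝ H p e) := fun hH e =>
    (hH.fderiv_right (m := ∞) (by norm_cast)).clm_apply contDiff_const
  have hd : ∀ {H : ℝ × ℝ → ℝ}, ContDiff ℝ ∞ H → ∀ p, HasFDerivAt H (fderiv ℝ H p) p :=
    fun hH p => (hH.differentiable (by simp) p).hasFDerivAt
  have slice_snd : ∀ {H : ℝ × ℝ → ℝ}, ContDiff ℝ ∞ H → ∀ s,
      deriv (fun x => H (s, x)) = fun x => fderiv ℝ H (s, x) (0, 1) := by
    intro H hH s
    funext x
    have h1 : HasDerivAt (fun x : ℝ => (s, x)) ((0 : ℝ), (1 : ℝ)) x :=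
      (hasDerivAt_const x s).prodMk (hasDerivAt_id x)
    exact ((hd hH (s, x)).comp_hasDerivAt x h1).deriv
  have slice_fst : ∀ {H : ℝ × ℝ → ℝ}, ContDiff ℝ ∞ H → ∀ s x,
      HasDerivAt (fun s => H (s, x)) (fderiv ℝ H (s, x) (1, 0)) s := by
    intro H hH s x
    have h1 : HasDerivAt (fun s : ℝ => (s, x)) ((1 : ℝ), (0 : ℝ)) s :=
      (hasDerivAt_id s).prodMk (hasDerivAt_const s x)
    exact (hd hH (s, x)).comp_hasDerivAt s h1
  have comm : ∀ {H : ℝ × ℝ → ℝ}, ContDiff ℝ ∞ H → ∀ p,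
      fderiv ℝ (fun q => fderiv ℝ H q (1, 0)) p (0, 1)
        = fderiv ℝ (fun q => fderiv ℝ H q (0, 1)) p (1, 0) := by
    intro H hH p
    have e : ∀ u v : ℝ × ℝ, fderiv ℝ (fun q => fderiv ℝ H q u) p v
        = fderiv ℝ (fderiv ℝ H) p v u := by
      intro u v
      have := ((hH.fderiv_right (m := ∞) (by norm_cast)).differentiable (by simp) p)
      rw [fderiv_clm_apply this (differentiableAt_const u)]
      simp
    rw [e, e]
    have hsymm : IsSymmSndFDerivAt ℝ H p := 
      (contDiff_infty.mp hH 2).contDiffAt.isSymmSndFDerivAt (by simp)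
    exact hsymm _ _
  set G1 : ℝ × ℝ → ℝ := fun p => fderiv ℝ G p (0, 1)
  set G2 : ℝ × ℝ → ℝ := fun p => fderiv ℝ G1 p (0, 1)
  have hG1 : ContDiff ℝ ∞ G1 := smooth hG _
  have hG2 : ContDiff ℝ ∞ G2 := smooth hG1 _
  have d1 : ∀ s, deriv (fun x => G (s, x)) = fun x => G1 (s, x) := fun s => slice_snd hG s
  have d2 : ∀ s, deriv (fun x => G1 (s, x)) = fun x => G2 (s, x) := fun s => slice_snd hG1 s
  have e1 : ∀ s, deriv (fun x => fderiv ℝ G (s, x) (1, 0))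
      = fun x => fderiv ℝ G1 (s, x) (1, 0) := fun s => by
    rw [slice_snd (smooth hG (1, 0))]
    funext x
    exact comm hG (s, x)
  have e2 : ∀ s, deriv (fun x => fderiv ℝ G1 (s, x) (1, 0))
      = fun x => fderiv ℝ G2 (s, x) (1, 0) := fun s => by
    rw [slice_snd (smooth hG1 (1, 0))]
    funext x
    exact comm hG1 (s, x)
  unfold ridge
  simp only [d1, d2, e1, e2]
  have bound : ∀ {H : ℝ × ℝ → ℝ}, ContDiff ℝ ∞ H → ∃ C : ℝ, ∀ s ∈ Metric.closedBall s₀ 1,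
      ∀ x ∈ Set.Icc (-R) R, |fderiv ℝ H (s, x) (1, 0)| ≤ C := by
    intro H hH
    obtain ⟨C, hC⟩ := ((isCompact_closedBall s₀ 1).prod
      (isCompact_Icc (a := -R) (b := R))).exists_bound_of_continuousOn
      (smooth hH (1, 0)).continuous.continuousOn
    exact ⟨C, fun s hs x hx => hC (s, x) ⟨hs, hx⟩⟩
  obtain ⟨C0, hC0⟩ := bound hG
  obtain ⟨C1, hC1⟩ := bound hG1
  obtain ⟨C2, hC2⟩ := bound hG2
  have cs : ∀ {H : ℝ × ℝ → ℝ}, ContDiff ℝ ∞ H → ∀ s, Continuous fun x => H (s, x) :=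
    fun hH s => hH.continuous.comp (continuous_const.prodMk continuous_id)
  have int : ∀ s, Integrable (fun x => M0 x * G (s, Y x) + M1 x * G1 (s, Y x)
      + M2 x * G2 (s, Y x)) μ := fun s =>
    ((h.integrable_mul h.int0 (cs hG s)).add (h.integrable_mul h.int1 (cs hG1 s))).add
      (h.integrable_mul h.int2 (cs hG2 s))
  have int' : ∀ s, Integrable (fun x => M0 x * fderiv ℝ G (s, Y x) (1, 0)
      + M1 x * fderiv ℝ G1 (s, Y x) (1, 0) + M2 x * fderiv ℝ G2 (s, Y x) (1, 0)) μ := fun s =>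
    ((h.integrable_mul h.int0 (cs (smooth hG _) s)).add
      (h.integrable_mul h.int1 (cs (smooth hG1 _) s))).add
      (h.integrable_mul h.int2 (cs (smooth hG2 _) s))
  refine (hasDerivAt_integral_of_dominated_loc_of_deriv_le
    (F := fun s x => M0 x * G (s, Y x) + M1 x * G1 (s, Y x) + M2 x * G2 (s, Y x))
    (F' := fun s x => M0 x * fderiv ℝ G (s, Y x) (1, 0)
      + M1 x * fderiv ℝ G1 (s, Y x) (1, 0) + M2 x * fderiv ℝ G2 (s, Y x) (1, 0))
    (bound := fun x => |M0 x| * C0 + |M1 x| * C1 + |M2 x| * C2)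
    (Metric.closedBall_mem_nhds s₀ one_pos) (Eventually.of_forall fun s => (int s).1) (int s₀)
    (int' s₀).1 ?_ ?_ ?_).2
  · filter_upwards [h.bdd] with x hx s hs
    have hx' := abs_le.mp hx
    refine (norm_add_le _ _).trans (add_le_add ((norm_add_le _ _).trans (add_le_add ?_ ?_)) ?_)
    · rw [norm_mul]
      exact mul_le_mul_of_nonneg_left (hC0 s hs _ hx') (norm_nonneg _)
    · rw [norm_mul]
      exact mul_le_mul_of_nonneg_left (hC1 s hs _ hx') (norm_nonneg _)
    · rw [norm_mul]
      exact mul_le_mul_of_nonneg_left (hC2 s hs _ hx') (norm_nonneg _)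
  · exact ((h.int0.abs.mul_const _).add (h.int1.abs.mul_const _)).add (h.int2.abs.mul_const _)
  · refine Eventually.of_forall fun x s _ => ?_
    exact (((slice_fst hG s (Y x)).const_mul _).add ((slice_fst hG1 s (Y x)).const_mul _)).add
      ((slice_fst hG2 s (Y x)).const_mul _)

/-- If the functional kills all dilations and translations of a smooth function which is not a
polynomial, it kills all monomials. -/
lemma IsRidge.pow_eq_zero {X : Type*} [MeasurableSpace X] {μ : Measure X}
    {M0 M1 M2 Y : X → ℝ} {R : ℝ} (h : IsRidge μ M0 M1 M2 Y R) {τ : ℝ → ℝ} (hτ : ContDiff ℝ ∞ τ)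
    (hker : ∀ s b, ridge μ M0 M1 M2 Y (fun x => τ (s * x + b)) = 0) (k : ℕ)
    (hk : ∃ b, iteratedDeriv k τ b ≠ 0) : ridge μ M0 M1 M2 Y (fun x => x ^ k) = 0 := by
  obtain ⟨b, hb⟩ := hk
  have hτk : ∀ k, ContDiff ℝ ∞ (iteratedDeriv k τ) := fun k => by
    rw [iteratedDeriv_eq_iterate]
    exact hτ.iterate_deriv k
  let G : ℕ → ℝ × ℝ → ℝ := fun k p => p.2 ^ k * iteratedDeriv k τ (p.1 * p.2 + b)
  have hG : ∀ k, ContDiff ℝ ∞ (G k) := fun k =>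
    (contDiff_snd.pow k).mul ((hτk k).comp ((contDiff_fst.mul contDiff_snd).add contDiff_const))
  have hGs : ∀ k s x, fderiv ℝ (G k) (s, x) (1, 0) = G (k + 1) (s, x) := by
    intro k s x
    have h1 : HasDerivAt (fun s : ℝ => (s, x)) ((1 : ℝ), (0 : ℝ)) s :=
      (hasDerivAt_id s).prodMk (hasDerivAt_const s x)
    have h2 := ((hG k).differentiable (by simp) (s, x)).hasFDerivAt.comp_hasDerivAt s h1
    have h3 : HasDerivAt (fun s : ℝ => s * x + b) x s := by
      simpa using ((hasDerivAt_id s).mul_const x).add_const b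
    have h4 : HasDerivAt (iteratedDeriv k τ) (iteratedDeriv (k + 1) τ (s * x + b)) (s * x + b) := by
      rw [iteratedDeriv_succ]
      exact ((hτk k).differentiable (by simp) _).hasDerivAt
    have h5 := (h4.comp s h3).const_mul (x ^ k)
    refine (h2.unique h5).trans ?_
    simp only [G]
    ring
  have key : ∀ k s, ridge μ M0 M1 M2 Y (fun x => G k (s, x)) = 0 := by
    intro k
    induction k with
    | zero =>
      intro s
      simpa [G] using hker s b
    | succ k ih =>
      intro s
      have h1 := h.hasDerivAt (hG k) s
      simp only [ih, hGs] at h1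
      exact h1.unique (hasDerivAt_const s 0)
  have h0 := key k 0
  have e : (fun x => G k (0, x)) = fun x => iteratedDeriv k τ b * x ^ k := by
    funext x
    simp [G, mul_comm]
  rw [e] at h0
  have e2 : ridge μ M0 M1 M2 Y (fun x => iteratedDeriv k τ b * x ^ k)
      = iteratedDeriv k τ b * ridge μ M0 M1 M2 Y (fun x => x ^ k) := by
    unfold ridge
    rw [← integral_const_mul]
    congr 1
    funext x
    have d1 : deriv (fun x : ℝ => iteratedDeriv k τ b * x ^ k)
        = fun x => iteratedDeriv k τ b * deriv (fun x : ℝ => x ^ k) x := by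
      funext y
      exact deriv_const_mul_field _
    rw [d1, deriv_const_mul_field]
    ring
  rw [e2] at h0
  exact (mul_eq_zero.mp h0).resolve_left hb

/-- The terms of the exponential series differentiated termwise `j` times, `j ≤ 2`. -/
def expTerm (j : ℕ) (z : ℂ) (k : ℕ) : ℂ :=
  (k.descFactorial j : ℂ) * z ^ (k - j) / k.factorial

lemma hasSum_expTerm (j : ℕ) (z : ℂ) : HasSum (expTerm j z) (Complex.exp z) := by
  have h1 : HasSum (fun k => expTerm j z (k + j)) (Complex.exp z) := by
    have e : (fun k => expTerm j z (k + j)) = fun k : ℕ => z ^ k / k.factorial := by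
      funext k
      unfold expTerm
      have h2 : ((k + j).factorial : ℂ) = k.factorial * (k + j).descFactorial j := by
        have := Nat.factorial_mul_descFactorial (Nat.le_add_left j k)
        rw [Nat.add_sub_cancel] at this
        exact_mod_cast this.symm
      have h3 : (k.factorial : ℂ) ≠ 0 := by exact_mod_cast k.factorial_ne_zero
      have h4 : ((k + j).factorial : ℂ) ≠ 0 := by exact_mod_cast (k + j).factorial_ne_zero
      rw [Nat.add_sub_cancel, div_eq_div_iff h4 h3, h2]
      ring
    rw [e, Complex.exp_eq_exp_ℂ]
    exact NormedSpace.expSeries_div_hasSum_exp z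
  have h2 := (hasSum_nat_add_iff j).mp h1
  have h3 : ∑ i ∈ Finset.range j, expTerm j z i = 0 := by
    refine Finset.sum_eq_zero fun i hi => ?_
    rw [expTerm, Nat.descFactorial_of_lt (Finset.mem_range.mp hi)]
    simp
  rwa [h3, add_zero] at h2

lemma norm_expTerm_le (j : ℕ) {z z' : ℂ} (h : ‖z‖ ≤ ‖z'‖) (k : ℕ) :
    ‖expTerm j z k‖ ≤ ‖expTerm j z' k‖ := by
  unfold expTerm
  rw [norm_div, norm_div, norm_mul, norm_mul, norm_pow, norm_pow]
  gcongr

/-- A ridge functional which kills all monomials kills `exp (i ·)`. -/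
lemma IsRidge.exp_eq_zero {X : Type*} [MeasurableSpace X] {μ : Measure X}
    {M0 M1 M2 Y : X → ℝ} {R : ℝ} (h : IsRidge μ M0 M1 M2 Y R)
    (hker : ∀ k : ℕ, ridge μ M0 M1 M2 Y (fun x => x ^ k) = 0) :
    ∫ x, ((M0 x : ℂ) + Complex.I * M1 x - M2 x) * Complex.exp (Complex.I * Y x) ∂μ = 0 := by
  let F : ℕ → X → ℂ := fun k x => M0 x * expTerm 0 (Complex.I * Y x) k
    + Complex.I * M1 x * expTerm 1 (Complex.I * Y x) k - M2 x * expTerm 2 (Complex.I * Y x) k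
  have hFsum : ∀ x, HasSum (fun k => F k x)
      (((M0 x : ℂ) + Complex.I * M1 x - M2 x) * Complex.exp (Complex.I * Y x)) := by
    intro x
    have := (((hasSum_expTerm 0 (Complex.I * Y x)).mul_left (M0 x : ℂ)).add
      ((hasSum_expTerm 1 (Complex.I * Y x)).mul_left (Complex.I * M1 x))).sub
      ((hasSum_expTerm 2 (Complex.I * Y x)).mul_left (M2 x : ℂ))
    have e : ((M0 x : ℂ) + Complex.I * M1 x - M2 x) * Complex.exp (Complex.I * Y x)
        = M0 x * Complex.exp (Complex.I * Y x) + Complex.I * M1 x * Complex.exp (Complex.I * Y x)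
          - M2 x * Complex.exp (Complex.I * Y x) := by
      ring
    rw [e]
    exact this
  let B : ℕ → ℝ := fun k => ‖expTerm 0 R k‖ + ‖expTerm 1 R k‖ + ‖expTerm 2 R k‖
  have hB : Summable B := ((hasSum_expTerm 0 R).summable.norm.add
    (hasSum_expTerm 1 R).summable.norm).add (hasSum_expTerm 2 R).summable.norm
  have hYm : AEStronglyMeasurable (fun x => Complex.I * (Y x : ℂ)) μ :=
    (Complex.continuous_ofReal.comp_aestronglyMeasurable h.meas).const_mul _
  have hcont : ∀ j k, Continuous fun z => expTerm j z k := by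
    intro j k
    unfold expTerm
    fun_prop
  have hFm : ∀ k, AEStronglyMeasurable (F k) μ := by
    intro k
    have m : ∀ {M : X → ℝ}, Integrable M μ → AEStronglyMeasurable (fun x => (M x : ℂ)) μ :=
      fun hM => Complex.continuous_ofReal.comp_aestronglyMeasurable hM.1
    have e : ∀ j, AEStronglyMeasurable (fun x => expTerm j (Complex.I * Y x) k) μ := fun j =>
      (hcont j k).comp_aestronglyMeasurable hYm
    exact (((m h.int0).mul (e 0)).add (((m h.int1).const_mul _).mul (e 1))).sub
      ((m h.int2).mul (e 2))
  have hbound : ∀ k, ∀ᵐ x ∂μ, ‖F k x‖ ≤ (|M0 x| + |M1 x| + |M2 x|) * B k := by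
    intro k
    filter_upwards [h.bdd] with x hx
    have hn : ‖Complex.I * (Y x : ℂ)‖ ≤ ‖(R : ℂ)‖ := by
      rw [norm_mul, Complex.norm_I, one_mul, Complex.norm_real, Complex.norm_real]
      exact hx.trans (le_abs_self R)
    have b0 := norm_expTerm_le 0 hn k
    have b1 := norm_expTerm_le 1 hn k
    have b2 := norm_expTerm_le 2 hn k
    have n0 := norm_nonneg (expTerm 0 (R : ℂ) k)
    have n1 := norm_nonneg (expTerm 1 (R : ℂ) k)
    have n2 := norm_nonneg (expTerm 2 (R : ℂ) k)
    calc ‖F k x‖ ≤ |M0 x| * B k + |M1 x| * B k + |M2 x| * B k := by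
          refine (norm_sub_le _ _).trans (add_le_add ((norm_add_le _ _).trans
            (add_le_add ?_ ?_)) ?_)
          · rw [norm_mul, Complex.norm_real]
            exact mul_le_mul_of_nonneg_left (by simp only [B]; linarith) (abs_nonneg _)
          · rw [norm_mul, norm_mul, Complex.norm_I, one_mul, Complex.norm_real]
            exact mul_le_mul_of_nonneg_left (by simp only [B]; linarith) (abs_nonneg _)
          · rw [norm_mul, Complex.norm_real]
            exact mul_le_mul_of_nonneg_left (by simp only [B]; linarith) (abs_nonneg _)
      _ = _ := by ring
  have hsum := hasSum_integral_of_dominated_convergence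
    (fun k x => (|M0 x| + |M1 x| + |M2 x|) * B k) hFm hbound
    (Eventually.of_forall fun x => hB.mul_left _) (by
      simp only [tsum_mul_left]
      exact ((h.int0.abs.add h.int1.abs).add h.int2.abs).mul_const _)
    (Eventually.of_forall hFsum)
  have hzero : ∀ k, ∫ x, F k x ∂μ = 0 := by
    intro k
    have d1 : deriv (fun x : ℝ => x ^ k) = fun x => (k.descFactorial 1 : ℝ) * x ^ (k - 1) := by
      funext x
      simp
    have d2 : deriv (fun x : ℝ => (k.descFactorial 1 : ℝ) * x ^ (k - 1))
        = fun x => (k.descFactorial 2 : ℝ) * x ^ (k - 2) := by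
      funext x
      rw [deriv_const_mul_field]
      simp [Nat.descFactorial, Nat.sub_sub]
      ring
    have h1 := hker k
    unfold ridge at h1
    simp only [d1, d2] at h1
    have e : F k = fun x => (Complex.I ^ k / k.factorial) * ((M0 x * Y x ^ k
        + M1 x * ((k.descFactorial 1 : ℝ) * Y x ^ (k - 1))
        + M2 x * ((k.descFactorial 2 : ℝ) * Y x ^ (k - 2)) : ℝ) : ℂ) := by
      funext x
      simp only [F, expTerm]
      rcases k with _ | _ | k
      · simp
      · simp [Nat.descFactorial]
        ring
      · simp only [Nat.descFactorial_zero, Nat.sub_zero, mul_pow, Nat.add_sub_cancel,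
          show k + 1 + 1 - 2 = k from rfl]
        push_cast
        have : Complex.I ^ (k + 1 + 1) = - Complex.I ^ k := by
          rw [pow_succ, pow_succ, mul_assoc, Complex.I_mul_I]
          ring
        have h2 : Complex.I * Complex.I ^ (k + 1) = - Complex.I ^ k := by
          rw [← this]
          ring
        rw [this]
        linear_combination (M1 x * (((k + 1 + 1).descFactorial 1 : ℕ) * (Y x) ^ (k + 1)
          / (k + 1 + 1).factorial)) * h2
    rw [e, integral_const_mul, integral_complex_ofReal, h1]
    simp
  simp only [hzero] at hsum
  exact hsum.unique hasSum_zero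

end DGM
end

noncomputable section

namespace DGM

/-! ### Smoothing the activation function -/

/-- The convolution `∫ φ(c) f(y - c) dc`. -/
def smear (φ f : ℝ → ℝ) (y : ℝ) : ℝ := ∫ c, φ c * f (y - c)

lemma smear_eq_convolution (φ f : ℝ → ℝ) :
    smear φ f = MeasureTheory.convolution φ f (ContinuousLinearMap.lsmul ℝ ℝ) volume := rfl

lemma integrable_smear {φ f : ℝ → ℝ} (hφ : Continuous φ) (hφc : HasCompactSupport φ)
    (hf : Continuous f) (y : ℝ) : Integrable (fun c => φ c * f (y - c)) :=
  (hφ.mul (hf.comp (continuous_const.sub continuous_id))).integrable_of_hasCompactSupport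
    hφc.mul_right

lemma abs_smear_le {φ f : ℝ → ℝ} (hφ : Continuous φ) (hφc : HasCompactSupport φ)
    {C : ℝ} (hC : ∀ y, |f y| ≤ C) (y : ℝ) :
    |smear φ f y| ≤ ∫ c, |φ c| * C := by
  unfold smear
  have hi : Integrable φ := hφ.integrable_of_hasCompactSupport hφc
  rw [← Real.norm_eq_abs]
  refine norm_integral_le_of_norm_le (hi.abs.mul_const C) (Eventually.of_forall fun c => ?_)
  rw [norm_mul]
  exact mul_le_mul_of_nonneg_left (hC _) (norm_nonneg _)

lemma contDiff_smear {φ f : ℝ → ℝ} (hφ : ContDiff ℝ ∞ φ) (hφc : HasCompactSupport φ)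
    (hf : Continuous f) : ContDiff ℝ ∞ (smear φ f) := by
  rw [smear_eq_convolution]
  exact hφc.contDiff_convolution_left _ hφ hf.locallyIntegrable

lemma deriv_smear_left {φ f : ℝ → ℝ} (hφ : ContDiff ℝ ∞ φ) (hφc : HasCompactSupport φ)
    (hf : Continuous f) : deriv (smear φ f) = smear (deriv φ) f := by
  funext y
  exact (hφc.hasDerivAt_convolution_left (ContinuousLinearMap.lsmul ℝ ℝ)
    (contDiff_infty.mp hφ 1) hf.locallyIntegrable y).deriv

lemma deriv_smear_right {φ f : ℝ → ℝ} (hφ : Continuous φ) (hφc : HasCompactSupport φ)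
    (hf : ContDiff ℝ 1 f) {C : ℝ} (hC : ∀ y, |deriv f y| ≤ C) :
    deriv (smear φ f) = smear φ (deriv f) := by
  funext y
  have hf' : Continuous (deriv f) := hf.continuous_deriv le_rfl
  refine (hasDerivAt_integral_of_dominated_loc_of_deriv_le (F := fun y c => φ c * f (y - c))
    (F' := fun y c => φ c * deriv f (y - c)) (bound := fun c => |φ c| * C) univ_mem
    (Eventually.of_forall fun z => (integrable_smear hφ hφc hf.continuous z).1)
    (integrable_smear hφ hφc hf.continuous y) (integrable_smear hφ hφc hf' y).1 ?_ ?_ ?_).2.deriv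
  · refine Eventually.of_forall fun c z _ => ?_
    rw [norm_mul]
    exact mul_le_mul_of_nonneg_left (hC _) (norm_nonneg _)
  · exact (hφ.integrable_of_hasCompactSupport hφc).abs.mul_const C
  · refine Eventually.of_forall fun c z _ => ?_
    have h1 : HasDerivAt f (deriv f (z - c)) (z - c) :=
      (hf.differentiable one_ne_zero _).hasDerivAt
    exact (h1.comp_sub_const z c).const_mul (φ c)

/-- A smooth function with bounded derivatives, one of which vanishes, is constant. -/
lemma deriv_eq_zero_of_iteratedDeriv {f : ℝ → ℝ} (hf : ContDiff ℝ ∞ f)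
    (hb : ∀ k, ∃ C, ∀ y, |iteratedDeriv k f y| ≤ C) (k : ℕ)
    (hk : ∀ y, iteratedDeriv (k + 1) f y = 0) : ∀ y, deriv f y = 0 := by
  have hfk : ∀ k, ContDiff ℝ ∞ (iteratedDeriv k f) := fun k => by
    rw [iteratedDeriv_eq_iterate]
    exact hf.iterate_deriv k
  have hd : ∀ k y, HasDerivAt (iteratedDeriv k f) (iteratedDeriv (k + 1) f y) y := by
    intro k y
    rw [iteratedDeriv_succ]
    exact ((hfk k).differentiable (by simp) y).hasDerivAt
  induction k with
  | zero =>
    intro y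
    simpa using hk y
  | succ k ih =>
    refine ih fun y => ?_
    set c := iteratedDeriv (k + 1) f y
    have hconst : ∀ z, iteratedDeriv (k + 1) f z = c := fun z =>
      is_const_of_deriv_eq_zero (fun z => (hd (k + 1) z).differentiableAt)
        (fun z => (hd (k + 1) z).deriv.trans (hk z)) z y
    obtain ⟨C, hC⟩ := hb k
    have hlin : ∀ z, iteratedDeriv k f z = c * z + iteratedDeriv k f 0 := by
      intro z
      have h0 : ∀ z, HasDerivAt (fun z => iteratedDeriv k f z - c * z) 0 z := by
        intro z
        refine ((hd k z).sub ((hasDerivAt_id z).const_mul c)).congr_deriv ?_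
        rw [hconst z]
        simp
      have := is_const_of_deriv_eq_zero (fun z => (h0 z).differentiableAt)
        (fun z => (h0 z).deriv) z 0
      simp only [mul_zero, sub_zero] at this
      linarith
    by_contra hc
    have h1 := hC ((2 * C + 1) / c)
    have h2 := hC 0
    rw [hlin, mul_div_cancel₀ _ hc] at h1
    have h3 := abs_le.mp h1
    have h4 := abs_le.mp h2
    linarith [h3.2, h4.1]

lemma iteratedDeriv_smear {φ f : ℝ → ℝ} (hφ : ContDiff ℝ ∞ φ) (hφc : HasCompactSupport φ)
    (hf : Continuous f) (k : ℕ) :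
    ∃ ψ : ℝ → ℝ, ContDiff ℝ ∞ ψ ∧ HasCompactSupport ψ ∧
      iteratedDeriv k (smear φ f) = smear ψ f := by
  induction k with
  | zero => exact ⟨φ, hφ, hφc, by simp⟩
  | succ k ih =>
    obtain ⟨ψ, h1, h2, h3⟩ := ih
    refine ⟨deriv ψ, ?_, h2.deriv, ?_⟩
    · exact (contDiff_infty_iff_deriv.mp h1).2
    · rw [iteratedDeriv_succ, h3, deriv_smear_left h1 h2 hf]

/-- There is a smoothing of a bounded non-constant function none of whose derivatives vanishes
identically. -/
lemma exists_smear {σ : ℝ → ℝ} (hσ : Continuous σ) {C : ℝ} (hC : ∀ y, |σ y| ≤ C)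
    (hσc : ¬ ∃ s, ∀ x, σ x = s) :
    ∃ φ : ℝ → ℝ, ContDiff ℝ ∞ φ ∧ HasCompactSupport φ ∧
      ∀ k, ∃ b, iteratedDeriv k (smear φ σ) b ≠ 0 := by
  obtain ⟨y₁, y₂, hy⟩ : ∃ y₁ y₂, σ y₁ ≠ σ y₂ := by
    by_contra! h
    exact hσc ⟨σ 0, fun x => h x 0⟩
  let b : ℕ → ContDiffBump (0 : ℝ) := fun n =>
    ⟨1 / (n + 1) / 2, 1 / (n + 1), by positivity, half_lt_self (by positivity)⟩
  have hlim : Tendsto (fun n => (b n).rOut) atTop (𝓝 0) :=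
    tendsto_one_div_add_atTop_nhds_zero_nat (𝕜 := ℝ)
  have h1 := fun y => ContDiffBump.convolution_tendsto_right_of_continuous (μ := volume)
    hlim hσ y
  have h2 : ∀ᶠ n in atTop, smear ((b n).normed volume) σ y₁ ≠ smear ((b n).normed volume) σ y₂ :=
    
    (((h1 y₁).sub (h1 y₂)).eventually_ne (sub_ne_zero.mpr hy)).mono
      fun n hn h => hn (sub_eq_zero.mpr h)
  obtain ⟨n, hn⟩ := h2.exists
  have hφ : ContDiff ℝ ∞ ((b n).normed volume) := (b n).contDiff_normed
  have hφc : HasCompactSupport ((b n).normed volume) := (b n).hasCompactSupport_normed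
  refine ⟨(b n).normed volume, hφ, hφc, fun k => ?_⟩
  by_contra! hzero
  have hs := contDiff_smear hφ hφc hσ
  have hd : ∀ y, deriv (smear ((b n).normed volume) σ) y = 0 := by
    refine deriv_eq_zero_of_iteratedDeriv hs (fun j => ?_) k fun y => ?_
    · obtain ⟨ψ, g1, g2, g3⟩ := iteratedDeriv_smear hφ hφc hσ j
      rw [g3]
      exact ⟨_, abs_smear_le g1.continuous g2 hC⟩
    · have : iteratedDeriv k (smear ((b n).normed volume) σ) = 0 := funext hzero
      rw [iteratedDeriv_succ, this]
      simp
  exact hn (is_const_of_deriv_eq_zero (hs.differentiable (by simp)) hd y₁ y₂)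

lemma ridge_comp_affine {X : Type*} [MeasurableSpace X] (μ : Measure X) (M0 M1 M2 Y : X → ℝ)
    {g : ℝ → ℝ} (hg : ContDiff ℝ 2 g) (s b : ℝ) :
    ridge μ M0 M1 M2 Y (fun x => g (s * x + b)) = ∫ x, M0 x * g (s * Y x + b)
      + s * M1 x * deriv g (s * Y x + b) + s ^ 2 * M2 x * deriv (deriv g) (s * Y x + b) ∂μ := by
  have hg1 : ContDiff ℝ 1 (deriv g) := (contDiff_succ_iff_deriv.mp hg).2.2
  have h3 : ∀ x, HasDerivAt (fun x : ℝ => s * x + b) s x := fun x => by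
    simpa using ((hasDerivAt_id x).const_mul s).add_const b
  have key : ∀ {f : ℝ → ℝ}, ContDiff ℝ 1 f →
      deriv (fun x => f (s * x + b)) = fun x => s * deriv f (s * x + b) := by
    intro f hf
    funext x
    have h4 : HasDerivAt f (deriv f (s * x + b)) (s * x + b) :=
      (hf.differentiable one_ne_zero _).hasDerivAt
    exact (h4.comp x (h3 x)).deriv.trans (mul_comm _ _)
  unfold ridge
  rw [key (hg.of_le one_le_two)]
  have e : deriv (fun x => s * deriv g (s * x + b))
      = fun x => s * (s * deriv (deriv g) (s * x + b)) := by
    funext x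
    rw [deriv_const_mul_field, key hg1]
  rw [e]
  congr 1
  funext x
  ring

/-- Smoothing preserves the kernel of a ridge functional. -/
lemma IsRidge.smear_eq_zero {X : Type*} [MeasurableSpace X] {μ : Measure X} [SFinite μ]
    {M0 M1 M2 Y : X → ℝ} {R : ℝ} (h : IsRidge μ M0 M1 M2 Y R) {σ φ : ℝ → ℝ}
    (hσ : ContDiff ℝ 2 σ) {C : ℝ} (hC0 : ∀ y, |σ y| ≤ C) (hC1 : ∀ y, |deriv σ y| ≤ C)
    (hC2 : ∀ y, |deriv (deriv σ) y| ≤ C) (hφ : ContDiff ℝ ∞ φ) (hφc : HasCompactSupport φ)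
    (hker : ∀ s b, ridge μ M0 M1 M2 Y (fun x => σ (s * x + b)) = 0) (s b : ℝ) :
    ridge μ M0 M1 M2 Y (fun x => smear φ σ (s * x + b)) = 0 := by
  have hσ1 : ContDiff ℝ 1 (deriv σ) := (contDiff_succ_iff_deriv.mp hσ).2.2
  have hσ2 : Continuous (deriv (deriv σ)) := hσ1.continuous_deriv le_rfl
  have d1 : deriv (smear φ σ) = smear φ (deriv σ) :=
    deriv_smear_right hφ.continuous hφc (hσ.of_le one_le_two) hC1
  have d2 : deriv (smear φ (deriv σ)) = smear φ (deriv (deriv σ)) :=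
    deriv_smear_right hφ.continuous hφc hσ1 hC2
  have hφi : Integrable φ := hφ.continuous.integrable_of_hasCompactSupport hφc
  rw [ridge_comp_affine _ _ _ _ _ (contDiff_infty.mp (contDiff_smear hφ hφc hσ.continuous) 2),
    d1, d2]
  let K : X → ℝ → ℝ := fun x c => M0 x * (φ c * σ (s * Y x + b - c))
    + s * M1 x * (φ c * deriv σ (s * Y x + b - c))
    + s ^ 2 * M2 x * (φ c * deriv (deriv σ) (s * Y x + b - c))
  have e1 : ∀ x, M0 x * smear φ σ (s * Y x + b) + s * M1 x * smear φ (deriv σ) (s * Y x + b)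
      + s ^ 2 * M2 x * smear φ (deriv (deriv σ)) (s * Y x + b) = ∫ c, K x c := by
    intro x
    have i0 := (integrable_smear hφ.continuous hφc hσ.continuous (s * Y x + b)).const_mul (M0 x)
    have i1 := (integrable_smear hφ.continuous hφc hσ1.continuous
      (s * Y x + b)).const_mul (s * M1 x)
    have i2 := (integrable_smear hφ.continuous hφc hσ2 (s * Y x + b)).const_mul (s ^ 2 * M2 x)
    simp only [K]
    have i01 : Integrable (fun c => M0 x * (φ c * σ (s * Y x + b - c))
      + s * M1 x * (φ c * deriv σ (s * Y x + b - c))) := i0.add i1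
    rw [integral_add i01 i2, integral_add i0 i1, integral_const_mul, integral_const_mul,
      integral_const_mul]
    rfl
  simp only [e1]
  have hinteg : ∀ {M : X → ℝ} {g : ℝ → ℝ}, Integrable M μ → Continuous g → (∀ y, |g y| ≤ C) →
      Integrable (fun p : X × ℝ => M p.1 * (φ p.2 * g (s * Y p.1 + b - p.2)))
        (μ.prod volume) := by
    intro M g hM hg hgC
    have h1 : Integrable (fun p : X × ℝ => M p.1 * φ p.2) (μ.prod volume) := hM.mul_prod hφi
    have h2 : AEStronglyMeasurable (fun p : X × ℝ => g (s * Y p.1 + b - p.2))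
        (μ.prod volume) := by
      refine hg.comp_aestronglyMeasurable (((h.meas.comp_fst.const_mul s).add_const b).sub ?_)
      exact measurable_snd.aestronglyMeasurable
    have h3 := h1.mul_bdd (c := C) h2 (Eventually.of_forall fun p => hgC _)
    refine h3.congr (Eventually.of_forall fun p => ?_)
    simp only
    ring
  rw [integral_integral_swap]
  · refine integral_eq_zero_of_ae (Eventually.of_forall fun c => ?_)
    have hk := hker s (b - c)
    rw [ridge_comp_affine _ _ _ _ _ hσ] at hk
    have e2 : ∀ x, K x c = φ c * (M0 x * σ (s * Y x + (b - c))
        + s * M1 x * deriv σ (s * Y x + (b - c))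
        + s ^ 2 * M2 x * deriv (deriv σ) (s * Y x + (b - c))) := by
      intro x
      simp only [K, add_sub_assoc]
      ring
    simp only [e2, integral_const_mul, hk, mul_zero, Pi.zero_apply]
  · exact ((hinteg h.int0 hσ.continuous hC0).add (hinteg (h.int1.const_mul s) hσ1.continuous hC1)).add
      (hinteg (h.int2.const_mul (s ^ 2)) hσ2 hC2)

/-- A ridge functional which kills all `σ(s · + b)`, with `σ` bounded and not constant, kills the
exponential. -/
lemma IsRidge.exp_eq_zero_of_activation {X : Type*} [MeasurableSpace X] {μ : Measure X} [SFinite μ]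
    {M0 M1 M2 Y : X → ℝ} {R : ℝ} (h : IsRidge μ M0 M1 M2 Y R) {σ : ℝ → ℝ}
    (hσ : ContDiff ℝ 2 σ) {C : ℝ} (hC0 : ∀ y, |σ y| ≤ C) (hC1 : ∀ y, |deriv σ y| ≤ C)
    (hC2 : ∀ y, |deriv (deriv σ) y| ≤ C) (hσc : ¬ ∃ s, ∀ x, σ x = s)
    (hker : ∀ s b, ridge μ M0 M1 M2 Y (fun x => σ (s * x + b)) = 0) :
    ∫ x, ((M0 x : ℂ) + Complex.I * M1 x - M2 x) * Complex.exp (Complex.I * Y x) ∂μ = 0 := by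
  obtain ⟨φ, hφ, hφc, hne⟩ := exists_smear hσ.continuous hC0 hσc
  exact h.exp_eq_zero fun k => h.pow_eq_zero (contDiff_smear hφ hφc hσ.continuous)
    (h.smear_eq_zero hσ hC0 hC1 hC2 hφ hφc hker) k (hne k)

end DGM
end

noncomputable section

namespace DGM

/-! ### Second-order functionals and Fourier inversion -/

/-- The symbol of `D_α`. -/
def symb {d : ℕ} (w : Eucl d) : Idx d 2 → ℂ :=
  jet2 1 (fun i => Complex.I * w i) (fun i j => -((w i : ℂ) * w j))

open FourierTransform in
lemma schwartz_inversion {d : ℕ} (f : SchwartzMap (Eucl d) ℂ) (x : Eucl d) :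
    f x = ∫ v, Complex.exp (Complex.I * (inner ℝ ((2 * Real.pi) • v) x : ℝ)) * (𝓕 f) v := by
  have h : 𝓕⁻ (𝓕 f) = f := FourierTransform.fourierInv_fourier_eq f
  conv_lhs => rw [← h]
  rw [SchwartzMap.fourierInv_coe, Real.fourierInv_eq']
  congr 1
  funext v
  rw [smul_eq_mul, inner_smul_left]
  congr 2
  simp
  ring

open FourierTransform LineDeriv in
lemma schwartz_fourier_lineDeriv {d : ℕ} (f : SchwartzMap (Eucl d) ℂ) (i : Fin d) (v : Eucl d) :
    (𝓕 (∂_{bv i} f)) v = Complex.I * ((2 * Real.pi) • v) i * (𝓕 f) v := by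
  have h : (fun x : Eucl d => inner ℝ x (bv i)).HasTemperateGrowth := by fun_prop
  have e : inner ℝ v (bv i) = v i := by
    simp [bv, EuclideanSpace.inner_single_right]
  rw [SchwartzMap.fourier_lineDerivOp_eq, smul_apply,
    SchwartzMap.smulLeftCLM_apply_apply h, e]
  simp only [PiLp.smul_apply, smul_eq_mul, Complex.real_smul]
  push_cast
  ring

open FourierTransform LineDeriv in
/-- Fourier representation of a test function and its derivatives. -/
lemma exists_fourier_jet {d : ℕ} {W : Eucl d → ℝ} (hW : ContDiff ℝ ∞ W)
    (hWc : HasCompactSupport W) :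
    ∃ g : Eucl d → ℂ, (∀ α, Integrable (fun v => symb ((2 * Real.pi) • v) α * g v)) ∧
      ∀ α x, (partialD α W x : ℂ) = ∫ v, Complex.exp (Complex.I *
        (inner ℝ ((2 * Real.pi) • v) x : ℝ)) * (symb ((2 * Real.pi) • v) α * g v) := by
  have hW' : ContDiff ℝ ∞ (fun x => (W x : ℂ)) := Complex.ofRealCLM.contDiff.comp hW
  have hWc' : HasCompactSupport (fun x => (W x : ℂ)) := hWc.comp_left Complex.ofReal_zero
  let f : SchwartzMap (Eucl d) ℂ := hWc'.toSchwartzMap hW'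
  have hW2 : ContDiff ℝ 2 W := contDiff_infty.mp hW 2
  have der : ∀ {F : SchwartzMap (Eucl d) ℂ} {w : Eucl d → ℝ}, (∀ x, F x = w x) →
      Differentiable ℝ w → ∀ i x, (∂_{bv i} F) x = (pd i w x : ℂ) := by
    intro F w hF hw i x
    rw [SchwartzMap.lineDerivOp_apply_eq_fderiv]
    have e : (F : Eucl d → ℂ) = fun x => (w x : ℂ) := funext hF
    have h1 : HasFDerivAt (fun x => (w x : ℂ)) (Complex.ofRealCLM.comp (fderiv ℝ w x)) x :=
      Complex.ofRealCLM.hasFDerivAt.comp x (hw x).hasFDerivAt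
    rw [e, h1.fderiv]
    rfl
  have f0 : ∀ x, f x = W x := fun x => rfl
  have f1 := fun i => der f0 (hW2.differentiable two_ne_zero) i
  have f2 := fun i j => der (f1 j) ((contDiff_pd (m := 1) j hW2 le_rfl).differentiable
    one_ne_zero) i
  refine ⟨fun v => (𝓕 f) v, fun α => ?_, fun α => ?_⟩
  · induction α using Idx.cases_two with
    | h0 => simpa [symb] using (𝓕 f).integrable
    | h1 i =>
      refine (𝓕 (∂_{bv i} f)).integrable.congr (Eventually.of_forall fun v => ?_)
      simp only [schwartz_fourier_lineDeriv, symb, jet2_one]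
    | h2 i j =>
      refine (𝓕 (∂_{bv i} (∂_{bv j} f))).integrable.congr (Eventually.of_forall fun v => ?_)
      simp only [schwartz_fourier_lineDeriv, symb, jet2_two]
      linear_combination (((2 * Real.pi) • v) i * ((2 * Real.pi) • v) j * (𝓕 f) v)
        * Complex.I_mul_I
  · intro x
    induction α using Idx.cases_two with
    | h0 =>
      rw [partialD_nil, ← f0, schwartz_inversion]
      simp [symb]
    | h1 i =>
      rw [partialD_one, ← f1, schwartz_inversion]
      simp only [schwartz_fourier_lineDeriv, symb, jet2_one]
    | h2 i j =>
      rw [partialD_two i j hW2, ← f2, schwartz_inversion]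
      congr 1
      funext v
      simp only [schwartz_fourier_lineDeriv, symb, jet2_two]
      linear_combination Complex.exp (Complex.I * (inner ℝ ((2 * Real.pi) • v) x : ℝ)) *
        (((2 * Real.pi) • v) i * ((2 * Real.pi) • v) j * (𝓕 f) v) * Complex.I_mul_I

/-- A second-order functional on a bounded set which kills all exponentials kills all test
functions. -/
lemma functional_eq_zero_of_exp {d : ℕ} {Ω : Set (Eucl d)} {m : Idx d 2 → Eucl d → ℝ}
    (hm : ∀ α, IntegrableOn (m α) Ω)
    (hexp : ∀ w : Eucl d, ∫ x in Ω, (∑ α, (m α x : ℂ) * symb w α)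
      * Complex.exp (Complex.I * (inner ℝ w x : ℝ)) = 0)
    {W : Eucl d → ℝ} (hW : ContDiff ℝ ∞ W) (hWc : HasCompactSupport W) :
    ∫ x in Ω, ∑ α, m α x * partialD α W x = 0 := by
  obtain ⟨g, hg, hrep⟩ := exists_fourier_jet hW hWc
  let E : Eucl d → Eucl d → ℂ := fun x v =>
    Complex.exp (Complex.I * (inner ℝ ((2 * Real.pi) • v) x : ℝ))
  have hE : ∀ x v, ‖E x v‖ ≤ 1 := fun x v => by
    simp only [E]
    rw [mul_comm, Complex.norm_exp_ofReal_mul_I]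
  have hEc : Continuous fun p : Eucl d × Eucl d => E p.1 p.2 := by
    simp only [E]
    fun_prop
  let K : Eucl d → Eucl d → ℂ := fun x v =>
    ∑ α, (m α x : ℂ) * (E x v * (symb ((2 * Real.pi) • v) α * g v))
  have hKi : Integrable (Function.uncurry K) ((volume.restrict Ω).prod volume) := by
    refine integrable_finsetSum _ fun α _ => ?_
    have h1 : Integrable (fun p : Eucl d × Eucl d =>
        (m α p.1 : ℂ) * (symb ((2 * Real.pi) • p.2) α * g p.2))
        ((volume.restrict Ω).prod volume) := Integrable.mul_prod (hm α).ofReal (hg α)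
    have h2 := h1.mul_bdd (c := 1) hEc.aestronglyMeasurable
      (Eventually.of_forall fun p => hE p.1 p.2)
    refine h2.congr (Eventually.of_forall fun p => ?_)
    simp only
    ring
  have hpt : ∀ x, ((∑ α, m α x * partialD α W x : ℝ) : ℂ) = ∫ v, K x v := by
    intro x
    have hi : ∀ α, Integrable (fun v => E x v * (symb ((2 * Real.pi) • v) α * g v)) := fun α =>
      (hg α).bdd_mul (c := 1) (hEc.comp (continuous_const.prodMk
        continuous_id)).aestronglyMeasurable (Eventually.of_forall fun v => hE x v)
    simp only [K]
    rw [integral_finsetSum _ fun α _ => (hi α).const_mul _]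
    push_cast
    refine Finset.sum_congr rfl fun α _ => ?_
    rw [integral_const_mul, hrep]
  have hC : ((∫ x in Ω, ∑ α, m α x * partialD α W x : ℝ) : ℂ) = 0 := by
    rw [← integral_complex_ofReal]
    simp only [hpt]
    rw [integral_integral_swap hKi]
    refine integral_eq_zero_of_ae (Eventually.of_forall fun v => ?_)
    have e : ∀ x, K x v = g v * ((∑ α, (m α x : ℂ) * symb ((2 * Real.pi) • v) α) * E x v) := by
      intro x
      simp only [K]
      rw [Finset.sum_mul, Finset.mul_sum]
      exact Finset.sum_congr rfl fun α _ => by ring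
    simp only [e, integral_const_mul, E, hexp, mul_zero, Pi.zero_apply]
  exact_mod_cast hC

end DGM
end

noncomputable section

namespace DGM

/-! ### Density of networks -/

lemma inner_jet_eq {d : ℕ} {Ω : Set (Eucl d)} (l v : Jet Ω 2) :
    inner ℝ l v = ∑ α, ∫ x in Ω, l α x * v α x := by
  rw [PiLp.inner_apply]
  refine Finset.sum_congr rfl fun α _ => ?_
  rw [L2.inner_def]
  refine integral_congr_ae (Eventually.of_forall fun x => ?_)
  simp [mul_comm]

lemma inner_cjet_mul {d : ℕ} {Ω : Set (Eucl d)} (hΩ : IsOpen Ω) (hΩb : Bornology.IsBounded Ω)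
    {η : Eucl d → ℝ} (hη : ContDiff ℝ 2 η) (l : Jet Ω 2) :
    ∃ m : Idx d 2 → Eucl d → ℝ, (∀ α, IntegrableOn (m α) Ω) ∧
      ∀ f : Eucl d → ℝ, ContDiff ℝ 2 f → ∀ h : ContDiff ℝ 2 (fun x => η x * f x),
        inner ℝ l (cjet hΩb _ h) = ∫ x in Ω, ∑ α, m α x * partialD α f x := by
  have L : ∀ α, MemLp (l α) 2 (volume.restrict Ω) := fun α => Lp.memLp _
  have c0 : Continuous η := hη.continuous
  have c1 : ∀ i, Continuous (pd i η) := fun i => (contDiff_pd (m := 1) i hη le_rfl).continuous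
  have P : ∀ {g : Eucl d → ℝ}, Continuous g → ∀ α,
      MemLp (fun x => g x * l α x) 2 (volume.restrict Ω) := fun hg α => memLp_mul hΩ hΩb hg (L α)
  refine ⟨jet2 (fun x => ∑ α, partialD α η x * l α x)
    (fun i x => η x * l (Idx.one i) x
      + ∑ j, (pd j η x * l (Idx.two i j) x + pd j η x * l (Idx.two j i) x))
    (fun i j x => η x * l (Idx.two i j) x), ?_, ?_⟩
  · refine Idx.cases_two ?_ (fun i => ?_) (fun i j => ?_)
    · exact integrableOn_of_memLp hΩb (memLp_finsetSum _ fun α _ => P (continuous_partialD hη α) α)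
    · exact integrableOn_of_memLp hΩb ((P c0 _).add (memLp_finsetSum _ fun j _ =>
        (P (c1 j) _).add (P (c1 j) _)))
    · exact integrableOn_of_memLp hΩb (P c0 _)
  · intro f hf h
    rw [inner_jet_eq, ← integral_finsetSum]
    · refine integral_congr_ae ?_
      have hae : ∀ᵐ x ∂(volume.restrict Ω), ∀ α, cjet hΩb _ h α x
          = partialD α (fun x => η x * f x) x := ae_all_iff.mpr fun α => coeFn_cjet hΩb h α
      filter_upwards [hae] with x hx
      have dη := hη.differentiable two_ne_zero x
      have df := hf.differentiable two_ne_zero x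
      simp only [hx, Idx.sum_two, partialD_nil, partialD_one, partialD_two _ _ h,
        partialD_two _ _ hf, partialD_two _ _ hη, pd_mul _ dη df, pd_pd_mul _ _ hη hf, jet2_nil,
        jet2_one, jet2_two]
      have e1 : ∑ i, ∑ j, l (Idx.two i j) x * (pd i (pd j η) x * f x + pd j η x * pd i f x
            + pd i η x * pd j f x + η x * pd i (pd j f) x)
          = (∑ i, ∑ j, pd i (pd j η) x * l (Idx.two i j) x) * f x
            + (∑ i, (∑ j, pd j η x * l (Idx.two i j) x) * pd i f x)
            + (∑ i, (∑ j, pd j η x * l (Idx.two j i) x) * pd i f x)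
            + ∑ i, ∑ j, η x * l (Idx.two i j) x * pd i (pd j f) x := by
        have e2 : ∑ i, (∑ j, pd j η x * l (Idx.two j i) x) * pd i f x
            = ∑ i, ∑ j, pd i η x * l (Idx.two i j) x * pd j f x := by
          simp only [Finset.sum_mul]
          exact Finset.sum_comm
        rw [e2]
        simp only [Finset.sum_mul, ← Finset.sum_add_distrib]
        exact Finset.sum_congr rfl fun i _ => Finset.sum_congr rfl fun j _ => by ring
      rw [e1]
      have e3 : ∑ i, l (Idx.one i) x * (pd i η x * f x + η x * pd i f x)
          = (∑ i, pd i η x * l (Idx.one i) x) * f x + ∑ i, η x * l (Idx.one i) x * pd i f x := by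
        simp only [Finset.sum_mul, ← Finset.sum_add_distrib]
        exact Finset.sum_congr rfl fun i _ => by ring
      rw [e3]
      simp only [add_mul, Finset.sum_add_distrib]
      ring
    · intro α _
      exact (L α).integrable_mul (Lp.memLp (cjet hΩb _ h α))

lemma pd_comp_affine {d : ℕ} {g : ℝ → ℝ} (hg : Differentiable ℝ g) (w : Eucl d) (b : ℝ)
    (i : Fin d) :
    pd i (fun x => g (inner ℝ w x + b)) = fun x => w i * deriv g (inner ℝ w x + b) := by
  funext x
  have h1 : HasFDerivAt (fun x : Eucl d => inner ℝ w x + b) (innerSL ℝ w) x :=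
    (innerSL ℝ w).hasFDerivAt.add_const b
  have h2 := (hg (inner ℝ w x + b)).hasDerivAt.comp_hasFDerivAt x h1
  have h3 : fderiv ℝ (fun x : Eucl d => g (inner ℝ w x + b)) x = _ := h2.fderiv
  rw [pd, h3]
  simp [bv, mul_comm, EuclideanSpace.inner_single_right]

lemma contDiff_comp_affine {d : ℕ} {g : ℝ → ℝ} {n : WithTop ℕ∞} (hg : ContDiff ℝ n g) (w : Eucl d)
    (b : ℝ) : ContDiff ℝ n (fun x : Eucl d => g (inner ℝ w x + b)) :=
  hg.comp ((contDiff_const.inner ℝ contDiff_id).add contDiff_const)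

lemma IsCkb.exists_bound {σ : ℝ → ℝ} {k : ℕ} (hσ : IsCkb k σ) :
    ∃ C : ℝ, 0 ≤ C ∧ ∀ j ≤ k, ∀ y, |iteratedDeriv j σ y| ≤ C := by
  choose! C hC using hσ.2
  refine ⟨∑ j ∈ Finset.range (k + 1), |C j|, Finset.sum_nonneg fun _ _ => abs_nonneg _,
    fun j hj y => ?_⟩
  have h1 := hC j hj y
  rw [norm_iteratedFDeriv_eq_norm_iteratedDeriv] at h1
  refine h1.trans ((le_abs_self _).trans ?_)
  exact Finset.single_le_sum (f := fun j => |C j|) (fun _ _ => abs_nonneg _)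
    (Finset.mem_range.mpr (by omega))

/-- The functions `η σ(w · x + b)` are total in `H² ∩ H¹₀`. -/
lemma inner_eq_zero_of_activation {d : ℕ} {Ω : Set (Eucl d)} (hΩ : IsOpen Ω)
    (hΩb : Bornology.IsBounded Ω) {a : ℝ} (hbdry : HasHolderBoundary 3 a Ω) {η : Eucl d → ℝ}
    (hη : IsAuxiliary Ω η) {σ : ℝ → ℝ} (hσ : IsCkb 4 σ) (hσc : ¬ ∃ s, ∀ x, σ x = s)
    {l : Jet Ω 2}
    (hl : ∀ w b, ∀ h : ContDiff ℝ 2 (fun x => η x * σ (inner ℝ w x + b)),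
      inner ℝ l (cjet hΩb _ h) = 0)
    {u : Jet Ω 2} (hu : u ∈ H20 Ω) : inner ℝ l u = 0 := by
  have hη2 : ContDiff ℝ 2 η := hη.smooth.1.of_le (by norm_cast)
  have hσ2 : ContDiff ℝ 2 σ := hσ.1.of_le (by norm_cast)
  have hσ1 : ContDiff ℝ 1 (deriv σ) := (contDiff_succ_iff_deriv.mp hσ2).2.2
  obtain ⟨C, -, hC⟩ := hσ.exists_bound
  have hC0 : ∀ y, |σ y| ≤ C := fun y => by simpa using hC 0 (by norm_num) y
  have hC1 : ∀ y, |deriv σ y| ≤ C := fun y => by simpa using hC 1 (by norm_num) y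
  have hC2 : ∀ y, |deriv (deriv σ) y| ≤ C := fun y => by
    have := hC 2 (by norm_num) y
    rwa [iteratedDeriv_succ, iteratedDeriv_one] at this
  obtain ⟨m, hm, hrep⟩ := inner_cjet_mul hΩ hΩb hη2 l
  refine inner_eq_zero_of_smooth hΩ hΩb hbdry hη (fun W hW hWc h => ?_) hu
  rw [hrep W (contDiff_infty.mp hW 2) h]
  refine functional_eq_zero_of_exp hm (fun w => ?_) hW hWc
  obtain ⟨R, -, hR⟩ := exists_bound_on hΩb (m := fun x => inner ℝ w x) (by fun_prop)
  have hridge : IsRidge (volume.restrict Ω) (m (Idx.nil d 2))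
      (fun x => ∑ i, w i * m (Idx.one i) x) (fun x => ∑ i, ∑ j, w i * w j * m (Idx.two i j) x)
      (fun x => inner ℝ w x) R :=
    ⟨hm _, integrable_finsetSum _ fun i _ => (hm _).const_mul _,
      integrable_finsetSum _ fun i _ => integrable_finsetSum _ fun j _ => (hm _).const_mul _,
      (by fun_prop : Continuous fun x : Eucl d => inner ℝ w x).aestronglyMeasurable, by
        filter_upwards [ae_restrict_mem hΩ.measurableSet] with x hx using hR x hx⟩
  have hfin := hridge.exp_eq_zero_of_activation hσ2 hC0 hC1 hC2 hσc fun s b => ?_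
  · rw [← hfin]
    congr 1
    funext x
    congr 1
    rw [Idx.sum_two]
    simp only [symb, jet2_nil, jet2_one, jet2_two]
    push_cast
    rw [Finset.mul_sum, mul_one, sub_eq_add_neg, ← Finset.sum_neg_distrib]
    congr 1
    · congr 1
      exact Finset.sum_congr rfl fun i _ => by ring
    · refine Finset.sum_congr rfl fun i _ => ?_
      rw [← Finset.sum_neg_distrib]
      exact Finset.sum_congr rfl fun j _ => by ring
  · have hc : ContDiff ℝ 2 (fun x : Eucl d => σ (inner ℝ (s • w) x + b)) :=
      contDiff_comp_affine hσ2 _ _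
    have h0 := hl (s • w) b (hη2.mul hc)
    rw [hrep _ hc] at h0
    rw [ridge_comp_affine _ _ _ _ _ hσ2, ← h0]
    congr 1
    funext x
    have p1 := fun i => pd_comp_affine (hσ2.differentiable two_ne_zero) (s • w) b i
    have p2 : ∀ i j, pd i (pd j fun x => σ (inner ℝ (s • w) x + b))
        = fun x => (s • w) j * ((s • w) i * deriv (deriv σ) (inner ℝ (s • w) x + b)) := by
      intro i j
      rw [p1 j]
      have := pd_comp_affine (hσ1.differentiable one_ne_zero) (s • w) b i
      funext x
      rw [← congrFun this x]
      simp only [pd]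
      rw [fderiv_const_mul ((contDiff_comp_affine hσ1 (s • w) b).differentiable one_ne_zero x)]
      simp
    rw [Idx.sum_two]
    simp only [partialD_nil, partialD_one, partialD_two _ _ hc, p2]
    simp only [p1]
    have e : inner ℝ (s • w) x = s * inner ℝ w x := by
      rw [inner_smul_left]
      simp
    simp only [e, PiLp.smul_apply, smul_eq_mul, Finset.mul_sum, Finset.sum_mul]
    congr 1
    · congr 1
      exact Finset.sum_congr rfl fun i _ => by ring
    · exact Finset.sum_congr rfl fun i _ => Finset.sum_congr rfl fun j _ => by ring

end DGM
end

noncomputable section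

namespace DGM

/-! ### Linear gradient flows in Hilbert space -/

section Flow

variable {E : Type*} [NormedAddCommGroup E] [InnerProductSpace ℝ E]

lemma exists_linear_flow [CompleteSpace E] (T : E →L[ℝ] E) (y : E) :
    ∃ q : ℝ → E, q 0 = y ∧ ∀ t, HasDerivAt q (-T (q t)) t := by
  refine ⟨fun t => NormedSpace.exp (t • (-T)) y, by simp, fun t => ?_⟩
  have h := hasDerivAt_exp_smul_const' (𝕂 := ℝ) (-T) t
  have h2 := h.clm_apply (hasDerivAt_const t y)
  simpa using h2

lemma norm_le_of_flow {T : E →L[ℝ] E} (hpos : ∀ x, 0 ≤ inner ℝ (T x) x) {r : ℝ → E}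
    (hr : ∀ t, 0 ≤ t → HasDerivWithinAt r (-T (r t)) (Set.Ici 0) t) {t : ℝ} (ht : 0 ≤ t) :
    ‖r t‖ ≤ ‖r 0‖ := by
  have hd : ∀ t, 0 ≤ t → HasDerivWithinAt (fun t => inner ℝ (r t) (r t))
      (inner ℝ (r t) (-T (r t)) + inner ℝ (-T (r t)) (r t)) (Set.Ici 0) t := fun t ht =>
    (hr t ht).inner ℝ (hr t ht)
  have hanti : AntitoneOn (fun t => inner ℝ (r t) (r t)) (Set.Ici 0) := by
    refine antitoneOn_of_hasDerivWithinAt_nonpos (convex_Ici 0)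
      (fun t ht => (hd t ht).continuousWithinAt)
      (fun t ht => (hd t (interior_subset ht)).mono interior_subset) fun t _ => ?_
    rw [inner_neg_right, inner_neg_left, real_inner_comm]
    have := hpos (r t)
    linarith [real_inner_comm (T (r t)) (r t)]
  have h := hanti (Set.mem_Ici.mpr le_rfl) (Set.mem_Ici.mpr ht) ht
  simp only [real_inner_self_eq_norm_sq] at h
  exact le_of_sq_le_sq h (norm_nonneg _)

lemma mul_norm_sq_le_of_flow {T : E →L[ℝ] E} (hsymm : ∀ x y, inner ℝ (T x) y = inner ℝ x (T y))
    (hpos : ∀ x, 0 ≤ inner ℝ (T x) x) {q : ℝ → E} (hq : ∀ t, HasDerivAt q (-T (q t)) t)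
    {t : ℝ} (ht : 0 ≤ t) : 2 * t * ‖T (q t)‖ ^ 2 ≤ inner ℝ (T (q 0)) (q 0) := by
  have hTq : ∀ t, HasDerivAt (fun t => T (q t)) (T (-T (q t))) t := fun t =>
    T.hasFDerivAt.comp_hasDerivAt t (hq t)
  let Φ : ℝ → ℝ := fun t => inner ℝ (T (q t)) (q t) + 2 * t * inner ℝ (T (q t)) (T (q t))
  have hd : ∀ t, HasDerivAt Φ (-(4 * t * inner ℝ (T (T (q t))) (T (q t)))) t := by
    intro t
    have h1 := (hTq t).inner ℝ (hq t)
    have h2 := ((hasDerivAt_id t).const_mul 2).mul ((hTq t).inner ℝ (hTq t))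
    refine (h1.add h2).congr_deriv ?_
    simp only [map_neg, inner_neg_left, inner_neg_right, id]
    have e1 : inner ℝ (T (T (q t))) (q t) = inner ℝ (T (q t)) (T (q t)) := hsymm _ _
    rw [e1, real_inner_comm (T (T (q t))) (T (q t))]
    ring
  have hanti : AntitoneOn Φ (Set.Ici 0) := by
    refine antitoneOn_of_hasDerivWithinAt_nonpos (convex_Ici 0)
      (fun t _ => (hd t).continuousAt.continuousWithinAt)
      (fun t _ => (hd t).hasDerivWithinAt) fun t ht => ?_
    have h0 : 0 ≤ t := interior_subset ht
    have := mul_nonneg (mul_nonneg (by norm_num : (0 : ℝ) ≤ 4) h0) (hpos (T (q t)))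
    linarith
  have h := hanti (Set.mem_Ici.mpr le_rfl) (Set.mem_Ici.mpr ht) ht
  simp only [Φ, real_inner_self_eq_norm_sq, mul_zero, zero_mul, add_zero] at h
  linarith [hpos (q t)]

/-- The flow of a bounded positive operator converges to zero from initial data in the closure of
its range. -/
lemma tendsto_zero_of_flow [CompleteSpace E] {T : E →L[ℝ] E}
    (hsymm : ∀ x y, inner ℝ (T x) y = inner ℝ x (T y)) (hpos : ∀ x, 0 ≤ inner ℝ (T x) x)
    {r : ℝ → E} (hr : ∀ t, 0 ≤ t → HasDerivWithinAt r (-T (r t)) (Set.Ici 0) t)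
    (h0 : r 0 ∈ closure (Set.range T)) : Tendsto r atTop (𝓝 0) := by
  rw [Metric.tendsto_nhds]
  intro ε hε
  obtain ⟨_, ⟨y, rfl⟩, hy⟩ := Metric.mem_closure_iff.mp h0 (ε / 2) (by positivity)
  obtain ⟨q, hq0, hq⟩ := exists_linear_flow T y
  have hdiff : ∀ t, 0 ≤ t → ‖r t - T (q t)‖ ≤ ‖r 0 - T (q 0)‖ := by
    intro t ht
    refine norm_le_of_flow (r := fun t => r t - T (q t)) hpos (fun t ht => ?_) ht
    have h1 := (hr t ht).sub (T.hasFDerivAt.comp_hasDerivAt t (hq t)).hasDerivWithinAt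
    refine h1.congr_deriv ?_
    simp only [map_neg, map_sub]
    abel
  set K := inner ℝ (T (q 0)) (q 0)
  have hlim : Tendsto (fun t : ℝ => K / (2 * t)) atTop (𝓝 0) :=
    Tendsto.div_atTop tendsto_const_nhds (tendsto_id.const_mul_atTop two_pos)
  filter_upwards [hlim.eventually_lt_const (show 0 < (ε / 2) ^ 2 by positivity),
    eventually_gt_atTop 0] with t ht1 ht0
  have h1 := mul_norm_sq_le_of_flow hsymm hpos hq ht0.le
  have h2 : ‖T (q t)‖ ^ 2 < (ε / 2) ^ 2 := by
    refine lt_of_le_of_lt ?_ ht1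
    rw [le_div_iff₀ (by positivity)]
    linarith
  have h3 : ‖T (q t)‖ < ε / 2 := lt_of_pow_lt_pow_left₀ 2 (by positivity) h2
  have h4 := hdiff t ht0.le
  rw [hq0] at h4
  rw [dist_eq_norm] at hy
  rw [dist_zero_right]
  calc ‖r t‖ = ‖(r t - T (q t)) + T (q t)‖ := by simp
    _ ≤ ‖r t - T (q t)‖ + ‖T (q t)‖ := norm_add_le _ _
    _ < ε := by linarith

lemma mem_closure_range_of_symm [CompleteSpace E] {T : E →L[ℝ] E}
    (hsymm : ∀ x y, inner ℝ (T x) y = inner ℝ x (T y)) {y : E}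
    (hy : ∀ x, T x = 0 → inner ℝ x y = 0) : y ∈ closure (Set.range T) := by
  have h1 : y ∈ (LinearMap.range (T : E →ₗ[ℝ] E)).topologicalClosure := by
    rw [← Submodule.orthogonal_orthogonal_eq_closure, Submodule.mem_orthogonal]
    intro x hx
    refine hy x ?_
    rw [← inner_self_eq_zero (𝕜 := ℝ), hsymm, real_inner_comm]
    exact Submodule.inner_right_of_mem_orthogonal
      (LinearMap.mem_range_self (T : E →ₗ[ℝ] E) (T x)) hx
  exact h1

end Flow

end DGM
end

noncomputable section

namespace DGM

/-! ### The operator as a bounded map `H²_{(0)}(Ω) → L²(μ)` -/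

lemma IsSamplingMeasure.exists_le_smul {d : ℕ} {Ω : Set (Eucl d)} {μ : Measure (Eucl d)}
    (hμ : IsSamplingMeasure Ω μ) : ∃ C : ℝ≥0∞, C ≠ ⊤ ∧ μ ≤ C • volume.restrict Ω := by
  have := hμ.finite
  obtain ⟨M, hM⟩ := hμ.log_bdd
  refine ⟨ENNReal.ofReal (Real.exp M), ENNReal.ofReal_ne_top, ?_⟩
  rw [← withDensity_const]
  conv_lhs => rw [← Measure.withDensity_rnDeriv_eq μ (volume.restrict Ω) hμ.ac]
  refine withDensity_mono ?_
  filter_upwards [hM, Measure.rnDeriv_lt_top μ (volume.restrict Ω)] with x hx hlt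
  rw [ENNReal.le_ofReal_iff_toReal_le hlt.ne (Real.exp_pos M).le]
  rcases (ENNReal.toReal_nonneg (a := μ.rnDeriv (volume.restrict Ω) x)).eq_or_lt with h | h
  · rw [← h]
    exact (Real.exp_pos M).le
  · exact (Real.log_le_iff_le_exp h).mp ((le_abs_self _).trans hx)

lemma IsLipschitzOp.exists_bound {d : ℕ} {Ω : Set (Eucl d)} {a : Idx d 2 → Eucl d → ℝ}
    (hA : IsLipschitzOp Ω a) : ∃ k : ℝ, 0 < k ∧ ∀ v ∈ sobolev Ω 2,
      ∀ᵐ x ∂(volume.restrict Ω), |opA a v x| ≤ k * ∑ α, |v α x| := by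
  obtain ⟨k, hk, h⟩ := hA
  refine ⟨k, hk, fun v hv => ?_⟩
  have h0 : ∀ᵐ x ∂(volume.restrict Ω), ∀ α, (0 : Jet Ω 2) α x = 0 :=
    ae_all_iff.mpr fun α => Lp.coeFn_zero _ _ _
  filter_upwards [h v hv 0 (Submodule.zero_mem _), h0] with x hx hx0
  have e : opA a (0 : Jet Ω 2) x = 0 := by simp only [opA, hx0, mul_zero, Finset.sum_const_zero]
  simpa only [e, hx0, sub_zero] using hx

lemma opA_add {d : ℕ} {Ω : Set (Eucl d)} (a : Idx d 2 → Eucl d → ℝ) (u v : Jet Ω 2) :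
    opA a (u + v) =ᵐ[volume.restrict Ω] opA a u + opA a v := by
  have h : ∀ᵐ x ∂(volume.restrict Ω), ∀ α, (u + v) α x = u α x + v α x :=
    ae_all_iff.mpr fun α => Lp.coeFn_add _ _
  filter_upwards [h] with x hx
  simp only [opA, hx, mul_add, Finset.sum_add_distrib, Pi.add_apply]

lemma opA_smul {d : ℕ} {Ω : Set (Eucl d)} (a : Idx d 2 → Eucl d → ℝ) (c : ℝ) (v : Jet Ω 2) :
    opA a (c • v) =ᵐ[volume.restrict Ω] c • opA a v := by
  have h : ∀ᵐ x ∂(volume.restrict Ω), ∀ α, (c • v) α x = c * v α x :=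
    ae_all_iff.mpr fun α => Lp.coeFn_smul _ _
  filter_upwards [h] with x hx
  simp only [opA, hx, Pi.smul_apply, smul_eq_mul, Finset.mul_sum]
  exact Finset.sum_congr rfl fun α _ => by ring

lemma aestronglyMeasurable_opA {d : ℕ} {Ω : Set (Eucl d)} {a : Idx d 2 → Eucl d → ℝ}
    (ha : ∀ α, AEMeasurable (a α) (volume.restrict Ω)) (v : Jet Ω 2) :
    AEStronglyMeasurable (opA a v) (volume.restrict Ω) := by
  unfold opA
  exact (Finset.aemeasurable_fun_sum _ fun α _ =>
    (ha α).mul (Lp.aestronglyMeasurable (v α)).aemeasurable).aestronglyMeasurable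

lemma memLp_opA {d : ℕ} {Ω : Set (Eucl d)} {a : Idx d 2 → Eucl d → ℝ}
    (ha : ∀ α, AEMeasurable (a α) (volume.restrict Ω)) (hA : IsLipschitzOp Ω a) {v : Jet Ω 2}
    (hv : v ∈ sobolev Ω 2) : MemLp (opA a v) 2 (volume.restrict Ω) := by
  obtain ⟨k, -, h⟩ := hA.exists_bound
  refine MemLp.of_le_mul (g := fun x => ∑ α, |v α x|) (c := k)
    (memLp_finsetSum _ fun α _ => (Lp.memLp (v α)).abs) (aestronglyMeasurable_opA ha v) ?_
  filter_upwards [h v hv] with x hx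
  rwa [Real.norm_eq_abs, Real.norm_eq_abs,
    abs_of_nonneg (Finset.sum_nonneg fun α _ => abs_nonneg (v α x))]

lemma norm_component_le {d p : ℕ} {Ω : Set (Eucl d)} (v : Jet Ω p) (α : Idx d p) :
    ‖v α‖ ≤ ‖v‖ := PiLp.norm_apply_le v α

lemma exists_opA_clm_volume {d : ℕ} {Ω : Set (Eucl d)} {a : Idx d 2 → Eucl d → ℝ}
    (ha : ∀ α, AEMeasurable (a α) (volume.restrict Ω)) (hA : IsLipschitzOp Ω a) :
    ∃ A : H20 Ω →L[ℝ] L2 Ω, ∀ v : H20 Ω, A v =ᵐ[volume.restrict Ω] opA a (v : Jet Ω 2) := by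
  obtain ⟨k, hk, h⟩ := hA.exists_bound
  have hm : ∀ v : H20 Ω, MemLp (opA a (v : Jet Ω 2)) 2 (volume.restrict Ω) := fun v =>
    memLp_opA ha hA v.2.1
  let L : H20 Ω →ₗ[ℝ] L2 Ω :=
    { toFun := fun v => (hm v).toLp _
      map_add' := fun u v => by
        rw [← MemLp.toLp_add]
        exact MemLp.toLp_congr _ _ (opA_add a _ _)
      map_smul' := fun c v => by
        rw [RingHom.id_apply, ← MemLp.toLp_const_smul]
        exact MemLp.toLp_congr _ _ (opA_smul a _ _) }
  refine ⟨L.mkContinuous (k * Fintype.card (Idx d 2)) fun v => ?_, fun v => (hm v).coeFn_toLp⟩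
  have hs : ‖∑ α, |(v : Jet Ω 2) α|‖ ≤ Fintype.card (Idx d 2) * ‖v‖ := by
    refine (norm_sum_le _ _).trans ?_
    calc ∑ α, ‖|(v : Jet Ω 2) α|‖ ≤ ∑ _α : Idx d 2, ‖v‖ := Finset.sum_le_sum fun α _ => by
          rw [norm_abs_eq_norm]
          exact norm_component_le _ α
      _ = _ := by simp
  rw [mul_assoc]
  refine (Lp.norm_le_mul_norm_of_ae_le_mul (c := k) (g := ∑ α, |(v : Jet Ω 2) α|) ?_).trans
    (mul_le_mul_of_nonneg_left hs hk.le)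
  have h1 : ∀ᵐ x ∂(volume.restrict Ω), ∀ α, |(v : Jet Ω 2) α| x = |(v : Jet Ω 2) α x| :=
    ae_all_iff.mpr fun α => Lp.coeFn_abs _
  filter_upwards [h v v.2.1, (hm v).coeFn_toLp, h1,
    Lp.coeFn_finsetSum Finset.univ fun α => |(v : Jet Ω 2) α|] with x hx hx1 hx2 hx3
  have hx1' : L v x = opA a (v : Jet Ω 2) x := hx1
  rw [hx1', hx3, Finset.sum_apply, Real.norm_eq_abs, Real.norm_eq_abs]
  simp only [hx2]
  rwa [abs_of_nonneg (Finset.sum_nonneg fun α _ => abs_nonneg ((v : Jet Ω 2) α x))]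

lemma exists_opA_clm {d : ℕ} {Ω : Set (Eucl d)} {μ : Measure (Eucl d)}
    (hμ : IsSamplingMeasure Ω μ) {a : Idx d 2 → Eucl d → ℝ}
    (ha : ∀ α, AEMeasurable (a α) (volume.restrict Ω)) (hA : IsLipschitzOp Ω a) :
    ∃ A : H20 Ω →L[ℝ] Lp ℝ 2 μ, ∀ v : H20 Ω, A v =ᵐ[μ] opA a (v : Jet Ω 2) := by
  obtain ⟨A, hA'⟩ := exists_opA_clm_volume ha hA
  obtain ⟨C, hC, hle⟩ := hμ.exists_le_smul
  refine ⟨(Lp.LpToLpOfMeasureLeSMul hC hle).comp A, fun v => ?_⟩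
  exact (Lp.coeFn_LpToLpOfMeasureLeSMul hC hle (A v)).trans (hμ.ac.ae_eq (hA' v))

end DGM

end

noncomputable section

namespace DGM

/-! ### Covariance operators and Bochner integrals in `L²` -/

section Covariance

variable {X E ι : Type*} [MeasurableSpace X] [NormedAddCommGroup E] [InnerProductSpace ℝ E]

lemma integrable_inner_smul {π : Measure X} {ψ : ι → X → E} (hψ : ∀ i, MemLp (ψ i) 2 π) (v : E)
    (i : ι) : Integrable (fun θ => inner ℝ (ψ i θ) v • ψ i θ) π := by
  have h1 : MemLp (fun θ => inner ℝ (ψ i θ) v) 2 π := (hψ i).inner_const v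
  exact memLp_one_iff_integrable.mp ((hψ i).smul h1)

variable [Fintype ι]

/-- The operator `v ↦ E[∑ᵢ ⟨ψᵢ, v⟩ ψᵢ]`. -/
lemma exists_covariance {π : Measure X} {ψ : ι → X → E} (hψ : ∀ i, MemLp (ψ i) 2 π) :
    ∃ S : E →L[ℝ] E, ∀ v, S v = ∑ i, ∫ θ, inner ℝ (ψ i θ) v • ψ i θ ∂π := by
  let R : E →L[ℝ] E →L[ℝ] E →L[ℝ] E := InnerProductSpace.rankOne ℝ
  have hinteg : ∀ i, Integrable (fun θ => InnerProductSpace.rankOne ℝ (ψ i θ) (ψ i θ)) π := by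
    intro i
    refine Integrable.mono' (g := fun θ => ‖ψ i θ‖ ^ 2) ((hψ i).integrable_norm_pow two_ne_zero)
      ?_ ?_
    · have hm := (hψ i).aestronglyMeasurable
      exact (R.aestronglyMeasurable_comp₂ hm hm)
    · refine ae_of_all _ fun θ => ?_
      rw [InnerProductSpace.norm_rankOne, sq]
  refine ⟨∑ i, ∫ θ, InnerProductSpace.rankOne ℝ (ψ i θ) (ψ i θ) ∂π, fun v => ?_⟩
  rw [sum_apply]
  refine Finset.sum_congr rfl fun i _ => ?_
  rw [ContinuousLinearMap.integral_apply (hinteg i)]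
  simp only [InnerProductSpace.rankOne_apply]

variable [CompleteSpace E]

lemma inner_covariance {π : Measure X} {ψ : ι → X → E} (hψ : ∀ i, MemLp (ψ i) 2 π)
    {S : E →L[ℝ] E} (hS : ∀ v, S v = ∑ i, ∫ θ, inner ℝ (ψ i θ) v • ψ i θ ∂π) (v w : E) :
    inner ℝ (S v) w = ∑ i, ∫ θ, inner ℝ (ψ i θ) v * inner ℝ (ψ i θ) w ∂π := by
  rw [hS, sum_inner]
  refine Finset.sum_congr rfl fun i _ => ?_
  rw [real_inner_comm, ← integral_inner (integrable_inner_smul hψ v i)]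
  refine integral_congr_ae (ae_of_all _ fun θ => ?_)
  simp only [inner_smul_right]
  rw [real_inner_comm w]

lemma covariance_symm {π : Measure X} {ψ : ι → X → E} (hψ : ∀ i, MemLp (ψ i) 2 π)
    {S : E →L[ℝ] E} (hS : ∀ v, S v = ∑ i, ∫ θ, inner ℝ (ψ i θ) v • ψ i θ ∂π) (v w : E) :
    inner ℝ (S v) w = inner ℝ v (S w) := by
  rw [real_inner_comm (S w) v, inner_covariance hψ hS, inner_covariance hψ hS]
  exact Finset.sum_congr rfl fun i _ => integral_congr_ae (ae_of_all _ fun θ => mul_comm _ _)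

lemma inner_eq_zero_of_covariance {π : Measure X} {ψ : ι → X → E} (hψ : ∀ i, MemLp (ψ i) 2 π)
    {S : E →L[ℝ] E} (hS : ∀ v, S v = ∑ i, ∫ θ, inner ℝ (ψ i θ) v • ψ i θ ∂π) {v : E}
    (h : inner ℝ (S v) v = 0) (i : ι) : ∀ᵐ θ ∂π, inner ℝ (ψ i θ) v = 0 := by
  rw [inner_covariance hψ hS] at h
  have h0 := (Finset.sum_eq_zero_iff_of_nonneg fun i _ =>
    integral_nonneg fun θ => mul_self_nonneg (inner ℝ (ψ i θ) v)).mp h i (Finset.mem_univ i)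
  have h1 : MemLp (fun θ => inner ℝ (ψ i θ) v) 2 π := (hψ i).inner_const v
  have h2 := (integral_eq_zero_iff_of_nonneg (fun θ => mul_self_nonneg _)
    (h1.integrable_mul h1)).mp h0
  filter_upwards [h2] with θ hθ
  exact mul_self_eq_zero.mp hθ

end Covariance

/-- A Bochner integral in `L²` may be computed pointwise. -/
lemma coeFn_integral_Lp {X Y : Type*} [MeasurableSpace X] [MeasurableSpace Y] {π : Measure X}
    [SFinite π] {ν : Measure Y} [IsFiniteMeasure ν] {G : X → Lp ℝ 2 ν} (hG : Integrable G π)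
    {f : X → Y → ℝ} (hf : AEStronglyMeasurable (Function.uncurry f) (π.prod ν))
    (hGf : ∀ θ, G θ =ᵐ[ν] f θ) :
    (∫ θ, G θ ∂π : Lp ℝ 2 ν) =ᵐ[ν] fun y => ∫ θ, f θ y ∂π := by
  have hinteg : Integrable (Function.uncurry f) (π.prod ν) := by
    have hi : ∀ θ, Integrable (f θ) ν := fun θ =>
      ((Lp.memLp (G θ)).integrable one_le_two).congr (hGf θ)
    rw [integrable_prod_iff hf]
    refine ⟨ae_of_all _ hi, ?_⟩
    let o : Lp ℝ 2 ν := (memLp_const (1 : ℝ)).toLp (fun _ : Y => (1 : ℝ))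
    refine Integrable.mono' (hG.norm.mul_const ‖o‖) hf.norm.integral_prod_right' ?_
    refine ae_of_all _ fun θ => ?_
    rw [Real.norm_of_nonneg (integral_nonneg fun y => norm_nonneg _)]
    have e : ∫ y, ‖Function.uncurry f (θ, y)‖ ∂ν = inner ℝ |G θ| o := by
      rw [L2.inner_def]
      refine integral_congr_ae ?_
      filter_upwards [hGf θ, (memLp_const (1 : ℝ)).coeFn_toLp (μ := ν), Lp.coeFn_abs (G θ)]
        with y h1 h2 h3
      rw [h3, h1]
      have : o y = 1 := h2
      simp [this]
    rw [e]
    refine (real_inner_le_norm _ _).trans (by rw [norm_abs_eq_norm])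
  refine Integrable.ae_eq_of_forall_setIntegral_eq _ _ ((Lp.memLp _).integrable one_le_two)
    hinteg.integral_prod_right fun s hs _ => ?_
  let c : Lp ℝ 2 ν := (memLp_indicator_const 2 hs (1 : ℝ) (Or.inr (measure_ne_top ν s))).toLp _
  have hc : c =ᵐ[ν] s.indicator fun _ => (1 : ℝ) := MemLp.coeFn_toLp _
  have key : ∀ g : Lp ℝ 2 ν, ∫ y in s, g y ∂ν = inner ℝ c g := by
    intro g
    rw [L2.inner_def, ← integral_indicator hs]
    refine integral_congr_ae ?_
    filter_upwards [hc] with y hy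
    by_cases h : y ∈ s <;> simp [hy, h]
  rw [key, ← integral_inner hG]
  have hinteg_s : Integrable (Function.uncurry f) (π.prod (ν.restrict s)) := by
    have e : π.prod (ν.restrict s) = (π.prod ν).restrict (Set.univ ×ˢ s) := by
      rw [← Measure.prod_restrict, Measure.restrict_univ]
    rw [e]
    exact hinteg.restrict
  rw [← integral_integral_swap hinteg_s]
  refine integral_congr_ae (ae_of_all _ fun θ => ?_)
  simp only
  rw [← key]
  exact integral_congr_ae (ae_restrict_of_ae (hGf θ))

end DGM

end

noncomputable section

namespace DGM

/-! ### Jets of functions depending on parameters -/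

section Param

variable {W : Type*} [NormedAddCommGroup W] [NormedSpace ℝ W] {d : ℕ}

/-- The derivative of `F` in the direction `v`. -/
def dirD (v : W) (F : W → ℝ) (p : W) : ℝ := fderiv ℝ F p v

lemma contDiff_dirD {m n : ℕ∞ω} (v : W) {F : W → ℝ} (hF : ContDiff ℝ n F) (h : m + 1 ≤ n) :
    ContDiff ℝ m (dirD v F) :=
  (hF.fderiv_right h).clm_apply contDiff_const

lemma dirD_comm {F : W → ℝ} (hF : ContDiff ℝ 2 F) (v w : W) :
    dirD v (dirD w F) = dirD w (dirD v F) := by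
  funext p
  have hs : IsSymmSndFDerivAt ℝ F p := hF.contDiffAt.isSymmSndFDerivAt (by simp)
  have hd : DifferentiableAt ℝ (fderiv ℝ F) p :=
    ((hF.fderiv_right (m := 1) (by norm_num)).differentiable (by norm_num)) p
  have key : ∀ v w : W, dirD v (dirD w F) p = fderiv ℝ (fderiv ℝ F) p v w := by
    intro v w
    unfold dirD
    rw [fderiv_clm_apply hd (differentiableAt_const w)]
    simp
  rw [key, key]
  exact hs.eq v w

lemma pd_slice {F : W × Eucl d → ℝ} (hF : Differentiable ℝ F) (θ : W) (i : Fin d) :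
    pd i (fun x => F (θ, x)) = fun x => dirD (0, bv i) F (θ, x) := by
  funext x
  have h : HasFDerivAt (fun x => F (θ, x))
      ((fderiv ℝ F (θ, x)).comp (ContinuousLinearMap.inr ℝ W (Eucl d))) x :=
    (hF (θ, x)).hasFDerivAt.comp x (hasFDerivAt_prodMk_right θ x)
  simp [pd, h.fderiv, dirD]

lemma fderiv_slice {F : W × Eucl d → ℝ} (hF : Differentiable ℝ F) (θ e : W) (x : Eucl d) :
    fderiv ℝ (fun θ => F (θ, x)) θ e = dirD (e, 0) F (θ, x) := by
  have h : HasFDerivAt (fun θ => F (θ, x))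
      ((fderiv ℝ F (θ, x)).comp (ContinuousLinearMap.inl ℝ W (Eucl d))) θ :=
    HasFDerivAt.comp (g := F) (f := fun θ => (θ, x)) θ (hF (θ, x)).hasFDerivAt
      (hasFDerivAt_prodMk_left θ x)
  simp [h.fderiv, dirD]

/-- The derivatives of `F` with respect to its second argument. -/
def sliceJet (F : W × Eucl d → ℝ) : Idx d 2 → W × Eucl d → ℝ := fun α p =>
  partialD α (fun x => F (p.1, x)) p.2

lemma sliceJet_nil {V : Type*} (F : V × Eucl d → ℝ) : sliceJet F (Idx.nil d 2) = F := by
  funext p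
  simp [sliceJet, partialD_nil]

lemma sliceJet_one {F : W × Eucl d → ℝ} (hF : Differentiable ℝ F) (i : Fin d) :
    sliceJet F (Idx.one i) = dirD (0, bv i) F := by
  funext p
  simp [sliceJet, partialD_one, pd_slice hF]

lemma contDiff_slice {n : ℕ∞ω} {F : W × Eucl d → ℝ} (hF : ContDiff ℝ n F) (θ : W) :
    ContDiff ℝ n (fun x => F (θ, x)) :=
  hF.comp (contDiff_prodMk_right θ)

lemma sliceJet_two {F : W × Eucl d → ℝ} (hF : ContDiff ℝ 2 F) (i j : Fin d) :
    sliceJet F (Idx.two i j) = dirD (0, bv i) (dirD (0, bv j) F) := by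
  funext p
  have h1 : ContDiff ℝ 1 (dirD (0, bv j) F) := contDiff_dirD _ hF (by norm_num)
  simp [sliceJet, partialD_two i j (contDiff_slice hF p.1),
    pd_slice (hF.differentiable (by norm_num)), pd_slice (h1.differentiable (by norm_num))]

lemma continuous_sliceJet {F : W × Eucl d → ℝ} (hF : ContDiff ℝ 2 F) (α : Idx d 2) :
    Continuous (sliceJet F α) := by
  induction α using Idx.cases_two with
  | h0 => rw [sliceJet_nil]; exact hF.continuous
  | h1 i =>
    rw [sliceJet_one (hF.differentiable (by norm_num))]
    exact (contDiff_dirD (m := 0) _ hF (by norm_num)).continuous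
  | h2 i j =>
    rw [sliceJet_two hF]
    exact (contDiff_dirD (m := 0) _ (contDiff_dirD (m := 1) _ hF (by norm_num))
      (by norm_num)).continuous

lemma contDiff_sliceJet {F : W × Eucl d → ℝ} (hF : ContDiff ℝ 3 F) (α : Idx d 2) :
    ContDiff ℝ 1 (sliceJet F α) := by
  induction α using Idx.cases_two with
  | h0 => rw [sliceJet_nil]; exact hF.of_le (by norm_num)
  | h1 i =>
    rw [sliceJet_one (hF.differentiable (by norm_num))]
    exact contDiff_dirD _ (hF.of_le (m := 2) (by norm_num)) (by norm_num)
  | h2 i j =>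
    rw [sliceJet_two (hF.of_le (by norm_num))]
    exact contDiff_dirD _ (contDiff_dirD (m := 2) _ hF (by norm_num)) (by norm_num)

lemma dirD_sliceJet {F : W × Eucl d → ℝ} (hF : ContDiff ℝ 3 F) (e : W) (α : Idx d 2) :
    dirD (e, 0) (sliceJet F α) = sliceJet (dirD (e, 0) F) α := by
  have h2 : ContDiff ℝ 2 F := hF.of_le (by norm_num)
  have hd : Differentiable ℝ F := hF.differentiable (by norm_num)
  have he : ContDiff ℝ 2 (dirD (e, 0) F) := contDiff_dirD _ hF (by norm_num)
  induction α using Idx.cases_two with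
  | h0 => rw [sliceJet_nil, sliceJet_nil]
  | h1 i =>
    rw [sliceJet_one hd, sliceJet_one (he.differentiable (by norm_num)), dirD_comm h2]
  | h2 i j =>
    have hj : ContDiff ℝ 2 (dirD (0, bv j) F) := contDiff_dirD _ hF (by norm_num)
    rw [sliceJet_two h2, sliceJet_two he, dirD_comm hj, dirD_comm h2]

/-- Parameter derivatives commute with a differential operator in the space variable. -/
lemma fderiv_opAclassical {F : W × Eucl d → ℝ} (hF : ContDiff ℝ 3 F)
    (a : Idx d 2 → Eucl d → ℝ) (θ e : W) (x : Eucl d) :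
    fderiv ℝ (fun θ => opAclassical a (fun y => F (θ, y)) x) θ e
      = opAclassical a (fun y => dirD (e, 0) F (θ, y)) x := by
  have hs : ∀ α, Differentiable ℝ (sliceJet F α) := fun α =>
    (contDiff_sliceJet hF α).differentiable (by norm_num)
  have hd : ∀ α, DifferentiableAt ℝ (fun θ => sliceJet F α (θ, x)) θ := fun α =>
    (hs α).comp (differentiable_id.prodMk (differentiable_const x)) θ
  have h1 : (fun θ => opAclassical a (fun y => F (θ, y)) x)
      = fun θ => ∑ α, a α x * sliceJet F α (θ, x) := rfl
  rw [h1, fderiv_fun_sum fun α _ => (hd α).const_mul (a α x), sum_apply]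
  refine Finset.sum_congr rfl fun α _ => ?_
  rw [fderiv_const_mul (hd α)]
  simp only [FunLike.coe_smul, Pi.smul_apply, smul_eq_mul]
  rw [fderiv_slice (hs α), dirD_sliceJet hF]
  rfl

end Param

end DGM

end

noncomputable section

namespace DGM

/-! ### Derivatives of the network with respect to its parameters -/

lemma partialD_add {d : ℕ} {f g : Eucl d → ℝ} (hf : ContDiff ℝ 2 f) (hg : ContDiff ℝ 2 g)
    (α : Idx d 2) (x : Eucl d) :
    partialD α (fun y => f y + g y) x = partialD α f x + partialD α g x := by
  have hα : ((α.1 : ℕ) : ℕ∞ω) ≤ ((2 : ℕ) : ℕ∞ω) :=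
    Nat.cast_le.mpr (Nat.lt_succ_iff.mp α.1.2)
  have h := iteratedFDeriv_add_apply (𝕜 := ℝ) (hf.of_le hα).contDiffAt (hg.of_le hα).contDiffAt
    (x := x)
  simp only [partialD]
  rw [show (fun y => f y + g y) = f + g from rfl, h]
  rfl

lemma abs_partialD_mul_le {d : ℕ} {f g : Eucl d → ℝ} (hf : ContDiff ℝ 2 f)
    (hg : ContDiff ℝ 2 g) {x : Eucl d} {A B : ℝ} (hA : ∀ α : Idx d 2, |partialD α f x| ≤ A)
    (hB : ∀ α : Idx d 2, |partialD α g x| ≤ B) (α : Idx d 2) :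
    |partialD α (fun y => f y * g y) x| ≤ 4 * (A * B) := by
  have hA0 : 0 ≤ A := (abs_nonneg _).trans (hA (Idx.nil d 2))
  have hB0 : 0 ≤ B := (abs_nonneg _).trans (hB (Idx.nil d 2))
  have hp : ∀ s t : ℝ, |s| ≤ A → |t| ≤ B → |s * t| ≤ A * B := fun s t hs ht => by
    rw [abs_mul]
    exact mul_le_mul hs ht (abs_nonneg _) hA0
  have hAB : 0 ≤ A * B := mul_nonneg hA0 hB0
  have f0 : |f x| ≤ A := by simpa [partialD_nil] using hA (Idx.nil d 2)
  have g0 : |g x| ≤ B := by simpa [partialD_nil] using hB (Idx.nil d 2)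
  have f1 : ∀ i, |pd i f x| ≤ A := fun i => by simpa [partialD_one] using hA (Idx.one i)
  have g1 : ∀ i, |pd i g x| ≤ B := fun i => by simpa [partialD_one] using hB (Idx.one i)
  have f2 : ∀ i j, |pd i (pd j f) x| ≤ A := fun i j => by
    simpa [partialD_two i j hf] using hA (Idx.two i j)
  have g2 : ∀ i j, |pd i (pd j g) x| ≤ B := fun i j => by
    simpa [partialD_two i j hg] using hB (Idx.two i j)
  induction α using Idx.cases_two with
  | h0 =>
    rw [partialD_nil]
    linarith [hp _ _ f0 g0]
  | h1 i =>
    rw [partialD_one, pd_mul i (hf.differentiable two_ne_zero x) (hg.differentiable two_ne_zero x)]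
    linarith [abs_add_le (pd i f x * g x) (f x * pd i g x), hp _ _ (f1 i) g0, hp _ _ f0 (g1 i)]
  | h2 i j =>
    rw [partialD_two i j (hf.mul hg), pd_pd_mul i j hf hg]
    have t1 := hp _ _ (f2 i j) g0
    have t2 := hp _ _ (f1 j) (g1 i)
    have t3 := hp _ _ (f1 i) (g1 j)
    have t4 := hp _ _ f0 (g2 i j)
    rw [abs_le] at *
    constructor <;> linarith [t1.1, t1.2, t2.1, t2.2, t3.1, t3.2, t4.1, t4.2]

lemma abs_partialD_comp_affine_le {d : ℕ} {g : ℝ → ℝ} (hg : ContDiff ℝ 2 g) {M : ℝ}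
    (hM : ∀ j ≤ 2, ∀ y, |iteratedDeriv j g y| ≤ M) (w : Eucl d) (b : ℝ) (x : Eucl d)
    (α : Idx d 2) :
    |partialD α (fun x => g (inner ℝ w x + b)) x| ≤ M * (1 + ‖w‖) ^ 2 := by
  have hM0 : 0 ≤ M := (abs_nonneg _).trans (hM 0 (by norm_num) 0)
  have h0 : ∀ y, |g y| ≤ M := fun y => by simpa using hM 0 (by norm_num) y
  have h1 : ∀ y, |deriv g y| ≤ M := fun y => by simpa using hM 1 (by norm_num) y
  have h2 : ∀ y, |deriv (deriv g) y| ≤ M := fun y => by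
    have := hM 2 le_rfl y
    rwa [iteratedDeriv_succ, iteratedDeriv_one] at this
  have hw : ∀ i, |w i| ≤ ‖w‖ := fun i => PiLp.norm_apply_le w i
  have hn := norm_nonneg w
  have hd : Differentiable ℝ g := hg.differentiable two_ne_zero
  have hd' : Differentiable ℝ (deriv g) :=
    ((contDiff_succ_iff_deriv (n := 1)).mp hg).2.2.differentiable one_ne_zero
  induction α using Idx.cases_two with
  | h0 =>
    rw [partialD_nil]
    nlinarith [h0 (inner ℝ w x + b), mul_nonneg hM0 hn, mul_nonneg (mul_nonneg hM0 hn) hn]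
  | h1 i =>
    rw [partialD_one, pd_comp_affine hd, abs_mul]
    have := mul_le_mul (hw i) (h1 (inner ℝ w x + b)) (abs_nonneg _) hn
    nlinarith [mul_nonneg hM0 hn, mul_nonneg (mul_nonneg hM0 hn) hn]
  | h2 i j =>
    rw [partialD_two i j (contDiff_comp_affine hg w b), pd_comp_affine hd]
    have e : pd i (fun x => w j * deriv g (inner ℝ w x + b)) x
        = w j * (w i * deriv (deriv g) (inner ℝ w x + b)) := by
      have h3 := pd_comp_affine hd' w b i
      have h4 : DifferentiableAt ℝ (fun x => deriv g (inner ℝ w x + b)) x :=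
        (hd'.comp ((contDiff_const.inner ℝ contDiff_id).add
          contDiff_const |>.differentiable one_ne_zero)) x
      rw [pd, fderiv_const_mul h4]
      have h5 := congrFun h3 x
      rw [pd] at h5
      simp [h5]
    rw [e, abs_mul, abs_mul]
    have h3 := mul_le_mul (hw i) (h2 (inner ℝ w x + b)) (abs_nonneg _) hn
    have h4 := mul_le_mul (hw j) h3 (by positivity) hn
    nlinarith [mul_nonneg hM0 hn, mul_nonneg (mul_nonneg hM0 hn) hn]

/-- The derivative of `η(x) c σ(w · x + b)` with respect to `(c, w, b)` in the direction `e`. -/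
def feature {d : ℕ} (η : Eucl d → ℝ) (σ : ℝ → ℝ) (e : Param d) (p : Param d × Eucl d) : ℝ :=
  dirD (e, 0) (fun p : Param d × Eucl d => neuron η σ p.1 p.2) p

lemma contDiff_neuron {d : ℕ} {η : Eucl d → ℝ} {σ : ℝ → ℝ} {n : ℕ∞ω} (hη : ContDiff ℝ n η)
    (hσ : ContDiff ℝ n σ) :
    ContDiff ℝ n (fun p : Param d × Eucl d => neuron η σ p.1 p.2) := by
  unfold neuron
  refine (hη.comp contDiff_snd).mul (contDiff_fst.fst.mul (hσ.comp ?_))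
  exact (contDiff_fst.snd.fst.inner ℝ contDiff_snd).add contDiff_fst.snd.snd

lemma feature_eq {d : ℕ} {η : Eucl d → ℝ} {σ : ℝ → ℝ} (hη : Differentiable ℝ η)
    (hσ : Differentiable ℝ σ) (e θ : Param d) (x : Eucl d) :
    feature η σ e (θ, x) = η x * (e.1 * σ (inner ℝ θ.2.1 x + θ.2.2)
      + (inner ℝ e.2.1 x + e.2.2) * (θ.1 * deriv σ (inner ℝ θ.2.1 x + θ.2.2))) := by
  have hN : Differentiable ℝ (fun p : Param d × Eucl d => neuron η σ p.1 p.2) := by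
    unfold neuron
    refine (hη.comp differentiable_snd).mul (differentiable_fst.fst.mul (hσ.comp ?_))
    exact (differentiable_fst.snd.fst.inner ℝ differentiable_snd).add differentiable_fst.snd.snd
  rw [feature, ← fderiv_slice hN]
  have hs : HasFDerivAt (fun θ : Param d => inner ℝ θ.2.1 x + θ.2.2)
      (((innerSL ℝ x).comp ((ContinuousLinearMap.fst ℝ (Eucl d) ℝ).comp
        (ContinuousLinearMap.snd ℝ ℝ (Eucl d × ℝ))))
        + (ContinuousLinearMap.snd ℝ (Eucl d) ℝ).comp
          (ContinuousLinearMap.snd ℝ ℝ (Eucl d × ℝ))) θ := by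
    have := (((innerSL ℝ x).comp ((ContinuousLinearMap.fst ℝ (Eucl d) ℝ).comp
        (ContinuousLinearMap.snd ℝ ℝ (Eucl d × ℝ))))
        + (ContinuousLinearMap.snd ℝ (Eucl d) ℝ).comp
          (ContinuousLinearMap.snd ℝ ℝ (Eucl d × ℝ))).hasFDerivAt (x := θ)
    convert this using 1
    funext θ
    simp [real_inner_comm]
  have h1 := (hσ (inner ℝ θ.2.1 x + θ.2.2)).hasDerivAt.comp_hasFDerivAt θ hs
  have h2 := ((hasFDerivAt_fst (𝕜 := ℝ) (p := θ)).mul h1).const_mul (η x)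
  have h3 : fderiv ℝ (fun θ : Param d => neuron η σ θ x) θ = _ := h2.fderiv
  rw [h3]
  simp [real_inner_comm]
  ring

lemma contDiff_feature {d : ℕ} {η : Eucl d → ℝ} {σ : ℝ → ℝ} (hη : ContDiff ℝ 3 η)
    (hσ : ContDiff ℝ 3 σ) (e : Param d) : ContDiff ℝ 2 (feature η σ e) :=
  contDiff_dirD _ (contDiff_neuron hη hσ) (by norm_num)

lemma exists_abs_partialD_feature_le {d : ℕ} {Ω : Set (Eucl d)} (hΩb : Bornology.IsBounded Ω)
    {η : Eucl d → ℝ} {σ : ℝ → ℝ} (hη : ContDiff ℝ 3 η) (hσ : IsCkb 4 σ) (e : Param d) (K : ℝ) :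
    ∃ C : ℝ, 0 ≤ C ∧ ∀ θ : Param d, |θ.1| ≤ K → ∀ α : Idx d 2, ∀ x ∈ Ω,
      |partialD α (fun x => feature η σ e (θ, x)) x| ≤ C * (1 + ‖θ.2.1‖) ^ 2 := by
  have hη2 : ContDiff ℝ 2 η := hη.of_le (by norm_num)
  have hσ2 : ContDiff ℝ 2 σ := hσ.1.of_le (by norm_num)
  have hσ' : ContDiff ℝ 2 (deriv σ) := (contDiff_succ_iff_deriv (n := 2)).mp
    (hσ.1.of_le (by norm_num)) |>.2.2
  obtain ⟨M, hM0, hM⟩ := hσ.exists_bound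
  have bd : ∀ p : Eucl d → ℝ, ContDiff ℝ 2 p → ∃ B : ℝ, 0 ≤ B ∧
      ∀ α : Idx d 2, ∀ x ∈ Ω, |partialD α p x| ≤ B := by
    intro p hp
    choose B hB0 hB using fun α : Idx d 2 => exists_bound_on hΩb (continuous_partialD hp α)
    exact ⟨∑ α, B α, Finset.sum_nonneg fun α _ => hB0 α, fun α x hx =>
      (hB α x hx).trans (Finset.single_le_sum (fun α _ => hB0 α) (Finset.mem_univ α))⟩
  have hp1 : ContDiff ℝ 2 (fun x => e.1 * η x) := contDiff_const.mul hη2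
  have hp2 : ContDiff ℝ 2 (fun x => η x * (inner ℝ e.2.1 x + e.2.2)) :=
    hη2.mul ((contDiff_const.inner ℝ contDiff_id).add contDiff_const)
  obtain ⟨B1, hB10, hB1⟩ := bd _ hp1
  obtain ⟨B2, hB20, hB2⟩ := bd _ hp2
  refine ⟨4 * (B1 * M) + 4 * (B2 * (|K| * M)), by positivity, fun θ hθ α x hx => ?_⟩
  have hg : ContDiff ℝ 2 (fun y => θ.1 * deriv σ y) := contDiff_const.mul hσ'
  have hgM : ∀ j ≤ 2, ∀ y, |iteratedDeriv j (fun y => θ.1 * deriv σ y) y| ≤ |K| * M := by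
    intro j hj y
    rw [iteratedDeriv_const_mul_field, abs_mul, ← iteratedDeriv_succ']
    exact mul_le_mul (hθ.trans (le_abs_self K)) (hM _ (by omega) y) (abs_nonneg _) (abs_nonneg _)
  have e1 : (fun x => feature η σ e (θ, x)) = fun x =>
      (e.1 * η x) * σ (inner ℝ θ.2.1 x + θ.2.2)
        + (η x * (inner ℝ e.2.1 x + e.2.2)) * (fun y => θ.1 * deriv σ y)
          (inner ℝ θ.2.1 x + θ.2.2) := by
    funext x
    rw [feature_eq (hη.differentiable (by norm_num)) (hσ2.differentiable two_ne_zero)]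
    ring
  rw [e1, partialD_add (hp1.mul (contDiff_comp_affine hσ2 _ _))
    (hp2.mul (contDiff_comp_affine hg _ _))]
  have t1 := abs_partialD_mul_le hp1 (contDiff_comp_affine hσ2 θ.2.1 θ.2.2)
    (fun α => hB1 α x hx) (abs_partialD_comp_affine_le hσ2 (fun j hj => hM j (by omega)) _ _ x) α
  have t2 := abs_partialD_mul_le hp2 (contDiff_comp_affine hg θ.2.1 θ.2.2)
    (fun α => hB2 α x hx) (abs_partialD_comp_affine_le hg hgM _ _ x) α
  refine (abs_add_le _ _).trans ((add_le_add t1 t2).trans (le_of_eq (by ring)))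

end DGM

end

noncomputable section

namespace DGM

/-! ### The parameter derivatives as random elements of `H²_{(0)}(Ω)` -/

lemma norm_L2_le {d : ℕ} {Ω : Set (Eucl d)} (hΩ : IsOpen Ω) (hΩb : Bornology.IsBounded Ω)
    {f : L2 Ω} {g : Eucl d → ℝ} (hfg : f =ᵐ[volume.restrict Ω] g) {C : ℝ} (hC : 0 ≤ C)
    (hg : ∀ x ∈ Ω, |g x| ≤ C) : ‖f‖ ≤ (measureUnivNNReal (volume.restrict Ω) : ℝ) ^ (2 : ℝ)⁻¹ * C := by
  have := volume_restrict_finite hΩb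
  have h := Lp.norm_le_of_ae_bound (p := 2) (f := f) hC (by
    filter_upwards [hfg, ae_restrict_mem hΩ.measurableSet] with x hx hxΩ
    rw [hx]
    exact hg x hxΩ)
  simpa using h

lemma continuous_L2_of_continuous {d : ℕ} {Ω : Set (Eucl d)} (hΩ : IsOpen Ω)
    (hΩb : Bornology.IsBounded Ω) {X : Type*} [TopologicalSpace X] {F : X × Eucl d → ℝ}
    (hF : Continuous F) {G : X → L2 Ω}
    (hG : ∀ θ, G θ =ᵐ[volume.restrict Ω] fun x => F (θ, x)) : Continuous G := by
  have hK : CompactSpace (closure Ω) := isCompact_iff_compactSpace.mp hΩb.isCompact_closure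
  let f : C(X × closure Ω, ℝ) := ⟨fun p => F (p.1, p.2.1), by fun_prop⟩
  have hc : Continuous f.curry := f.curry.continuous
  set D : ℝ := (measureUnivNNReal (volume.restrict Ω) : ℝ) ^ (2 : ℝ)⁻¹ with hD
  have hdist : ∀ θ θ', dist (G θ) (G θ') ≤ D * dist (f.curry θ) (f.curry θ') := by
    intro θ θ'
    rw [dist_eq_norm]
    refine norm_L2_le hΩ hΩb (g := fun x => F (θ, x) - F (θ', x)) ?_ dist_nonneg fun x hx => ?_
    · filter_upwards [Lp.coeFn_sub (G θ) (G θ'), hG θ, hG θ'] with x h1 h2 h3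
      rw [h1, Pi.sub_apply, h2, h3]
    · have := ContinuousMap.dist_apply_le_dist (f := f.curry θ) (g := f.curry θ')
        ⟨x, subset_closure hx⟩
      exact this
  refine continuous_iff_continuousAt.mpr fun θ₀ => ?_
  refine tendsto_iff_dist_tendsto_zero.mpr ?_
  have h0 : Tendsto (fun θ => D * dist (f.curry θ) (f.curry θ₀)) (𝓝 θ₀) (𝓝 0) := by
    have := ((hc.tendsto θ₀).dist (tendsto_const_nhds (x := f.curry θ₀))).const_mul D
    simpa using this
  exact squeeze_zero (fun _ => dist_nonneg) (fun θ => hdist θ θ₀) h0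

lemma contDiff_feature_slice {d : ℕ} {Ω : Set (Eucl d)} {η : Eucl d → ℝ} {σ : ℝ → ℝ}
    (hη : IsAuxiliary Ω η) (hσ : IsCkb 4 σ) (e θ : Param d) :
    ContDiff ℝ 2 (fun x => feature η σ e (θ, x)) :=
  contDiff_slice (contDiff_feature hη.smooth.1 (hσ.1.of_le (by norm_num)) e) θ

lemma cjet_feature_mem_H20 {d : ℕ} {Ω : Set (Eucl d)} (hΩ : IsOpen Ω)
    (hΩb : Bornology.IsBounded Ω) {η : Eucl d → ℝ} {σ : ℝ → ℝ} (hη : IsAuxiliary Ω η)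
    (hσ : IsCkb 4 σ) (e θ : Param d) :
    cjet hΩb _ (contDiff_feature_slice hη hσ e θ) ∈ H20 Ω := by
  have hη' : Differentiable ℝ η := hη.smooth.1.differentiable (by norm_num)
  have hσ1 : ContDiff ℝ 2 σ := hσ.1.of_le (by norm_num)
  have hσ2 : ContDiff ℝ 2 (deriv σ) := (contDiff_succ_iff_deriv (n := 2)).mp
    (hσ.1.of_le (by norm_num)) |>.2.2
  have hm : ContDiff ℝ 2 (fun x : Eucl d => e.1 * σ (inner ℝ θ.2.1 x + θ.2.2)
      + (inner ℝ e.2.1 x + e.2.2) * (θ.1 * deriv σ (inner ℝ θ.2.1 x + θ.2.2))) :=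
    (contDiff_const.mul (contDiff_comp_affine hσ1 _ _)).add
      (((contDiff_const.inner ℝ contDiff_id).add contDiff_const).mul
        (contDiff_const.mul (contDiff_comp_affine hσ2 _ _)))
  have he := funext (feature_eq hη' (hσ1.differentiable two_ne_zero) e θ)
  have hηm := contDiff_feature_slice hη hσ e θ
  have key := cjet_mul_mem_H20 hΩ hΩb hη hm (by rw [← he]; exact hηm)
  convert key using 2

/-- The jet of `feature η σ e (θ, ·)`, as an element of `H²_{(0)}(Ω)`. -/
def featureJet {d : ℕ} {Ω : Set (Eucl d)} (hΩ : IsOpen Ω)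
    (hΩb : Bornology.IsBounded Ω) {η : Eucl d → ℝ} {σ : ℝ → ℝ} (hη : IsAuxiliary Ω η)
    (hσ : IsCkb 4 σ) (e θ : Param d) : H20 Ω :=
  ⟨_, cjet_feature_mem_H20 hΩ hΩb hη hσ e θ⟩

lemma IsInitLaw.integrable_moment {d : ℕ} {π : Measure (Param d)} (hπ : IsInitLaw π) :
    Integrable (fun θ : Param d => (1 + ‖θ.2.1‖) ^ 4) π := by
  have := hπ.prob
  have h1 : ∀ i, MemLp (fun θ : Param d => θ.2.1 i) 4 π := by
    intro i
    have hc : Continuous (fun θ : Param d => θ.2.1 i) := by fun_prop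
    have h := hπ.w_moment i
    rw [← integrable_norm_rpow_iff hc.aestronglyMeasurable (by norm_num) (by norm_num)]
    refine h.congr (ae_of_all _ fun θ => ?_)
    beta_reduce
    rw [Real.norm_eq_abs, show (4 : ℝ≥0∞).toReal = ((4 : ℕ) : ℝ) by simp, Real.rpow_natCast]
  have h2 : MemLp (fun θ : Param d => 1 + ∑ i, |θ.2.1 i|) 4 π :=
    (memLp_const (1 : ℝ)).add (memLp_finsetSum _ fun i _ => (h1 i).abs)
  have h3 : MemLp (fun θ : Param d => 1 + ‖θ.2.1‖) 4 π := by
    refine h2.mono (by fun_prop : Continuous fun θ : Param d =>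
      1 + ‖θ.2.1‖).aestronglyMeasurable (ae_of_all _ fun θ => ?_)
    have hle : ‖θ.2.1‖ ≤ ∑ i, |θ.2.1 i| := by
      conv_lhs => rw [← (EuclideanSpace.basisFun (Fin d) ℝ).sum_repr θ.2.1]
      refine (norm_sum_le _ _).trans (Finset.sum_le_sum fun i _ => ?_)
      simp [norm_smul]
    have h0 := norm_nonneg θ.2.1
    rw [Real.norm_of_nonneg (by positivity), Real.norm_of_nonneg (by linarith)]
    linarith
  have h3' : MemLp (fun θ : Param d => 1 + ‖θ.2.1‖) ((4 : ℕ) : ℝ≥0∞) π := by exact_mod_cast h3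
  have h4 := h3'.integrable_norm_pow four_ne_zero
  refine h4.congr (ae_of_all _ fun θ => ?_)
  have : 0 ≤ 1 + ‖θ.2.1‖ := by positivity
  simp only [Real.norm_of_nonneg this]

section Feature

variable {d : ℕ} {Ω : Set (Eucl d)} (hΩ : IsOpen Ω) (hΩb : Bornology.IsBounded Ω)
  {η : Eucl d → ℝ} {σ : ℝ → ℝ} (hη : IsAuxiliary Ω η) (hσ : IsCkb 4 σ)

lemma coeFn_featureJet (e θ : Param d) (α : Idx d 2) :
    (featureJet hΩ hΩb hη hσ e θ : Jet Ω 2) α =ᵐ[volume.restrict Ω]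
      fun x => sliceJet (feature η σ e) α (θ, x) :=
  coeFn_cjet hΩb (contDiff_feature_slice hη hσ e θ) α

lemma continuous_featureJet (e : Param d) : Continuous (featureJet hΩ hΩb hη hσ e) := by
  refine Continuous.subtype_mk ?_ _
  refine (PiLp.continuous_toLp 2 _).comp (continuous_pi fun α => ?_)
  exact continuous_L2_of_continuous hΩ hΩb (continuous_sliceJet
    (contDiff_feature hη.smooth.1 (hσ.1.of_le (by norm_num)) e) α)
    fun θ => coeFn_featureJet hΩ hΩb hη hσ e θ α

lemma exists_norm_featureJet_le (e : Param d) (K : ℝ) : ∃ C : ℝ, 0 ≤ C ∧ ∀ θ : Param d,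
    |θ.1| ≤ K → ‖featureJet hΩ hΩb hη hσ e θ‖ ≤ C * (1 + ‖θ.2.1‖) ^ 2 := by
  obtain ⟨C, hC0, hC⟩ := exists_abs_partialD_feature_le hΩb hη.smooth.1 hσ e K
  set D : ℝ := (measureUnivNNReal (volume.restrict Ω) : ℝ) ^ (2 : ℝ)⁻¹ with hD
  have hD0 : 0 ≤ D := by positivity
  refine ⟨Fintype.card (Idx d 2) * (D * C), by positivity, fun θ hθ => ?_⟩
  have := norm_jet_le (v := (featureJet hΩ hΩb hη hσ e θ : Jet Ω 2))
    (B := D * (C * (1 + ‖θ.2.1‖) ^ 2)) fun α =>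
      norm_L2_le hΩ hΩb (coeFn_featureJet hΩ hΩb hη hσ e θ α) (by positivity) (hC θ hθ α)
  refine this.trans (le_of_eq (by ring))

lemma memLp_featureJet {π : Measure (Param d)} (hπ : IsInitLaw π) (e : Param d) :
    MemLp (featureJet hΩ hΩb hη hσ e) 2 π := by
  obtain ⟨K, hK⟩ := hπ.c_bdd
  obtain ⟨C, hC0, hC⟩ := exists_norm_featureJet_le hΩ hΩb hη hσ e K
  have := secondCountableTopologyEither_of_left (Param d) (H20 Ω)
  have hm : AEStronglyMeasurable (featureJet hΩ hΩb hη hσ e) π :=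
    (continuous_featureJet hΩ hΩb hη hσ e).aestronglyMeasurable
  refine (memLp_two_iff_integrable_sq_norm hm).mpr ?_
  refine (hπ.integrable_moment.const_mul (C ^ 2)).mono' (hm.norm.pow 2) ?_
  filter_upwards [hK] with θ hθ
  rw [Real.norm_of_nonneg (by positivity)]
  exact (pow_le_pow_left₀ (norm_nonneg _) (hC θ hθ.le) 2).trans (le_of_eq (by ring))

end Feature

end DGM

end

noncomputable section

namespace DGM

/-! ### The limit kernel through the parameter derivatives -/

/-- The coordinate directions of the parameter space. -/
def coordDir (d : ℕ) : Unit ⊕ Fin d ⊕ Unit → Param d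
  | .inl _ => (1, 0, 0)
  | .inr (.inl i) => (0, EuclideanSpace.single i 1, 0)
  | .inr (.inr _) => (0, 0, 1)

lemma gradDot_eq_sum {d : ℕ} (F G : Param d → ℝ) (θ : Param d) :
    gradDot F G θ = ∑ k, fderiv ℝ F θ (coordDir d k) * fderiv ℝ G θ (coordDir d k) := by
  simp [gradDot, coordDir, Fintype.sum_sum_type, add_assoc]

section Kernel

variable {d : ℕ} {Ω : Set (Eucl d)} (hΩ : IsOpen Ω) (hΩb : Bornology.IsBounded Ω)
  {η : Eucl d → ℝ} {σ : ℝ → ℝ} (hη : IsAuxiliary Ω η) (hσ : IsCkb 4 σ)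
  {μ : Measure (Eucl d)} {a : Idx d 2 → Eucl d → ℝ} {π : Measure (Param d)}

lemma kernelU_eq
    (hη : IsAuxiliary Ω η) (hσ : IsCkb 4 σ)
    (x y : Eucl d) :
    kernelU a η σ π x y = ∫ θ, ∑ k, opAclassical a (fun z => feature η σ (coordDir d k) (θ, z)) x
      * feature η σ (coordDir d k) (θ, y) ∂π := by
  have hN : ContDiff ℝ 3 (fun p : Param d × Eucl d => neuron η σ p.1 p.2) :=
    contDiff_neuron hη.smooth.1 (hσ.1.of_le (by norm_num))
  unfold kernelU
  refine integral_congr_ae (ae_of_all _ fun θ => ?_)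
  beta_reduce
  rw [gradDot_eq_sum]
  refine Finset.sum_congr rfl fun k _ => ?_
  congr 1
  · exact fderiv_opAclassical hN a θ (coordDir d k) x
  · exact fderiv_slice (hN.differentiable (by norm_num)) θ (coordDir d k) y

lemma opA_featureJet (e θ : Param d) :
    opA a (featureJet hΩ hΩb hη hσ e θ : Jet Ω 2) =ᵐ[volume.restrict Ω]
      opAclassical a (fun z => feature η σ e (θ, z)) := by
  have h : ∀ᵐ x ∂(volume.restrict Ω), ∀ α, (featureJet hΩ hΩb hη hσ e θ : Jet Ω 2) α x
      = sliceJet (feature η σ e) α (θ, x) :=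
    ae_all_iff.mpr fun α => coeFn_featureJet hΩ hΩb hη hσ e θ α
  filter_upwards [h] with x hx
  simp only [opA, hx]
  rfl

section Adjoint

variable {A : H20 Ω →L[ℝ] Lp ℝ 2 μ}

lemma coeFn_apply_featureJet
    (hμ : IsSamplingMeasure Ω μ) (hA : ∀ v : H20 Ω, A v =ᵐ[μ] opA a (v : Jet Ω 2))
    (e θ : Param d) :
    A (featureJet hΩ hΩb hη hσ e θ) =ᵐ[μ] opAclassical a (fun z => feature η σ e (θ, z)) :=
  (hA _).trans (hμ.ac.ae_eq (opA_featureJet hΩ hΩb hη hσ e θ))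

lemma inner_featureJet_adjoint
    (hμ : IsSamplingMeasure Ω μ) (hA : ∀ v : H20 Ω, A v =ᵐ[μ] opA a (v : Jet Ω 2))
    (f : Lp ℝ 2 μ) (e θ : Param d) :
    inner ℝ (featureJet hΩ hΩb hη hσ e θ) (A.adjoint f)
      = ∫ x, f x * opAclassical a (fun z => feature η σ e (θ, z)) x ∂μ := by
  rw [ContinuousLinearMap.adjoint_inner_right, L2.inner_def]
  refine integral_congr_ae ?_
  filter_upwards [coeFn_apply_featureJet hΩ hΩb hη hσ hμ hA e θ] with x hx
  simp [hx]

lemma integrable_mul_opAclassical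
    (hΩ : IsOpen Ω) (hΩb : Bornology.IsBounded Ω) (hη : IsAuxiliary Ω η) (hσ : IsCkb 4 σ)
    (hμ : IsSamplingMeasure Ω μ) (hA : ∀ v : H20 Ω, A v =ᵐ[μ] opA a (v : Jet Ω 2))
    (f : Lp ℝ 2 μ) (e θ : Param d) :
    Integrable (fun x => f x * opAclassical a (fun z => feature η σ e (θ, z)) x) μ := by
  have h := (Lp.memLp f).integrable_mul (Lp.memLp (A (featureJet hΩ hΩb hη hσ e θ)))
  refine h.congr ?_
  filter_upwards [coeFn_apply_featureJet hΩ hΩb hη hσ hμ hA e θ] with x hx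
  simp [hx]

lemma integral_norm_mul_opAclassical_le
    (hμ : IsSamplingMeasure Ω μ) (hA : ∀ v : H20 Ω, A v =ᵐ[μ] opA a (v : Jet Ω 2))
    (f : Lp ℝ 2 μ) (e θ : Param d) :
    ∫ x, ‖f x * opAclassical a (fun z => feature η σ e (θ, z)) x‖ ∂μ
      ≤ ‖f‖ * (‖A‖ * ‖featureJet hΩ hΩb hη hσ e θ‖) := by
  have e1 : ∫ x, ‖f x * opAclassical a (fun z => feature η σ e (θ, z)) x‖ ∂μ
      = inner ℝ |f| |A (featureJet hΩ hΩb hη hσ e θ)| := by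
    rw [L2.inner_def]
    refine integral_congr_ae ?_
    filter_upwards [coeFn_apply_featureJet hΩ hΩb hη hσ hμ hA e θ, Lp.coeFn_abs f,
      Lp.coeFn_abs (A (featureJet hΩ hΩb hη hσ e θ))] with x hx h1 h2
    rw [h1, h2, hx]
    simp [mul_comm]
  rw [e1]
  refine (real_inner_le_norm _ _).trans ?_
  rw [norm_abs_eq_norm, norm_abs_eq_norm]
  exact mul_le_mul_of_nonneg_left (A.le_opNorm _) (norm_nonneg _)

lemma integrable_kernel
    (hΩ : IsOpen Ω) (hΩb : Bornology.IsBounded Ω) (hη : IsAuxiliary Ω η) (hσ : IsCkb 4 σ)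
    (hμ : IsSamplingMeasure Ω μ) (ha : ∀ α, AEMeasurable (a α) (volume.restrict Ω))
    (hπ : IsInitLaw π) (hA : ∀ v : H20 Ω, A v =ᵐ[μ] opA a (v : Jet Ω 2))
    (f : Lp ℝ 2 μ) (e : Param d) {y : Eucl d} (hy : y ∈ Ω) :
    Integrable (fun p : Eucl d × Param d => f p.1
      * (opAclassical a (fun z => feature η σ e (p.2, z)) p.1 * feature η σ e (p.2, y)))
      (μ.prod π) := by
  have := hμ.finite
  have := hπ.prob
  have hF : ContDiff ℝ 2 (feature η σ e) :=
    contDiff_feature hη.smooth.1 (hσ.1.of_le (by norm_num)) e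
  have hm : AEStronglyMeasurable (fun p : Eucl d × Param d => f p.1
      * (opAclassical a (fun z => feature η σ e (p.2, z)) p.1 * feature η σ e (p.2, y)))
      (μ.prod π) := by
    refine (Lp.aestronglyMeasurable f).comp_fst.mul (AEStronglyMeasurable.mul ?_ ?_)
    · refine (Finset.aemeasurable_fun_sum _ fun α _ => ?_).aestronglyMeasurable
      refine (((ha α).mono_ac hμ.ac).comp_fst).mul ?_
      exact ((continuous_sliceJet hF α).comp continuous_swap).aemeasurable
    · exact (hF.continuous.comp (by fun_prop : Continuous fun p : Eucl d × Param d =>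
        (p.2, y))).aestronglyMeasurable
  obtain ⟨K, hK⟩ := hπ.c_bdd
  obtain ⟨C, hC0, hC⟩ := exists_norm_featureJet_le hΩ hΩb hη hσ e K
  obtain ⟨D, hD0, hD⟩ := exists_abs_partialD_feature_le hΩb hη.smooth.1 hσ e K
  rw [integrable_prod_iff' hm]
  refine ⟨ae_of_all _ fun θ => ?_, ?_⟩
  · refine ((integrable_mul_opAclassical hΩ hΩb hη hσ hμ hA f e θ).mul_const
      (feature η σ e (θ, y))).congr (ae_of_all _ fun x => ?_)
    simp only
    ring
  · refine (hπ.integrable_moment.const_mul (‖f‖ * (‖A‖ * C) * D)).mono'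
      hm.norm.prod_swap.integral_prod_right' ?_
    filter_upwards [hK] with θ hθ
    rw [Real.norm_of_nonneg (integral_nonneg fun _ => norm_nonneg _)]
    have h1 := integral_norm_mul_opAclassical_le hΩ hΩb hη hσ hμ hA f e θ
    have h2 := hC θ hθ.le
    have h3 := hD θ hθ.le (Idx.nil d 2) y hy
    rw [partialD_nil] at h3
    have e1 : ∫ x, ‖f x * (opAclassical a (fun z => feature η σ e (θ, z)) x
        * feature η σ e (θ, y))‖ ∂μ
        = (∫ x, ‖f x * opAclassical a (fun z => feature η σ e (θ, z)) x‖ ∂μ)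
          * |feature η σ e (θ, y)| := by
      rw [← integral_mul_const]
      refine integral_congr_ae (ae_of_all _ fun x => ?_)
      simp only [norm_mul, Real.norm_eq_abs]
      ring
    have h4 : ‖f‖ * (‖A‖ * ‖featureJet hΩ hΩb hη hσ e θ‖)
        ≤ ‖f‖ * (‖A‖ * (C * (1 + ‖θ.2.1‖) ^ 2)) := by gcongr
    calc _ = _ := e1
      _ ≤ (‖f‖ * (‖A‖ * (C * (1 + ‖θ.2.1‖) ^ 2))) * (D * (1 + ‖θ.2.1‖) ^ 2) :=
        mul_le_mul (h1.trans h4) h3 (abs_nonneg _) (by positivity)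
      _ = _ := by ring

lemma opU_eq
    (hμ : IsSamplingMeasure Ω μ) (ha : ∀ α, AEMeasurable (a α) (volume.restrict Ω))
    (hπ : IsInitLaw π) (hA : ∀ v : H20 Ω, A v =ᵐ[μ] opA a (v : Jet Ω 2))
    (f : Lp ℝ 2 μ) {y : Eucl d} (hy : y ∈ Ω) :
    opU μ a η σ π f y = ∑ k, ∫ θ, inner ℝ (featureJet hΩ hΩb hη hσ (coordDir d k) θ)
      (A.adjoint f) * feature η σ (coordDir d k) (θ, y) ∂π := by
  have := hμ.finite
  have := hπ.prob
  have hinteg := integrable_finsetSum Finset.univ fun k (_ : k ∈ Finset.univ) =>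
    integrable_kernel hΩ hΩb hη hσ hμ ha hπ hA f (coordDir d k) hy
  have h1 : opU μ a η σ π f y = ∫ x, ∫ θ, ∑ k, f x
      * (opAclassical a (fun z => feature η σ (coordDir d k) (θ, z)) x
        * feature η σ (coordDir d k) (θ, y)) ∂π ∂μ := by
    unfold opU
    refine integral_congr_ae (ae_of_all _ fun x => ?_)
    beta_reduce
    rw [kernelU_eq hη hσ, ← integral_const_mul]
    simp only [Finset.mul_sum]
  have hk : ∀ k θ, ∫ x, f x * (opAclassical a (fun z => feature η σ (coordDir d k) (θ, z)) x
      * feature η σ (coordDir d k) (θ, y)) ∂μ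
      = inner ℝ (featureJet hΩ hΩb hη hσ (coordDir d k) θ) (A.adjoint f)
        * feature η σ (coordDir d k) (θ, y) := fun k θ => by
    rw [inner_featureJet_adjoint hΩ hΩb hη hσ hμ hA, ← integral_mul_const]
    simp only [mul_assoc]
  have hi : ∀ k θ, Integrable (fun x => f x
      * (opAclassical a (fun z => feature η σ (coordDir d k) (θ, z)) x
        * feature η σ (coordDir d k) (θ, y))) μ := fun k θ => by
    simpa only [mul_assoc] using (integrable_mul_opAclassical hΩ hΩb hη hσ hμ hA f
      (coordDir d k) θ).mul_const (feature η σ (coordDir d k) (θ, y))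
  rw [h1, integral_integral_swap hinteg, ← integral_finsetSum]
  · refine integral_congr_ae (ae_of_all _ fun θ => ?_)
    beta_reduce
    rw [integral_finsetSum _ fun k _ => hi k θ]
    exact Finset.sum_congr rfl fun k _ => hk k θ
  · intro k _
    refine (integrable_kernel hΩ hΩb hη hσ hμ ha hπ hA f
      (coordDir d k) hy).integral_prod_right.congr (ae_of_all _ fun θ => ?_)
    exact hk k θ

/-- The limit kernel acts as the covariance of the parameter derivatives composed with the adjoint
of the operator. -/
lemma coeFn_covariance_adjoint
    (hμ : IsSamplingMeasure Ω μ) (ha : ∀ α, AEMeasurable (a α) (volume.restrict Ω))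
    (hπ : IsInitLaw π) (hA : ∀ v : H20 Ω, A v =ᵐ[μ] opA a (v : Jet Ω 2))
    {S : H20 Ω →L[ℝ] H20 Ω}
    (hS : ∀ v, S v = ∑ k, ∫ θ, inner ℝ (featureJet hΩ hΩb hη hσ (coordDir d k) θ) v •
      featureJet hΩ hΩb hη hσ (coordDir d k) θ ∂π) (f : Lp ℝ 2 μ) :
    (S (A.adjoint f) : Jet Ω 2) (Idx.nil d 2) =ᵐ[volume.restrict Ω] opU μ a η σ π f := by
  have := hμ.finite
  have := hπ.prob
  have := volume_restrict_finite hΩb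
  let N : H20 Ω →L[ℝ] L2 Ω := (PiLp.proj 2 (fun _ : Idx d 2 => L2 Ω) (Idx.nil d 2)).comp
    (H20 Ω).subtypeL
  set v := A.adjoint f with hv
  have hinteg := fun k => integrable_inner_smul
    (fun k => memLp_featureJet hΩ hΩb hη hσ hπ (coordDir d k)) v k
  have hN : N (S v) = ∑ k, ∫ θ, N (inner ℝ (featureJet hΩ hΩb hη hσ (coordDir d k) θ) v •
      featureJet hΩ hΩb hη hσ (coordDir d k) θ) ∂π := by
    rw [hS, map_sum]
    exact Finset.sum_congr rfl fun k _ => (N.integral_comp_comm (hinteg k)).symm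
  have hc : ∀ k, Continuous (fun p : Param d × Eucl d =>
      inner ℝ (featureJet hΩ hΩb hη hσ (coordDir d k) p.1) v
        * feature η σ (coordDir d k) p) := fun k =>
    (((continuous_featureJet hΩ hΩb hη hσ (coordDir d k)).comp continuous_fst).inner
      continuous_const).mul (contDiff_feature hη.smooth.1 (hσ.1.of_le (by norm_num)) _).continuous
  have hk : ∀ᵐ y ∂(volume.restrict Ω), ∀ k, (∫ θ, N (inner ℝ (featureJet hΩ hΩb hη hσ
      (coordDir d k) θ) v • featureJet hΩ hΩb hη hσ (coordDir d k) θ) ∂π : L2 Ω) y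
      = ∫ θ, inner ℝ (featureJet hΩ hΩb hη hσ (coordDir d k) θ) v
        * feature η σ (coordDir d k) (θ, y) ∂π := by
    refine ae_all_iff.mpr fun k => ?_
    refine coeFn_integral_Lp (N.integrable_comp (hinteg k)) (hc k).aestronglyMeasurable fun θ => ?_
    rw [map_smul]
    filter_upwards [Lp.coeFn_smul (inner ℝ (featureJet hΩ hΩb hη hσ (coordDir d k) θ) v)
      (N (featureJet hΩ hΩb hη hσ (coordDir d k) θ)),
      coeFn_featureJet hΩ hΩb hη hσ (coordDir d k) θ (Idx.nil d 2)] with y h1 h2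
    rw [h1, Pi.smul_apply, smul_eq_mul]
    rw [sliceJet_nil] at h2
    exact congrArg _ h2
  have hsum := Lp.coeFn_finsetSum Finset.univ fun k => (∫ θ, N (inner ℝ (featureJet hΩ hΩb hη hσ
      (coordDir d k) θ) v • featureJet hΩ hΩb hη hσ (coordDir d k) θ) ∂π : L2 Ω)
  change N (S v) =ᵐ[volume.restrict Ω] _
  rw [hN]
  filter_upwards [hsum, hk, ae_restrict_mem hΩ.measurableSet] with y h1 h2 hy
  rw [h1, Finset.sum_apply, opU_eq hΩ hΩb hη hσ hμ ha hπ hA f hy]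
  exact Finset.sum_congr rfl fun k _ => h2 k

end Adjoint

end Kernel

end DGM

end

noncomputable section

namespace DGM

/-! ### The wide-limit flow -/

lemma opU_congr {d : ℕ} {μ : Measure (Eucl d)} (a : Idx d 2 → Eucl d → ℝ) (η : Eucl d → ℝ)
    (σ : ℝ → ℝ) (π : Measure (Param d)) {f f' : Eucl d → ℝ} (h : f =ᵐ[μ] f') :
    opU μ a η σ π f = opU μ a η σ π f' := by
  funext y
  refine integral_congr_ae ?_
  filter_upwards [h] with x hx
  rw [hx]

section Flow

variable {d : ℕ} {Ω : Set (Eucl d)} {hΩ : IsOpen Ω} {hΩb : Bornology.IsBounded Ω}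
  {η : Eucl d → ℝ} {σ : ℝ → ℝ} {hη : IsAuxiliary Ω η} {hσ : IsCkb 4 σ}
  {μ : Measure (Eucl d)} {a : Idx d 2 → Eucl d → ℝ} {π : Measure (Param d)}
  {A : H20 Ω →L[ℝ] Lp ℝ 2 μ} {S : H20 Ω →L[ℝ] H20 Ω} {g : Eucl d → ℝ} {u : H20 Ω}

lemma coeFn_residual (hμ : IsSamplingMeasure Ω μ)
    (hA : ∀ v : H20 Ω, A v =ᵐ[μ] opA a (v : Jet Ω 2))
    (hu : opA a (u : Jet Ω 2) =ᵐ[volume.restrict Ω] g) (v : H20 Ω) :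
    A (v - u) =ᵐ[μ] fun x => opA a (v : Jet Ω 2) x - g x := by
  rw [map_sub]
  filter_upwards [Lp.coeFn_sub (A v) (A u), hA v, hA u, hμ.ac.ae_eq hu] with x h1 h2 h3 h4
  rw [h1, Pi.sub_apply, h2, h3, h4]

lemma isWideLimit_iff (hμ : IsSamplingMeasure Ω μ)
    (ha : ∀ α, AEMeasurable (a α) (volume.restrict Ω)) (hπ : IsInitLaw π)
    (hA : ∀ v : H20 Ω, A v =ᵐ[μ] opA a (v : Jet Ω 2))
    (hS : ∀ v, S v = ∑ k, ∫ θ, inner ℝ (featureJet hΩ hΩb hη hσ (coordDir d k) θ) v •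
      featureJet hΩ hΩb hη hσ (coordDir d k) θ ∂π)
    (hu : opA a (u : Jet Ω 2) =ᵐ[volume.restrict Ω] g) (Q : ℝ → H20 Ω) :
    IsWideLimit Ω μ a η σ π g Q ↔ Q 0 = 0 ∧ ∀ t, 0 ≤ t →
      HasDerivWithinAt Q (-S (A.adjoint (A (Q t - u)))) (Set.Ici 0) t := by
  have key : ∀ v : H20 Ω, (S (A.adjoint (A (v - u))) : Jet Ω 2) (Idx.nil d 2)
      =ᵐ[volume.restrict Ω] opU μ a η σ π (fun x => opA a (v : Jet Ω 2) x - g x) := fun v => by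
    rw [← opU_congr a η σ π (coeFn_residual hμ hA hu v)]
    exact coeFn_covariance_adjoint hΩ hΩb hη hσ hμ ha hπ hA hS _
  refine and_congr_right fun _ => forall₂_congr fun t _ => ⟨?_, fun h => ⟨_, key (Q t), h⟩⟩
  rintro ⟨V, hV, hd⟩
  have : V = S (A.adjoint (A (Q t - u))) :=
    Subtype.ext (sobolev_ext hΩ hΩb V.2.1 (S (A.adjoint (A (Q t - u)))).2.1 (hV.trans (key (Q t)).symm))
  rwa [this] at hd

lemma featureJet_outer (w : Eucl d) (b c : ℝ)
    (h : ContDiff ℝ 2 (fun x => η x * σ (inner ℝ w x + b))) :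
    (featureJet hΩ hΩb hη hσ (1, 0, 0) (c, w, b) : Jet Ω 2) = cjet hΩb _ h := by
  have e : (fun x => feature η σ (1, 0, 0) ((c, w, b), x))
      = fun x => η x * σ (inner ℝ w x + b) := by
    funext x
    rw [feature_eq (hη.smooth.1.differentiable (by norm_num)) (hσ.1.differentiable (by norm_num))]
    simp
  refine jet_ext fun α => ((coeFn_cjet hΩb (contDiff_feature_slice hη hσ _ _) α).trans ?_).trans
    (coeFn_cjet hΩb h α).symm
  rw [e]

/-- Only zero is orthogonal to almost all parameter derivatives. -/
lemma inner_eq_zero_of_features {s : ℝ} (hbdry : HasHolderBoundary 3 s Ω)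
    (hσc : ¬ ∃ s, ∀ x, σ x = s) (hπ : IsInitLaw π) {l : H20 Ω}
    (hl : ∀ᵐ θ ∂π, inner ℝ (featureJet hΩ hΩb hη hσ (1, 0, 0) θ) l = 0) (v : H20 Ω) :
    inner ℝ l v = 0 := by
  let G : Eucl d × ℝ → ℝ := fun p => inner ℝ (featureJet hΩ hΩb hη hσ (1, 0, 0) (0, p)) l
  have hG : Continuous G :=
    ((continuous_featureJet hΩ hΩb hη hσ (1, 0, 0)).comp (by fun_prop)).inner continuous_const
  have hsm : ∀ w b, ContDiff ℝ 2 (fun x => η x * σ (inner ℝ w x + b)) := fun w b =>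
    (hη.smooth.1.of_le (by norm_num)).mul (contDiff_comp_affine (hσ.1.of_le (by norm_num)) w b)
  have hGθ : ∀ θ : Param d, inner ℝ (featureJet hΩ hΩb hη hσ (1, 0, 0) θ) l = G θ.2 := by
    rintro ⟨c, w, b⟩
    have : featureJet hΩ hΩb hη hσ (1, 0, 0) (c, w, b)
        = featureJet hΩ hΩb hη hσ (1, 0, 0) (0, w, b) :=
      Subtype.ext ((featureJet_outer w b c (hsm w b)).trans (featureJet_outer w b 0 (hsm w b)).symm)
    rw [this]
  have hG0 : ∀ p, G p = 0 := by
    by_contra! h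
    obtain ⟨p, hp⟩ := h
    have h1 := hπ.full_support {p | G p ≠ 0} (isOpen_ne_fun hG continuous_const) ⟨p, hp⟩
    have h2 : π {θ | ¬ inner ℝ (featureJet hΩ hΩb hη hσ (1, 0, 0) θ) l = 0} = 0 := ae_iff.mp hl
    simp only [hGθ] at h2
    exact h1.ne' h2
  refine inner_eq_zero_of_activation hΩ hΩb hbdry hη hσ hσc (fun w b h => ?_) v.2
  have h0 := hG0 (w, b)
  rw [← featureJet_outer (hΩ := hΩ) (hη := hη) (hσ := hσ) w b 0 h, real_inner_comm]
  exact h0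

end Flow

end DGM

end
theorem mainTheorem2 {d : ℕ} (Ω : Set (DGM.Eucl d)) (hΩ : IsOpen Ω)
    (hΩb : Bornology.IsBounded Ω)
    (hbdry : ∃ r : ℝ, 0 < r ∧ r < 1 ∧ DGM.HasHolderBoundary 3 r Ω)
    (μ : Measure (DGM.Eucl d)) (hμ : DGM.IsSamplingMeasure Ω μ)
    (η : DGM.Eucl d → ℝ) (hη : DGM.IsAuxiliary Ω η)
    (a : DGM.Idx d 2 → DGM.Eucl d → ℝ)
    (ha : ∀ α, AEMeasurable (a α) (volume.restrict Ω))
    (hA : DGM.IsLipschitzOp Ω a)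
    (σ : ℝ → ℝ) (hσ : DGM.IsCkb 4 σ) (hσc : ¬ ∃ s, ∀ x, σ x = s)
    (π : Measure (DGM.Param d)) (hπ : DGM.IsInitLaw π)
    (g : DGM.Eucl d → ℝ)
    (hsol : ∃ u ∈ DGM.H20 Ω, DGM.opA a u =ᵐ[volume.restrict Ω] g) :
    (∃ Q, DGM.IsWideLimit Ω μ a η σ π g Q) ∧
      ∀ Q, DGM.IsWideLimit Ω μ a η σ π g Q →
        Tendsto (fun t : ℝ => eLpNorm (fun x => DGM.opA a (Q t : DGM.Jet Ω 2) x - g x) 2 μ)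
          atTop (𝓝 0) := by
  obtain ⟨s, -, -, hs⟩ := hbdry
  obtain ⟨u₀, hu₀, hu⟩ := hsol
  obtain ⟨u, rfl⟩ : ∃ u : DGM.H20 Ω, (u : DGM.Jet Ω 2) = u₀ := ⟨⟨u₀, hu₀⟩, rfl⟩
  obtain ⟨A, hAop⟩ := DGM.exists_opA_clm hμ ha hA
  have hψ := fun k => DGM.memLp_featureJet hΩ hΩb hη hσ hπ (DGM.coordDir d k)
  obtain ⟨S, hS⟩ := DGM.exists_covariance hψ
  have hiff := DGM.isWideLimit_iff hμ ha hπ hAop hS hu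
  refine ⟨?_, fun Q hQ => ?_⟩
  · obtain ⟨q, hq0, hq⟩ := DGM.exists_linear_flow (S.comp (A.adjoint.comp A)) u
    refine ⟨fun t => u - q t, (hiff _).mpr ⟨by simp [hq0], fun t _ => ?_⟩⟩
    have h := ((hq t).const_sub u).hasDerivWithinAt (s := Set.Ici 0)
    have e : u - q t - u = -q t := by abel
    rw [e, map_neg, map_neg, map_neg]
    exact h
  · obtain ⟨hQ0, hQd⟩ := (hiff Q).mp hQ
    let T : Lp ℝ 2 μ →L[ℝ] Lp ℝ 2 μ := A.comp (S.comp A.adjoint)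
    have hT : ∀ f f', inner ℝ (T f) f' = inner ℝ (S (A.adjoint f)) (A.adjoint f') := fun f f' =>
      (A.adjoint_inner_right _ _).symm
    have hinner := DGM.inner_covariance hψ hS
    have hsymm : ∀ f f', inner ℝ (T f) f' = inner ℝ f (T f') := fun f f' => by
      rw [hT, DGM.covariance_symm hψ hS, A.adjoint_inner_left]
      rfl
    have hpos : ∀ f, 0 ≤ inner ℝ (T f) f := fun f => by
      rw [hT, hinner]
      exact Finset.sum_nonneg fun k _ => integral_nonneg fun θ => mul_self_nonneg _
    have hker : ∀ f, T f = 0 → inner ℝ f (-A u) = 0 := fun f hf => by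
      have h0 : inner ℝ (S (A.adjoint f)) (A.adjoint f) = 0 := by rw [← hT, hf, inner_zero_left]
      have h1 := DGM.inner_eq_zero_of_covariance hψ hS h0 (.inl ())
      have h2 := DGM.inner_eq_zero_of_features hs hσc hπ h1 u
      rw [inner_neg_right, ← A.adjoint_inner_left, h2, neg_zero]
    have hlim := DGM.tendsto_zero_of_flow (T := T) (r := fun t => A (Q t - u)) hsymm hpos
      (fun t ht => by
        have h := A.hasFDerivAt.comp_hasDerivWithinAt t ((hQd t ht).sub_const u)
        rw [map_neg] at h
        exact h)
      (by
        rw [hQ0, zero_sub, map_neg]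
        exact DGM.mem_closure_range_of_symm hsymm hker)
    have hnorm : ∀ t, eLpNorm (fun x => DGM.opA a (Q t : DGM.Jet Ω 2) x - g x) 2 μ
        = ‖A (Q t - u)‖ₑ := fun t => by
      rw [Lp.enorm_def, eLpNorm_congr_ae (DGM.coeFn_residual hμ hAop hu (Q t))]
    simp only [hnorm]
    simpa using hlim.enorm
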